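/- **Setting.** A *sc-structure* on a Banach space $E$ is a nested sequence of Banach spaces $E=E_0\supseteq E_1\supseteq\cdots$ such that $E_n\to E_m$ is compact for $m<n$ and $E_\infty=\bigcap_m E_m$ is dense in every $E_m$. Write $U_m=U\cap E_m$, $TE=E^1\oplus E$ (levels $E_{m+1}\oplus E_m$) and $TU=U^1\oplus E$. A map $f:U\to F$ is sc$^0$ if it induces continuous maps $U_m\to F_m$ for all $m$. It is sc$^{k+1}$ if it is sc$^0$, for every $x\in U_1$ there is a bounded $Df(x):E_0\to F_0$ with $\|f(x+h)-f(x)-Df(x)h\|_0/\|h\|_1\to0$ as $\|h\|_1\to 0$, and $Tf:TU\to TF$, $Tf(x,h)=(f(x),Df(x)h)$, is sc$^k$. It is sc-smooth if it is sc$^k$ for all $k$. A *sc-smooth splicing* $(\pi,E,V)$ consists of a relatively open subset $V$ of a partial cone in a finite-dimensional vector space, a Banach space $E$ with a sc-structure, and linear projections $\pi_v:E\to E$, $v\in V$, bounded on every level $E_m$, such that $V\oplus E\to E$, $(v,e)\mapsto\pi_v(e)$, is sc-smooth. Let $D_x,D_y$ be disks with interior points $x,y$ and coordinates $\bar h_x:(D_x,x)\to(D,0)$,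 $\bar h_y:(D_y,y)\to(D,0)$ onto the closed unit disk. Let $S^1=\mathbb R/\mathbb Z$ and, for a map $u$ on $D_x\cup D_y$, $$u^+(s,t)=u\big(\bar h_x^{-1}(e^{-2\pi(s+it)})\big)\ (s\ge0),\qquad u^-(s',t')=u\big(\bar h_y^{-1}(e^{2\pi(s'+it')})\big)\ (s'\le0).$$ Fix $0<\delta_0<\delta_1<\cdots<2\pi$. Let $E$ be the space of continuous maps $u:D_x\cup D_y\to\mathbb R^{2n}$ with $u(x)=u(y)=c$ for some $c$ and $u^\pm-c\in H^{3,\delta_0}(\mathbb R^\pm\times S^1,\mathbb R^{2n})$, and let $E_m\subseteq E$ consist of those with $u^\pm-c\in H^{m+3,\delta_m}$. Here $H^{k,\delta}$ means that all weak derivatives of order at most $k$, multiplied by $e^{\delta|s|}$, are in $L^2$; $E_m$ is normed by $|c|$ and these weighted $L^2$-norms. Let $\beta:\mathbb R\to[0,1]$ be smooth with $\beta=1$ on $(-\infty,-1]$, $\beta'<0$ on $(-1,1)$ and $\beta(s)+\beta(-s)=1$. For $a\in\mathbb C$ with $0<|a|\le\frac12$ let $R=e^{1/|a|}-e$ and $a=|a|e^{-2\pi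 i\vartheta}$. For $h\in E$ let $$\oplus_a(h)(s,t)=\beta(s-\tfrac R2)h^+(s,t)+(1-\beta(s-\tfrac R2))h^-(s-R,t-\vartheta),\qquad (s,t)\in[0,R]\times S^1,$$ $$\ominus_a(h)(s,t)=-(1-\beta(s-\tfrac R2))(h^+(s,t)-\mathrm{av}_R(h))+\beta(s-\tfrac R2)(h^-(s-R,t-\vartheta)-\mathrm{av}_R(h)),\qquad (s,t)\in\mathbb R\times S^1,$$ where $\mathrm{av}_R(h)=\frac12\int_{S^1}\big(h^+(\tfrac R2,t)+h^-(-\tfrac R2,t)\big)\,dt$ and terms whose cut-off factor vanishes are read as $0$. Put $\oplus_0(h)=h$ and $\ominus_0(h)=0$. **Theorem.** For every $a\in\mathbb C$ with $|a|\le\frac12$ we have $E=\ker(\ominus_a)\oplus\ker(\oplus_a)$. Let $\pi_a:E\to E$ be the projection onto $\ker(\ominus_a)$ along $\ker(\oplus_a)$, and let $B_{1/2}=\{a\in\mathbb C: |a|<\frac12\}$. Then $(\pi,E,B_{1/2})$ is a sc-smooth splicing. -/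

import Mathlib

open MeasureTheory Set Topology
open scoped ContDiff ENNReal

noncomputable section

namespace GWSplicing

/-! ### Scales of Banach spaces and sc-smoothness -/

/-- The data of a nested sequence `E_0 ⊇ E_1 ⊇ …` of normed real vector spaces; the level `E_m` is
`Lev m`, and `incl` is the inclusion `E_n → E_m` for `m ≤ n`. -/
structure ScScale where
  Lev : ℕ → Type
  [grp : ∀ m, NormedAddCommGroup (Lev m)]
  [spc : ∀ m, NormedSpace ℝ (Lev m)]
  incl : ∀ {m n : ℕ}, m ≤ n → (Lev n →L[ℝ] Lev m)

attribute [instance] ScScale.grp ScScale.spc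

namespace ScScale

/-- The image of a point of the level `E_m` in `E_0`. -/
abbrev base (E : ScScale) (m : ℕ) : E.Lev m →L[ℝ] E.Lev 0 := E.incl (Nat.zero_le m)

/-- The scale is a sc-smooth structure on the Banach space `E_0`: all levels are Banach spaces, the
maps `incl` are compatible injections, they are compact for `m < n`, and the intersection `E_∞` of
all levels is dense in every level. -/
structure IsScBanach (E : ScScale) : Prop where
  complete : ∀ m, CompleteSpace (E.Lev m)
  incl_refl : ∀ m (x : E.Lev m), E.incl (le_refl m) x = x
  incl_trans : ∀ {l m n : ℕ} (h : l ≤ m) (h' : m ≤ n) (x : E.Lev n),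
    E.incl h (E.incl h' x) = E.incl (h.trans h') x
  injective : ∀ {m n : ℕ} (h : m ≤ n), Function.Injective (E.incl h)
  compact : ∀ {m n : ℕ} (h : m < n), IsCompactOperator (E.incl h.le)
  dense : ∀ m, Dense {x : E.Lev m | ∀ n, ∃ y : E.Lev n, E.base n y = E.base m x}

/-- The levelwise direct sum. -/
def prod (E F : ScScale) : ScScale where
  Lev m := E.Lev m × F.Lev m
  incl h := (E.incl h).prodMap (F.incl h)

/-- The scale `E^1`, with `(E^1)_m = E_{m+1}`. -/
def shift (E : ScScale) : ScScale where
  Lev m := E.Lev (m + 1)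
  incl h := E.incl (Nat.succ_le_succ h)

/-- The tangent `TE = E^1 ⊕ E`. -/
def tangent (E : ScScale) : ScScale := E.shift.prod E

/-- A finite-dimensional space, with its constant scale. -/
def const (A : Type) [NormedAddCommGroup A] [NormedSpace ℝ A] : ScScale where
  Lev _ := A
  incl _ := ContinuousLinearMap.id ℝ A

/-- `U_m = U ∩ E_m`. -/
def levelSet (E : ScScale) (U : Set (E.Lev 0)) (m : ℕ) : Set (E.Lev m) := E.base m ⁻¹' U

/-- The tangent `TU = U^1 ⊕ E` of a subset `U`; its base level is `U_1 × E_0`. -/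
def tangentSet (E : ScScale) (U : Set (E.Lev 0)) : Set (E.tangent.Lev 0) :=
  {p : E.Lev 1 × E.Lev 0 | p.1 ∈ E.levelSet U 1}

end ScScale

/-- `f : U → F` is `sc⁰`: it induces continuous maps `U_m → F_m` on all levels. -/
def IsSc0 (E F : ScScale) (U : Set (E.Lev 0)) (f : E.Lev 0 → F.Lev 0) : Prop :=
  ∀ m, ∃ g : E.Lev m → F.Lev m, ContinuousOn g (E.levelSet U m) ∧
    ∀ x ∈ E.levelSet U m, F.base m (g x) = f (E.base m x)

/-- `Tf : TU → TF` is the tangent map of `f : U → F`: `Tf(x, h) = (f(x), Df(x)h)`, where for every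
`x ∈ U_1` the bounded operator `Df(x) : E_0 → F_0` satisfies
`‖f(x + h) - f(x) - Df(x)h‖_0 / ‖h‖_1 → 0` as `‖h‖_1 → 0`, `h ∈ E_1`, `x + h ∈ U`. -/
def IsTangentMap (E F : ScScale) (U : Set (E.Lev 0)) (f : E.Lev 0 → F.Lev 0)
    (Tf : E.Lev 1 × E.Lev 0 → F.Lev 1 × F.Lev 0) : Prop :=
  ∀ x ∈ E.levelSet U 1, ∃ Df : E.Lev 0 →L[ℝ] F.Lev 0,
    (∀ h, F.base 1 (Tf (x, h)).1 = f (E.base 1 x) ∧ (Tf (x, h)).2 = Df h) ∧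
    HasFDerivWithinAt (fun y : E.Lev 1 => f (E.base 1 y)) (Df.comp (E.base 1)) (E.levelSet U 1) x

/-- `f : U → F` is of class `sc^k`: for `k ≥ 1` this means that `f` is `sc⁰`, that the tangent map
`Tf : TU → TF` exists, and that it is of class `sc^{k-1}`. -/
def IsScK : ℕ → ∀ (E F : ScScale), Set (E.Lev 0) → (E.Lev 0 → F.Lev 0) → Prop
  | 0, E, F, U, f => IsSc0 E F U f
  | k + 1, E, F, U, f => IsSc0 E F U f ∧
      ∃ Tf : E.Lev 1 × E.Lev 0 → F.Lev 1 × F.Lev 0, IsTangentMap E F U f Tf ∧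
        IsScK k E.tangent F.tangent (E.tangentSet U) Tf

/-- sc-smooth maps. -/
def IsScSmooth (E F : ScScale) (U : Set (E.Lev 0)) (f : E.Lev 0 → F.Lev 0) : Prop :=
  ∀ k, IsScK k E F U f

/-- A linear sc-operator: it induces bounded operators on all levels. -/
def IsScOperator (E F : ScScale) (T : E.Lev 0 →ₗ[ℝ] F.Lev 0) : Prop :=
  ∀ m, ∃ S : E.Lev m →L[ℝ] F.Lev m, ∀ x, F.base m (S x) = T (E.base m x)

/-- A partial cone: some linear isomorphism maps it onto `[0,∞)^k × ℝ^{n-k}`. -/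
def IsPartialCone {A : Type} [NormedAddCommGroup A] [NormedSpace ℝ A] (C : Set A) : Prop :=
  ∃ (n k : ℕ) (T : A ≃ₗ[ℝ] (Fin n → ℝ)), T '' C = {x | ∀ i : Fin n, i.val < k → 0 ≤ x i}

/-- `(π, E, V)` is a sc-smooth splicing: `V` is a relatively open subset of a partial cone, `E` is a
Banach space with a sc-smooth structure, and the `π_v`, `v ∈ V`, are sc-projections of `E` such that
`V ⊕ E → E, (v, e) ↦ π_v(e)` is sc-smooth. -/
structure IsScSmoothSplicing {A : Type} [NormedAddCommGroup A] [NormedSpace ℝ A] (E : ScScale)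
    (V : Set A) (π : A → (E.Lev 0 →ₗ[ℝ] E.Lev 0)) : Prop where
  param : ∃ C O : Set A, IsPartialCone C ∧ IsOpen O ∧ V = C ∩ O
  scBanach : E.IsScBanach
  operator : ∀ v ∈ V, IsScOperator E E (π v)
  projection : ∀ v ∈ V, IsIdempotentElem (π v)
  smooth : IsScSmooth ((ScScale.const A).prod E) E {p : A × E.Lev 0 | p.1 ∈ V}
    (fun p : A × E.Lev 0 => π p.1 p.2)

/-! ### Weighted Sobolev spaces on half-cylinders -/

/-- The cylinder `ℝ × S¹`, `S¹ = ℝ/ℤ`. -/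
abbrev Cyl : Type := ℝ × UnitAddCircle

/-- The covering `ℝ² → ℝ × S¹`. -/
def cover (p : ℝ × ℝ) : Cyl := (p.1, (p.2 : UnitAddCircle))

/-- The measure `e^{2δ|s|} ds dt` on `I × S¹`: a function `g` is square integrable for it if and
only if `e^{δ|s|} g` is square integrable on `I × S¹`. -/
def weightedMeasure (I : Set ℝ) (δ : ℝ) : Measure Cyl :=
  ((volume.restrict I).prod volume).withDensity
    (fun p => ENNReal.ofReal (Real.exp (2 * δ * |p.1|)))

/-- `∂_s φ`. -/
def dS (φ : ℝ × ℝ → ℝ) (p : ℝ × ℝ) : ℝ := fderiv ℝ φ p (1, 0)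

/-- `∂_t φ`. -/
def dT (φ : ℝ × ℝ → ℝ) (p : ℝ × ℝ) : ℝ := fderiv ℝ φ p (0, 1)

section Sobolev

variable {F : Type} [NormedAddCommGroup F] [NormedSpace ℝ F]

/-- `g = ∂_s^i ∂_t^j f` weakly on `I × S¹`, tested in the coordinates of the covering. -/
def IsWeakDeriv (I : Set ℝ) (i j : ℕ) (f g : Cyl → F) : Prop :=
  ∀ φ : ℝ × ℝ → ℝ, ContDiff ℝ ∞ φ → HasCompactSupport φ → tsupport φ ⊆ I ×ˢ univ →
    ∫ p, (dS^[i] (dT^[j] φ)) p • f (cover p) = (-1 : ℝ) ^ (i + j) • ∫ p, φ p • g (cover p)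

/-- `f` has the weak derivative `∂_s^i ∂_t^j f` on `I × S¹`, and it is in the weighted `L²`. -/
def HasWDeriv (I : Set ℝ) (δ : ℝ) (i j : ℕ) (f : Cyl → F) : Prop :=
  ∃ g : Lp F 2 (weightedMeasure I δ), IsWeakDeriv I i j f g

open Classical in
/-- The weak derivative `∂_s^i ∂_t^j f` as an element of the weighted `L²` (it is unique by
`IsWeakDeriv.unique`), and `0` if there is none. -/
def wDeriv (I : Set ℝ) (δ : ℝ) (i j : ℕ) (f : Cyl → F) : Lp F 2 (weightedMeasure I δ) :=
  if h : HasWDeriv I δ i j f then h.choose else 0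

theorem wDeriv_spec {I : Set ℝ} {δ : ℝ} {i j : ℕ} {f : Cyl → F} (h : HasWDeriv I δ i j f) :
    IsWeakDeriv I i j f (wDeriv I δ i j f) := by
  rw [wDeriv, dif_pos h]; exact h.choose_spec

/-- `f` is of class `H^{k,δ}` on `I × S¹`. -/
def IsSobolev (I : Set ℝ) (k : ℕ) (δ : ℝ) (f : Cyl → F) : Prop :=
  ∀ i j, i + j ≤ k → HasWDeriv I δ i j f

theorem measurable_weight (δ : ℝ) :
    Measurable (fun p : Cyl => ENNReal.ofReal (Real.exp (2 * δ * |p.1|))) := by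
  apply ENNReal.measurable_ofReal.comp
  apply Real.measurable_exp.comp
  exact (measurable_fst.abs).const_mul _

theorem base_ac (I : Set ℝ) (δ : ℝ) :
    ((volume.restrict I).prod (volume : Measure UnitAddCircle)) ≪ weightedMeasure I δ :=
  withDensity_absolutelyContinuous' (measurable_weight δ).aemeasurable
    (Filter.Eventually.of_forall fun p => by
      simp [Real.exp_pos])

theorem weighted_mono (I : Set ℝ) {δ δ' : ℝ} (h : δ ≤ δ') :
    weightedMeasure I δ ≤ weightedMeasure I δ' := by
  apply withDensity_mono
  refine Filter.Eventually.of_forall fun p => ?_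
  apply ENNReal.ofReal_le_ofReal
  apply Real.exp_le_exp.2
  have := abs_nonneg p.1
  nlinarith

theorem base_le (I : Set ℝ) {δ : ℝ} (h : 0 ≤ δ) :
    ((volume.restrict I).prod (volume : Measure UnitAddCircle)) ≤ weightedMeasure I δ := by
  have := weighted_mono I h
  simpa [weightedMeasure] using this

theorem cover_mp (I : Set ℝ) (a : ℝ) :
    MeasurePreserving cover (volume.restrict (I ×ˢ Ioc a (a + 1)))
      ((volume.restrict I).prod (volume : Measure UnitAddCircle)) := by
  have h := (MeasurePreserving.id (volume.restrict I)).prod (UnitAddCircle.measurePreserving_mk a)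
  rw [Measure.prod_restrict] at h
  exact h

theorem cover_locInt {I : Set ℝ} (hI : IsOpen I) {δ : ℝ} (hδ : 0 ≤ δ)
    (g : Lp F 2 (weightedMeasure I δ)) :
    LocallyIntegrableOn (fun p => g (cover p)) (I ×ˢ univ) volume := by
  intro p hp
  have h1 : MemLp g 2 ((volume.restrict I).prod (volume : Measure UnitAddCircle)) :=
    (Lp.memLp g).mono_measure (base_le I hδ)
  have h2 := h1.comp_measurePreserving (cover_mp I (p.2 - 1 / 2))
  obtain ⟨W, hW, hWo, hpW, hWf⟩ : ∃ W : Set (ℝ × ℝ), W ⊆ I ×ˢ Ioc (p.2 - 1/2) (p.2 - 1/2 + 1) ∧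
      IsOpen W ∧ p ∈ W ∧ volume W < ⊤ := by
    refine ⟨(I ×ˢ Ioo (p.2 - 1/2) (p.2 - 1/2 + 1)) ∩ Metric.ball p 1, ?_, ?_, ?_, ?_⟩
    · exact fun q hq => ⟨hq.1.1, Ioo_subset_Ioc_self hq.1.2⟩
    · exact (hI.prod isOpen_Ioo).inter Metric.isOpen_ball
    · exact ⟨⟨hp.1, by constructor <;> linarith⟩, Metric.mem_ball_self one_pos⟩
    · exact (measure_mono inter_subset_right).trans_lt measure_ball_lt_top
  refine ⟨W, mem_nhdsWithin_of_mem_nhds (hWo.mem_nhds hpW), ?_⟩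
  have h3 : MemLp (fun p => g (cover p)) 2 (volume.restrict W) := 
    h2.mono_measure (Measure.restrict_mono hW le_rfl)
  have : IsFiniteMeasure (volume.restrict W) := ⟨by simpa using hWf⟩
  exact h3.integrable (by norm_num)

theorem cover_ae (I : Set ℝ) (hI : IsOpen I) {δ : ℝ} {P : Cyl → Prop}
    (h : ∀ᵐ x ∂(weightedMeasure I δ), P x) : 
    ∀ᵐ p : ℝ × ℝ, p ∈ I ×ˢ (univ : Set ℝ) → P (cover p) := by
  have h1 := (base_ac I δ).ae_le h
  have h2 : ∀ k : ℤ, ∀ᵐ p : ℝ × ℝ, p ∈ I ×ˢ Ioc (k : ℝ) (k + 1) → P (cover p) := by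
    intro k
    have := (cover_mp I k).quasiMeasurePreserving.ae h1
    exact (ae_restrict_iff' (hI.measurableSet.prod measurableSet_Ioc)).1 this
  filter_upwards [ae_all_iff.2 h2] with p hp hpI
  refine hp (⌈p.2⌉ - 1) ⟨hpI.1, ?_, ?_⟩
  · push_cast; linarith [Int.ceil_lt_add_one p.2]
  · push_cast; linarith [Int.le_ceil p.2]

theorem integrable_test {I : Set ℝ} {f : ℝ × ℝ → F}
    (hf : LocallyIntegrableOn f (I ×ˢ univ) volume) {φ : ℝ × ℝ → ℝ} (hφ : Continuous φ)
    (hc : HasCompactSupport φ) (hs : tsupport φ ⊆ I ×ˢ univ) :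
    Integrable (fun p => φ p • f p) := by
  have h1 : IntegrableOn f (tsupport φ) := hf.integrableOn_compact_subset hs hc
  have h2 : IntegrableOn (fun p => φ p • f p) (tsupport φ) :=
    h1.continuousOn_smul hφ.continuousOn hc
  rwa [integrableOn_iff_integrable_of_support_subset] at h2
  intro p hp
  apply subset_tsupport φ
  intro h0
  exact hp (by simp [h0])

theorem ae_cover_zero {I : Set ℝ} (hI : IsOpen I) {f : ℝ × ℝ → F} [CompleteSpace F]
    (hf : LocallyIntegrableOn f (I ×ˢ univ) volume)
    (h : ∀ φ : ℝ × ℝ → ℝ, ContDiff ℝ ∞ φ → HasCompactSupport φ → tsupport φ ⊆ I ×ˢ univ →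
      ∫ p, φ p • f p = 0) : ∀ᵐ p : ℝ × ℝ, p ∈ I ×ˢ (univ : Set ℝ) → f p = 0 :=
  (hI.prod isOpen_univ).ae_eq_zero_of_integral_contDiff_smul_eq_zero hf h

/-- Weak derivatives are unique. -/
theorem IsWeakDeriv.unique [CompleteSpace F] {I : Set ℝ} (hI : IsOpen I) {δ : ℝ} (hδ : 0 ≤ δ)
    {i j : ℕ} {f : Cyl → F} {g g' : Lp F 2 (weightedMeasure I δ)} (hg : IsWeakDeriv I i j f g)
    (hg' : IsWeakDeriv I i j f g') : g = g' := by
  have key : ∀ᵐ p : ℝ × ℝ, p ∈ I ×ˢ (univ : Set ℝ) → g (cover p) - g' (cover p) = 0 := by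
    refine ae_cover_zero hI ((cover_locInt hI hδ g).sub (cover_locInt hI hδ g')) ?_
    intro φ h1 h2 h3
    have e1 := hg φ h1 h2 h3
    rw [hg' φ h1 h2 h3] at e1
    have e2 : ∫ p, φ p • g' (cover p) = ∫ p, φ p • g (cover p) :=
      smul_right_injective _ (pow_ne_zero (i + j) (by norm_num : (-1 : ℝ) ≠ 0)) e1
    simp only [smul_sub]
    rw [integral_sub (integrable_test (cover_locInt hI hδ g) h1.continuous h2 h3)
      (integrable_test (cover_locInt hI hδ g') h1.continuous h2 h3), e2, sub_self]
  have k2 : ∀ᵐ p ∂(volume.restrict (I ×ˢ Ioc (0 : ℝ) (0 + 1))), g (cover p) = g' (cover p) := by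
    rw [ae_restrict_iff' (hI.measurableSet.prod measurableSet_Ioc)]
    filter_upwards [key] with p hp hpI
    exact sub_eq_zero.1 (hp ⟨hpI.1, mem_univ _⟩)
  have k3 : ∀ᵐ x ∂((volume.restrict I).prod (volume : Measure UnitAddCircle)), g x = g' x := by
    rw [← (cover_mp I 0).map_eq, ae_map_iff (cover_mp I 0).measurable.aemeasurable]
    · exact k2
    · exact (Lp.stronglyMeasurable g).measurableSet_eq_fun (Lp.stronglyMeasurable g')
  apply Lp.ext
  exact (withDensity_absolutelyContinuous _ _).ae_le k3

theorem dS_smooth {φ : ℝ × ℝ → ℝ} (h : ContDiff ℝ ∞ φ) : ContDiff ℝ ∞ (dS φ) :=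
  (h.fderiv_right (m := ∞) le_rfl).clm_apply contDiff_const

theorem dT_smooth {φ : ℝ × ℝ → ℝ} (h : ContDiff ℝ ∞ φ) : ContDiff ℝ ∞ (dT φ) :=
  (h.fderiv_right (m := ∞) le_rfl).clm_apply contDiff_const

theorem test_dST {φ : ℝ × ℝ → ℝ} (h : ContDiff ℝ ∞ φ) (i j : ℕ) :
    ContDiff ℝ ∞ (dS^[i] (dT^[j] φ)) ∧ tsupport (dS^[i] (dT^[j] φ)) ⊆ tsupport φ := by
  have hT : ContDiff ℝ ∞ (dT^[j] φ) ∧ tsupport (dT^[j] φ) ⊆ tsupport φ := by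
    induction j with
    | zero => exact ⟨h, subset_rfl⟩
    | succ j ih =>
      rw [Function.iterate_succ_apply']
      exact ⟨dT_smooth ih.1, (tsupport_fderiv_apply_subset ℝ _).trans ih.2⟩
  induction i with
  | zero => exact hT
  | succ i ih =>
    rw [Function.iterate_succ_apply']
    exact ⟨dS_smooth ih.1, (tsupport_fderiv_apply_subset ℝ _).trans ih.2⟩

theorem integrable_dtest {f : Cyl → F} (hf : Continuous f) {φ : ℝ × ℝ → ℝ}
    (h : ContDiff ℝ ∞ φ) (hc : HasCompactSupport φ) (i j : ℕ) :
    Integrable (fun p => (dS^[i] (dT^[j] φ)) p • f (cover p)) := by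
  have hcov : Continuous cover := by unfold cover; fun_prop
  apply Continuous.integrable_of_hasCompactSupport
  · exact (test_dST h i j).1.continuous.smul (hf.comp hcov)
  · exact HasCompactSupport.smul_right (hc.of_isClosed_subset (isClosed_tsupport _) (test_dST h i j).2)

theorem IsWeakDeriv.add {I : Set ℝ} (hI : IsOpen I) {δ : ℝ} (hδ : 0 ≤ δ)
    {i j : ℕ} {f f' : Cyl → F} (hf : Continuous f) (hf' : Continuous f')
    {g g' : Lp F 2 (weightedMeasure I δ)} (hg : IsWeakDeriv I i j f g)
    (hg' : IsWeakDeriv I i j f' g') : IsWeakDeriv I i j (fun p => f p + f' p) (g + g' : Lp F 2 _) := by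
  intro φ h1 h2 h3
  have e : ∫ p, φ p • (g + g' : Lp F 2 (weightedMeasure I δ)) (cover p) =
      ∫ p, (φ p • g (cover p) + φ p • g' (cover p)) := by
    apply integral_congr_ae
    filter_upwards [cover_ae I hI (Lp.coeFn_add g g')] with p hp
    by_cases hpI : p ∈ I ×ˢ (univ : Set ℝ)
    · rw [hp hpI, Pi.add_apply, smul_add]
    · have : φ p = 0 := by
        by_contra h0
        exact hpI (h3 (subset_tsupport φ h0))
      simp [this]
  rw [e, integral_add (integrable_test (cover_locInt hI hδ g) h1.continuous h2 h3)
      (integrable_test (cover_locInt hI hδ g') h1.continuous h2 h3), smul_add,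
      ← hg φ h1 h2 h3, ← hg' φ h1 h2 h3, 
      ← integral_add (integrable_dtest hf h1 h2 i j) (integrable_dtest hf' h1 h2 i j)]
  simp only [smul_add]

theorem IsWeakDeriv.smul {I : Set ℝ} (hI : IsOpen I) {δ : ℝ} 
    {i j : ℕ} {f : Cyl → F} (c : ℝ)
    {g : Lp F 2 (weightedMeasure I δ)} (hg : IsWeakDeriv I i j f g) :
    IsWeakDeriv I i j (fun p => c • f p) (c • g : Lp F 2 _) := by
  intro φ h1 h2 h3
  have e : ∫ p, φ p • (c • g : Lp F 2 (weightedMeasure I δ)) (cover p) =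
      ∫ p, c • (φ p • g (cover p)) := by
    apply integral_congr_ae
    filter_upwards [cover_ae I hI (Lp.coeFn_smul c g)] with p hp
    by_cases hpI : p ∈ I ×ˢ (univ : Set ℝ)
    · rw [hp hpI, Pi.smul_apply, smul_comm]
    · have : φ p = 0 := by
        by_contra h0
        exact hpI (h3 (subset_tsupport φ h0))
      simp [this]
  rw [e, integral_smul, smul_comm, ← hg φ h1 h2 h3, ← integral_smul]
  simp only [smul_comm c]

theorem isWeakDeriv_zero {I : Set ℝ} (hI : IsOpen I) {δ : ℝ} {i j : ℕ} :
    IsWeakDeriv I i j (fun _ : Cyl => (0 : F)) (0 : Lp F 2 (weightedMeasure I δ)) := by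
  intro φ h1 h2 h3
  have e : ∫ p, φ p • (0 : Lp F 2 (weightedMeasure I δ)) (cover p) =
      ∫ _ : ℝ × ℝ, (0 : F) := by
    apply integral_congr_ae
    filter_upwards [cover_ae I hI (Lp.coeFn_zero F 2 (weightedMeasure I δ))] with p hp
    by_cases hpI : p ∈ I ×ˢ (univ : Set ℝ)
    · rw [hp hpI]; simp
    · have : φ p = 0 := by
        by_contra h0
        exact hpI (h3 (subset_tsupport φ h0))
      simp [this]
  rw [e]
  simp

/-- A weak derivative in `L²` for the weight `δ'` is one for the weight `δ ≤ δ'`. -/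
theorem HasWDeriv.mono {I : Set ℝ} (hI : IsOpen I) {δ δ' : ℝ} (h : δ ≤ δ') {i j : ℕ}
    {f : Cyl → F} (g : Lp F 2 (weightedMeasure I δ')) (hg : IsWeakDeriv I i j f g) :
    ∃ g' : Lp F 2 (weightedMeasure I δ), IsWeakDeriv I i j f g' ∧ ‖g'‖ ≤ ‖g‖ := by
  have hm : MemLp g 2 (weightedMeasure I δ) := (Lp.memLp g).mono_measure (weighted_mono I h)
  refine ⟨hm.toLp g, ?_, ?_⟩
  · intro φ h1 h2 h3
    rw [hg φ h1 h2 h3]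
    congr 1
    apply integral_congr_ae
    filter_upwards [cover_ae I hI hm.coeFn_toLp] with p hp
    by_cases hpI : p ∈ I ×ˢ (univ : Set ℝ)
    · rw [hp hpI]
    · have : φ p = 0 := by
        by_contra h0
        exact hpI (h3 (subset_tsupport φ h0))
      simp [this]
  · rw [Lp.norm_toLp, Lp.norm_def]
    exact ENNReal.toReal_mono (Lp.eLpNorm_ne_top g) (eLpNorm_mono_measure _ (weighted_mono I h))

end Sobolev

/-! ### Maps on a noded disk pair -/

/-- A noded disk pair `(D_x ∪ D_y, {x, y})`, with coordinates `h̄_x : (D_x, x) → (D, 0)` and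
`h̄_y : (D_y, y) → (D, 0)` on the closed unit disk `D`. Only the topology of the disks and the
coordinates enter the construction; biholomorphic coordinates are in particular homeomorphisms. -/
structure NodedDiskPair where
  Dx : Type
  Dy : Type
  [topX : TopologicalSpace Dx]
  [topY : TopologicalSpace Dy]
  chartX : Dx ≃ₜ Metric.closedBall (0 : ℂ) 1
  chartY : Dy ≃ₜ Metric.closedBall (0 : ℂ) 1

attribute [instance] NodedDiskPair.topX NodedDiskPair.topY

/-- The point `e^{-2π(|s| + it)}` of the closed unit disk. -/
def diskPoint (p : Cyl) : Metric.closedBall (0 : ℂ) 1 :=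
  ⟨(Real.exp (-(2 * Real.pi * |p.1|)) : ℂ) * (AddCircle.toCircle (-p.2) : ℂ), by
    rw [mem_closedBall_zero_iff, norm_mul, Circle.norm_coe, mul_one, Complex.norm_real,
      Real.norm_eq_abs, abs_of_pos (Real.exp_pos _), Real.exp_le_one_iff]
    have := mul_nonneg Real.two_pi_pos.le (abs_nonneg p.1)
    linarith⟩

namespace NodedDiskPair

variable (D : NodedDiskPair)

/-- The nodal point `x`. -/
def x : D.Dx := D.chartX.symm ⟨0, by simp⟩

/-- The nodal point `y`. -/
def y : D.Dy := D.chartY.symm ⟨0, by simp⟩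

/-- Positive holomorphic polar coordinates `h_x(s,t) = h̄_x⁻¹(e^{-2π(s+it)})`, used for `s ≥ 0`
(the total function is even in `s`). -/
def polarX (p : Cyl) : D.Dx := D.chartX.symm (diskPoint p)

/-- Negative holomorphic polar coordinates `h_y(s',t') = h̄_y⁻¹(e^{2π(s'+it')})`, used for `s' ≤ 0`
(the total function is even in `s'`). -/
def polarY (p : Cyl) : D.Dy := D.chartY.symm (diskPoint (p.1, -p.2))

end NodedDiskPair

/-- The target space `ℝ^{2n}`. -/
abbrev Target (n : ℕ) : Type := EuclideanSpace ℝ (Fin (2 * n))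

/-- Pairs of continuous maps `D_x → ℝ^{2n}`, `D_y → ℝ^{2n}`. -/
abbrev DiskMap (D : NodedDiskPair) (n : ℕ) : Type := C(D.Dx, Target n) × C(D.Dy, Target n)

section Maps

variable {D : NodedDiskPair} {n : ℕ}

/-- `u⁺ = u ∘ h_x`. -/
def uPlus (u : DiskMap D n) (p : Cyl) : Target n := u.1 (D.polarX p)

/-- `u⁻ = u ∘ h_y`. -/
def uMinus (u : DiskMap D n) (p : Cyl) : Target n := u.2 (D.polarY p)

/-- `u⁺ - c`, where `c = u(x)`. -/
def decPlus (u : DiskMap D n) (p : Cyl) : Target n := uPlus u p - u.1 D.x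

/-- `u⁻ - c`, where `c = u(y)`. -/
def decMinus (u : DiskMap D n) (p : Cyl) : Target n := uMinus u p - u.2 D.y

theorem continuous_diskPoint : Continuous diskPoint := by
  unfold diskPoint
  refine Continuous.subtype_mk ?_ _
  refine Continuous.mul ?_ ?_
  · exact Complex.continuous_ofReal.comp (by fun_prop)
  · exact continuous_subtype_val.comp (AddCircle.continuous_toCircle.comp continuous_snd.neg)

theorem continuous_polarX : Continuous D.polarX :=
  D.chartX.symm.continuous.comp continuous_diskPoint

theorem continuous_polarY : Continuous D.polarY :=
  D.chartY.symm.continuous.comp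
    (continuous_diskPoint.comp (continuous_fst.prodMk continuous_snd.neg))

theorem continuous_uPlus (u : DiskMap D n) : Continuous (uPlus u) :=
  u.1.continuous.comp continuous_polarX

theorem continuous_uMinus (u : DiskMap D n) : Continuous (uMinus u) :=
  u.2.continuous.comp continuous_polarY

theorem continuous_decPlus (u : DiskMap D n) : Continuous (decPlus u) :=
  (continuous_uPlus u).sub continuous_const

theorem continuous_decMinus (u : DiskMap D n) : Continuous (decMinus u) :=
  (continuous_uMinus u).sub continuous_const

theorem decPlus_add (u v : DiskMap D n) :
    decPlus (u + v) = fun p => decPlus u p + decPlus v p := by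
  funext p; simp only [decPlus, uPlus, Prod.fst_add, ContinuousMap.add_apply]; abel

theorem decMinus_add (u v : DiskMap D n) :
    decMinus (u + v) = fun p => decMinus u p + decMinus v p := by
  funext p; simp only [decMinus, uMinus, Prod.snd_add, ContinuousMap.add_apply]; abel

theorem decPlus_smul (c : ℝ) (u : DiskMap D n) : decPlus (c • u) = fun p => c • decPlus u p := by
  funext p; simp [decPlus, uPlus, smul_sub]

theorem decMinus_smul (c : ℝ) (u : DiskMap D n) :
    decMinus (c • u) = fun p => c • decMinus u p := by
  funext p; simp [decMinus, uMinus, smul_sub]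

theorem exists_diskPoint (z : Metric.closedBall (0 : ℂ) 1) (hz : (z : ℂ) ≠ 0) :
    ∃ p : Cyl, 0 ≤ p.1 ∧ diskPoint p = z := by
  have hn : 0 < ‖(z : ℂ)‖ := norm_pos_iff.2 hz
  have h1 : ‖(z : ℂ)‖ ≤ 1 := mem_closedBall_zero_iff.1 z.2
  have hl : Real.log ‖(z : ℂ)‖ ≤ 0 := Real.log_nonpos hn.le h1
  have hp : (0 : ℝ) < 2 * Real.pi := Real.two_pi_pos
  have hs : 0 ≤ -Real.log ‖(z : ℂ)‖ / (2 * Real.pi) := div_nonneg (by linarith) hp.le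
  refine ⟨(-Real.log ‖(z : ℂ)‖ / (2 * Real.pi),
    ((-(Complex.arg z / (2 * Real.pi)) : ℝ) : UnitAddCircle)), hs, ?_⟩
  apply Subtype.ext
  simp only [diskPoint]
  rw [abs_of_nonneg hs, ← AddCircle.coe_neg, neg_neg, AddCircle.toCircle_apply_mk,
    Circle.coe_exp]
  have e1 : -(2 * Real.pi * (-Real.log ‖(z : ℂ)‖ / (2 * Real.pi))) = Real.log ‖(z : ℂ)‖ := by
    field_simp; try ring
  have e2 : 2 * Real.pi / 1 * (Complex.arg z / (2 * Real.pi)) = Complex.arg z := by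
    field_simp
  rw [e1, e2, Real.exp_log hn]
  exact Complex.norm_mul_exp_arg_mul_I z

/-- Weights `0 < δ_0 < δ_1 < … < 2π`. -/
structure Weights where
  δ : ℕ → ℝ
  strictMono : StrictMono δ
  pos : ∀ m, 0 < δ m
  lt_two_pi : ∀ m, δ m < 2 * Real.pi

end Maps

/-- The maps `u` with `u(x) = u(y) = c` such that `u^± - c` is of class `(m+3, δ_m)` on the
half-cylinder `ℝ^± × S¹`. -/
def level (D : NodedDiskPair) (n : ℕ) (W : Weights) (m : ℕ) : Submodule ℝ (DiskMap D n) where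
  carrier := {u | u.1 D.x = u.2 D.y ∧ IsSobolev (Ioi 0) (m + 3) (W.δ m) (decPlus u) ∧
    IsSobolev (Iio 0) (m + 3) (W.δ m) (decMinus u)}
  zero_mem' := by
    have hp : decPlus (0 : DiskMap D n) = fun _ => 0 := by funext p; simp [decPlus, uPlus]
    have hm : decMinus (0 : DiskMap D n) = fun _ => 0 := by funext p; simp [decMinus, uMinus]
    refine ⟨by simp, fun i j _ => ?_, fun i j _ => ?_⟩
    · rw [hp]; exact ⟨0, isWeakDeriv_zero isOpen_Ioi⟩
    · rw [hm]; exact ⟨0, isWeakDeriv_zero isOpen_Iio⟩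
  add_mem' := by
    rintro u v ⟨h1, h2, h3⟩ ⟨h1', h2', h3'⟩
    refine ⟨by simp [h1, h1'], fun i j hij => ?_, fun i j hij => ?_⟩
    · rw [decPlus_add]
      exact ⟨_, (wDeriv_spec (h2 i j hij)).add isOpen_Ioi (W.pos m).le (continuous_decPlus u)
        (continuous_decPlus v) (wDeriv_spec (h2' i j hij))⟩
    · rw [decMinus_add]
      exact ⟨_, (wDeriv_spec (h3 i j hij)).add isOpen_Iio (W.pos m).le (continuous_decMinus u)
        (continuous_decMinus v) (wDeriv_spec (h3' i j hij))⟩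
  smul_mem' := by
    rintro c u ⟨h1, h2, h3⟩
    refine ⟨by simp [h1], fun i j hij => ?_, fun i j hij => ?_⟩
    · rw [decPlus_smul]
      exact ⟨_, (wDeriv_spec (h2 i j hij)).smul isOpen_Ioi c⟩
    · rw [decMinus_smul]
      exact ⟨_, (wDeriv_spec (h3 i j hij)).smul isOpen_Iio c⟩

/-- The level `E_m` as a vector space; its norm is defined below. -/
def LevelSpace (D : NodedDiskPair) (n : ℕ) (W : Weights) (m : ℕ) : Type := level D n W m

section Norm

variable (D : NodedDiskPair) (n : ℕ) (W : Weights) (m : ℕ)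

instance : AddCommGroup (LevelSpace D n W m) := inferInstanceAs (AddCommGroup (level D n W m))

instance : Module ℝ (LevelSpace D n W m) := inferInstanceAs (Module ℝ (level D n W m))

/-- The multi-indices of order at most `k`. -/
abbrev MultiIdx (k : ℕ) : Type := {α : Fin (k + 1) × Fin (k + 1) // α.1.val + α.2.val ≤ k}

/-- The underlying map of an element of `E_m`. -/
def toMap : LevelSpace D n W m →ₗ[ℝ] DiskMap D n := (level D n W m).subtype

variable {D n W m}

/-- The asymptotic constant `c` together with all weak derivatives of `u^± - c` of order at most
`m + 3`, in `L²` for the weight `e^{δ_m |s|}`. -/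
def jet : LevelSpace D n W m →ₗ[ℝ]
    Target n × (MultiIdx (m + 3) → Lp (Target n) 2 (weightedMeasure (Ioi 0) (W.δ m))) ×
      (MultiIdx (m + 3) → Lp (Target n) 2 (weightedMeasure (Iio 0) (W.δ m))) where
  toFun u := ((toMap D n W m u).1 D.x,
    fun α => wDeriv (Ioi 0) (W.δ m) α.1.1 α.1.2 (decPlus (toMap D n W m u)),
    fun α => wDeriv (Iio 0) (W.δ m) α.1.1 α.1.2 (decMinus (toMap D n W m u)))
  map_add' u v := by
    refine Prod.ext (by simp) (Prod.ext (funext fun α => ?_) (funext fun α => ?_))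
    · refine IsWeakDeriv.unique isOpen_Ioi (W.pos m).le
        (wDeriv_spec ((u + v).2.2.1 _ _ α.2)) ?_
      have := (wDeriv_spec (u.2.2.1 _ _ α.2)).add isOpen_Ioi (W.pos m).le
        (continuous_decPlus u.1) (continuous_decPlus v.1) (wDeriv_spec (v.2.2.1 _ _ α.2))
      rw [← decPlus_add] at this
      exact this
    · refine IsWeakDeriv.unique isOpen_Iio (W.pos m).le
        (wDeriv_spec ((u + v).2.2.2 _ _ α.2)) ?_
      have := (wDeriv_spec (u.2.2.2 _ _ α.2)).add isOpen_Iio (W.pos m).le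
        (continuous_decMinus u.1) (continuous_decMinus v.1) (wDeriv_spec (v.2.2.2 _ _ α.2))
      rw [← decMinus_add] at this
      exact this
  map_smul' c u := by
    refine Prod.ext (by simp) (Prod.ext (funext fun α => ?_) (funext fun α => ?_))
    · refine IsWeakDeriv.unique isOpen_Ioi (W.pos m).le
        (wDeriv_spec ((c • u).2.2.1 _ _ α.2)) ?_
      have := (wDeriv_spec (u.2.2.1 _ _ α.2)).smul isOpen_Ioi c
      rw [← decPlus_smul] at this
      exact this
    · refine IsWeakDeriv.unique isOpen_Iio (W.pos m).le
        (wDeriv_spec ((c • u).2.2.2 _ _ α.2)) ?_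
      have := (wDeriv_spec (u.2.2.2 _ _ α.2)).smul isOpen_Iio c
      rw [← decMinus_smul] at this
      exact this

theorem eq_zero_of_weak {I : Set ℝ} (hI : IsOpen I) {δ : ℝ} {f : Cyl → Target n}
    (hf : Continuous f) (h : IsWeakDeriv I 0 0 f (0 : Lp (Target n) 2 (weightedMeasure I δ))) :
    ∀ p ∈ closure I ×ˢ (univ : Set UnitAddCircle), f p = 0 := by
  have hcov : Continuous cover := by unfold cover; fun_prop
  have h1 : ∀ᵐ p : ℝ × ℝ, p ∈ I ×ˢ (univ : Set ℝ) → f (cover p) = 0 := by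
    refine ae_cover_zero hI ((hf.comp hcov).continuousOn.locallyIntegrableOn
      (hI.measurableSet.prod MeasurableSet.univ)) ?_
    intro φ h1 h2 h3
    have e := h φ h1 h2 h3
    simp only [Function.iterate_zero, id, add_zero, pow_zero, one_smul] at e
    rw [e]
    rw [← integral_zero (ℝ × ℝ) (Target n)]
    apply integral_congr_ae
    filter_upwards [cover_ae I hI (Lp.coeFn_zero (Target n) 2 (weightedMeasure I δ))] with p hp
    by_cases hpI : p ∈ I ×ˢ (univ : Set ℝ)
    · rw [hp hpI]; simp
    · have : φ p = 0 := by
        by_contra h0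
        exact hpI (h3 (subset_tsupport φ h0))
      simp [this]
  have h2 : EqOn (fun p => f (cover p)) (fun _ => 0) (I ×ˢ (univ : Set ℝ)) := by
    refine Measure.eqOn_open_of_ae_eq (μ := volume) ?_ (hI.prod isOpen_univ)
      (hf.comp hcov).continuousOn continuousOn_const
    exact (ae_restrict_iff' (hI.measurableSet.prod MeasurableSet.univ)).2 h1
  have h3 : EqOn f (fun _ => 0) (I ×ˢ (univ : Set UnitAddCircle)) := by
    rintro ⟨s, t⟩ hp
    obtain ⟨t, rfl⟩ := QuotientAddGroup.mk_surjective t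
    exact h2 (x := (s, t)) ⟨hp.1, mem_univ _⟩
  have h4 := h3.closure hf continuous_const
  rw [closure_prod_eq, closure_univ] at h4
  exact h4

theorem jet_injective : Function.Injective (jet : LevelSpace D n W m →ₗ[ℝ] _) := by
  rw [injective_iff_map_eq_zero]
  intro u hu
  have hc : u.1.1 D.x = 0 := congrArg Prod.fst hu
  have hc' : u.1.2 D.y = 0 := u.2.1.symm.trans hc
  let α : MultiIdx (m + 3) := ⟨(0, 0), by simp⟩
  have hp : wDeriv (Ioi 0) (W.δ m) 0 0 (decPlus u.1) = 0 :=
    congrFun (congrArg (fun q => q.2.1) hu) α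
  have hm : wDeriv (Iio 0) (W.δ m) 0 0 (decMinus u.1) = 0 :=
    congrFun (congrArg (fun q => q.2.2) hu) α
  have hp' := wDeriv_spec (u.2.2.1 0 0 (by omega))
  have hm' := wDeriv_spec (u.2.2.2 0 0 (by omega))
  rw [hp] at hp'
  rw [hm] at hm'
  have zp := eq_zero_of_weak isOpen_Ioi (continuous_decPlus u.1) hp'
  have zm := eq_zero_of_weak isOpen_Iio (continuous_decMinus u.1) hm'
  apply Subtype.ext
  refine Prod.ext (ContinuousMap.ext fun z => ?_) (ContinuousMap.ext fun z => ?_)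
  · by_cases hz : ((D.chartX z : Metric.closedBall (0 : ℂ) 1) : ℂ) = 0
    · have : z = D.x := by
        rw [NodedDiskPair.x, ← D.chartX.symm_apply_apply z]
        exact congrArg _ (Subtype.ext hz)
      rw [this]; exact hc
    · obtain ⟨p, hp0, hpz⟩ := exists_diskPoint _ hz
      have := zp p ⟨by rw [closure_Ioi]; exact hp0, mem_univ _⟩
      simp only [decPlus, uPlus, NodedDiskPair.polarX, hpz, Homeomorph.symm_apply_apply, hc,
        sub_zero] at this
      exact this
  · by_cases hz : ((D.chartY z : Metric.closedBall (0 : ℂ) 1) : ℂ) = 0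
    · have : z = D.y := by
        rw [NodedDiskPair.y, ← D.chartY.symm_apply_apply z]
        exact congrArg _ (Subtype.ext hz)
      rw [this]; exact hc'
    · obtain ⟨p, hp0, hpz⟩ := exists_diskPoint _ hz
      have := zm (-p.1, -p.2) ⟨by rw [closure_Iio]; simpa using hp0, mem_univ _⟩
      have e : diskPoint (-p.1, p.2) = diskPoint p := by simp [diskPoint]
      simp only [decMinus, uMinus, NodedDiskPair.polarY, neg_neg, e, hpz,
        Homeomorph.symm_apply_apply, hc', sub_zero] at this
      exact this

/-- The norm of the level `E_m`: the maximum of `|c|` and of the weighted `L²`-norms of all weak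
derivatives of `u^± - c` of order at most `m + 3`. -/
instance : NormedAddCommGroup (LevelSpace D n W m) :=
  NormedAddCommGroup.induced _ _ jet jet_injective

instance : NormedSpace ℝ (LevelSpace D n W m) := NormedSpace.induced ℝ _ _ jet

end Norm

theorem sobolev_mono {n : ℕ} {I : Set ℝ} (hI : IsOpen I) {δ δ' : ℝ} (h : δ ≤ δ') (hδ : 0 ≤ δ)
    {i j : ℕ} {f : Cyl → Target n} (hf : HasWDeriv I δ' i j f) :
    HasWDeriv I δ i j f ∧ ‖wDeriv I δ i j f‖ ≤ ‖wDeriv I δ' i j f‖ := by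
  obtain ⟨g, hg, hle⟩ := HasWDeriv.mono hI h _ (wDeriv_spec hf)
  have h1 : HasWDeriv I δ i j f := ⟨g, hg⟩
  refine ⟨h1, ?_⟩
  rwa [IsWeakDeriv.unique hI hδ (wDeriv_spec h1) hg]

theorem level_mono (D : NodedDiskPair) (n : ℕ) (W : Weights) {m k : ℕ} (h : m ≤ k) :
    level D n W k ≤ level D n W m := by
  intro u hu
  have hw := W.strictMono.monotone h
  exact ⟨hu.1, fun i j hij => (sobolev_mono isOpen_Ioi hw (W.pos m).le
    (hu.2.1 i j (by omega))).1, fun i j hij => (sobolev_mono isOpen_Iio hw (W.pos m).le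
    (hu.2.2 i j (by omega))).1⟩

/-- The inclusion `E_k → E_m` for `m ≤ k`. -/
def levelIncl (D : NodedDiskPair) (n : ℕ) (W : Weights) {m k : ℕ} (h : m ≤ k) :
    LevelSpace D n W k →ₗ[ℝ] LevelSpace D n W m :=
  Submodule.inclusion (level_mono D n W h)

theorem norm_mono (D : NodedDiskPair) (n : ℕ) (W : Weights) {m k : ℕ} (h : m ≤ k)
    (u : LevelSpace D n W k) : ‖levelIncl D n W h u‖ ≤ 1 * ‖u‖ := by
  have hw := W.strictMono.monotone h
  rw [one_mul]
  change ‖jet (levelIncl D n W h u)‖ ≤ ‖jet u‖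
  refine max_le ?_ (max_le ?_ ?_)
  · exact norm_fst_le (jet u)
  · refine (pi_norm_le_iff_of_nonneg (norm_nonneg _)).2 fun α => ?_
    have hα := α.2
    let α' : MultiIdx (k + 3) := ⟨(⟨α.1.1, by omega⟩, ⟨α.1.2, by omega⟩), by
      simp only; omega⟩
    refine le_trans ?_ (((norm_le_pi_norm (jet u).2.1 α').trans (norm_fst_le _)).trans
      (norm_snd_le (jet u)))
    exact (sobolev_mono isOpen_Ioi hw (W.pos m).le (u.2.2.1 _ _ α'.2)).2
  · refine (pi_norm_le_iff_of_nonneg (norm_nonneg _)).2 fun α => ?_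
    have hα := α.2
    let α' : MultiIdx (k + 3) := ⟨(⟨α.1.1, by omega⟩, ⟨α.1.2, by omega⟩), by
      simp only; omega⟩
    refine le_trans ?_ (((norm_le_pi_norm (jet u).2.2 α').trans (norm_snd_le _)).trans
      (norm_snd_le (jet u)))
    exact (sobolev_mono isOpen_Iio hw (W.pos m).le (u.2.2.2 _ _ α'.2)).2

/-- The sc-space `E` of maps on the noded disk pair with matching asymptotic constant, with levels
of regularity `(m+3, δ_m)`. -/
def mapScale (D : NodedDiskPair) (n : ℕ) (W : Weights) : ScScale where
  Lev := LevelSpace D n W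
  incl h := (levelIncl D n W h).mkContinuous 1 (norm_mono D n W h)

/-! ### Gluing and anti-gluing -/

/-- A smooth cut-off function `β : ℝ → [0,1]` with `β = 1` on `(-∞,-1]`, `β' < 0` on `(-1,1)` and
`β(s) + β(-s) = 1`. -/
structure IsCutoff (β : ℝ → ℝ) : Prop where
  smooth : ContDiff ℝ ∞ β
  mem_Icc : ∀ s, β s ∈ Icc (0 : ℝ) 1
  eq_one : ∀ s ≤ -1, β s = 1
  deriv_neg : ∀ s ∈ Ioo (-1 : ℝ) 1, deriv β s < 0
  symm : ∀ s, β s + β (-s) = 1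

/-- The gluing length `R = φ(|a|)` of `a ≠ 0`, for the exponential profile `φ(r) = e^{1/r} - e`. -/
def gluingLength (a : ℂ) : ℝ := Real.exp (1 / ‖a‖) - Real.exp 1

/-- The gluing angle `ϑ` of `a ≠ 0`: `a = |a| e^{-2πiϑ}`. -/
def gluingAngle (a : ℂ) : UnitAddCircle := ((-(Complex.arg a / (2 * Real.pi)) : ℝ) : UnitAddCircle)

theorem gluingAngle_spec (a : ℂ) :
    a = ‖a‖ * (AddCircle.toCircle (-gluingAngle a) : ℂ) := by
  rw [gluingAngle, ← AddCircle.coe_neg, neg_neg, AddCircle.toCircle_apply_mk, Circle.coe_exp]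
  have e2 : 2 * Real.pi / 1 * (Complex.arg a / (2 * Real.pi)) = Complex.arg a := by
    have := Real.pi_ne_zero
    field_simp
  rw [e2]
  exact (Complex.norm_mul_exp_arg_mul_I a).symm

section Gluing

variable {D : NodedDiskPair} {n : ℕ}

/-- `⊕_a(h) : Z_a → ℝ^{2n}` for `a ≠ 0`, in the coordinates `[s,t] ∈ [0,R] × S¹` of `Z_a`. -/
def glue (D : NodedDiskPair) (n : ℕ) (β : ℝ → ℝ) (a : ℂ) :
    DiskMap D n →ₗ[ℝ] ({p : Cyl // p.1 ∈ Icc 0 (gluingLength a)} → Target n) where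
  toFun h p := β (p.1.1 - gluingLength a / 2) • uPlus h p.1 +
    (1 - β (p.1.1 - gluingLength a / 2)) •
      uMinus h (p.1.1 - gluingLength a, p.1.2 - gluingAngle a)
  map_add' h k := by
    funext p; simp only [uPlus, uMinus, Prod.fst_add, Prod.snd_add, ContinuousMap.add_apply,
      Pi.add_apply]; module
  map_smul' c h := by
    funext p; simp only [uPlus, uMinus, Prod.smul_fst, Prod.smul_snd, ContinuousMap.smul_apply,
      Pi.smul_apply, RingHom.id_apply]; module

/-- The average `av_R(h) = ½ ∫_{S¹} (h⁺(R/2,t) + h⁻(-R/2,t)) dt`. -/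
def average (D : NodedDiskPair) (n : ℕ) (R : ℝ) : DiskMap D n →ₗ[ℝ] Target n where
  toFun h := (1 / 2 : ℝ) • ∫ t : UnitAddCircle, (uPlus h (R / 2, t) + uMinus h (-(R / 2), t))
  map_add' h k := by
    have hi : ∀ u : DiskMap D n, Integrable
        (fun t : UnitAddCircle => uPlus u (R / 2, t) + uMinus u (-(R / 2), t)) := fun u => by
      have h1 := continuous_uPlus u
      have h2 := continuous_uMinus u
      exact Continuous.integrable_of_hasCompactSupport (by fun_prop)
        (HasCompactSupport.of_compactSpace _)
    rw [← smul_add, ← integral_add (hi h) (hi k)]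
    congr 2
    funext t
    simp only [uPlus, uMinus, Prod.fst_add, Prod.snd_add, ContinuousMap.add_apply]
    abel
  map_smul' c h := by
    simp only [uPlus, uMinus, Prod.smul_fst, Prod.smul_snd, ContinuousMap.smul_apply,
      RingHom.id_apply, ← smul_add, integral_smul]
    rw [smul_comm]

/-- `⊖_a(h) : Σ_a → ℝ^{2n}` for `a ≠ 0`, in the coordinates `[s,t] ∈ ℝ × S¹` of `Σ_a ∖ {x,y}`.
For `s < 0`, outside the domain of `h⁺`, the factor of `h⁺` vanishes, and for `s > R` that of
`h⁻`. -/
def antiGlue (D : NodedDiskPair) (n : ℕ) (β : ℝ → ℝ) (a : ℂ) :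
    DiskMap D n →ₗ[ℝ] (Cyl → Target n) where
  toFun h p := -((1 - β (p.1 - gluingLength a / 2)) •
      (uPlus h p - average D n (gluingLength a) h)) +
    β (p.1 - gluingLength a / 2) •
      (uMinus h (p.1 - gluingLength a, p.2 - gluingAngle a) - average D n (gluingLength a) h)
  map_add' h k := by
    funext p; simp only [uPlus, uMinus, Prod.fst_add, Prod.snd_add, ContinuousMap.add_apply,
      Pi.add_apply, map_add]; module
  map_smul' c h := by
    funext p; simp only [uPlus, uMinus, Prod.smul_fst, Prod.smul_snd, ContinuousMap.smul_apply,
      Pi.smul_apply, RingHom.id_apply, map_smul]; module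

end Gluing

section Projection

variable (D : NodedDiskPair) (n : ℕ) (W : Weights) (β : ℝ → ℝ)

open Classical in
/-- `ker(⊕_a) ⊆ E`, where `⊕_0` is the identity. -/
def kerGlue (a : ℂ) : Submodule ℝ ((mapScale D n W).Lev 0) :=
  if a = 0 then LinearMap.ker (LinearMap.id : (mapScale D n W).Lev 0 →ₗ[ℝ] _)
  else LinearMap.ker ((glue D n β a).comp (toMap D n W 0))

open Classical in
/-- `ker(⊖_a) ⊆ E`, where `⊖_0` is zero. -/
def kerAntiGlue (a : ℂ) : Submodule ℝ ((mapScale D n W).Lev 0) :=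
  if a = 0 then LinearMap.ker (0 : (mapScale D n W).Lev 0 →ₗ[ℝ] (mapScale D n W).Lev 0)
  else LinearMap.ker ((antiGlue D n β a).comp (toMap D n W 0))

open Classical in
/-- The projection `π_a` onto `ker(⊖_a)` along `ker(⊕_a)`. (The value `0` is used only if these
subspaces were not complementary.) -/
def splicingProj (a : ℂ) : (mapScale D n W).Lev 0 →ₗ[ℝ] (mapScale D n W).Lev 0 :=
  if h : IsCompl (kerAntiGlue D n W β a) (kerGlue D n W β a) then
    (kerAntiGlue D n W β a).projection (kerGlue D n W β a) h
  else 0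

end Projection

end GWSplicing

end

noncomputable section

namespace GWSplicing

/-! ### A criterion for sc-smoothness of parametrized families of operators -/

/-! After the negative half-cylinder is reflected, an element of E consists of a constant c and two
decaying functions f_b, b ∈ {true, false}, on [0,∞) × S¹. For a ≠ 0, gluing and anti-gluing couple
the value of f_b at p = (s,t) only to the value of f_{!b} at q - p, where q = (R,ϑ), and to
constants. With r = β(s - R/2) the coupling matrix has rows (r, 1-r) and (-(1-r), r), and its
determinant γ = r² + (1-r)² is positive. Solving the system gives π_a explicitly. If A is the
average of f_true and f_false over the middle circle s = R/2, then π_a replaces c by c + A and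
f_b(p) by (r/γ)(r f_b(p) + (1-r) f_{!b}(q-p) - A); this is `node_splicingOp` and `dec_splicingOp`.
That the formula is the projection onto ker ⊖_a along ker ⊕_a is then algebra with r, plus one
integration over the middle circle and one use of the decay at infinity.

For smoothness, π_a - id is written as a sum of multiplications by cut-offs, cut-off reflections and
averages. These involve f only at s ≥ R/2 - 1, so an operator of this type from E_k to E_m, k > m,
has norm O(e^{-(δ_k-δ_m)R/2}) (`IsTerm.exists_bound`). A derivative in R or ϑ produces operators of
the same type with one more derivative on f, hence a loss of one level. By the chain rule a
derivative in a also brings in coefficients built from Re a, Im a, 1/|a| and e^{1/|a|}, which are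
bounded by C e^{N/|a|}. Since R = e^{1/|a|} - e, the gain from the weights beats every such
coefficient (`exp_mul_exp_gluingLength_le`). The class `IsFamily` is therefore closed under
differentiation with bounds uniform up to a = 0, where all terms other than the identity are set to
0.

The passage from these bounds to sc-smoothness is abstract (`OperatorCalculus`). On a core, dense in
every level, of smooth maps that are constant near the nodes, differentiability is checked only
under point evaluations; near a = 0 every term vanishes on a fixed core element, since R is large.
Compactness of E_{m+1} → E_m turns pointwise into norm continuity (`continuousOn_core`), the
fundamental theorem of calculus gives norm derivatives on the core, and the uniform bounds extend
them to all of E_n. Finally, the maps generated by such operator families are stable under taking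
tangent maps (`Generated.exists_tangent`), so every order of sc-differentiability follows by
induction.

It remains that E is a sc-Banach space. Completeness uses the Sobolev inequality and the closedness
of weak derivatives. Density of the core is mollification into the half-cylinder followed by
truncation. Compactness of E_k → E_m for m < k is an Ehrling inequality: interpolation reduces all
derivatives to the function itself, the extra weight controls the ends, and finitely many point
values control the rest (`isCompactOperator_incl`). -/

/-- The real linear map `ℂ → Y` with partial derivatives `y₁`, `y₂`. -/
def partials {Y : Type} [NormedAddCommGroup Y] [NormedSpace ℝ Y] (y₁ y₂ : Y) : ℂ →L[ℝ] Y :=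
  Complex.reCLM.smulRight y₁ + Complex.imCLM.smulRight y₂

theorem partials_apply {Y : Type} [NormedAddCommGroup Y] [NormedSpace ℝ Y] (y₁ y₂ : Y) (w : ℂ) :
    partials y₁ y₂ w = w.re • y₁ + w.im • y₂ := by
  simp [partials]

theorem norm_partials_le {Y : Type} [NormedAddCommGroup Y] [NormedSpace ℝ Y] (y₁ y₂ : Y) :
    ‖partials y₁ y₂‖ ≤ ‖y₁‖ + ‖y₂‖ := by
  refine ContinuousLinearMap.opNorm_le_bound _ (by positivity) fun w => ?_
  rw [partials_apply]
  refine (norm_add_le _ _).trans ?_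
  rw [norm_smul, norm_smul, add_mul, mul_comm ‖y₁‖, mul_comm ‖y₂‖]
  gcongr
  · exact Complex.abs_re_le_norm w
  · exact Complex.abs_im_le_norm w

theorem partials_sub {Y : Type} [NormedAddCommGroup Y] [NormedSpace ℝ Y] (y₁ y₂ z₁ z₂ : Y) :
    partials y₁ y₂ - partials z₁ z₂ = partials (y₁ - z₁) (y₂ - z₂) := by
  ext w
  simp only [_root_.sub_apply, partials_apply]
  module

theorem map_partials {Y Z : Type} [NormedAddCommGroup Y] [NormedSpace ℝ Y]
    [NormedAddCommGroup Z] [NormedSpace ℝ Z] (T : Y →L[ℝ] Z) (y₁ y₂ : Y) (w : ℂ) :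
    T (partials y₁ y₂ w) = partials (T y₁) (T y₂) w := by
  simp [partials_apply]

/-- Classes of families of operators, parametrized by an open set `V ⊆ ℂ`, on a common dense
subspace of all levels of a sc-Banach space. The families of class `cls ℓ` lose `ℓ` levels; their
derivatives exist in the weak sense of a separating family of functionals and are of class
`cls (ℓ + 1)`. -/
structure OperatorCalculus (E : ScScale) (X Y : Type) [AddCommGroup X] [Module ℝ X]
    [NormedAddCommGroup Y] [NormedSpace ℝ Y] (V : Set ℂ) where
  sc : E.IsScBanach
  isOpen : IsOpen V
  ι : ∀ m, X →ₗ[ℝ] E.Lev m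
  dense : ∀ m, DenseRange (ι m)
  incl_ι : ∀ {m n : ℕ} (h : m ≤ n) (x : X), E.incl h (ι n x) = ι m x
  Ev : Type
  ev : Ev → (E.Lev 0 →L[ℝ] Y)
  sep : ∀ e, (∀ t, ev t e = 0) → e = 0
  cls : ℕ → (ℂ → X →ₗ[ℝ] X) → Prop
  bound : ∀ {ℓ G}, cls ℓ G → ∀ {m n}, m + ℓ ≤ n →
    ∃ C, ∀ v ∈ V, ∀ x, ‖ι m (G v x)‖ ≤ C * ‖ι n x‖
  deriv : ∀ {ℓ G}, cls ℓ G → ∃ Gx Gy, cls (ℓ + 1) Gx ∧ cls (ℓ + 1) Gy ∧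
    ∀ x t, ∀ v ∈ V, HasFDerivAt (fun v => ev t (ι 0 (G v x)))
      (partials (ev t (ι 0 (Gx v x))) (ev t (ι 0 (Gy v x)))) v

namespace OperatorCalculus

variable {E : ScScale} {X Y : Type} [AddCommGroup X] [Module ℝ X]
    [NormedAddCommGroup Y] [NormedSpace ℝ Y] {V : Set ℂ}
    (S : OperatorCalculus E X Y V) 

/-- The extension of a family to an operator `E_n → E_m`. -/
def op (G : ℂ → X →ₗ[ℝ] X) (m n : ℕ) (v : ℂ) : E.Lev n →L[ℝ] E.Lev m :=
  haveI := S.sc.complete m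
  LinearMap.extendOfNorm ((S.ι m).comp (G v)) (S.ι n)

variable {S} {ℓ : ℕ} {G : ℂ → X →ₗ[ℝ] X}

theorem op_ι (hG : S.cls ℓ G) {m n : ℕ} (h : m + ℓ ≤ n) {v : ℂ} (hv : v ∈ V) (x : X) :
    S.op G m n v (S.ι n x) = S.ι m (G v x) := by
  have := S.sc.complete m
  obtain ⟨C, hC⟩ := S.bound hG h
  exact LinearMap.extendOfNorm_eq (f := (S.ι m).comp (G v)) (S.dense n) ⟨C, fun x => hC v hv x⟩ x

theorem op_norm (hG : S.cls ℓ G) {m n : ℕ} (h : m + ℓ ≤ n) :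
    ∃ C, 0 ≤ C ∧ ∀ v ∈ V, ∀ e, ‖S.op G m n v e‖ ≤ C * ‖e‖ := by
  have := S.sc.complete m
  obtain ⟨C, hC⟩ := S.bound hG h
  refine ⟨|C|, abs_nonneg C, fun v hv e => ?_⟩
  refine LinearMap.norm_extendOfNorm_apply_le (f := (S.ι m).comp (G v)) (S.dense n) |C|
    (fun x => (hC v hv x).trans ?_) e
  gcongr
  exact le_abs_self C

theorem op_compat (hG : S.cls ℓ G) {m n m' n' : ℕ} (h : m + ℓ ≤ n) (h' : m' + ℓ ≤ n')
    (hm : m ≤ m') (hn : n ≤ n') {v : ℂ} (hv : v ∈ V) (e : E.Lev n') :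
    E.incl hm (S.op G m' n' v e) = S.op G m n v (E.incl hn e) := by
  refine (S.dense n').induction_on (p := fun e =>
    E.incl hm (S.op G m' n' v e) = S.op G m n v (E.incl hn e)) e ?_ ?_
  · exact isClosed_eq (by fun_prop) (by fun_prop)
  · intro x
    rw [op_ι hG h' hv, S.incl_ι, S.incl_ι, op_ι hG h hv]

theorem base_injective (S : OperatorCalculus E X Y V) (m : ℕ) : Function.Injective (E.base m) :=
  S.sc.injective _

/-- The bound at level m+1 keeps the orbit v ↦ G_v x in a bounded set of E_{m+1}, hence in a compact
subset K of E_m. On K the norm topology coincides with the Hausdorff topology of the separating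
functionals, and under these the orbit is continuous because it is differentiable. -/
theorem continuousOn_core (hG : S.cls ℓ G) (m : ℕ) (x : X) :
    ContinuousOn (fun v => S.ι m (G v x)) V := by
  obtain ⟨C, hC⟩ := S.bound hG (le_refl (m + 1 + ℓ))
  set r := C * ‖S.ι (m + 1 + ℓ) x‖
  have hcomp := S.sc.compact (Nat.lt_succ_self m)
  have hK : IsCompact (closure (E.incl (Nat.lt_succ_self m).le '' Metric.closedBall 0 r)) :=
    IsCompactOperator.isCompact_closure_image_closedBall
      (f := (E.incl (Nat.lt_succ_self m).le).toLinearMap) hcomp r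
  set K := closure (E.incl (Nat.lt_succ_self m).le '' Metric.closedBall 0 r)
  have : CompactSpace K := isCompact_iff_compactSpace.1 hK
  let Φ : K → (S.Ev → Y) := fun e t => S.ev t (E.base m e)
  have hΦc : Continuous Φ := by fun_prop
  have hΦi : Function.Injective Φ := by
    intro e e' hee
    apply Subtype.ext
    apply S.base_injective m
    rw [← sub_eq_zero]
    apply S.sep
    intro t
    rw [map_sub, sub_eq_zero]
    exact congrFun hee t
  -- A continuous injection of a compact space into a Hausdorff space is an embedding; this is where
  -- weak continuity becomes continuity in norm.
  have hemb := hΦc.isClosedEmbedding hΦi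
  have hmem : ∀ v : V, S.ι m (G v x) ∈ K := fun v => by
    apply subset_closure
    refine ⟨S.ι (m + 1) (G v x), ?_, S.incl_ι _ _⟩
    rw [mem_closedBall_zero_iff]
    exact hC v v.2 x
  have hcont : Continuous (fun v : V => (⟨S.ι m (G v x), hmem v⟩ : K)) := by
    rw [hemb.isInducing.continuous_iff]
    refine continuous_pi fun t => ?_
    obtain ⟨Gx, Gy, -, -, hd⟩ := S.deriv hG
    have h1 : ContinuousOn (fun v => S.ev t (S.ι 0 (G v x))) V := fun v hv =>
      (hd x t v hv).continuousAt.continuousWithinAt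
    have h2 := continuousOn_iff_continuous_domRestrict.1 h1
    convert h2 using 2 with v
    simp [Φ, S.incl_ι]
  exact continuousOn_iff_continuous_domRestrict.2 (continuous_subtype_val.comp hcont)

/-- The operator norms are bounded uniformly in v, so strong continuity on the dense core passes to
all vectors, jointly with the vector, by an ε/4 argument. No continuity in the operator norm is
claimed. -/
theorem continuousOn_op (hG : S.cls ℓ G) {m n : ℕ} (h : m + ℓ ≤ n) :
    ContinuousOn (fun p : ℂ × E.Lev n => S.op G m n p.1 p.2) (V ×ˢ univ) := by
  obtain ⟨C, hC0, hC⟩ := op_norm hG h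
  rintro ⟨v, e⟩ ⟨hv, -⟩
  rw [ContinuousWithinAt, Metric.tendsto_nhdsWithin_nhds]
  intro ε hε
  obtain ⟨x, hx⟩ := (S.dense n).exists_dist_lt e (show 0 < ε / (4 * (C + 1)) by positivity)
  have hc := S.continuousOn_core hG m x v hv
  rw [ContinuousWithinAt, Metric.tendsto_nhdsWithin_nhds] at hc
  obtain ⟨d, hd, hd'⟩ := hc (ε / 4) (by positivity)
  refine ⟨min d (ε / (4 * (C + 1))), by positivity, ?_⟩
  rintro ⟨v', e'⟩ ⟨hv', -⟩ hdist
  rw [Prod.dist_eq, max_lt_iff] at hdist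
  have h1 := hd' hv' (hdist.1.trans_le (min_le_left _ _))
  have h2 := hdist.2.trans_le (min_le_right _ _)
  simp only at h1 h2 ⊢
  rw [← op_ι hG h hv', ← op_ι hG h hv] at h1
  have k1 : dist (S.op G m n v' e') (S.op G m n v' e) ≤ ε / 4 := by
    rw [dist_eq_norm, ← map_sub]
    refine (hC v' hv' _).trans ?_
    rw [← dist_eq_norm]
    calc C * dist e' e ≤ (C + 1) * (ε / (4 * (C + 1))) := by gcongr; linarith
      _ = ε / 4 := by field_simp
  have k2 : ∀ u ∈ V, dist (S.op G m n u e) (S.op G m n u (S.ι n x)) ≤ ε / 4 := by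
    intro u hu
    rw [dist_eq_norm, ← map_sub]
    refine (hC u hu _).trans ?_
    rw [← dist_eq_norm]
    calc C * dist e _ ≤ (C + 1) * (ε / (4 * (C + 1))) := by gcongr; linarith
      _ = ε / 4 := by field_simp
  have k3 := k2 v' hv'
  have k4 := k2 v hv
  rw [dist_comm] at k4
  calc _ ≤ dist (S.op G m n v' e') (S.op G m n v' e) + dist (S.op G m n v' e) (S.op G m n v' (S.ι n x))
      + dist (S.op G m n v' (S.ι n x)) (S.op G m n v (S.ι n x))
      + dist (S.op G m n v (S.ι n x)) (S.op G m n v e) := by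
        refine (dist_triangle _ (S.op G m n v (S.ι n x)) _).trans ?_
        gcongr
        refine (dist_triangle _ (S.op G m n v' (S.ι n x)) _).trans ?_
        gcongr
        exact dist_triangle _ _ _
    _ < ε := by linarith

/-- The pairs of families that are partial derivatives of a family. -/
def IsDeriv (S : OperatorCalculus E X Y V) (G Gx Gy : ℂ → X →ₗ[ℝ] X) : Prop :=
  ∀ x t, ∀ v ∈ V, HasFDerivAt (fun v => S.ev t (S.ι 0 (G v x)))
      (partials (S.ev t (S.ι 0 (Gx v x))) (S.ev t (S.ι 0 (Gy v x)))) v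

variable {Gx Gy : ℂ → X →ₗ[ℝ] X}

/-- Along the segment from v to u the increment minus its linear part is the integral of the
increments of the partial derivatives. The identity lives in E_m but is verified under the
separating functionals, where the derivative is given. Since the partial derivatives are already
continuous in the norm of E_m, the integral is o(|u - v|). -/
theorem hasFDerivAt_core [CompleteSpace Y] (hGx : S.cls (ℓ + 1) Gx)
    (hGy : S.cls (ℓ + 1) Gy) (hd : S.IsDeriv G Gx Gy) (m : ℕ) (x : X) {v : ℂ} (hv : v ∈ V) :
    HasFDerivAt (fun v => S.ι m (G v x)) (partials (S.ι m (Gx v x)) (S.ι m (Gy v x))) v := by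
  have := S.sc.complete m
  have hcx := continuousOn_core hGx m x
  have hcy := continuousOn_core hGy m x
  refine HasFDerivAt.of_isLittleO ?_
  rw [Asymptotics.isLittleO_iff]
  intro c hc
  have e1 := (hcx v hv).continuousAt (S.isOpen.mem_nhds hv)
  have e2 := (hcy v hv).continuousAt (S.isOpen.mem_nhds hv)
  have e3 := Metric.tendsto_nhds.1 e1 (c / 2) (by positivity)
  have e4 := Metric.tendsto_nhds.1 e2 (c / 2) (by positivity)
  obtain ⟨r, hr, hball⟩ := Metric.eventually_nhds_iff_ball.1
    ((e3.and e4).and (S.isOpen.mem_nhds hv))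
  filter_upwards [Metric.ball_mem_nhds v hr] with u hu
  let γ' : ℂ → ℂ →L[ℝ] E.Lev m := fun a => partials (S.ι m (Gx a x)) (S.ι m (Gy a x))
  have hseg : ∀ τ ∈ Icc (0 : ℝ) 1, v + τ • (u - v) ∈ Metric.ball v r := by
    intro τ hτ
    have : v + τ • (u - v) ∈ segment ℝ v u := by
      rw [segment_eq_image']; exact ⟨τ, hτ, rfl⟩
    exact (convex_ball v r).segment_subset (Metric.mem_ball_self hr) hu this
  have hcont : ContinuousOn (fun τ : ℝ => γ' (v + τ • (u - v)) (u - v) - γ' v (u - v)) (uIcc 0 1) := by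
    rw [uIcc_of_le zero_le_one]
    have hmaps : MapsTo (fun τ : ℝ => v + τ • (u - v)) (Icc 0 1) V := fun τ hτ => (hball _ (hseg τ hτ)).2
    have hline : ContinuousOn (fun τ : ℝ => v + τ • (u - v)) (Icc 0 1) := by fun_prop
    simp only [γ', partials_apply]
    exact (((hcx.comp hline hmaps).const_smul _).add ((hcy.comp hline hmaps).const_smul _)).sub
      continuousOn_const
  have key : S.ι m (G u x) - S.ι m (G v x) - γ' v (u - v) =
      ∫ τ in (0 : ℝ)..1, (γ' (v + τ • (u - v)) (u - v) - γ' v (u - v)) := by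
    apply S.base_injective m
    rw [← sub_eq_zero, ← map_sub]
    apply S.sep
    intro t
    have ec := ContinuousLinearMap.intervalIntegral_comp_comm ((S.ev t).comp (E.base m))
      (hcont.intervalIntegrable (μ := volume))
    simp only [ContinuousLinearMap.comp_apply] at ec
    rw [map_sub, map_sub, ← ec, sub_eq_zero]
    have hder : ∀ τ ∈ uIcc (0 : ℝ) 1, HasDerivAt
        (fun τ : ℝ => S.ev t (S.ι 0 (G (v + τ • (u - v)) x)) - τ • S.ev t (E.base m (γ' v (u - v))))
        (S.ev t (E.base m (γ' (v + τ • (u - v)) (u - v) - γ' v (u - v)))) τ := by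
      intro τ hτ
      rw [uIcc_of_le zero_le_one] at hτ
      have h1 := hd x t _ (hball _ (hseg τ hτ)).2
      have h2 : HasDerivAt (fun τ : ℝ => v + τ • (u - v)) (u - v) τ := by
        simpa using ((hasDerivAt_id τ).smul_const (u - v)).const_add v
      have h3 := h1.comp_hasDerivAt τ h2
      have h4 := h3.sub ((hasDerivAt_id τ).smul_const (S.ev t (E.base m (γ' v (u - v)))))
      refine h4.congr_deriv ?_
      rw [map_sub (E.base m) (γ' (v + τ • (u - v)) (u - v)), map_sub (S.ev t), one_smul]
      congr 1
      symm
      simp only [γ']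
      have := map_partials ((S.ev t).comp (E.base m)) (S.ι m (Gx (v + τ • (u - v)) x))
        (S.ι m (Gy (v + τ • (u - v)) x)) (u - v)
      simp only [ContinuousLinearMap.comp_apply, S.incl_ι] at this
      exact this
    have hcont' := ((S.ev t).comp (E.base m)).continuous.comp_continuousOn hcont
    rw [intervalIntegral.integral_eq_sub_of_hasDerivAt hder hcont'.intervalIntegrable]
    simp [S.incl_ι]
    abel
  change ‖S.ι m (G u x) - S.ι m (G v x) - γ' v (u - v)‖ ≤ c * ‖u - v‖
  rw [key]
  refine (intervalIntegral.norm_integral_le_of_norm_le_const (C := c * ‖u - v‖) ?_).trans (by simp)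
  intro τ hτ
  rw [uIoc_of_le zero_le_one] at hτ
  have hb := (hball _ (hseg τ ⟨hτ.1.le, hτ.2⟩)).1
  rw [← _root_.sub_apply]
  refine (ContinuousLinearMap.le_opNorm _ _).trans ?_
  gcongr
  simp only [γ']
  rw [partials_sub]
  refine (norm_partials_le _ _).trans ?_
  rw [← dist_eq_norm, ← dist_eq_norm]
  linarith [hb.1, hb.2]

/-- Core elements approximating e give differentiable curves whose derivatives converge uniformly on
V, by the uniform bounds for `Gx` and `Gy`. These bounds lose ℓ+1 levels, which explains the
condition on m and n. -/
theorem hasFDerivAt_op_apply [CompleteSpace Y] (hG : S.cls ℓ G) (hGx : S.cls (ℓ + 1) Gx)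
    (hGy : S.cls (ℓ + 1) Gy) (hd : S.IsDeriv G Gx Gy) {m n : ℕ} (h : m + (ℓ + 1) ≤ n)
    (e : E.Lev n) {v : ℂ} (hv : v ∈ V) :
    HasFDerivAt (fun v => S.op G m n v e)
      (partials (S.op Gx m n v e) (S.op Gy m n v e)) v := by
  have := S.sc.complete m
  obtain ⟨Cx, hx0, hCx⟩ := op_norm hGx h
  obtain ⟨Cy, hy0, hCy⟩ := op_norm hGy h
  have hseq : ∀ k : ℕ, ∃ x : X, dist e (S.ι n x) < 1 / ((k : ℝ) + 1) := fun k =>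
    (S.dense n).exists_dist_lt e (by positivity)
  choose x hx using hseq
  have hlim : Filter.Tendsto (fun k => S.ι n (x k)) Filter.atTop (𝓝 e) := by
    rw [tendsto_iff_dist_tendsto_zero]
    refine squeeze_zero (fun _ => dist_nonneg) (fun k => ?_) tendsto_one_div_add_atTop_nhds_zero_nat
    rw [dist_comm]; exact (hx k).le
  refine hasFDerivAt_of_tendstoUniformlyOn (l := Filter.atTop) S.isOpen
    (f := fun k v => S.op G m n v (S.ι n (x k)))
    (f' := fun k v => partials (S.op Gx m n v (S.ι n (x k))) (S.op Gy m n v (S.ι n (x k))))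
    (g' := fun v => partials (S.op Gx m n v e) (S.op Gy m n v e)) ?_ ?_ ?_ hv
  · rw [Metric.tendstoUniformlyOn_iff]
    intro ε hε
    have := Metric.tendsto_nhds.1 hlim (ε / (Cx + Cy + 1)) (by positivity)
    filter_upwards [this] with k hk u hu
    rw [dist_eq_norm, partials_sub]
    refine (norm_partials_le _ _).trans_lt ?_
    rw [← map_sub, ← map_sub]
    have a1 := hCx u hu (e - S.ι n (x k))
    have a2 := hCy u hu (e - S.ι n (x k))
    rw [dist_comm, dist_eq_norm, lt_div_iff₀ (by positivity)] at hk
    nlinarith [norm_nonneg (e - S.ι n (x k))]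
  · intro k u hu
    have := S.hasFDerivAt_core hGx hGy hd m (x k) hu
    rw [op_ι hGx h hu, op_ι hGy h hu]
    refine this.congr_of_eventuallyEq ?_
    filter_upwards [S.isOpen.mem_nhds hu] with w hw
    exact op_ι hG (by omega) hw _
  · intro u hu
    exact ((S.op G m n u).continuous.tendsto e).comp hlim

/-- The map splits into its partial behaviour at (v, e) and the mixed term (G_{v'} - G_v)(e' - e).
By the mean value inequality the mixed term is bounded by a constant times |v' - v| ‖e' - e‖, so its
derivative vanishes; differentiability in the operator norm is not needed. -/
theorem hasFDerivAt_op [CompleteSpace Y] (hG : S.cls ℓ G) (hGx : S.cls (ℓ + 1) Gx)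
    (hGy : S.cls (ℓ + 1) Gy) (hd : S.IsDeriv G Gx Gy) {m n : ℕ} (h : m + (ℓ + 1) ≤ n)
    (e : E.Lev n) {v : ℂ} (hv : v ∈ V) :
    HasFDerivAt (fun p : ℂ × E.Lev n => S.op G m n p.1 p.2)
      ((partials (S.op Gx m n v e) (S.op Gy m n v e)).comp (ContinuousLinearMap.fst ℝ _ _) +
        (S.op G m n v).comp (ContinuousLinearMap.snd ℝ _ _)) (v, e) := by
  obtain ⟨Cx, hx0, hCx⟩ := op_norm hGx h
  obtain ⟨Cy, hy0, hCy⟩ := op_norm hGy h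
  have h1 := hasFDerivAt_op_apply hG hGx hGy hd h e hv
  have h2 : HasFDerivAt (fun p : ℂ × E.Lev n => S.op G m n p.1 e + S.op G m n v (p.2 - e))
      ((partials (S.op Gx m n v e) (S.op Gy m n v e)).comp (ContinuousLinearMap.fst ℝ _ _) +
        (S.op G m n v).comp (ContinuousLinearMap.snd ℝ _ _)) (v, e) := by
    refine HasFDerivAt.add ?_ ?_
    · exact HasFDerivAt.comp (v, e) h1 (ContinuousLinearMap.fst ℝ ℂ (E.Lev n)).hasFDerivAt
    · exact HasFDerivAt.comp (v, e) (S.op G m n v).hasFDerivAt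
        ((ContinuousLinearMap.snd ℝ ℂ (E.Lev n)).hasFDerivAt.sub_const e)
  have h3 : HasFDerivAt (fun p : ℂ × E.Lev n => S.op G m n p.1 (p.2 - e) - S.op G m n v (p.2 - e))
      (0 : ℂ × E.Lev n →L[ℝ] E.Lev m) (v, e) := by
    refine HasFDerivAt.of_isLittleO ?_
    rw [Asymptotics.isLittleO_iff]
    intro c hc
    obtain ⟨r, hr, hball⟩ := Metric.isOpen_iff.1 S.isOpen v hv
    have hr' : 0 < min r (c / (Cx + Cy + 1)) := by positivity
    filter_upwards [Metric.ball_mem_nhds (v, e) hr'] with p hp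
    have hp1 : dist p.1 v < min r (c / (Cx + Cy + 1)) :=
      (le_max_left _ _).trans_lt (by simpa [Prod.dist_eq] using hp)
    have hlip : ‖S.op G m n p.1 (p.2 - e) - S.op G m n v (p.2 - e)‖ ≤
        ((Cx + Cy) * ‖p.2 - e‖) * ‖p.1 - v‖ := by
      refine (convex_ball v r).norm_image_sub_le_of_norm_hasFDerivWithin_le
        (f := fun u => S.op G m n u (p.2 - e)) (fun u hu =>
          (hasFDerivAt_op_apply hG hGx hGy hd h (p.2 - e) (hball hu)).hasFDerivWithinAt) ?_
        (Metric.mem_ball_self hr) (hp1.trans_le (min_le_left _ _))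
      intro u hu
      refine (norm_partials_le _ _).trans ?_
      rw [add_mul]
      exact add_le_add (hCx u (hball hu) _) (hCy u (hball hu) _)
    simp only [sub_self, map_zero, sub_zero, _root_.zero_apply]
    refine hlip.trans ?_
    have hq : ‖p.1 - v‖ * (Cx + Cy + 1) ≤ c := by
      rw [← dist_eq_norm, ← le_div_iff₀ (by positivity)]
      exact (hp1.trans_le (min_le_right _ _)).le
    have hq' : ‖p.2 - e‖ ≤ ‖p - (v, e)‖ := norm_snd_le (p - (v, e))
    have : (Cx + Cy) * ‖p.1 - v‖ ≤ c := by nlinarith [norm_nonneg (p.1 - v)]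
    calc (Cx + Cy) * ‖p.2 - e‖ * ‖p.1 - v‖ = ((Cx + Cy) * ‖p.1 - v‖) * ‖p.2 - e‖ := by ring
      _ ≤ c * ‖p - (v, e)‖ := by gcongr
  have h4 := h2.add h3
  rw [add_zero] at h4
  refine h4.congr_of_eventuallyEq (Filter.Eventually.of_forall fun p => ?_)
  simp only [Pi.add_apply, map_sub]
  abel

end OperatorCalculus

end GWSplicing

end
-- Stability of the calculus under tangent maps, and sc-smoothness.
noncomputable section

namespace GWSplicing

namespace OperatorCalculus

variable {E : ScScale} {X Y : Type} [AddCommGroup X] [Module ℝ X]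
    [NormedAddCommGroup Y] [NormedSpace ℝ Y] {V : Set ℂ}

/-- The maps `G_0 → H_0` obtained by addition and multiplication by linear functionals from the maps
`x ↦ κ (Q(a x) (l x))`, where `Q` is a family of operators of the calculus and `a`, `l`, `κ` are
linear and compatible with the scales. -/
inductive Generated (S : OperatorCalculus E X Y V) (G H : ScScale) (a : G.Lev 0 →L[ℝ] ℂ) :
    (G.Lev 0 → H.Lev 0) → Prop
  | term {q r ℓ : ℕ} (h : r + ℓ ≤ q)
      {Q : ℂ → X →ₗ[ℝ] X} (hQ : S.cls ℓ Q) (l : ∀ m, G.Lev m →L[ℝ] E.Lev (m + q))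
      (hl : ∀ {m n : ℕ} (h : m ≤ n) (x : G.Lev n),
        E.incl (Nat.add_le_add_right h q) (l n x) = l m (G.incl h x))
      (κ : ∀ m, E.Lev (m + r) →L[ℝ] H.Lev m)
      (hκ : ∀ {m n : ℕ} (h : m ≤ n) (x : E.Lev (n + r)),
        H.incl h (κ n x) = κ m (E.incl (Nat.add_le_add_right h r) x)) :
      Generated S G H a (fun x => κ 0 (S.op Q (0 + r) (0 + q) (a x) (l 0 x)))
  | add {f g : G.Lev 0 → H.Lev 0} :
      Generated S G H a f → Generated S G H a g → Generated S G H a (fun x => f x + g x)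
  | smul {f : G.Lev 0 → H.Lev 0} (φ : G.Lev 0 →L[ℝ] ℝ) :
      Generated S G H a f → Generated S G H a (fun x => φ x • f x)

/-- The parameter functional of the tangent. -/
abbrev tangentParam (G : ScScale) (a : G.Lev 0 →L[ℝ] ℂ) : G.tangent.Lev 0 →L[ℝ] ℂ :=
  (a.comp (G.base 1)).comp (ContinuousLinearMap.fst ℝ (G.Lev 1) (G.Lev 0))

variable {S : OperatorCalculus E X Y V} {G H : ScScale} {a : G.Lev 0 →L[ℝ] ℂ}
  {f : G.Lev 0 → H.Lev 0}

theorem Generated.isSc0 (hf : Generated S G H a f) : IsSc0 G H (a ⁻¹' V) f := by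
  induction hf with
  | @term q r ℓ h Q hQ l hl κ hκ =>
    intro m
    refine ⟨fun x => κ m (S.op Q (m + r) (m + q) (a (G.base m x)) (l m x)), ?_, ?_⟩
    · refine (κ m).continuous.comp_continuousOn ?_
      refine (continuousOn_op hQ (m := m + r) (n := m + q) (by omega)).comp
        (f := fun x => (a (G.base m x), l m x)) (by fun_prop) ?_
      intro x hx
      exact ⟨hx, mem_univ _⟩
    · intro x hx
      rw [ScScale.base, hκ, op_compat hQ (by omega) (by omega) _
        (Nat.add_le_add_right (Nat.zero_le m) q) hx, hl]
  | add _ _ ih1 ih2 =>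
    intro m
    obtain ⟨g1, h1, h1'⟩ := ih1 m
    obtain ⟨g2, h2, h2'⟩ := ih2 m
    exact ⟨fun x => g1 x + g2 x, h1.add h2, fun x hx => by rw [map_add, h1' x hx, h2' x hx]⟩
  | @smul f φ _ ih =>
    intro m
    obtain ⟨g, h, h'⟩ := ih m
    exact ⟨fun x => φ (G.base m x) • g x,
      (by fun_prop : Continuous fun x => φ (G.base m x)).continuousOn.smul h,
      fun x hx => by rw [map_smul, h' x hx]⟩

theorem Generated.congr {f g : G.Lev 0 → H.Lev 0} (hf : Generated S G H a f)
    (h : ∀ x, g x = f x) : Generated S G H a g :=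
  (funext h : g = f) ▸ hf

/-- Needed for the product rule: the tangent of φ·f contains the term φ(h) f(x) in its second
component, with f read off at the base point x of level one and no derivative taken. -/
theorem Generated.inr (hf : Generated S G H a f) :
    Generated S G.tangent H.tangent (tangentParam G a)
      (fun p : G.Lev 1 × G.Lev 0 => ((0 : H.Lev 1), f (G.base 1 p.1))) := by
  induction hf with
  | @term q r ℓ h Q hQ l hl κ hκ =>
    refine (Generated.term (S := S) (G := G.tangent) (H := H.tangent) (a := tangentParam G a) h hQ
      (fun m => ((E.incl (by omega : m + q ≤ m + 1 + q)).comp (l (m + 1))).comp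
        (ContinuousLinearMap.fst ℝ (G.Lev (m + 1)) (G.Lev m)))
      (fun {m n} hmn p => ?_)
      (fun m => (ContinuousLinearMap.inr ℝ (H.Lev (m + 1)) (H.Lev m)).comp (κ m))
      (fun {m n} hmn x => Prod.ext (map_zero (H.incl (Nat.succ_le_succ hmn))) (hκ hmn x))).congr fun p => ?_
    · have e : ∀ y : G.Lev (n + 1), E.incl (Nat.add_le_add_right hmn q)
          (E.incl (by omega : n + q ≤ n + 1 + q) (l (n + 1) y)) =
          E.incl (by omega : m + q ≤ m + 1 + q)
            (l (m + 1) (G.incl (Nat.succ_le_succ hmn) y)) := fun y => by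
        rw [← hl, S.sc.incl_trans, S.sc.incl_trans]
      exact e p.1
    · have e : ∀ y : G.Lev 1, κ 0 (S.op Q (0 + r) (0 + q) (a (G.base 1 y)) (l 0 (G.base 1 y))) =
          κ 0 (S.op Q (0 + r) (0 + q) (a (G.base 1 y))
            (E.incl (by omega : 0 + q ≤ 1 + q) (l 1 y))) := fun y => by rw [← hl]
      exact Prod.ext rfl (e p.1)
  | add _ _ ih1 ih2 =>
    exact (ih1.add ih2).congr fun p => Prod.ext (add_zero _).symm rfl
  | @smul f φ _ ih =>
    exact (ih.smul ((φ.comp (G.base 1)).comp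
      (ContinuousLinearMap.fst ℝ (G.Lev 1) (G.Lev 0)))).congr fun p =>
        Prod.ext (smul_zero (A := H.Lev 1) (φ (G.base 1 p.1))).symm rfl

/-- The tangent of a generated map is again generated because the scale TE pays for the derivative:
base points lie one level higher, which is exactly the level lost by the derivative of an operator
family. -/
theorem Generated.exists_tangent [CompleteSpace Y] (hf : Generated S G H a f) :
    ∃ Tf : G.Lev 1 × G.Lev 0 → H.Lev 1 × H.Lev 0,
      Generated S G.tangent H.tangent (tangentParam G a) Tf ∧
      ∀ x ∈ G.levelSet (a ⁻¹' V) 1, ∃ Df : G.Lev 0 →L[ℝ] H.Lev 0,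
        (∀ h, H.base 1 (Tf (x, h)).1 = f (G.base 1 x) ∧ (Tf (x, h)).2 = Df h) ∧
        HasFDerivAt (fun y : G.Lev 1 => f (G.base 1 y)) (Df.comp (G.base 1)) x := by
  induction hf with
  | @term q r ℓ h Q hQ l hl κ hκ =>
    obtain ⟨Qx, Qy, hQx, hQy, hd⟩ := S.deriv hQ
    -- The base point lies in G_{m+1}, so its image lies in E_{m+1+q} = E_{m+(q+1)}: the extra level
    -- is the one spent on `Qx` and `Qy`.
    let l₁ : ∀ m, G.tangent.Lev m →L[ℝ] E.Lev (m + (q + 1)) := fun m =>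
      ((E.incl (by omega : m + (q + 1) ≤ m + 1 + q)).comp (l (m + 1))).comp
        (ContinuousLinearMap.fst ℝ (G.Lev (m + 1)) (G.Lev m))
    have hl₁ : ∀ {m n : ℕ} (h : m ≤ n) (x : G.tangent.Lev n),
        E.incl (Nat.add_le_add_right h (q + 1)) (l₁ n x) = l₁ m (G.tangent.incl h x) := by
      intro m n hmn p
      have e : ∀ y : G.Lev (n + 1), E.incl (Nat.add_le_add_right hmn (q + 1))
          (E.incl (by omega : n + (q + 1) ≤ n + 1 + q) (l (n + 1) y)) =
          E.incl (by omega : m + (q + 1) ≤ m + 1 + q)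
            (l (m + 1) (G.incl (Nat.succ_le_succ hmn) y)) := fun y => by
        rw [← hl, S.sc.incl_trans, S.sc.incl_trans]
      exact e p.1
    -- The first component of the tangent map must land in H_{m+1}, so there both r and q increase
    -- by one.
    let κ₀ : ∀ m, E.Lev (m + (r + 1)) →L[ℝ] H.tangent.Lev m := fun m =>
      (ContinuousLinearMap.inl ℝ (H.Lev (m + 1)) (H.Lev m)).comp
        ((κ (m + 1)).comp (E.incl (by omega : m + 1 + r ≤ m + (r + 1))))
    have hκ₀ : ∀ {m n : ℕ} (h : m ≤ n) (x : E.Lev (n + (r + 1))),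
        H.tangent.incl h (κ₀ n x) = κ₀ m (E.incl (Nat.add_le_add_right h (r + 1)) x) := by
      intro m n hmn x
      refine Prod.ext ?_ (map_zero (H.incl hmn))
      have e : H.incl (Nat.succ_le_succ hmn)
          (κ (n + 1) (E.incl (by omega : n + 1 + r ≤ n + (r + 1)) x)) =
          κ (m + 1) (E.incl (by omega : m + 1 + r ≤ m + (r + 1))
            (E.incl (Nat.add_le_add_right hmn (r + 1)) x)) := by
        rw [hκ, S.sc.incl_trans, S.sc.incl_trans]
      exact e
    let κ₁ : ∀ m, E.Lev (m + r) →L[ℝ] H.tangent.Lev m := fun m =>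
      (ContinuousLinearMap.inr ℝ (H.Lev (m + 1)) (H.Lev m)).comp (κ m)
    have hκ₁ : ∀ {m n : ℕ} (h : m ≤ n) (x : E.Lev (n + r)),
        H.tangent.incl h (κ₁ n x) = κ₁ m (E.incl (Nat.add_le_add_right h r) x) :=
      fun hmn x => Prod.ext (map_zero (H.incl (Nat.succ_le_succ hmn))) (hκ hmn x)
    let l₂ : ∀ m, G.tangent.Lev m →L[ℝ] E.Lev (m + q) := fun m =>
      (l m).comp (ContinuousLinearMap.snd ℝ (G.Lev (m + 1)) (G.Lev m))
    have hl₂ : ∀ {m n : ℕ} (h : m ≤ n) (x : G.tangent.Lev n),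
        E.incl (Nat.add_le_add_right h q) (l₂ n x) = l₂ m (G.tangent.incl h x) :=
      fun hmn p => hl hmn p.2
    let φ : ∀ ψ : ℂ →L[ℝ] ℝ, G.tangent.Lev 0 →L[ℝ] ℝ := fun ψ =>
      (ψ.comp a).comp (ContinuousLinearMap.snd ℝ (G.Lev 1) (G.Lev 0))
    -- `t₀` is f(x) in the first component. In the second component `t₁` and `t₂` are the two
    -- partial derivatives in the parameter, multiplied by the real and imaginary part of the
    -- parameter direction, and `t₃` is the operator applied to the direction itself.
    have t₀ := Generated.term (S := S) (H := H.tangent) (a := tangentParam G a)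
      (by omega : r + 1 + ℓ ≤ q + 1) hQ l₁ hl₁ κ₀ hκ₀
    have t₁ := (Generated.term (S := S) (H := H.tangent) (a := tangentParam G a)
      (by omega : r + (ℓ + 1) ≤ q + 1) hQx l₁ hl₁ κ₁ hκ₁).smul (φ Complex.reCLM)
    have t₂ := (Generated.term (S := S) (H := H.tangent) (a := tangentParam G a)
      (by omega : r + (ℓ + 1) ≤ q + 1) hQy l₁ hl₁ κ₁ hκ₁).smul (φ Complex.imCLM)
    have t₃ := Generated.term (S := S) (H := H.tangent) (a := tangentParam G a) h hQ l₂ hl₂ κ₁ hκ₁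
    refine ⟨_, t₀.add ((t₁.add t₂).add t₃), fun x hx => ?_⟩
    have hx' : a (G.base 1 x) ∈ V := hx
    have hc : (0 + r) + (ℓ + 1) ≤ 0 + (q + 1) := by omega
    refine ⟨(κ 0).comp ((partials
        (S.op Qx (0 + r) (0 + (q + 1)) (a (G.base 1 x)) (E.incl (by omega) (l 1 x)))
        (S.op Qy (0 + r) (0 + (q + 1)) (a (G.base 1 x)) (E.incl (by omega) (l 1 x)))).comp a +
        (S.op Q (0 + r) (0 + q) (a (G.base 1 x))).comp (l 0)), fun k => ⟨?_, ?_⟩, ?_⟩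
    · change H.base 1 (κ 1 (E.incl _ (S.op Q (0 + (r + 1)) (0 + (q + 1)) (a (G.base 1 x))
          (E.incl _ (l 1 x)))) + (φ _ (x, k) • (0 : H.Lev 1) + φ _ (x, k) • (0 : H.Lev 1) + 0)) = _
      rw [smul_zero, smul_zero, add_zero, add_zero, add_zero, ScScale.base, hκ,
        op_compat (m := 1 + r) (n := 1 + q) hQ (by omega) (by omega) _ (by omega) hx',
        op_compat (m := 0 + r) (n := 0 + q) hQ (by omega) (by omega) _ (by omega) hx',
        S.sc.incl_trans, S.sc.incl_trans, hl]
    · change (0 : H.Lev 0) + (_ + _ + _) = _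
      rw [zero_add]
      simp only [ContinuousLinearMap.comp_apply, _root_.add_apply, partials_apply, map_add,
        map_smul]
      rfl
    · have hop := (hasFDerivAt_op hQ hQx hQy hd hc (E.incl (by omega) (l 1 x)) hx')
      have hin : HasFDerivAt (fun y : G.Lev 1 => (a (G.base 1 y),
          E.incl (by omega : 0 + (q + 1) ≤ 1 + q) (l 1 y)))
          ((a.comp (G.base 1)).prod ((E.incl (by omega : 0 + (q + 1) ≤ 1 + q)).comp (l 1))) x :=
        ((a.comp (G.base 1)).prod ((E.incl (by omega : 0 + (q + 1) ≤ 1 + q)).comp (l 1))).hasFDerivAt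
      have hall := (κ 0).hasFDerivAt.comp x (hop.comp x hin)
      -- Differentiability was obtained for the operator on the smaller space of index q+1; by
      -- compatibility it agrees there with the operator on index q that defines f.
      have hev : ∀ v ∈ V, ∀ y : G.Lev 1, S.op Q (0 + r) (0 + (q + 1)) v
          (E.incl (by omega : 0 + (q + 1) ≤ 1 + q) (l 1 y)) =
          S.op Q (0 + r) (0 + q) v (l 0 (G.base 1 y)) := by
        intro v hv y
        have := op_compat (m := 0 + r) (n := 0 + q) hQ (by omega)
          (by omega : 0 + r + ℓ ≤ 0 + (q + 1)) le_rfl (by omega) hv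
          (E.incl (by omega : 0 + (q + 1) ≤ 1 + q) (l 1 y))
        rw [S.sc.incl_refl, S.sc.incl_trans, hl] at this
        exact this
      have hall' := hall.congr_of_eventuallyEq (f₁ := fun y : G.Lev 1 =>
        κ 0 (S.op Q (0 + r) (0 + q) (a (G.base 1 y)) (l 0 (G.base 1 y)))) (by
          have hV : {y : G.Lev 1 | a (G.base 1 y) ∈ V} ∈ 𝓝 x :=
            (S.isOpen.preimage (by fun_prop)).mem_nhds hx'
          filter_upwards [hV] with y hy
          simp only [Function.comp_apply]
          rw [hev _ hy])
      convert hall' using 1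
      ext k
      simp only [ContinuousLinearMap.comp_apply, _root_.add_apply, ContinuousLinearMap.prod_apply,
        ContinuousLinearMap.coe_fst', ContinuousLinearMap.coe_snd']
      rw [hev _ hx']
  | add _ _ ih1 ih2 =>
    obtain ⟨T1, g1, h1⟩ := ih1
    obtain ⟨T2, g2, h2⟩ := ih2
    refine ⟨fun p => T1 p + T2 p, g1.add g2, fun x hx => ?_⟩
    obtain ⟨D1, e1, d1⟩ := h1 x hx
    obtain ⟨D2, e2, d2⟩ := h2 x hx
    refine ⟨D1 + D2, fun k => ⟨?_, ?_⟩, ?_⟩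
    · rw [Prod.fst_add, map_add, (e1 k).1, (e2 k).1]
    · rw [Prod.snd_add, (e1 k).2, (e2 k).2, _root_.add_apply]
    · exact d1.add d2
  | @smul f φ hf ih =>
    obtain ⟨T, g, h⟩ := ih
    refine ⟨_, (g.smul ((φ.comp (G.base 1)).comp (ContinuousLinearMap.fst ℝ (G.Lev 1) (G.Lev 0)))).add
      (hf.inr.smul (φ.comp (ContinuousLinearMap.snd ℝ (G.Lev 1) (G.Lev 0)))), fun x hx => ?_⟩
    obtain ⟨D, e, d⟩ := h x hx
    refine ⟨φ (G.base 1 x) • D + φ.smulRight (f (G.base 1 x)), fun k => ⟨?_, ?_⟩, ?_⟩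
    · change H.base 1 (φ (G.base 1 x) • (T (x, k)).1 + φ k • (0 : H.Lev 1)) = _
      rw [smul_zero, add_zero, map_smul, (e k).1]
    · change φ (G.base 1 x) • (T (x, k)).2 + φ k • f (G.base 1 x) = _
      rw [(e k).2]
      rfl
    · exact (φ.comp (G.base 1)).hasFDerivAt.smul d

theorem Generated.isScK [CompleteSpace Y] (k : ℕ) : ∀ {G H : ScScale} {a : G.Lev 0 →L[ℝ] ℂ}
    {f : G.Lev 0 → H.Lev 0}, Generated S G H a f → IsScK k G H (a ⁻¹' V) f := by
  induction k with
  | zero => exact fun hf => hf.isSc0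
  | succ k ih =>
    intro G H a f hf
    obtain ⟨Tf, hTf, h⟩ := hf.exists_tangent
    refine ⟨hf.isSc0, Tf, fun x hx => ?_, ih hTf⟩
    obtain ⟨Df, e, d⟩ := h x hx
    exact ⟨Df, e, d.hasFDerivWithinAt⟩

end OperatorCalculus

theorem IsScK.congr {k : ℕ} {E F : ScScale} {U : Set (E.Lev 0)} {f g : E.Lev 0 → F.Lev 0}
    (hf : IsScK k E F U f) (h : ∀ x ∈ U, g x = f x) : IsScK k E F U g := by
  have h0 : IsSc0 E F U f → IsSc0 E F U g := fun hf m => by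
    obtain ⟨G, h1, h2⟩ := hf m
    exact ⟨G, h1, fun x hx => by rw [h2 x hx, h _ hx]⟩
  cases k with
  | zero => exact h0 hf
  | succ k =>
    obtain ⟨hf0, Tf, hT, hk⟩ := hf
    refine ⟨h0 hf0, Tf, fun x hx => ?_, hk⟩
    obtain ⟨Df, e, d⟩ := hT x hx
    refine ⟨Df, fun k => ⟨?_, (e k).2⟩, d.congr (fun y hy => h _ hy) (h _ hx)⟩
    rw [h _ hx, (e k).1]

/-- A family of projections that extends a family of class `0` of an operator calculus is a
sc-smooth splicing. -/
theorem OperatorCalculus.isScSmooth {E : ScScale} {X Y : Type} [AddCommGroup X] [Module ℝ X]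
    [NormedAddCommGroup Y] [NormedSpace ℝ Y] {V : Set ℂ} [CompleteSpace Y]
    (S : OperatorCalculus E X Y V) {P : ℂ → X →ₗ[ℝ] X} (hP : S.cls 0 P)
    {π : ℂ → (E.Lev 0 →ₗ[ℝ] E.Lev 0)} (hπ : ∀ v ∈ V, ∀ e, π v e = S.op P 0 0 v e) :
    (∀ v ∈ V, IsScOperator E E (π v)) ∧
    IsScSmooth ((ScScale.const ℂ).prod E) E {p : ℂ × E.Lev 0 | p.1 ∈ V}
      (fun p : ℂ × E.Lev 0 => π p.1 p.2) := by
  constructor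
  · intro v hv m
    refine ⟨S.op P m m v, fun x => ?_⟩
    rw [hπ v hv, ScScale.base, op_compat hP (by omega) (by omega) _ (Nat.zero_le m) hv]
  · intro k
    have hg := Generated.term (S := S) (G := (ScScale.const ℂ).prod E) (H := E)
      (a := ContinuousLinearMap.fst ℝ ℂ (E.Lev 0)) (q := 0) (r := 0) (by omega) hP
      (fun m => ContinuousLinearMap.snd ℝ ℂ (E.Lev m)) (fun _ _ => rfl)
      (fun m => ContinuousLinearMap.id ℝ (E.Lev m)) (fun _ _ => rfl)
    exact (hg.isScK k).congr fun p hp => hπ p.1 hp p.2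

end GWSplicing

end
noncomputable section

namespace GWSplicing

/-! ### Smooth maps on the cylinder -/

section Smooth

variable {F : Type} [NormedAddCommGroup F] [NormedSpace ℝ F]

/-- Smooth maps on the cylinder `ℝ × S¹`. -/
def IsSmooth (f : Cyl → F) : Prop := ContDiff ℝ ∞ (fun p : ℝ × ℝ => f (cover p))

/-- `∂_s f`. -/
def pS (f : Cyl → F) (p : Cyl) : F := deriv (fun σ : ℝ => f (σ, p.2)) p.1

/-- `∂_t f`. -/
def pT (f : Cyl → F) (p : Cyl) : F := deriv (fun τ : ℝ => f (p.1, p.2 + (τ : UnitAddCircle))) 0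

theorem cover_add (p q : ℝ × ℝ) : cover (p + q) = cover p + cover q := rfl

theorem cover_sub (p q : ℝ × ℝ) : cover (p - q) = cover p - cover q := rfl

theorem cover_surjective : Function.Surjective cover := by
  rintro ⟨s, t⟩
  obtain ⟨t, rfl⟩ := QuotientAddGroup.mk_surjective t
  exact ⟨(s, t), rfl⟩

theorem continuous_cover : Continuous cover := by
  unfold cover
  fun_prop

theorem isQuotientMap_cover : IsOpenQuotientMap cover :=
  IsOpenQuotientMap.id.prodMap QuotientAddGroup.isOpenQuotientMap_mk

theorem IsSmooth.continuous {f : Cyl → F} (hf : IsSmooth f) : Continuous f :=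
  isQuotientMap_cover.isQuotientMap.continuous_iff.2 (ContDiff.continuous hf)

theorem IsSmooth.differentiable {f : Cyl → F} (hf : IsSmooth f) :
    Differentiable ℝ (fun p : ℝ × ℝ => f (cover p)) :=
  ContDiff.differentiable hf (by simp)

theorem IsSmooth.hasDerivAt_s {f : Cyl → F} (hf : IsSmooth f) (p : ℝ × ℝ) :
    HasDerivAt (fun σ : ℝ => f (σ, (p.2 : UnitAddCircle)))
      (fderiv ℝ (fun p : ℝ × ℝ => f (cover p)) p (1, 0)) p.1 := by
  have h1 : HasDerivAt (fun σ : ℝ => (σ, p.2)) ((1 : ℝ), (0 : ℝ)) p.1 :=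
    (hasDerivAt_id p.1).prodMk (hasDerivAt_const p.1 p.2)
  exact (hf.differentiable p).hasFDerivAt.comp_hasDerivAt p.1 h1

theorem IsSmooth.hasDerivAt_t {f : Cyl → F} (hf : IsSmooth f) (p : ℝ × ℝ) :
    HasDerivAt (fun τ : ℝ => f (p.1, (τ : UnitAddCircle)))
      (fderiv ℝ (fun p : ℝ × ℝ => f (cover p)) p (0, 1)) p.2 := by
  have h1 : HasDerivAt (fun τ : ℝ => (p.1, τ)) ((0 : ℝ), (1 : ℝ)) p.2 :=
    (hasDerivAt_const p.2 p.1).prodMk (hasDerivAt_id p.2)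
  exact (hf.differentiable p).hasFDerivAt.comp_hasDerivAt p.2 h1

theorem IsSmooth.pS_cover {f : Cyl → F} (hf : IsSmooth f) (p : ℝ × ℝ) :
    pS f (cover p) = fderiv ℝ (fun p : ℝ × ℝ => f (cover p)) p (1, 0) :=
  (hf.hasDerivAt_s p).deriv

theorem IsSmooth.pT_cover {f : Cyl → F} (hf : IsSmooth f) (p : ℝ × ℝ) :
    pT f (cover p) = fderiv ℝ (fun p : ℝ × ℝ => f (cover p)) p (0, 1) := by
  have h1 : HasDerivAt (fun τ : ℝ => p.2 + τ) 1 0 := by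
    simpa using (hasDerivAt_id (0 : ℝ)).const_add p.2
  have h2 : HasDerivAt (fun τ : ℝ => f (p.1, (τ : UnitAddCircle)))
      (fderiv ℝ (fun p : ℝ × ℝ => f (cover p)) p (0, 1)) (p.2 + 0) := by
    rw [add_zero]; exact hf.hasDerivAt_t p
  have h3 := h2.scomp (0 : ℝ) h1
  rw [one_smul] at h3
  exact h3.deriv

theorem IsSmooth.fderiv_cover {f : Cyl → F} (hf : IsSmooth f) (p v : ℝ × ℝ) :
    fderiv ℝ (fun p : ℝ × ℝ => f (cover p)) p v = v.1 • pS f (cover p) + v.2 • pT f (cover p) := by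
  rw [hf.pS_cover, hf.pT_cover, ← map_smul, ← map_smul, ← map_add]
  simp

theorem IsSmooth.pS {f : Cyl → F} (hf : IsSmooth f) : IsSmooth (pS f) := by
  unfold IsSmooth
  simp only [hf.pS_cover]
  exact (ContDiff.fderiv_right (m := ∞) hf le_rfl).clm_apply contDiff_const

theorem IsSmooth.pT {f : Cyl → F} (hf : IsSmooth f) : IsSmooth (pT f) := by
  unfold IsSmooth
  simp only [hf.pT_cover]
  exact (ContDiff.fderiv_right (m := ∞) hf le_rfl).clm_apply contDiff_const

theorem IsSmooth.pS_pT {f : Cyl → F} (hf : IsSmooth f) :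
    GWSplicing.pS (GWSplicing.pT f) = GWSplicing.pT (GWSplicing.pS f) := by
  funext q
  obtain ⟨p, rfl⟩ := cover_surjective q
  rw [hf.pT.pS_cover, hf.pS.pT_cover]
  simp only [hf.pS_cover, hf.pT_cover]
  have hd : DifferentiableAt ℝ (fderiv ℝ (fun p : ℝ × ℝ => f (cover p))) p :=
    (ContDiff.fderiv_right (m := ∞) hf le_rfl).differentiable (by simp) p
  rw [fderiv_clm_apply hd (differentiableAt_const _), fderiv_clm_apply hd (differentiableAt_const _)]
  have hs : IsSymmSndFDerivAt ℝ (fun p : ℝ × ℝ => f (cover p)) p :=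
    (ContDiff.contDiffAt hf).isSymmSndFDerivAt (by
      rw [minSmoothness_of_isRCLikeNormedField]
      exact WithTop.coe_le_coe.2 (le_top : (2 : ℕ∞) ≤ ⊤))
  simpa using hs.eq (1, 0) (0, 1)

/-- `∂_s^i ∂_t^j f`. -/
def pST (i j : ℕ) (f : Cyl → F) : Cyl → F := GWSplicing.pS^[i] (GWSplicing.pT^[j] f)

theorem pST_zero (f : Cyl → F) : pST 0 0 f = f := rfl

theorem pS_pST (i j : ℕ) (f : Cyl → F) : pS (pST i j f) = pST (i + 1) j f :=
  (Function.iterate_succ_apply' _ _ _).symm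

theorem IsSmooth.iterate_pT {f : Cyl → F} (hf : IsSmooth f) (j : ℕ) :
    IsSmooth (GWSplicing.pT^[j] f) := by
  induction j with
  | zero => exact hf
  | succ j ih => rw [Function.iterate_succ_apply']; exact ih.pT

theorem IsSmooth.pST {f : Cyl → F} (hf : IsSmooth f) (i j : ℕ) : IsSmooth (pST i j f) := by
  induction i with
  | zero => exact hf.iterate_pT j
  | succ i ih => rw [← pS_pST]; exact ih.pS

theorem IsSmooth.pT_pST {f : Cyl → F} (hf : IsSmooth f) (i j : ℕ) :
    GWSplicing.pT (GWSplicing.pST i j f) = GWSplicing.pST i (j + 1) f := by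
  induction i with
  | zero => exact (Function.iterate_succ_apply' GWSplicing.pT j f).symm
  | succ i ih => rw [← pS_pST, ← (hf.pST i j).pS_pT, ih, pS_pST]

theorem pST_pS (i : ℕ) (f : Cyl → F) : pST i 0 (pS f) = pST (i + 1) 0 f := rfl

theorem IsSmooth.pST_pST {f : Cyl → F} (hf : IsSmooth f) (i j k l : ℕ) :
    GWSplicing.pST i j (GWSplicing.pST k l f) = GWSplicing.pST (i + k) (j + l) f := by
  have h : ∀ j, GWSplicing.pT^[j] (GWSplicing.pST k l f) = GWSplicing.pST k (j + l) f := by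
    intro j
    induction j with
    | zero => simp
    | succ j ih => rw [Function.iterate_succ_apply', ih, hf.pT_pST]; congr 1; omega
  induction i with
  | zero => rw [zero_add]; exact h j
  | succ i ih => rw [← pS_pST, ih, pS_pST]; congr 1; omega

theorem IsSmooth.add {f g : Cyl → F} (hf : IsSmooth f) (hg : IsSmooth g) :
    IsSmooth (fun p => f p + g p) := ContDiff.add hf hg

theorem IsSmooth.const_smul {f : Cyl → F} (c : ℝ) (hf : IsSmooth f) :
    IsSmooth (fun p => c • f p) := ContDiff.const_smul c hf

theorem isSmooth_const (c : F) : IsSmooth (fun _ : Cyl => c) := contDiff_const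

theorem IsSmooth.pS_add {f g : Cyl → F} (hf : IsSmooth f) (hg : IsSmooth g) :
    GWSplicing.pS (fun p => f p + g p) = fun p => GWSplicing.pS f p + GWSplicing.pS g p := by
  funext q
  obtain ⟨p, rfl⟩ := cover_surjective q
  rw [(hf.add hg).pS_cover, hf.pS_cover, hg.pS_cover,
    fderiv_fun_add (hf.differentiable p) (hg.differentiable p)]
  rfl

theorem IsSmooth.pT_add {f g : Cyl → F} (hf : IsSmooth f) (hg : IsSmooth g) :
    GWSplicing.pT (fun p => f p + g p) = fun p => GWSplicing.pT f p + GWSplicing.pT g p := by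
  funext q
  obtain ⟨p, rfl⟩ := cover_surjective q
  rw [(hf.add hg).pT_cover, hf.pT_cover, hg.pT_cover,
    fderiv_fun_add (hf.differentiable p) (hg.differentiable p)]
  rfl

theorem IsSmooth.pST_add {f g : Cyl → F} (hf : IsSmooth f) (hg : IsSmooth g) (i j : ℕ) :
    GWSplicing.pST i j (fun p => f p + g p) =
      fun p => GWSplicing.pST i j f p + GWSplicing.pST i j g p := by
  induction i with
  | zero =>
    induction j with
    | zero => rfl
    | succ j ih =>
      rw [← (hf.add hg).pT_pST, ih, (hf.pST 0 j).pT_add (hg.pST 0 j), hf.pT_pST, hg.pT_pST]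
  | succ i ih => rw [← pS_pST, ih, (hf.pST i j).pS_add (hg.pST i j), pS_pST, pS_pST]

theorem IsSmooth.pST_smul {f : Cyl → F} (hf : IsSmooth f) (c : ℝ) (i j : ℕ) :
    GWSplicing.pST i j (fun p => c • f p) = fun p => c • GWSplicing.pST i j f p := by
  induction i with
  | zero =>
    induction j with
    | zero => rfl
    | succ j ih =>
      rw [← (hf.const_smul c).pT_pST, ih]
      funext q
      obtain ⟨p, rfl⟩ := cover_surjective q
      rw [((hf.pST 0 j).const_smul c).pT_cover, ← hf.pT_pST, (hf.pST 0 j).pT_cover,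
        fderiv_fun_const_smul ((hf.pST 0 j).differentiable p)]
      rfl
  | succ i ih =>
    rw [← pS_pST, ih]
    funext q
    obtain ⟨p, rfl⟩ := cover_surjective q
    rw [((hf.pST i j).const_smul c).pS_cover, ← pS_pST, (hf.pST i j).pS_cover,
      fderiv_fun_const_smul ((hf.pST i j).differentiable p)]
    rfl

/-- The product with a function of `s - r`. -/
theorem IsSmooth.mul_s {χ : ℝ → ℝ} (hχ : ContDiff ℝ ∞ χ) (r : ℝ) {f : Cyl → F} (hf : IsSmooth f) :
    IsSmooth (fun p => χ (p.1 - r) • f p) := by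
  have : ContDiff ℝ ∞ (fun p : ℝ × ℝ => χ (p.1 - r)) := hχ.comp (contDiff_fst.sub contDiff_const)
  exact this.smul hf

theorem IsSmooth.pS_mul_s {χ : ℝ → ℝ} (hχ : ContDiff ℝ ∞ χ) (r : ℝ) {f : Cyl → F}
    (hf : IsSmooth f) : GWSplicing.pS (fun p => χ (p.1 - r) • f p) =
      fun p => deriv χ (p.1 - r) • f p + χ (p.1 - r) • GWSplicing.pS f p := by
  funext q
  obtain ⟨p, rfl⟩ := cover_surjective q
  have h1 := hf.hasDerivAt_s p
  rw [← hf.pS_cover] at h1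
  have h2 : HasDerivAt (fun σ : ℝ => χ (σ - r)) (deriv χ (p.1 - r)) p.1 :=
    (hχ.differentiable (by simp) _).hasDerivAt.comp_sub_const p.1 r
  refine (h2.smul h1).deriv.trans ?_
  rw [add_comm]
  rfl

theorem IsSmooth.pT_mul_s {χ : ℝ → ℝ} (hχ : ContDiff ℝ ∞ χ) (r : ℝ) {f : Cyl → F}
    (hf : IsSmooth f) : GWSplicing.pT (fun p => χ (p.1 - r) • f p) =
      fun p => χ (p.1 - r) • GWSplicing.pT f p := by
  funext q
  obtain ⟨p, rfl⟩ := cover_surjective q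
  rw [(hf.mul_s hχ r).pT_cover]
  have h1 := hf.hasDerivAt_t p
  rw [← hf.pT_cover] at h1
  rw [← (hf.mul_s hχ r).pT_cover, (hf.mul_s hχ r).pT_cover]
  refine ((hf.mul_s hχ r).hasDerivAt_t p).unique ?_
  exact h1.const_smul (χ (p.1 - r))

theorem IsSmooth.pST_mul_s_zero {χ : ℝ → ℝ} (hχ : ContDiff ℝ ∞ χ) (r : ℝ) {f : Cyl → F}
    (hf : IsSmooth f) (j : ℕ) : GWSplicing.pST 0 j (fun p => χ (p.1 - r) • f p) =
      fun p => χ (p.1 - r) • GWSplicing.pST 0 j f p := by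
  induction j with
  | zero => rfl
  | succ j ih => rw [← (hf.mul_s hχ r).pT_pST, ih, (hf.pST 0 j).pT_mul_s hχ, hf.pT_pST]

/-- The reflection `p ↦ f (q - p)`. -/
theorem IsSmooth.reflect {f : Cyl → F} (hf : IsSmooth f) (q : Cyl) :
    IsSmooth (fun p => f (q - p)) := by
  obtain ⟨q, rfl⟩ := cover_surjective q
  have : ContDiff ℝ ∞ (fun p : ℝ × ℝ => q - p) := contDiff_const.sub contDiff_id
  exact ContDiff.comp (g := fun p : ℝ × ℝ => f (cover p)) hf this

theorem IsSmooth.fderiv_reflect {f : Cyl → F} (hf : IsSmooth f) (q p v : ℝ × ℝ) :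
    fderiv ℝ (fun p : ℝ × ℝ => f (cover q - cover p)) p v =
      - fderiv ℝ (fun p : ℝ × ℝ => f (cover p)) (q - p) v := by
  have h1 : HasFDerivAt (fun p : ℝ × ℝ => q - p) (-ContinuousLinearMap.id ℝ (ℝ × ℝ)) p :=
    (hasFDerivAt_id p).const_sub q
  have h2 := ((hf.differentiable (q - p)).hasFDerivAt.comp p h1).fderiv
  refine (congrArg (fun L => L v) h2).trans ?_
  simp

theorem IsSmooth.pST_reflect {f : Cyl → F} (hf : IsSmooth f) (q : Cyl) (i j : ℕ) :
    GWSplicing.pST i j (fun p => f (q - p)) =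
      fun p => (-1 : ℝ) ^ (i + j) • GWSplicing.pST i j f (q - p) := by
  obtain ⟨q, rfl⟩ := cover_surjective q
  have hS : ∀ {g : Cyl → F}, IsSmooth g → GWSplicing.pS (fun p => g (cover q - p)) =
      fun p => (-1 : ℝ) • GWSplicing.pS g (cover q - p) := by
    intro g hg
    funext p
    obtain ⟨p, rfl⟩ := cover_surjective p
    rw [(hg.reflect _).pS_cover, hg.fderiv_reflect, ← cover_sub, hg.pS_cover, neg_one_smul]
  have hT : ∀ {g : Cyl → F}, IsSmooth g → GWSplicing.pT (fun p => g (cover q - p)) =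
      fun p => (-1 : ℝ) • GWSplicing.pT g (cover q - p) := by
    intro g hg
    funext p
    obtain ⟨p, rfl⟩ := cover_surjective p
    rw [(hg.reflect _).pT_cover, hg.fderiv_reflect, ← cover_sub, hg.pT_cover, neg_one_smul]
  induction i with
  | zero =>
    induction j with
    | zero => simp [pST_zero]
    | succ j ih =>
      rw [← (hf.reflect _).pT_pST, ih, ← hf.pT_pST]
      have := ((hf.pST 0 j).reflect (cover q)).pST_smul ((-1 : ℝ) ^ (0 + j)) 0 1
      refine this.trans ?_
      funext p
      change _ • GWSplicing.pT (fun p => GWSplicing.pST 0 j f (cover q - p)) p = _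
      rw [hT (hf.pST 0 j), smul_smul]
      congr 1
  | succ i ih =>
    rw [← pS_pST, ih, ← pS_pST]
    have := ((hf.pST i j).reflect (cover q)).pST_smul ((-1 : ℝ) ^ (i + j)) 1 0
    refine this.trans ?_
    funext p
    change _ • GWSplicing.pS (fun p => GWSplicing.pST i j f (cover q - p)) p = _
    rw [hS (hf.pST i j), smul_smul]
    congr 1
    ring

/-! ### Classical derivatives are weak derivatives -/

theorem integral_dtest_pS {f : Cyl → F} (hf : IsSmooth f) {φ : ℝ × ℝ → ℝ}
    (h : ContDiff ℝ ∞ φ) (hc : HasCompactSupport φ) :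
    ∫ p, dS φ p • f (cover p) = -∫ p, φ p • pS f (cover p) := by
  have hi : ∀ {ψ : ℝ × ℝ → ℝ} {g : Cyl → F}, Continuous ψ → HasCompactSupport ψ → Continuous g →
      Integrable (fun p => ψ p • g (cover p)) := fun hψ hψc hg =>
    (hψ.smul (hg.comp continuous_cover)).integrable_of_hasCompactSupport hψc.smul_right
  have hcd : HasCompactSupport (dS φ) := hc.of_isClosed_subset (isClosed_tsupport _)
    (tsupport_fderiv_apply_subset ℝ _)
  have := integral_smul_fderiv_eq_neg_fderiv_smul_of_integrable (μ := volume) (𝕜 := ℝ)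
    (f := φ) (g := fun p => f (cover p)) (v := ((1 : ℝ), (0 : ℝ)))
    (hi (dS_smooth h).continuous hcd hf.continuous)
    (by simp only [← hf.pS_cover]; exact hi h.continuous hc hf.pS.continuous)
    (hi h.continuous hc hf.continuous) (fun x _ => h.differentiable (by simp) x)
    (fun x _ => hf.differentiable x)
  simp only [← hf.pS_cover] at this
  rw [this, neg_neg]
  rfl

theorem integral_dtest_pT {f : Cyl → F} (hf : IsSmooth f) {φ : ℝ × ℝ → ℝ}
    (h : ContDiff ℝ ∞ φ) (hc : HasCompactSupport φ) :
    ∫ p, dT φ p • f (cover p) = -∫ p, φ p • pT f (cover p) := by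
  have hi : ∀ {ψ : ℝ × ℝ → ℝ} {g : Cyl → F}, Continuous ψ → HasCompactSupport ψ → Continuous g →
      Integrable (fun p => ψ p • g (cover p)) := fun hψ hψc hg =>
    (hψ.smul (hg.comp continuous_cover)).integrable_of_hasCompactSupport hψc.smul_right
  have hcd : HasCompactSupport (dT φ) := hc.of_isClosed_subset (isClosed_tsupport _)
    (tsupport_fderiv_apply_subset ℝ _)
  have := integral_smul_fderiv_eq_neg_fderiv_smul_of_integrable (μ := volume) (𝕜 := ℝ)
    (f := φ) (g := fun p => f (cover p)) (v := ((0 : ℝ), (1 : ℝ)))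
    (hi (dT_smooth h).continuous hcd hf.continuous)
    (by simp only [← hf.pT_cover]; exact hi h.continuous hc hf.pT.continuous)
    (hi h.continuous hc hf.continuous) (fun x _ => h.differentiable (by simp) x)
    (fun x _ => hf.differentiable x)
  simp only [← hf.pT_cover] at this
  rw [this, neg_neg]
  rfl

theorem IsSmooth.isWeakDeriv {f : Cyl → F} (hf : IsSmooth f) (I : Set ℝ) (i j : ℕ) :
    IsWeakDeriv I i j f (GWSplicing.pST i j f) := by
  intro φ h1 h2 _
  have hc : ∀ i j, HasCompactSupport (dS^[i] (dT^[j] φ)) := fun i j =>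
    h2.of_isClosed_subset (isClosed_tsupport _) (test_dST h1 i j).2
  have hT : ∀ j {g : Cyl → F}, IsSmooth g →
      ∫ p, (dT^[j] φ) p • g (cover p) = (-1 : ℝ) ^ j • ∫ p, φ p • GWSplicing.pST 0 j g (cover p) := by
    intro j
    induction j with
    | zero => intro g _; simp [pST_zero]
    | succ j ih =>
      intro g hg
      rw [Function.iterate_succ_apply', integral_dtest_pT hg
        (show ContDiff ℝ ∞ (dT^[j] φ) from (test_dST h1 0 j).1) (hc 0 j), ih hg.pT,
        pow_succ, mul_neg_one, neg_smul]
      rfl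
  have hS : ∀ i {g : Cyl → F}, IsSmooth g →
      ∫ p, (dS^[i] (dT^[j] φ)) p • g (cover p) =
        (-1 : ℝ) ^ i • ∫ p, (dT^[j] φ) p • GWSplicing.pST i 0 g (cover p) := by
    intro i
    induction i with
    | zero => intro g _; simp [pST_zero]
    | succ i ih =>
      intro g hg
      rw [Function.iterate_succ_apply', integral_dtest_pS hg (test_dST h1 i j).1 (hc i j), ih hg.pS,
        pow_succ, mul_neg_one, neg_smul, pST_pS]
  rw [hS i hf, hT j (hf.pST i 0), hf.pST_pST, smul_smul, pow_add, zero_add, add_zero]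

end Smooth

end GWSplicing

end
noncomputable section

namespace GWSplicing

/-! ### Mollification -/

section Mollify

variable {F : Type} [NormedAddCommGroup F] [NormedSpace ℝ F]

/-- The average `∫ ρ(q) f(p + q) dq`. -/
def mollify (ρ : ℝ × ℝ → ℝ) (f : Cyl → F) (p : Cyl) : F := ∫ q, ρ q • f (p + cover q)

theorem mollify_cover (ρ : ℝ × ℝ → ℝ) (f : Cyl → F) (p : ℝ × ℝ) :
    mollify ρ f (cover p) = ∫ q, ρ (q - p) • f (cover q) := by
  rw [mollify, ← integral_sub_right_eq_self _ p]
  simp only [← cover_add, add_sub_cancel]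

theorem mollify_eq_convolution (ρ : ℝ × ℝ → ℝ) (f : Cyl → F) (p : ℝ × ℝ) :
    mollify ρ f (cover p) = convolution (fun q => ρ (-q)) (fun q => f (cover q))
      (ContinuousLinearMap.lsmul ℝ ℝ) volume p := by
  rw [mollify, convolution_def, ← integral_neg_eq_self]
  simp only [ContinuousLinearMap.lsmul_apply, sub_eq_add_neg]
  simp only [← cover_add]

variable {ρ : ℝ × ℝ → ℝ} {f : Cyl → F}

theorem isSmooth_mollify (hρ : ContDiff ℝ ∞ ρ) (hc : HasCompactSupport ρ) (hf : Continuous f) :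
    IsSmooth (mollify ρ f) := by
  unfold IsSmooth
  simp only [mollify_eq_convolution]
  refine HasCompactSupport.contDiff_convolution_left _ (hc.comp_homeomorph (Homeomorph.neg _))
    (hρ.comp contDiff_neg) ?_
  exact (hf.comp continuous_cover).locallyIntegrable

/-- The average is over f(p + q), so the convolution kernel is ρ(-q) and its derivative carries a
minus sign. These signs later cancel those in the definition of weak derivatives. -/
theorem fderiv_mollify (hρ : ContDiff ℝ ∞ ρ) (hc : HasCompactSupport ρ) (hf : Continuous f)
    (p v : ℝ × ℝ) : fderiv ℝ (fun p : ℝ × ℝ => mollify ρ f (cover p)) p v =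
      -mollify (fun q => fderiv ℝ ρ q v) f (cover p) := by
  have hg : LocallyIntegrable (fun q => f (cover q)) (volume : Measure (ℝ × ℝ)) :=
    (hf.comp continuous_cover).locallyIntegrable
  have hc' : HasCompactSupport (fun q => ρ (-q)) := hc.comp_homeomorph (Homeomorph.neg _)
  have hρ' : ContDiff ℝ ∞ (fun q => ρ (-q)) := hρ.comp contDiff_neg
  have h1 := hc'.hasFDerivAt_convolution_left (ContinuousLinearMap.lsmul ℝ ℝ)
    (hρ'.of_le (by exact_mod_cast le_top)) hg p
  simp only [mollify_eq_convolution]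
  have h1' : HasFDerivAt (fun p => convolution (fun q => ρ (-q)) (fun q => f (cover q))
      (ContinuousLinearMap.lsmul ℝ ℝ) volume p) _ p := h1
  rw [h1'.fderiv, convolution_def]
  have hint : ConvolutionExistsAt (fderiv ℝ (fun q => ρ (-q))) (fun q => f (cover q)) p
      ((ContinuousLinearMap.lsmul ℝ ℝ).precompL (ℝ × ℝ)) volume :=
    (hc'.fderiv ℝ).convolutionExists_left _ (hρ'.continuous_fderiv (by simp)) hg p
  rw [ContinuousLinearMap.integral_apply hint, convolution_def, ← integral_neg]
  congr 1
  funext t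
  have : fderiv ℝ (fun q => ρ (-q)) t v = -fderiv ℝ ρ (-t) v := by
    have h2 : HasFDerivAt (fun q => ρ (-q)) _ t :=
      ((hρ.differentiable (by simp) (-t)).hasFDerivAt).comp t (hasFDerivAt_id t).neg
    rw [h2.fderiv]
    simp
  rw [ContinuousLinearMap.precompL_apply, this]
  simp

theorem pS_mollify (hρ : ContDiff ℝ ∞ ρ) (hc : HasCompactSupport ρ) (hf : Continuous f) :
    pS (mollify ρ f) = fun p => (-1 : ℝ) • mollify (dS ρ) f p := by
  funext q
  obtain ⟨p, rfl⟩ := cover_surjective q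
  rw [(isSmooth_mollify hρ hc hf).pS_cover, fderiv_mollify hρ hc hf, neg_one_smul]
  rfl

theorem pT_mollify (hρ : ContDiff ℝ ∞ ρ) (hc : HasCompactSupport ρ) (hf : Continuous f) :
    pT (mollify ρ f) = fun p => (-1 : ℝ) • mollify (dT ρ) f p := by
  funext q
  obtain ⟨p, rfl⟩ := cover_surjective q
  rw [(isSmooth_mollify hρ hc hf).pT_cover, fderiv_mollify hρ hc hf, neg_one_smul]
  rfl

theorem pST_mollify (hρ : ContDiff ℝ ∞ ρ) (hc : HasCompactSupport ρ) (hf : Continuous f)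
    (i j : ℕ) : pST i j (mollify ρ f) =
      fun p => (-1 : ℝ) ^ (i + j) • mollify (dS^[i] (dT^[j] ρ)) f p := by
  have hc' : ∀ i j, HasCompactSupport (dS^[i] (dT^[j] ρ)) := fun i j =>
    hc.of_isClosed_subset (isClosed_tsupport _) (test_dST hρ i j).2
  have hs := fun i j => isSmooth_mollify (test_dST hρ i j).1 (hc' i j) hf
  induction i with
  | zero =>
    induction j with
    | zero => simp [pST_zero]
    | succ j ih =>
      rw [← (isSmooth_mollify hρ hc hf).pT_pST, ih]
      refine ((hs 0 j).pST_smul ((-1 : ℝ) ^ (0 + j)) 0 1).trans ?_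
      funext p
      change _ • pT (mollify (dS^[0] (dT^[j] ρ)) f) p = _
      rw [pT_mollify (test_dST hρ 0 j).1 (hc' 0 j) hf, smul_smul, ← pow_succ,
        Function.iterate_succ_apply' dT]
      rfl
  | succ i ih =>
    rw [← pS_pST, ih]
    refine ((hs i j).pST_smul ((-1 : ℝ) ^ (i + j)) 1 0).trans ?_
    funext p
    change _ • pS (mollify (dS^[i] (dT^[j] ρ)) f) p = _
    rw [pS_mollify (test_dST hρ i j).1 (hc' i j) hf, smul_smul, ← pow_succ,
      Function.iterate_succ_apply' dS, add_right_comm]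

theorem dST_translate (ρ : ℝ × ℝ → ℝ) (p : ℝ × ℝ) (i j : ℕ) :
    dS^[i] (dT^[j] (fun q => ρ (q - p))) = fun q => (dS^[i] (dT^[j] ρ)) (q - p) := by
  have hS : ∀ σ : ℝ × ℝ → ℝ, dS (fun q => σ (q - p)) = fun q => dS σ (q - p) := fun σ => by
    funext q; simp only [dS, fderiv_comp_sub]
  have hT : ∀ σ : ℝ × ℝ → ℝ, dT (fun q => σ (q - p)) = fun q => dT σ (q - p) := fun σ => by
    funext q; simp only [dT, fderiv_comp_sub]
  have h1 : dT^[j] (fun q => ρ (q - p)) = fun q => (dT^[j] ρ) (q - p) := by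
    induction j with
    | zero => rfl
    | succ j ih => rw [Function.iterate_succ_apply', ih, hT, Function.iterate_succ_apply']
  rw [h1]
  induction i with
  | zero => rfl
  | succ i ih => rw [Function.iterate_succ_apply', ih, hS, Function.iterate_succ_apply']

theorem tsupport_translate {ρ : ℝ × ℝ → ℝ} {I : Set ℝ} {p : ℝ × ℝ}
    (h : ∀ q ∈ tsupport ρ, p.1 + q.1 ∈ I) :
    tsupport (fun q => ρ (q - p)) ⊆ I ×ˢ univ := by
  intro q hq
  have : q - p ∈ tsupport ρ :=
    tsupport_comp_subset_preimage ρ (f := fun q : ℝ × ℝ => q - p) (by fun_prop) hq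
  have := h _ this
  simp only [Prod.fst_sub, add_sub_cancel] at this
  exact ⟨this, mem_univ _⟩

theorem hasCompactSupport_translate {ρ : ℝ × ℝ → ℝ} (hc : HasCompactSupport ρ) (p : ℝ × ℝ) :
    HasCompactSupport (fun q => ρ (q - p)) :=
  hc.comp_homeomorph (Homeomorph.subRight p)

/-- Weak derivatives of `f` become classical derivatives of its mollification. -/
theorem IsWeakDeriv.pST_mollify (hρ : ContDiff ℝ ∞ ρ) (hc : HasCompactSupport ρ)
    (hf : Continuous f) {I : Set ℝ} {i j : ℕ} {g : Cyl → F} (hg : IsWeakDeriv I i j f g) {p : Cyl}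
    (hp : ∀ q ∈ tsupport ρ, p.1 + q.1 ∈ I) : pST i j (mollify ρ f) p = mollify ρ g p := by
  obtain ⟨p, rfl⟩ := cover_surjective p
  rw [GWSplicing.pST_mollify hρ hc hf, mollify_cover]
  beta_reduce
  rw [mollify_cover]
  have h1 := hg (fun q => ρ (q - p)) (hρ.comp (contDiff_id.sub contDiff_const))
    (hasCompactSupport_translate hc p) (tsupport_translate hp)
  rw [dST_translate] at h1
  rw [h1, smul_smul, ← mul_pow]
  simp

theorem mollify_sub_const (hρ : Continuous ρ) (hc : HasCompactSupport ρ) (h1 : ∫ q, ρ q = 1)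
    {f : Cyl → F} [CompleteSpace F] {p : Cyl}
    (hf : Integrable (fun q => ρ q • f (p + cover q))) (c : F) :
    mollify ρ f p - c = ∫ q, ρ q • (f (p + cover q) - c) := by
  have h2 : ∫ q, ρ q • c = c := by rw [integral_smul_const, h1, one_smul]
  simp only [smul_sub]
  rw [integral_sub hf ((hρ.integrable_of_hasCompactSupport hc).smul_const c), h2]
  rfl

theorem norm_mollify_sub_le [CompleteSpace F] (hρ : Continuous ρ) (hc : HasCompactSupport ρ)
    (h0 : ∀ q, 0 ≤ ρ q) (h1 : ∫ q, ρ q = 1) (hf : Continuous f) {p : Cyl} {η : ℝ}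
    (h : ∀ q, ρ q ≠ 0 → ‖f (p + cover q) - f p‖ ≤ η) : ‖mollify ρ f p - f p‖ ≤ η := by
  have hcov := continuous_cover
  have hint : Integrable (fun q => ρ q • f (p + cover q)) :=
    (hρ.smul (by fun_prop)).integrable_of_hasCompactSupport hc.smul_right
  rw [mollify_sub_const hρ hc h1 hint]
  have : ∫ q, ρ q * η = η := by rw [integral_mul_const, h1, one_mul]
  rw [← this]
  refine norm_integral_le_of_norm_le ((hρ.integrable_of_hasCompactSupport hc).mul_const η)
    (Filter.Eventually.of_forall fun q => ?_)
  rw [norm_smul, Real.norm_of_nonneg (h0 q)]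
  by_cases hq : ρ q = 0
  · simp [hq]
  · exact mul_le_mul_of_nonneg_left (h q hq) (h0 q)

/-- Jensen's inequality for the square of the norm of an average. -/
theorem enorm_integral_sq_le {Ω : Type} [MeasurableSpace Ω] {ν : Measure Ω} [IsProbabilityMeasure ν]
    {h : Ω → F} (hh : AEStronglyMeasurable h ν) :
    ‖∫ q, h q ∂ν‖ₑ ^ 2 ≤ ∫⁻ q, ‖h q‖ₑ ^ 2 ∂ν := by
  have h1 := enorm_integral_le_lintegral_enorm h (μ := ν)
  have h2 := eLpNorm_le_eLpNorm_of_exponent_le (p := 1) (q := 2) (by norm_num) hh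
  rw [eLpNorm_one_eq_lintegral_enorm] at h2
  have h3 := eLpNorm_nnreal_pow_eq_lintegral (f := h) (μ := ν) (p := 2) (by norm_num)
  calc ‖∫ q, h q ∂ν‖ₑ ^ 2 ≤ (eLpNorm h 2 ν) ^ 2 := by gcongr; exact h1.trans h2
    _ = _ := by simpa using h3

end Mollify

/-! ### Translations and mollification in the weighted L² spaces. -/

theorem eLpNorm_two_sq {α F : Type} [MeasurableSpace α] [NormedAddCommGroup F] (μ : Measure α)
    (g : α → F) : eLpNorm g 2 μ ^ 2 = ∫⁻ p, ‖g p‖ₑ ^ 2 ∂μ := by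
  have h3 := eLpNorm_nnreal_pow_eq_lintegral (f := g) (μ := μ) (p := 2) (by norm_num)
  simpa using h3

theorem eLpNorm_two_le {α F : Type} [MeasurableSpace α] [NormedAddCommGroup F] {μ : Measure α}
    {g : α → F} {η : ℝ≥0∞} (h : ∫⁻ p, ‖g p‖ₑ ^ 2 ∂μ ≤ η ^ 2) : eLpNorm g 2 μ ≤ η := by
  rw [← eLpNorm_two_sq] at h
  exact (ENNReal.pow_le_pow_left_iff two_ne_zero).1 h


instance : Measure.IsAddHaarMeasure (volume : Measure Cyl) :=
  inferInstanceAs (Measure.IsAddHaarMeasure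
    ((volume : Measure ℝ).prod (volume : Measure UnitAddCircle)))

instance (I : Set ℝ) (δ : ℝ) : SFinite (weightedMeasure I δ) := by
  unfold weightedMeasure; infer_instance

theorem ae_mem_weightedMeasure {I : Set ℝ} (hI : MeasurableSet I) (δ : ℝ) :
    ∀ᵐ p ∂(weightedMeasure I δ), p.1 ∈ I := by
  refine (withDensity_absolutelyContinuous _ _).ae_le ?_
  have h := ae_restrict_mem (μ := (volume : Measure Cyl)) (hI.prod (MeasurableSet.univ (α := UnitAddCircle)))
  have e : (volume : Measure Cyl).restrict (I ×ˢ univ) =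
      ((volume.restrict I).prod (volume : Measure UnitAddCircle)) := by
    rw [Measure.volume_eq_prod, ← Measure.prod_restrict, Measure.restrict_univ]
  rw [e] at h
  filter_upwards [h] with p hp using hp.1

theorem weightedMeasure_eq (I : Set ℝ) (δ : ℝ) : weightedMeasure I δ =
    ((volume : Measure Cyl).restrict (I ×ˢ univ)).withDensity
      (fun p => ENNReal.ofReal (Real.exp (2 * δ * |p.1|))) := by
  rw [Measure.volume_eq_prod, ← Measure.prod_restrict, Measure.restrict_univ]
  rfl

/-- The square of the weighted norm. -/
theorem eLpNorm_weighted_sq {F : Type} [NormedAddCommGroup F] (I : Set ℝ)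
    (δ : ℝ) (g : Cyl → F) : eLpNorm g 2 (weightedMeasure I δ) ^ 2 =
      ∫⁻ p in I ×ˢ univ, ENNReal.ofReal (Real.exp (2 * δ * |p.1|)) * ‖g p‖ₑ ^ 2 := by
  rw [eLpNorm_two_sq, weightedMeasure_eq,
    lintegral_withDensity_eq_lintegral_mul_non_measurable _ (measurable_weight δ)
      (Filter.Eventually.of_forall fun p => ENNReal.ofReal_lt_top)]
  rfl

/-- The mollification minus g is the mean of the differences g(· + q) - g against the probability
measure ρ dq. Jensen's inequality moves the square inside and Tonelli's theorem exchanges the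
integrals, so the error is at most the largest translation error over the support of ρ. -/
theorem eLpNorm_mollify_sub_le {F : Type} [NormedAddCommGroup F] [NormedSpace ℝ F]
    [CompleteSpace F] {ρ : ℝ × ℝ → ℝ} (hρ : Continuous ρ) (hc : HasCompactSupport ρ)
    (h0 : ∀ q, 0 ≤ ρ q) (h1 : ∫ q, ρ q = 1) {I : Set ℝ} (hI : MeasurableSet I) {δ : ℝ} {g : Cyl → F}
    (hg : StronglyMeasurable g)
    (hint : ∀ p : Cyl, p.1 ∈ I → Integrable (fun q => ρ q • g (p + cover q))) {η : ℝ≥0∞}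
    (h : ∀ q, ρ q ≠ 0 → eLpNorm (fun p => g (p + cover q) - g p) 2 (weightedMeasure I δ) ≤ η) :
    eLpNorm (fun p => mollify ρ g p - g p) 2 (weightedMeasure I δ) ≤ η := by
  have hcov := continuous_cover
  have hmeas : Measurable (fun q => ENNReal.ofReal (ρ q)) := hρ.measurable.ennreal_ofReal
  set ν := (volume : Measure (ℝ × ℝ)).withDensity (fun q => ENNReal.ofReal (ρ q)) with hν
  have hprob : IsProbabilityMeasure ν := ⟨by
    rw [hν, withDensity_apply _ MeasurableSet.univ, Measure.restrict_univ,
      ← ofReal_integral_eq_lintegral_ofReal (hρ.integrable_of_hasCompactSupport hc)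
        (Filter.Eventually.of_forall h0), h1, ENNReal.ofReal_one]⟩
  have hmap : Measurable (fun z : Cyl × (ℝ × ℝ) => z.1 + cover z.2) := by
    have : Continuous (fun z : Cyl × (ℝ × ℝ) => z.1 + cover z.2) := by fun_prop
    exact this.measurable
  have hjoint : StronglyMeasurable (fun z : Cyl × (ℝ × ℝ) => g (z.1 + cover z.2) - g z.1) :=
    (hg.comp_measurable hmap).sub (hg.comp_measurable measurable_fst)
  apply eLpNorm_two_le
  calc ∫⁻ p, ‖mollify ρ g p - g p‖ₑ ^ 2 ∂(weightedMeasure I δ)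
      ≤ ∫⁻ p, ∫⁻ q, ‖g (p + cover q) - g p‖ₑ ^ 2 ∂ν ∂(weightedMeasure I δ) := by
        apply lintegral_mono_ae
        filter_upwards [ae_mem_weightedMeasure hI δ] with p hp
        rw [mollify_sub_const hρ hc h1 (hint p hp)]
        have e : ∫ q, ρ q • (g (p + cover q) - g p) = ∫ q, (g (p + cover q) - g p) ∂ν := by
          rw [hν, integral_withDensity_eq_integral_toReal_smul hmeas
            (Filter.Eventually.of_forall fun q => ENNReal.ofReal_lt_top)]
          simp only [ENNReal.toReal_ofReal (h0 _)]
        rw [e]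
        exact enorm_integral_sq_le
          (hjoint.comp_measurable (measurable_prodMk_left (x := p))).aestronglyMeasurable
    _ = ∫⁻ q, ∫⁻ p, ‖g (p + cover q) - g p‖ₑ ^ 2 ∂(weightedMeasure I δ) ∂ν := by
        refine lintegral_lintegral_swap ?_
        exact (hjoint.enorm.pow_const 2).aemeasurable
    _ ≤ ∫⁻ _, η ^ 2 ∂ν := by
        apply lintegral_mono_ae
        rw [hν, ae_withDensity_iff hmeas]
        refine Filter.Eventually.of_forall fun q hq => ?_
        rw [← eLpNorm_two_sq]
        gcongr
        refine h q fun h0 => hq ?_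
        simp [h0]
    _ = η ^ 2 := by simp

/-- Translations are continuous in the weighted `L²`. -/
theorem exists_translate_le {F : Type} [NormedAddCommGroup F] [NormedSpace ℝ F] {δ : ℝ}
    (hδ : 0 ≤ δ) {g : Cyl → F} (hg : MemLp g 2 (weightedMeasure (Ioi 0) δ))
    (hgm : StronglyMeasurable g) {η : ℝ≥0∞} (hη : η ≠ 0) :
    ∃ ε > 0, ∀ q : ℝ × ℝ, 0 < q.1 → q.1 < ε → |q.2| < ε →
      eLpNorm (fun p => g (p + cover q) - g p) 2 (weightedMeasure (Ioi 0) δ) ≤ η := by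
  -- e^{δs} g, extended by zero to the whole cylinder, is in the unweighted L², where translations
  -- act continuously.
  let G : Cyl → F := (Ioi (0 : ℝ) ×ˢ univ).indicator (fun p => Real.exp (δ * p.1) • g p)
  have hset : MeasurableSet (Ioi (0 : ℝ) ×ˢ (univ : Set UnitAddCircle)) :=
    measurableSet_Ioi.prod MeasurableSet.univ
  have hexp : Continuous (fun p : Cyl => Real.exp (δ * p.1)) := by fun_prop
  have hGm : StronglyMeasurable G := (hexp.stronglyMeasurable.smul hgm).indicator hset
  have hw : ∀ u : Cyl → F, eLpNorm u 2 (weightedMeasure (Ioi 0) δ) =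
      eLpNorm ((Ioi (0 : ℝ) ×ˢ univ).indicator (fun p => Real.exp (δ * p.1) • u p)) 2
        (volume : Measure Cyl) := by
    intro u
    refine (ENNReal.pow_right_strictMono two_ne_zero).injective ?_
    rw [eLpNorm_weighted_sq, eLpNorm_two_sq, ← lintegral_indicator hset]
    congr 1
    funext p
    by_cases hp : p ∈ Ioi (0 : ℝ) ×ˢ (univ : Set UnitAddCircle)
    · rw [indicator_of_mem hp, indicator_of_mem hp, enorm_smul, mul_pow, Real.enorm_of_nonneg
        (Real.exp_nonneg _), ← ENNReal.ofReal_pow (Real.exp_nonneg _), ← Real.exp_nat_mul,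
        abs_of_pos hp.1]
      have : 2 * δ * p.1 = ((2 : ℕ) : ℝ) * (δ * p.1) := by push_cast; ring
      rw [this]
    · rw [indicator_of_notMem hp, indicator_of_notMem hp]
      simp
  have hG : MemLp G 2 (volume : Measure Cyl) := ⟨hGm.aestronglyMeasurable, by
    rw [← hw]; exact hg.2⟩
  have : Fact ((2 : ℝ≥0∞) ≠ ⊤) := ⟨by simp⟩
  have : ContinuousVAdd (Cylᵈᵃᵃ) (Lp F 2 (volume : Measure Cyl)) := Lp.instContinuousVAddDomAddAct
  have hcont : Continuous (fun q : ℝ × ℝ => DomAddAct.mk (cover q) +ᵥ hG.toLp G) :=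
    (DomAddAct.continuous_mk.comp continuous_cover).vadd continuous_const
  have hG0 : DomAddAct.mk (cover 0) +ᵥ hG.toLp G = hG.toLp G := by
    rw [DomAddAct.mk_vadd_toLp]
    congr 1
    funext p
    have : cover 0 +ᵥ p = p := by
      change cover 0 + p = p
      have : cover 0 = 0 := rfl
      rw [this, zero_add]
    rw [this]
  have hvadd : ∀ q, ‖(DomAddAct.mk (cover q) +ᵥ hG.toLp G) - hG.toLp G‖ₑ =
      eLpNorm (fun p => G (p + cover q) - G p) 2 (volume : Measure Cyl) := by
    intro q
    rw [DomAddAct.mk_vadd_toLp, ← MemLp.toLp_sub, Lp.enorm_toLp]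
    congr 1
    funext p
    rw [add_comm]
    rfl
  have hlim : Filter.Tendsto (fun q : ℝ × ℝ =>
      ‖(DomAddAct.mk (cover q) +ᵥ hG.toLp G) - hG.toLp G‖ₑ +
        ‖Real.exp (-(δ * q.1)) - 1‖ₑ * eLpNorm G 2 (volume : Measure Cyl)) (𝓝 0) (𝓝 0) := by
    have h1 : Filter.Tendsto (fun q : ℝ × ℝ =>
        ‖(DomAddAct.mk (cover q) +ᵥ hG.toLp G) - hG.toLp G‖ₑ) (𝓝 0) (𝓝 0) := by
      have := ((hcont.sub continuous_const).enorm (E := Lp F 2 (volume : Measure Cyl))).tendsto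
        (x := 0) (f := fun q => ‖(DomAddAct.mk (cover q) +ᵥ hG.toLp G) - hG.toLp G‖ₑ)
      simpa [hG0] using this
    have h2 : Filter.Tendsto (fun q : ℝ × ℝ => ‖Real.exp (-(δ * q.1)) - 1‖ₑ) (𝓝 0) (𝓝 0) := by
      have hc : Continuous (fun q : ℝ × ℝ => Real.exp (-(δ * q.1)) - 1) := by fun_prop
      simpa using hc.enorm.tendsto 0
    have h3 := ENNReal.Tendsto.mul_const h2 (Or.inr hG.2.ne)
    simpa using h1.add h3
  have hev := hlim.eventually (gt_mem_nhds (pos_iff_ne_zero.2 hη))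
  obtain ⟨ε, hε, hball⟩ := Metric.eventually_nhds_iff_ball.1 hev
  refine ⟨ε, hε, fun q hq0 hq1 hq2 => ?_⟩
  have hq : q ∈ Metric.ball (0 : ℝ × ℝ) ε := by
    rw [mem_ball_zero_iff, Prod.norm_def, max_lt_iff]
    exact ⟨by rwa [Real.norm_of_nonneg hq0.le], hq2⟩
  refine le_trans ?_ (hball q hq).le
  rw [hvadd, hw]
  have hcov : (cover q).1 = q.1 := rfl
  have hexp1 : Real.exp (-(δ * q.1)) ≤ 1 := by
    rw [Real.exp_le_one_iff]; nlinarith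
  -- As q.1 > 0, the point p + q stays in the half-cylinder. The mismatch between the weights at p
  -- and at p + q is the constant factor e^{-δ q.1}, which tends to 1.
  have e : (Ioi (0 : ℝ) ×ˢ univ).indicator
      (fun p : Cyl => Real.exp (δ * p.1) • (g (p + cover q) - g p)) =
      (Ioi (0 : ℝ) ×ˢ univ).indicator (fun p : Cyl =>
        Real.exp (-(δ * q.1)) • (G (p + cover q) - G p) + (Real.exp (-(δ * q.1)) - 1) • G p) := by
    refine indicator_congr fun p hp => ?_
    have hp' : p + cover q ∈ Ioi (0 : ℝ) ×ˢ (univ : Set UnitAddCircle) :=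
      ⟨add_pos (show (0 : ℝ) < p.1 from hp.1) (show (0 : ℝ) < (cover q).1 from hq0), mem_univ _⟩
    simp only [G]
    rw [indicator_of_mem hp', indicator_of_mem hp]
    have : Real.exp (δ * p.1) = Real.exp (-(δ * q.1)) * Real.exp (δ * (p + cover q).1) := by
      rw [← Real.exp_add, Prod.fst_add, hcov]; congr 1; ring
    rw [smul_sub, smul_sub, smul_smul, sub_smul, one_smul, ← this]
    abel
  have hGq : StronglyMeasurable (fun p => G (p + cover q)) :=
    hGm.comp_measurable (measurable_add_const (cover q))
  rw [e]
  refine (eLpNorm_indicator_le _).trans ?_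
  refine (eLpNorm_add_le ((hGq.sub hGm).const_smul _).aestronglyMeasurable
    (hGm.const_smul _).aestronglyMeasurable (by norm_num)).trans ?_
  refine add_le_add ?_ ?_
  · refine (eLpNorm_const_smul_le (f := fun p => G (p + cover q) - G p)).trans ?_
    refine mul_le_of_le_one_left zero_le ?_
    rw [Real.enorm_of_nonneg (Real.exp_nonneg _)]
    simpa using hexp1
  · exact eLpNorm_const_smul_le

end GWSplicing

end
-- Smooth approximation on the half-cylinder.
noncomputable section

namespace GWSplicing

section Approximation

variable {F : Type} [NormedAddCommGroup F] [NormedSpace ℝ F]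

theorem integrable_translate {δ : ℝ} (hδ : 0 ≤ δ) {I : Set ℝ} (hI : IsOpen I)
    (g : Lp F 2 (weightedMeasure I δ)) {ρ : ℝ × ℝ → ℝ} (hρ : Continuous ρ)
    (hc : HasCompactSupport ρ) {p : Cyl} (hp : ∀ q ∈ tsupport ρ, p.1 + q.1 ∈ I) :
    Integrable (fun q => ρ q • g (p + cover q)) := by
  obtain ⟨p, rfl⟩ := cover_surjective p
  have h := integrable_test (cover_locInt hI hδ g) (hρ.comp (continuous_id.sub continuous_const))
    (hasCompactSupport_translate hc p) (tsupport_translate hp)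
  have h2 := h.comp_add_left p
  refine h2.congr (Filter.Eventually.of_forall fun q => ?_)
  simp [cover_add]

/-- The kernel is supported strictly in q.1 > 0, so averages at points of the open half-cylinder
only use values inside it. No extension of Sobolev functions across s = 0 is needed. -/
theorem exists_mollifier {ε : ℝ} (hε : 0 < ε) : ∃ ρ : ℝ × ℝ → ℝ, ContDiff ℝ ∞ ρ ∧
    HasCompactSupport ρ ∧ (∀ q, 0 ≤ ρ q) ∧ ∫ q, ρ q = 1 ∧
    ∀ q ∈ tsupport ρ, 0 < q.1 ∧ q.1 < ε ∧ |q.2| < ε := by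
  let B : ContDiffBump ((ε / 2, 0) : ℝ × ℝ) := ⟨ε / 8, ε / 4, by positivity, by linarith⟩
  refine ⟨B.normed volume, B.contDiff_normed, B.hasCompactSupport_normed, B.nonneg_normed,
    B.integral_normed, fun q hq => ?_⟩
  rw [B.tsupport_normed_eq, mem_closedBall_iff_norm, Prod.norm_def, max_le_iff] at hq
  have hB : B.rOut = ε / 4 := rfl
  rw [hB] at hq
  simp only [Prod.fst_sub, Prod.snd_sub, Real.norm_eq_abs, sub_zero, abs_le] at hq
  refine ⟨by linarith [hq.1.1], by linarith [hq.1.2], ?_⟩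
  rw [abs_lt]
  constructor <;> linarith [hq.2.1, hq.2.2]

/-- Smooth approximation of Sobolev functions on the half-cylinder. -/
theorem exists_smooth_approx [CompleteSpace F] {δ : ℝ} (hδ : 0 ≤ δ) {k : ℕ} {f : Cyl → F}
    (hf : Continuous f) (hs : IsSobolev (Ioi 0) k δ f) (p₀ : Cyl) {η : ℝ} (hη : 0 < η) :
    ∃ g : Cyl → F, IsSmooth g ∧ ‖g p₀ - f p₀‖ ≤ η ∧ ∀ i j, i + j ≤ k →
      eLpNorm (fun p => pST i j g p - wDeriv (Ioi 0) δ i j f p) 2 (weightedMeasure (Ioi 0) δ) ≤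
        ENNReal.ofReal η := by
  have h1 : ∀ a ∈ Finset.range (k + 1) ×ˢ Finset.range (k + 1), ∀ᶠ ε in 𝓝[>] (0 : ℝ),
      ∀ q : ℝ × ℝ, 0 < q.1 → q.1 < ε → |q.2| < ε →
      eLpNorm (fun p => wDeriv (Ioi 0) δ a.1 a.2 f (p + cover q) - wDeriv (Ioi 0) δ a.1 a.2 f p) 2
        (weightedMeasure (Ioi 0) δ) ≤ ENNReal.ofReal η := by
    intro a _
    obtain ⟨ε, hε, h⟩ := exists_translate_le hδ (Lp.memLp (wDeriv (Ioi 0) δ a.1 a.2 f))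
      (Lp.stronglyMeasurable _) (ENNReal.ofReal_pos.2 hη).ne'
    filter_upwards [Ioo_mem_nhdsGT hε] with ε' hε' q h0 h1 h2
    exact h q h0 (h1.trans hε'.2) (h2.trans hε'.2)
  have h2 : ∀ᶠ ε in 𝓝[>] (0 : ℝ), ∀ q : ℝ × ℝ, 0 < q.1 → q.1 < ε → |q.2| < ε →
      ‖f (p₀ + cover q) - f p₀‖ ≤ η := by
    have hc : Continuous (fun q => f (p₀ + cover q)) :=
      hf.comp (continuous_const.add continuous_cover)
    have := Metric.tendsto_nhds.1 (hc.tendsto 0) η hη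
    obtain ⟨ε, hε, h⟩ := Metric.eventually_nhds_iff_ball.1 this
    filter_upwards [Ioo_mem_nhdsGT hε] with ε' hε' q h0 h1 h2
    have hq : q ∈ Metric.ball (0 : ℝ × ℝ) ε := by
      rw [mem_ball_zero_iff, Prod.norm_def, max_lt_iff]
      exact ⟨by rw [Real.norm_of_nonneg h0.le]; exact h1.trans hε'.2, h2.trans hε'.2⟩
    have h3 := h q hq
    have h00 : p₀ + cover 0 = p₀ := by
      have : cover 0 = 0 := rfl
      rw [this, add_zero]
    rw [h00, dist_eq_norm] at h3
    exact h3.le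
  obtain ⟨ε, ⟨hA, hB⟩, hε⟩ := (((Filter.eventually_all_finset _).2 h1).and h2 |>.and
    self_mem_nhdsWithin).exists
  obtain ⟨ρ, hρ, hc, h0, hint, hsupp⟩ := exists_mollifier (show (0 : ℝ) < ε from hε)
  have hsupp' : ∀ q, ρ q ≠ 0 → 0 < q.1 ∧ q.1 < ε ∧ |q.2| < ε := fun q hq =>
    hsupp q (subset_tsupport ρ hq)
  refine ⟨mollify ρ f, isSmooth_mollify hρ hc hf, ?_, fun i j hij => ?_⟩
  · exact norm_mollify_sub_le hρ.continuous hc h0 hint hf fun q hq =>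
      hB q (hsupp' q hq).1 (hsupp' q hq).2.1 (hsupp' q hq).2.2
  · have hI : ∀ p : Cyl, p.1 ∈ Ioi (0 : ℝ) → ∀ q ∈ tsupport ρ, p.1 + q.1 ∈ Ioi (0 : ℝ) :=
      fun p hp q hq => add_pos (show (0 : ℝ) < p.1 from hp) (hsupp q hq).1
    have e : (fun p => pST i j (mollify ρ f) p - wDeriv (Ioi 0) δ i j f p)
        =ᵐ[weightedMeasure (Ioi 0) δ]
        fun p => mollify ρ (wDeriv (Ioi 0) δ i j f) p - wDeriv (Ioi 0) δ i j f p := by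
      filter_upwards [ae_mem_weightedMeasure measurableSet_Ioi δ] with p hp
      rw [(wDeriv_spec (hs i j hij)).pST_mollify hρ hc hf (hI p hp)]
    rw [eLpNorm_congr_ae e]
    refine eLpNorm_mollify_sub_le hρ.continuous hc h0 hint measurableSet_Ioi
      (Lp.stronglyMeasurable _) (fun p hp => integrable_translate hδ isOpen_Ioi _ hρ.continuous hc
        (hI p hp)) fun q hq => ?_
    exact hA (i, j) (Finset.mem_product.2 ⟨Finset.mem_range.2 (by simp only; omega),
      Finset.mem_range.2 (by simp only; omega)⟩) q (hsupp' q hq).1 (hsupp' q hq).2.1 (hsupp' q hq).2.2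

end Approximation

/-! ### The Sobolev inequality -/

section Embedding

variable {F : Type} [NormedAddCommGroup F] [NormedSpace ℝ F]

/-- Write w(a) = w(s) - ∫_a^s w' and average over s in the unit interval. -/
theorem enorm_le_lintegral_unit [CompleteSpace F] {w w' : ℝ → F}
    (hw : ∀ s, HasDerivAt w (w' s) s) (hw' : Continuous w') (a : ℝ) :
    ‖w a‖ₑ ≤ ∫⁻ s in Ioc a (a + 1), (‖w s‖ₑ + ‖w' s‖ₑ) := by
  have hwc : Continuous w := continuous_iff_continuousAt.2 fun s => (hw s).continuousAt
  have h1 : ∀ s ∈ Ioc a (a + 1), ‖w a‖ₑ ≤ ‖w s‖ₑ + ∫⁻ r in Ioc a (a + 1), ‖w' r‖ₑ := by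
    intro s hs
    have e := intervalIntegral.integral_eq_sub_of_hasDerivAt (fun r _ => hw r)
      (hw'.intervalIntegrable a s)
    have e2 : w a = w s - ∫ r in a..s, w' r := by rw [e]; abel
    rw [e2]
    refine (enorm_sub_le).trans ?_
    gcongr
    rw [intervalIntegral.integral_of_le hs.1.le]
    refine (enorm_integral_le_lintegral_enorm _).trans ?_
    exact lintegral_mono_set (Ioc_subset_Ioc_right hs.2)
  have hvol : (volume : Measure ℝ) (Ioc a (a + 1)) = 1 := by simp
  calc ‖w a‖ₑ = ∫⁻ _ in Ioc a (a + 1), ‖w a‖ₑ := by simp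
    _ ≤ ∫⁻ s in Ioc a (a + 1), (‖w s‖ₑ + ∫⁻ r in Ioc a (a + 1), ‖w' r‖ₑ) :=
      setLIntegral_mono' measurableSet_Ioc h1
    _ = _ := by
      rw [lintegral_add_left hwc.enorm.measurable, lintegral_add_left hwc.enorm.measurable]
      simp

/-- The strip has measure one, so L¹ is dominated by L², and on it the weight is at least e^{δs}.
This is the source of the exponential decay in the Sobolev inequality. -/
theorem lintegral_strip_le {s δ : ℝ} (hs : 0 ≤ s) (hδ : 0 ≤ δ) {g : Cyl → F} (hg : Continuous g) :
    ∫⁻ p, ‖g p‖ₑ ∂((volume.restrict (Ioc s (s + 1))).prod (volume : Measure UnitAddCircle)) ≤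
      ENNReal.ofReal (Real.exp (-(δ * s))) * eLpNorm g 2 (weightedMeasure (Ioi 0) δ) := by
  set ν := (volume.restrict (Ioc s (s + 1))).prod (volume : Measure UnitAddCircle) with hν
  have hprob : IsProbabilityMeasure (volume.restrict (Ioc s (s + 1)) : Measure ℝ) := ⟨by simp⟩
  have hprob' : IsProbabilityMeasure ν := ⟨by
    rw [hν, ← univ_prod_univ, Measure.prod_prod]; simp⟩
  have h2 := eLpNorm_le_eLpNorm_of_exponent_le (p := 1) (q := 2) (μ := ν) (by norm_num)
    (hg.aestronglyMeasurable (μ := ν))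
  rw [eLpNorm_one_eq_lintegral_enorm] at h2
  refine h2.trans (eLpNorm_two_le ?_)
  rw [mul_pow, eLpNorm_weighted_sq, ← ENNReal.ofReal_pow (Real.exp_nonneg _),
    ← lintegral_const_mul' _ _ ENNReal.ofReal_ne_top]
  have e : ν = (volume : Measure Cyl).restrict (Ioc s (s + 1) ×ˢ univ) := by
    rw [hν, Measure.volume_eq_prod, ← Measure.prod_restrict, Measure.restrict_univ]
  rw [e]
  have hmeas : MeasurableSet (Ioc s (s + 1) ×ˢ (univ : Set UnitAddCircle)) :=
    measurableSet_Ioc.prod MeasurableSet.univ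
  refine (setLIntegral_mono' hmeas (g := fun p : Cyl =>
    ENNReal.ofReal (Real.exp (-(δ * s)) ^ 2) * (ENNReal.ofReal (Real.exp (2 * δ * |p.1|)) *
      ‖g p‖ₑ ^ 2)) fun p hp => ?_).trans (lintegral_mono_set ?_)
  · rw [← mul_assoc, ← ENNReal.ofReal_mul (by positivity), ← Real.exp_nat_mul, ← Real.exp_add]
    refine le_mul_of_one_le_left zero_le ?_
    rw [ENNReal.one_le_ofReal, Real.one_le_exp_iff]
    have h1 : s < p.1 := hp.1.1
    rw [abs_of_pos (hs.trans_lt h1)]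
    push_cast
    nlinarith
  · exact prod_mono (fun r hr => hs.trans_lt hr.1) subset_rfl

/-- The Sobolev inequality for smooth maps. -/
theorem IsSmooth.enorm_le [CompleteSpace F] {f : Cyl → F} (hf : IsSmooth f) {δ : ℝ} (hδ : 0 ≤ δ)
    {p : Cyl} (hp : 0 ≤ p.1) : ‖f p‖ₑ ≤ ENNReal.ofReal (Real.exp (-(δ * p.1))) *
      ∑ a ∈ Finset.range 2 ×ˢ Finset.range 2,
        eLpNorm (GWSplicing.pST a.1 a.2 f) 2 (weightedMeasure (Ioi 0) δ) := by
  obtain ⟨⟨s, t⟩, rfl⟩ := cover_surjective p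
  have hD : ∀ {g : Cyl → F}, IsSmooth g → ∀ τ : ℝ, ‖g (cover (s, τ))‖ₑ ≤
      ∫⁻ σ in Ioc s (s + 1), (‖g (cover (σ, τ))‖ₑ + ‖GWSplicing.pS g (cover (σ, τ))‖ₑ) := by
    intro g hg τ
    refine enorm_le_lintegral_unit (w := fun σ => g (cover (σ, τ)))
      (w' := fun σ => GWSplicing.pS g (cover (σ, τ))) (fun σ => ?_) ?_ s
    · have := hg.hasDerivAt_s (σ, τ)
      rw [← hg.pS_cover] at this
      exact this
    · exact (hg.pS.continuous.comp continuous_cover).comp (by fun_prop)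
  have hT : ∀ {g : Cyl → F}, IsSmooth g → ∀ σ : ℝ, ‖g (cover (σ, t))‖ₑ ≤
      ∫⁻ τ in Ioc t (t + 1), (‖g (cover (σ, τ))‖ₑ + ‖GWSplicing.pT g (cover (σ, τ))‖ₑ) := by
    intro g hg σ
    refine enorm_le_lintegral_unit (w := fun τ => g (cover (σ, τ)))
      (w' := fun τ => GWSplicing.pT g (cover (σ, τ))) (fun τ => ?_) ?_ t
    · have := hg.hasDerivAt_t (σ, τ)
      rw [← hg.pT_cover] at this
      exact this
    · exact (hg.pT.continuous.comp continuous_cover).comp (by fun_prop)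
  -- One fundamental-theorem estimate in s followed by one in t leaves f, ∂_t f, ∂_s f and ∂_s∂_t f.
  -- This is why only the four multi-indices with entries at most 1 occur and two derivatives
  -- suffice.
  let J : Cyl → ℝ≥0∞ := fun p => (‖f p‖ₑ + ‖GWSplicing.pT f p‖ₑ) +
    (‖GWSplicing.pS f p‖ₑ + ‖GWSplicing.pT (GWSplicing.pS f) p‖ₑ)
  have m0 := hf.continuous.enorm
  have m1 := hf.pT.continuous.enorm
  have m2 := hf.pS.continuous.enorm
  have m3 := hf.pS.pT.continuous.enorm
  have hJ : Continuous J := by fun_prop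
  have hcov := continuous_cover
  have hmp := cover_mp (Ioc s (s + 1)) t
  have h1 : ‖f (cover (s, t))‖ₑ ≤ ∫⁻ p, J p ∂((volume.restrict (Ioc s (s + 1))).prod
      (volume : Measure UnitAddCircle)) := by
    rw [← hmp.lintegral_comp hJ.measurable, Measure.volume_eq_prod, ← Measure.prod_restrict,
      lintegral_prod (fun p : ℝ × ℝ => J (cover p)) (hJ.comp hcov).measurable.aemeasurable]
    refine (hD hf t).trans (lintegral_mono fun σ => ?_)
    refine (add_le_add (hT hf σ) (hT hf.pS σ)).trans (le_of_eq ?_)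
    rw [← lintegral_add_left (by
      have : Continuous fun τ : ℝ => ‖f (cover (σ, τ))‖ₑ + ‖GWSplicing.pT f (cover (σ, τ))‖ₑ := by
        exact (m0.comp (hcov.comp (by fun_prop))).add (m1.comp (hcov.comp (by fun_prop)))
      exact this.measurable)]
  refine h1.trans ?_
  simp only [J]
  rw [lintegral_add_left (show Continuous fun p => ‖f p‖ₑ + ‖GWSplicing.pT f p‖ₑ by
      fun_prop).measurable, lintegral_add_left m0.measurable,
    lintegral_add_left m2.measurable, Finset.mul_sum, Finset.sum_product]
  simp only [Finset.sum_range_succ, Finset.sum_range_zero, zero_add]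
  have e : GWSplicing.pT (GWSplicing.pS f) = GWSplicing.pST 1 1 f := hf.pT_pST 1 0
  rw [e]
  exact add_le_add (add_le_add (lintegral_strip_le hp hδ hf.continuous)
    (lintegral_strip_le hp hδ hf.pT.continuous)) (add_le_add
    (lintegral_strip_le hp hδ hf.pS.continuous)
    (lintegral_strip_le hp hδ (hf.pST 1 1).continuous))

/-- The Sobolev inequality. -/
theorem IsSobolev.norm_le [CompleteSpace F] {δ : ℝ} (hδ : 0 ≤ δ) {k : ℕ} (hk : 2 ≤ k) {f : Cyl → F}
    (hf : Continuous f) (hs : IsSobolev (Ioi 0) k δ f) {p : Cyl} (hp : 0 ≤ p.1) :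
    ‖f p‖ ≤ Real.exp (-(δ * p.1)) *
      ∑ a ∈ Finset.range 2 ×ˢ Finset.range 2, ‖wDeriv (Ioi 0) δ a.1 a.2 f‖ := by
  have key : ∀ η : ℝ, 0 < η → ‖f p‖ ≤ Real.exp (-(δ * p.1)) *
      ∑ a ∈ Finset.range 2 ×ˢ Finset.range 2, (‖wDeriv (Ioi 0) δ a.1 a.2 f‖ + η) + η := by
    intro η hη
    -- Closeness at the single point p is enough, since the inequality is proved one point at a time
    -- and η tends to 0 at the end.
    obtain ⟨g, hg, hp1, hg2⟩ := exists_smooth_approx hδ hf hs p hη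
    have h1 := hg.enorm_le hδ hp
    have h2 : ∑ a ∈ Finset.range 2 ×ˢ Finset.range 2,
        eLpNorm (pST a.1 a.2 g) 2 (weightedMeasure (Ioi 0) δ) ≤ 
        ENNReal.ofReal (∑ a ∈ Finset.range 2 ×ˢ Finset.range 2,
          (‖wDeriv (Ioi 0) δ a.1 a.2 f‖ + η)) := by
      rw [ENNReal.ofReal_sum_of_nonneg fun a _ => by positivity]
      refine Finset.sum_le_sum fun a ha => ?_
      have ha' := Finset.mem_product.1 ha
      have := Finset.mem_range.1 ha'.1
      have := Finset.mem_range.1 ha'.2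
      have h3 := hg2 a.1 a.2 (by omega)
      have e : pST a.1 a.2 g = (fun p => pST a.1 a.2 g p - wDeriv (Ioi 0) δ a.1 a.2 f p) +
          wDeriv (Ioi 0) δ a.1 a.2 f := by
        funext p; simp
      rw [e, ENNReal.ofReal_add (norm_nonneg _) hη.le, add_comm (ENNReal.ofReal _)]
      refine (eLpNorm_add_le ((hg.pST a.1 a.2).continuous.aestronglyMeasurable.sub
        (Lp.aestronglyMeasurable _)) (Lp.aestronglyMeasurable _) (by norm_num)).trans ?_
      refine add_le_add h3 ?_
      rw [Lp.norm_def, ENNReal.ofReal_toReal (Lp.eLpNorm_ne_top _)]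
    have h3 := h1.trans (mul_le_mul_right h2 _)
    rw [← ENNReal.ofReal_mul (Real.exp_nonneg _), ← ofReal_norm,
      ENNReal.ofReal_le_ofReal_iff (by positivity)] at h3
    have h4 : ‖f p‖ ≤ ‖g p‖ + ‖g p - f p‖ := by
      have := norm_sub_le (g p) (g p - f p)
      simpa using this
    linarith
  have hlim : Filter.Tendsto (fun η : ℝ => Real.exp (-(δ * p.1)) *
      ∑ a ∈ Finset.range 2 ×ˢ Finset.range 2, (‖wDeriv (Ioi 0) δ a.1 a.2 f‖ + η) + η) (𝓝[>] 0)
      (𝓝 (Real.exp (-(δ * p.1)) *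
        ∑ a ∈ Finset.range 2 ×ˢ Finset.range 2, ‖wDeriv (Ioi 0) δ a.1 a.2 f‖)) := by
    have hc : Continuous (fun η : ℝ => Real.exp (-(δ * p.1)) *
      ∑ a ∈ Finset.range 2 ×ˢ Finset.range 2, (‖wDeriv (Ioi 0) δ a.1 a.2 f‖ + η) + η) := by fun_prop
    have := (hc.tendsto 0).mono_left (nhdsWithin_le_nhds (s := Ioi 0))
    simpa using this
  refine ge_of_tendsto hlim ?_
  filter_upwards [self_mem_nhdsWithin] with η hη using key η hη

end Embedding

end GWSplicing

end
noncomputable section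

namespace GWSplicing

/-! ### Weak derivatives: almost everywhere equality, differences, reflection -/

section Weak

variable {F : Type} [NormedAddCommGroup F] [NormedSpace ℝ F]

theorem IsWeakDeriv.congr_ae {I : Set ℝ} (hI : IsOpen I) {δ : ℝ} {i j : ℕ} {f g g' : Cyl → F}
    (h : IsWeakDeriv I i j f g) (e : g =ᵐ[weightedMeasure I δ] g') : IsWeakDeriv I i j f g' := by
  intro φ h1 h2 h3
  rw [h φ h1 h2 h3]
  congr 1
  apply integral_congr_ae
  filter_upwards [cover_ae I hI e] with p hp
  by_cases hpI : p ∈ I ×ˢ (univ : Set ℝ)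
  · rw [hp hpI]
  · have : φ p = 0 := by
      by_contra h0
      exact hpI (h3 (subset_tsupport φ h0))
    simp [this]

theorem IsWeakDeriv.wDeriv_eq [CompleteSpace F] {I : Set ℝ} (hI : IsOpen I) {δ : ℝ} (hδ : 0 ≤ δ)
    {i j : ℕ} {f g : Cyl → F} (h : IsWeakDeriv I i j f g) (hg : MemLp g 2 (weightedMeasure I δ)) :
    HasWDeriv I δ i j f ∧ wDeriv I δ i j f = hg.toLp g := by
  have h1 : IsWeakDeriv I i j f (hg.toLp g) := h.congr_ae hI hg.coeFn_toLp.symm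
  have h2 : HasWDeriv I δ i j f := ⟨_, h1⟩
  exact ⟨h2, IsWeakDeriv.unique hI hδ (wDeriv_spec h2) h1⟩

theorem IsWeakDeriv.wDeriv_eq_Lp [CompleteSpace F] {I : Set ℝ} (hI : IsOpen I) {δ : ℝ} (hδ : 0 ≤ δ)
    {i j : ℕ} {f : Cyl → F} {g : Lp F 2 (weightedMeasure I δ)} (h : IsWeakDeriv I i j f g) :
    wDeriv I δ i j f = g :=
  IsWeakDeriv.unique hI hδ (wDeriv_spec ⟨g, h⟩) h

theorem fderiv_comp_neg (σ : ℝ × ℝ → ℝ) (q : ℝ × ℝ) :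
    fderiv ℝ (fun q => σ (-q)) q = -fderiv ℝ σ (-q) := by
  have := (ContinuousLinearEquiv.neg ℝ (M := ℝ × ℝ)).comp_right_fderiv (f := σ) (x := q)
  refine (show _ = _ from this).trans ?_
  ext <;> simp [← map_neg]

theorem dST_neg (φ : ℝ × ℝ → ℝ) (i j : ℕ) : dS^[i] (dT^[j] (fun q => φ (-q))) =
    fun q => (-1 : ℝ) ^ (i + j) * (dS^[i] (dT^[j] φ)) (-q) := by
  have hS : ∀ (c : ℝ) (σ : ℝ × ℝ → ℝ), dS (fun q => c * σ (-q)) = fun q => (c * -1) * dS σ (-q) := by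
    intro c σ
    funext q
    have h1 := fderiv_comp_neg (fun q => c * σ q) q
    have h2 : fderiv ℝ (fun q => c * σ q) (-q) = c • fderiv ℝ σ (-q) := by
      exact congrFun (fderiv_const_smul_field (𝕜 := ℝ) (f := σ) c) (-q)
    simp only [dS]
    rw [h1, h2]
    simp
  have hT : ∀ (c : ℝ) (σ : ℝ × ℝ → ℝ), dT (fun q => c * σ (-q)) = fun q => (c * -1) * dT σ (-q) := by
    intro c σ
    funext q
    have h1 := fderiv_comp_neg (fun q => c * σ q) q
    have h2 : fderiv ℝ (fun q => c * σ q) (-q) = c • fderiv ℝ σ (-q) := by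
      exact congrFun (fderiv_const_smul_field (𝕜 := ℝ) (f := σ) c) (-q)
    simp only [dT]
    rw [h1, h2]
    simp
  have h1 : dT^[j] (fun q => φ (-q)) = fun q => (-1 : ℝ) ^ j * (dT^[j] φ) (-q) := by
    induction j with
    | zero => simp
    | succ j ih => rw [Function.iterate_succ_apply', ih, hT, ← pow_succ, Function.iterate_succ_apply']
  rw [h1]
  induction i with
  | zero => simp
  | succ i ih =>
    rw [Function.iterate_succ_apply', ih, hS, ← pow_succ, Function.iterate_succ_apply',
      add_right_comm]

theorem cover_neg (p : ℝ × ℝ) : cover (-p) = -cover p := rfl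

/-- The reflection of a weak derivative. -/
theorem IsWeakDeriv.neg {I J : Set ℝ} (hIJ' : ∀ s, -s ∈ I → s ∈ J) {i j : ℕ} {f g : Cyl → F}
    (h : IsWeakDeriv J i j f g) :
    IsWeakDeriv I i j (fun p => f (-p)) (fun p => (-1 : ℝ) ^ (i + j) • g (-p)) := by
  intro φ h1 h2 h3
  have e := h (fun q => φ (-q)) (h1.comp contDiff_neg)
    (h2.comp_homeomorph (Homeomorph.neg (ℝ × ℝ))) ?_
  · rw [dST_neg] at e
    rw [← integral_neg_eq_self (fun p => (dS^[i] (dT^[j] φ)) p • f (-cover p)) volume,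
      ← integral_neg_eq_self (fun p => φ p • (-1 : ℝ) ^ (i + j) • g (-cover p)) volume]
    simp only [cover_neg, neg_neg]
    simp only [mul_smul, integral_smul] at e
    have hc : ∀ q, φ (-q) • (-1 : ℝ) ^ (i + j) • g (cover q) =
        (-1 : ℝ) ^ (i + j) • φ (-q) • g (cover q) := fun q => smul_comm _ _ _
    simp only [hc, integral_smul]
    rw [smul_right_injective _ (pow_ne_zero (i + j) (by norm_num : (-1 : ℝ) ≠ 0)) e, smul_smul,
      ← mul_pow]
    simp
  · intro p hp
    have : tsupport (fun q => φ (-q)) ⊆ Neg.neg ⁻¹' tsupport φ :=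
      tsupport_comp_subset_preimage φ continuous_neg
    have h4 := h3 (this hp)
    exact ⟨hIJ' _ h4.1, mem_univ _⟩

theorem eLpNorm_neg {I J : Set ℝ} (hI : MeasurableSet I) (hJ : MeasurableSet J)
    (hIJ : ∀ s, s ∈ I ↔ -s ∈ J) (δ : ℝ) (g : Cyl → F) :
    eLpNorm (fun p => g (-p)) 2 (weightedMeasure I δ) = eLpNorm g 2 (weightedMeasure J δ) := by
  refine (ENNReal.pow_right_strictMono two_ne_zero).injective ?_
  rw [eLpNorm_weighted_sq, eLpNorm_weighted_sq, ← lintegral_indicator (hI.prod MeasurableSet.univ),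
    ← lintegral_indicator (hJ.prod MeasurableSet.univ), ← lintegral_neg_eq_self]
  congr 1
  funext p
  by_cases hp : p.1 ∈ J
  · rw [indicator_of_mem (show p ∈ J ×ˢ univ from ⟨hp, mem_univ _⟩),
      indicator_of_mem (show -p ∈ I ×ˢ univ from ⟨(hIJ _).2 (by simpa using hp), mem_univ _⟩)]
    simp
  · rw [indicator_of_notMem (show p ∉ J ×ˢ univ from fun h => hp h.1),
      indicator_of_notMem (show -p ∉ I ×ˢ univ from fun h => hp (by simpa using (hIJ _).1 h.1))]

theorem HasWDeriv.neg [CompleteSpace F] {I J : Set ℝ} (hI : IsOpen I) (hJ : IsOpen J)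
    (hIJ : ∀ s, s ∈ I ↔ -s ∈ J) {δ : ℝ} (hδ : 0 ≤ δ) {i j : ℕ} {f : Cyl → F}
    (h : HasWDeriv J δ i j f) : HasWDeriv I δ i j (fun p => f (-p)) ∧
      ‖wDeriv I δ i j (fun p => f (-p))‖ = ‖wDeriv J δ i j f‖ := by
  set g := wDeriv J δ i j f
  have hm : StronglyMeasurable (fun p => (-1 : ℝ) ^ (i + j) • g (-p)) :=
    ((Lp.stronglyMeasurable g).comp_measurable measurable_neg).const_smul _
  have hn : eLpNorm (fun p => (-1 : ℝ) ^ (i + j) • g (-p)) 2 (weightedMeasure I δ) =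
      eLpNorm g 2 (weightedMeasure J δ) := by
    rw [← eLpNorm_neg hI.measurableSet hJ.measurableSet hIJ]
    exact (eLpNorm_const_smul _ (fun p => g (-p)) _ _).trans (by simp [enorm_pow])
  have hmem : MemLp (fun p => (-1 : ℝ) ^ (i + j) • g (-p)) 2 (weightedMeasure I δ) :=
    ⟨hm.aestronglyMeasurable, by rw [hn]; exact Lp.eLpNorm_lt_top g⟩
  obtain ⟨h1, h2⟩ := ((wDeriv_spec h).neg (I := I) fun s hs => by simpa using (hIJ _).1 hs).wDeriv_eq hI hδ hmem
  refine ⟨h1, ?_⟩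
  rw [h2, Lp.norm_toLp, hn]
  rfl

/-- Integrals against test functions are bounded by weighted norms. -/
theorem exists_lintegral_test_le {I : Set ℝ} {δ : ℝ} (hδ : 0 ≤ δ)
    {φ : ℝ × ℝ → ℝ} (hφ : Continuous φ) (hc : HasCompactSupport φ)
    (hs : tsupport φ ⊆ I ×ˢ univ) : ∃ C : ℝ≥0∞, C ≠ ⊤ ∧ ∀ h : Cyl → F, StronglyMeasurable h →
      ∫⁻ p, ‖φ p • h (cover p)‖ₑ ≤ C * eLpNorm h 2 (weightedMeasure I δ) := by
  obtain ⟨M, hM⟩ := hc.isCompact.isBounded.subset_closedBall (0 : ℝ × ℝ)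
  obtain ⟨B, hB⟩ := hφ.bounded_above_of_compact_support hc
  obtain ⟨N, hN⟩ := exists_nat_gt (|M| + 1)
  have hMN : M + 1 < N := by linarith [le_abs_self M]
  let I' := I ∩ Icc (-M) M
  have hI' : (volume : Measure ℝ) I' < ⊤ := (measure_mono inter_subset_right).trans_lt measure_Icc_lt_top
  -- The test function lives on the plane while the norm is on the cylinder: the support is covered
  -- by 2N strips of height one, each mapped to the cylinder in a measure-preserving way.
  let A : Fin (2 * N) → Set (ℝ × ℝ) := fun k => I' ×ˢ Ioc ((k : ℝ) - N) ((k : ℝ) - N + 1)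
  have hsub : Function.support φ ⊆ ⋃ k, A k := by
    intro p hp
    have hp' := subset_tsupport φ hp
    have h1 := hM hp'
    rw [mem_closedBall_zero_iff, Prod.norm_def, max_le_iff, Real.norm_eq_abs, Real.norm_eq_abs,
      abs_le, abs_le] at h1
    have hk0 : 0 ≤ ⌈p.2⌉ - 1 + N := by
      have := Int.le_ceil p.2
      have h2 : (-(N : ℤ) : ℝ) < ⌈p.2⌉ := by push_cast; linarith [h1.2.1]
      have h3 : -(N : ℤ) < ⌈p.2⌉ := by exact_mod_cast h2
      omega
    have hk1 : ⌈p.2⌉ - 1 + N < 2 * N := by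
      have := Int.ceil_lt_add_one p.2
      have h2 : (⌈p.2⌉ : ℝ) < ((N : ℤ) : ℝ) := by push_cast; linarith [h1.2.2]
      have h3 : ⌈p.2⌉ < (N : ℤ) := by exact_mod_cast h2
      omega
    obtain ⟨k, hk⟩ := Int.eq_ofNat_of_zero_le hk0
    have hkr : (k : ℝ) = ⌈p.2⌉ - 1 + N := by
      have : ((k : ℤ) : ℝ) = ((⌈p.2⌉ - 1 + N : ℤ) : ℝ) := by rw [hk]
      push_cast at this
      exact this
    refine mem_iUnion.2 ⟨⟨k, by omega⟩, ⟨(hs hp').1, h1.1⟩, ?_⟩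
    simp only [hkr]
    constructor
    · linarith [Int.ceil_lt_add_one p.2]
    · linarith [Int.le_ceil p.2]
  have hB0 : 0 ≤ B := (norm_nonneg _).trans (hB 0)
  set ν := (volume.restrict I').prod (volume : Measure UnitAddCircle) with hν
  have hνuniv : ν univ < ⊤ := by
    rw [hν, ← univ_prod_univ, Measure.prod_prod]
    simpa using hI'
  have hνle : ν ≤ weightedMeasure I δ := by
    refine le_trans ?_ (base_le I hδ)
    rw [hν]
    have : volume.restrict I' ≤ volume.restrict I := Measure.restrict_mono inter_subset_left le_rfl
    exact Measure.prod_mono this le_rfl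
  have hfin : IsFiniteMeasure ν := ⟨hνuniv⟩
  refine ⟨ENNReal.ofReal B * ((2 * N : ℕ) * ν univ ^ (1 / (1 : ℝ≥0∞).toReal - 1 / (2 : ℝ≥0∞).toReal)),
    ENNReal.mul_ne_top ENNReal.ofReal_ne_top (ENNReal.mul_ne_top (ENNReal.natCast_ne_top _)
      (ENNReal.rpow_ne_top_of_nonneg (by norm_num) hνuniv.ne)), fun h hh => ?_⟩
  have h1 : ∫⁻ p, ‖φ p • h (cover p)‖ₑ ≤ ENNReal.ofReal B * ∫⁻ p in ⋃ k, A k, ‖h (cover p)‖ₑ := by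
    have e : ∫⁻ p, ‖φ p • h (cover p)‖ₑ = ∫⁻ p in ⋃ k, A k, ‖φ p • h (cover p)‖ₑ := by
      refine (setLIntegral_eq_of_support_subset ?_).symm
      intro p hp
      apply hsub
      intro h0
      exact hp (by simp [h0])
    rw [e, ← lintegral_const_mul' _ _ ENNReal.ofReal_ne_top]
    refine lintegral_mono fun p => ?_
    rw [enorm_smul]
    gcongr
    rw [← ofReal_norm]
    exact ENNReal.ofReal_le_ofReal (hB p)
  have h2 : ∫⁻ p in ⋃ k, A k, ‖h (cover p)‖ₑ ≤ (2 * N : ℕ) * ∫⁻ p, ‖h p‖ₑ ∂ν := by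
    refine (lintegral_mono' Measure.restrict_iUnion_le le_rfl).trans ?_
    rw [lintegral_sum_measure, tsum_fintype]
    refine (Finset.sum_le_card_nsmul _ _ (∫⁻ p, ‖h p‖ₑ ∂ν) fun k _ => ?_).trans ?_
    · exact ((cover_mp I' ((k : ℝ) - N)).lintegral_comp hh.enorm).le
    · simp
  have h3 : ∫⁻ p, ‖h p‖ₑ ∂ν ≤ eLpNorm h 2 ν * ν univ ^ (1 / (1 : ℝ≥0∞).toReal - 1 / (2 : ℝ≥0∞).toReal) := by
    rw [← eLpNorm_one_eq_lintegral_enorm]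
    exact eLpNorm_le_eLpNorm_mul_rpow_measure_univ (by norm_num) hh.aestronglyMeasurable
  have h4 := eLpNorm_mono_measure h hνle (p := 2)
  calc _ ≤ ENNReal.ofReal B * ((2 * N : ℕ) * (eLpNorm h 2 (weightedMeasure I δ) *
        ν univ ^ (1 / (1 : ℝ≥0∞).toReal - 1 / (2 : ℝ≥0∞).toReal))) := by
        refine h1.trans ?_
        gcongr
        refine h2.trans ?_
        gcongr
        refine h3.trans ?_
        gcongr
    _ = _ := by ring

/-- Weak derivatives are preserved by simultaneous uniform and `L²` limits. -/
theorem isWeakDeriv_of_tendsto {I : Set ℝ} (hI : IsOpen I) {δ : ℝ} (hδ : 0 ≤ δ) {i j : ℕ}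
    {f : ℕ → Cyl → F} {f₀ : Cyl → F} {g : ℕ → Lp F 2 (weightedMeasure I δ)}
    {g₀ : Lp F 2 (weightedMeasure I δ)} (hf : ∀ k, Continuous (f k)) (hf₀ : Continuous f₀)
    (hlim : TendstoUniformly f f₀ Filter.atTop) (hg : Filter.Tendsto g Filter.atTop (𝓝 g₀))
    (h : ∀ k, IsWeakDeriv I i j (f k) (g k)) : IsWeakDeriv I i j f₀ g₀ := by
  intro φ h1 h2 h3
  have hl : Filter.Tendsto (fun k => ∫ p, (dS^[i] (dT^[j] φ)) p • f k (cover p)) Filter.atTop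
      (𝓝 (∫ p, (dS^[i] (dT^[j] φ)) p • f₀ (cover p))) := by
    set ψ := dS^[i] (dT^[j] φ)
    have hψ : Integrable ψ := (test_dST h1 i j).1.continuous.integrable_of_hasCompactSupport
      (h2.of_isClosed_subset (isClosed_tsupport _) (test_dST h1 i j).2)
    rw [Metric.tendsto_atTop]
    intro ε hε
    have hpos : 0 ≤ ∫ p, ‖ψ p‖ := integral_nonneg fun _ => norm_nonneg _
    have := Metric.tendstoUniformly_iff.1 hlim (ε / ((∫ p, ‖ψ p‖) + 1)) (by positivity)
    obtain ⟨K, hK⟩ := Filter.eventually_atTop.1 this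
    refine ⟨K, fun k hk => ?_⟩
    rw [dist_eq_norm, ← integral_sub (integrable_dtest (hf k) h1 h2 i j)
      (integrable_dtest hf₀ h1 h2 i j)]
    have hle : ‖∫ p, (ψ p • f k (cover p) - ψ p • f₀ (cover p))‖ ≤
        ∫ p, ‖ψ p‖ * (ε / ((∫ p, ‖ψ p‖) + 1)) := by
      refine norm_integral_le_of_norm_le (hψ.norm.mul_const _)
        (Filter.Eventually.of_forall fun p => ?_)
      rw [← smul_sub, norm_smul]
      gcongr
      have := (hK k hk (cover p)).le
      rwa [dist_comm, dist_eq_norm] at this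
    refine hle.trans_lt ?_
    rw [integral_mul_const, mul_div_assoc', div_lt_iff₀ (by positivity)]
    nlinarith
  have hr : Filter.Tendsto (fun k => ∫ p, φ p • g k (cover p)) Filter.atTop
      (𝓝 (∫ p, φ p • g₀ (cover p))) := by
    obtain ⟨C, hC, hb⟩ := exists_lintegral_test_le (F := F) hδ h1.continuous h2 h3
    rw [tendsto_iff_edist_tendsto_0]
    have hg' : Filter.Tendsto (fun k => C * edist (g k) g₀) Filter.atTop (𝓝 0) := by
      have := ENNReal.Tendsto.const_mul (tendsto_iff_edist_tendsto_0.1 hg) (a := C) (Or.inr hC)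
      simpa using this
    refine tendsto_of_tendsto_of_tendsto_of_le_of_le tendsto_const_nhds hg' (fun _ => zero_le)
      fun k => ?_
    rw [edist_eq_enorm_sub, ← integral_sub
      (integrable_test (cover_locInt hI hδ (g k)) h1.continuous h2 h3)
      (integrable_test (cover_locInt hI hδ g₀) h1.continuous h2 h3)]
    refine (enorm_integral_le_lintegral_enorm _).trans ?_
    simp only [← smul_sub]
    refine (hb (fun p => g k p - g₀ p) ((Lp.stronglyMeasurable _).sub (Lp.stronglyMeasurable _))).trans ?_
    rw [Lp.edist_def]
    rfl
  refine tendsto_nhds_unique hl ?_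
  have := hr.const_smul ((-1 : ℝ) ^ (i + j))
  refine this.congr fun k => ?_
  exact (h k φ h1 h2 h3).symm

end Weak

end GWSplicing

end
noncomputable section

namespace GWSplicing

/-! ### The levels `E_m` as spaces of pairs of decaying maps on `ℝ⁺ × S¹` -/

section Decay

variable {D : NodedDiskPair} {n : ℕ}

/-- The decaying part of `u` on either half-cylinder, both in the coordinates of `ℝ⁺ × S¹`. -/
def dec (u : DiskMap D n) : Bool → Cyl → Target n
  | true => decPlus u
  | false => fun p => decMinus u (-p)

theorem dec_true_apply (u : DiskMap D n) (p : Cyl) :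
    dec u true p = u.1 (D.chartX.symm (diskPoint p)) - u.1 D.x := rfl

theorem dec_false_apply (u : DiskMap D n) (p : Cyl) :
    dec u false p = u.2 (D.chartY.symm (diskPoint p)) - u.2 D.y := by
  have : diskPoint (-p.1, p.2) = diskPoint p := by simp [diskPoint]
  simp [dec, decMinus, uMinus, NodedDiskPair.polarY, this]

theorem continuous_dec (u : DiskMap D n) (b : Bool) : Continuous (dec u b) := by
  cases b
  · exact (continuous_decMinus u).comp continuous_neg
  · exact continuous_decPlus u

theorem dec_add (u v : DiskMap D n) (b : Bool) : dec (u + v) b = fun p => dec u b p + dec v b p := by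
  cases b
  · simp only [dec, decMinus_add]
  · simp only [dec, decPlus_add]

theorem dec_smul (c : ℝ) (u : DiskMap D n) (b : Bool) : dec (c • u) b = fun p => c • dec u b p := by
  cases b
  · simp only [dec, decMinus_smul]
  · simp only [dec, decPlus_smul]

end Decay

section Level

variable {D : NodedDiskPair} {n : ℕ} {W : Weights} {m : ℕ}

theorem mem_Ioi_zero_iff_neg (s : ℝ) : s ∈ Ioi (0 : ℝ) ↔ -s ∈ Iio (0 : ℝ) := by simp

theorem mem_Iio_zero_iff_neg (s : ℝ) : s ∈ Iio (0 : ℝ) ↔ -s ∈ Ioi (0 : ℝ) := by simp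

theorem mem_level_iff (u : DiskMap D n) : u ∈ level D n W m ↔
    u.1 D.x = u.2 D.y ∧ ∀ b, IsSobolev (Ioi 0) (m + 3) (W.δ m) (dec u b) := by
  constructor
  · rintro ⟨h1, h2, h3⟩
    refine ⟨h1, fun b => ?_⟩
    cases b
    · exact fun i j hij => ((h3 i j hij).neg isOpen_Ioi isOpen_Iio mem_Ioi_zero_iff_neg
        (W.pos m).le).1
    · exact h2
  · rintro ⟨h1, h2⟩
    refine ⟨h1, h2 true, fun i j hij => ?_⟩
    have := (HasWDeriv.neg isOpen_Iio isOpen_Ioi mem_Iio_zero_iff_neg (W.pos m).le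
      (h2 false i j hij)).1
    simpa [dec] using this

theorem LevelSpace.isSobolev (u : LevelSpace D n W m) (b : Bool) :
    IsSobolev (Ioi 0) (m + 3) (W.δ m) (dec u.1 b) := ((mem_level_iff u.1).1 u.2).2 b

theorem LevelSpace.snd_y (u : LevelSpace D n W m) : u.1.2 D.y = u.1.1 D.x := u.2.1.symm

theorem norm_wDeriv_dec_false (u : LevelSpace D n W m) {i j : ℕ} (h : i + j ≤ m + 3) :
    ‖wDeriv (Ioi 0) (W.δ m) i j (dec u.1 false)‖ =
      ‖wDeriv (Iio 0) (W.δ m) i j (decMinus u.1)‖ :=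
  (HasWDeriv.neg isOpen_Ioi isOpen_Iio mem_Ioi_zero_iff_neg (W.pos m).le (u.2.2.2 i j h)).2

theorem levelNorm_le_iff (u : LevelSpace D n W m) {r : ℝ} (hr : 0 ≤ r) : ‖u‖ ≤ r ↔
    ‖u.1.1 D.x‖ ≤ r ∧ ∀ b i j, i + j ≤ m + 3 →
      ‖wDeriv (Ioi 0) (W.δ m) i j (dec u.1 b)‖ ≤ r := by
  change ‖jet u‖ ≤ r ↔ _
  rw [Prod.norm_def, Prod.norm_def, max_le_iff, max_le_iff, pi_norm_le_iff_of_nonneg hr,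
    pi_norm_le_iff_of_nonneg hr]
  constructor
  · rintro ⟨h1, h2, h3⟩
    refine ⟨h1, fun b i j hij => ?_⟩
    let α : MultiIdx (m + 3) := ⟨(⟨i, by omega⟩, ⟨j, by omega⟩), hij⟩
    cases b
    · rw [norm_wDeriv_dec_false u hij]
      exact h3 α
    · exact h2 α
  · rintro ⟨h1, h2⟩
    refine ⟨h1, fun α => h2 true _ _ α.2, fun α => ?_⟩
    have := h2 false _ _ α.2
    rwa [norm_wDeriv_dec_false u α.2] at this

theorem norm_wDeriv_le (u : LevelSpace D n W m) (b : Bool) {i j : ℕ} (h : i + j ≤ m + 3) :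
    ‖wDeriv (Ioi 0) (W.δ m) i j (dec u.1 b)‖ ≤ ‖u‖ :=
  ((levelNorm_le_iff u (norm_nonneg u)).1 le_rfl).2 b i j h

theorem norm_node_le (u : LevelSpace D n W m) : ‖u.1.1 D.x‖ ≤ ‖u‖ :=
  ((levelNorm_le_iff u (norm_nonneg u)).1 le_rfl).1

theorem LevelSpace.wDeriv_add (u v : LevelSpace D n W m) (b : Bool) {i j : ℕ} (h : i + j ≤ m + 3) :
    wDeriv (Ioi 0) (W.δ m) i j (dec (u + v).1 b) =
      wDeriv (Ioi 0) (W.δ m) i j (dec u.1 b) + wDeriv (Ioi 0) (W.δ m) i j (dec v.1 b) := by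
  refine IsWeakDeriv.wDeriv_eq_Lp isOpen_Ioi (W.pos m).le ?_
  have := (wDeriv_spec (u.isSobolev b i j h)).add isOpen_Ioi (W.pos m).le
    (continuous_dec u.1 b) (continuous_dec v.1 b) (wDeriv_spec (v.isSobolev b i j h))
  rw [← dec_add] at this
  exact this

theorem LevelSpace.wDeriv_smul (c : ℝ) (u : LevelSpace D n W m) (b : Bool) {i j : ℕ}
    (h : i + j ≤ m + 3) : wDeriv (Ioi 0) (W.δ m) i j (dec (c • u).1 b) =
      c • wDeriv (Ioi 0) (W.δ m) i j (dec u.1 b) := by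
  refine IsWeakDeriv.wDeriv_eq_Lp isOpen_Ioi (W.pos m).le ?_
  have := (wDeriv_spec (u.isSobolev b i j h)).smul isOpen_Ioi c
  rw [← dec_smul] at this
  exact this

/-- The asymptotic constant and all weak derivatives, as an isometric embedding of `E_m`. -/
def jets : LevelSpace D n W m →ₗᵢ[ℝ]
    Target n × (Bool × MultiIdx (m + 3) → Lp (Target n) 2 (weightedMeasure (Ioi 0) (W.δ m))) where
  toFun u := (u.1.1 D.x, fun β => wDeriv (Ioi 0) (W.δ m) β.2.1.1 β.2.1.2 (dec u.1 β.1))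
  map_add' u v := Prod.ext rfl (funext fun β => LevelSpace.wDeriv_add u v β.1 β.2.2)
  map_smul' c u := Prod.ext rfl (funext fun β => LevelSpace.wDeriv_smul c u β.1 β.2.2)
  norm_map' u := by
    apply le_antisymm
    · refine max_le (norm_node_le u) ((pi_norm_le_iff_of_nonneg (norm_nonneg _)).2 fun β => ?_)
      exact norm_wDeriv_le u β.1 β.2.2
    · refine (levelNorm_le_iff u (norm_nonneg _)).2 ⟨le_max_left _ _, fun b i j hij => ?_⟩
      let α : MultiIdx (m + 3) := ⟨(⟨i, by omega⟩, ⟨j, by omega⟩), hij⟩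
      refine le_trans ?_ (le_max_right _ _)
      exact norm_le_pi_norm (fun β : Bool × MultiIdx (m + 3) =>
        wDeriv (Ioi 0) (W.δ m) β.2.1.1 β.2.1.2 (dec u.1 β.1)) (b, α)

/-- The constant 4 counts the derivatives in the Sobolev inequality, each bounded by the norm of the
level. -/
theorem norm_dec_le (u : LevelSpace D n W m) (b : Bool) {p : Cyl} (hp : 0 ≤ p.1) :
    ‖dec u.1 b p‖ ≤ Real.exp (-(W.δ m * p.1)) * (4 * ‖u‖) := by
  refine (IsSobolev.norm_le (W.pos m).le (by omega) (continuous_dec u.1 b) (u.isSobolev b) hp).trans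
    (mul_le_mul_of_nonneg_left ?_ (Real.exp_pos _).le)
  refine (Finset.sum_le_card_nsmul _ _ ‖u‖ fun a ha => ?_).trans ?_
  · simp only [Finset.mem_product, Finset.mem_range] at ha
    exact norm_wDeriv_le u b (by omega)
  · simp

theorem norm_dec_le' (u : LevelSpace D n W m) (b : Bool) {p : Cyl} (hp : 0 ≤ p.1) :
    ‖dec u.1 b p‖ ≤ 4 * ‖u‖ := by
  refine (norm_dec_le u b hp).trans (mul_le_of_le_one_left (by positivity) ?_)
  rw [Real.exp_le_one_iff]
  have := mul_nonneg (W.pos m).le hp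
  linarith

theorem exists_chartX (z : D.Dx) : z = D.x ∨ ∃ p : Cyl, 0 ≤ p.1 ∧
    z = D.chartX.symm (diskPoint p) := by
  by_cases hz : ((D.chartX z : Metric.closedBall (0 : ℂ) 1) : ℂ) = 0
  · left
    rw [NodedDiskPair.x, ← D.chartX.symm_apply_apply z]
    exact congrArg _ (Subtype.ext hz)
  · obtain ⟨p, hp0, hpz⟩ := exists_diskPoint _ hz
    exact Or.inr ⟨p, hp0, by rw [hpz, Homeomorph.symm_apply_apply]⟩

theorem exists_chartY (z : D.Dy) : z = D.y ∨ ∃ p : Cyl, 0 ≤ p.1 ∧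
    z = D.chartY.symm (diskPoint p) := by
  by_cases hz : ((D.chartY z : Metric.closedBall (0 : ℂ) 1) : ℂ) = 0
  · left
    rw [NodedDiskPair.y, ← D.chartY.symm_apply_apply z]
    exact congrArg _ (Subtype.ext hz)
  · obtain ⟨p, hp0, hpz⟩ := exists_diskPoint _ hz
    exact Or.inr ⟨p, hp0, by rw [hpz, Homeomorph.symm_apply_apply]⟩

/-- 5 = 4 + 1: the decaying part contributes 4 and the asymptotic constant 1. -/
theorem norm_fst_apply_le (u : LevelSpace D n W m) (z : D.Dx) : ‖u.1.1 z‖ ≤ 5 * ‖u‖ := by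
  have h0 := norm_node_le u
  rcases exists_chartX z with rfl | ⟨p, hp, rfl⟩
  · linarith [norm_nonneg u]
  · have h := norm_dec_le' u true hp
    rw [dec_true_apply] at h
    linarith [norm_le_norm_sub_add (u.1.1 (D.chartX.symm (diskPoint p))) (u.1.1 D.x)]

theorem norm_snd_apply_le (u : LevelSpace D n W m) (z : D.Dy) : ‖u.1.2 z‖ ≤ 5 * ‖u‖ := by
  have h0 := norm_node_le u
  rw [← u.snd_y] at h0
  rcases exists_chartY z with rfl | ⟨p, hp, rfl⟩
  · linarith [norm_nonneg u]
  · have h := norm_dec_le' u false hp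
    rw [dec_false_apply] at h
    linarith [norm_le_norm_sub_add (u.1.2 (D.chartY.symm (diskPoint p))) (u.1.2 D.y)]

/-- Two elements of `E_m` with the same asymptotic constant and decaying parts are equal. -/
theorem LevelSpace.ext_dec {u v : LevelSpace D n W m} (h0 : u.1.1 D.x = v.1.1 D.x)
    (h : ∀ b p, 0 ≤ p.1 → dec u.1 b p = dec v.1 b p) : u = v := by
  apply Subtype.ext
  refine Prod.ext (ContinuousMap.ext fun z => ?_) (ContinuousMap.ext fun z => ?_)
  · rcases exists_chartX z with rfl | ⟨p, hp, rfl⟩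
    · exact h0
    · have := h true p hp
      rw [dec_true_apply, dec_true_apply, h0] at this
      exact sub_left_injective this
  · have h0' : u.1.2 D.y = v.1.2 D.y := by rw [u.snd_y, v.snd_y, h0]
    rcases exists_chartY z with rfl | ⟨p, hp, rfl⟩
    · exact h0'
    · have := h false p hp
      rw [dec_false_apply, dec_false_apply, h0'] at this
      exact sub_left_injective this

instance compactSpace_Dx : CompactSpace D.Dx :=
  have : CompactSpace (Metric.closedBall (0 : ℂ) 1) :=
    isCompact_iff_compactSpace.1 (isCompact_closedBall _ _)
  D.chartX.symm.compactSpace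

instance compactSpace_Dy : CompactSpace D.Dy :=
  have : CompactSpace (Metric.closedBall (0 : ℂ) 1) :=
    isCompact_iff_compactSpace.1 (isCompact_closedBall _ _)
  D.chartY.symm.compactSpace

/-- The underlying map, with the supremum norm. -/
def toMapL : LevelSpace D n W m →L[ℝ] DiskMap D n :=
  (toMap D n W m).mkContinuous 5 fun u => max_le
    ((ContinuousMap.norm_le _ (by positivity)).2 (norm_fst_apply_le u))
    ((ContinuousMap.norm_le _ (by positivity)).2 (norm_snd_apply_le u))

theorem norm_dec_le_two_mul (u : DiskMap D n) (b : Bool) (p : Cyl) : ‖dec u b p‖ ≤ 2 * ‖u‖ := by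
  cases b
  · rw [dec_false_apply]
    refine (norm_sub_le _ _).trans ?_
    linarith [u.2.norm_coe_le_norm (D.chartY.symm (diskPoint p)), u.2.norm_coe_le_norm D.y,
      norm_snd_le u]
  · rw [dec_true_apply]
    refine (norm_sub_le _ _).trans ?_
    linarith [u.1.norm_coe_le_norm (D.chartX.symm (diskPoint p)), u.1.norm_coe_le_norm D.x,
      norm_fst_le u]

theorem dec_sub (u v : DiskMap D n) (b : Bool) (p : Cyl) : dec (u - v) b p = dec u b p - dec v b p := by
  have := congrFun (dec_add (u - v) v b) p
  rw [sub_add_cancel] at this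
  rw [this, add_sub_cancel_right]

/-- A Cauchy sequence converges uniformly on the disks by the Sobolev bound, and its jets converge
in the weighted L². The weak derivatives of the uniform limit are the limits of the jets, so the
limit belongs to the level and convergence holds in its norm. -/
instance : CompleteSpace (LevelSpace D n W m) := by
  refine Metric.complete_of_cauchySeq_tendsto fun u hu => ?_
  obtain ⟨U, hU⟩ := cauchySeq_tendsto_of_complete (toMapL.uniformContinuous.comp_cauchySeq hu)
  obtain ⟨J, hJ⟩ := cauchySeq_tendsto_of_complete ((jets (m := m)).isometry.uniformContinuous.comp_cauchySeq hu)
  have hlim : ∀ b, TendstoUniformly (fun k => dec (u k).1 b) (dec U b) Filter.atTop := by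
    intro b
    rw [Metric.tendstoUniformly_iff]
    intro ε hε
    filter_upwards [Metric.tendsto_nhds.1 hU (ε / 2) (by positivity)] with k hk p
    rw [dist_comm, dist_eq_norm, ← dec_sub]
    rw [dist_eq_norm] at hk
    have := norm_dec_le_two_mul ((u k).1 - U) b p
    have hk' : ‖(u k).1 - U‖ < ε / 2 := hk
    linarith
  have hw : ∀ (b : Bool) (α : MultiIdx (m + 3)),
      IsWeakDeriv (Ioi 0) α.1.1 α.1.2 (dec U b) (J.2 (b, α)) := by
    intro b α
    refine isWeakDeriv_of_tendsto isOpen_Ioi (W.pos m).le (fun k => continuous_dec (u k).1 b)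
      (continuous_dec U b) (hlim b) ?_ fun k => wDeriv_spec ((u k).isSobolev b _ _ α.2)
    exact (tendsto_pi_nhds.1 ((continuous_snd.tendsto J).comp hJ)) (b, α)
  have hU1 := (continuous_fst.tendsto U).comp hU
  have hU2 := (continuous_snd.tendsto U).comp hU
  have hx := ((continuous_eval_const D.x).tendsto U.1).comp hU1
  have hy := ((continuous_eval_const D.y).tendsto U.2).comp hU2
  have hmem : U ∈ level D n W m := by
    refine (mem_level_iff U).2 ⟨tendsto_nhds_unique hx (hy.congr fun k => ?_), fun b i j hij => ?_⟩
    · exact (u k).snd_y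
    · let α : MultiIdx (m + 3) := ⟨(⟨i, by omega⟩, ⟨j, by omega⟩), hij⟩
      exact ⟨_, hw b α⟩
  let v : LevelSpace D n W m := ⟨U, hmem⟩
  have hJe : jets v = J := by
    refine Prod.ext (tendsto_nhds_unique hx ((continuous_fst.tendsto J).comp hJ)) (funext fun β => ?_)
    exact IsWeakDeriv.wDeriv_eq_Lp isOpen_Ioi (W.pos m).le (hw β.1 β.2)
  refine ⟨v, ((jets (m := m)).isometry.isUniformInducing.isInducing.tendsto_nhds_iff).2 ?_⟩
  rw [hJe]
  exact hJ

end Level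

end GWSplicing

end
noncomputable section

namespace GWSplicing

/-! ### Locality and estimates for the smooth calculus -/

section Calculus

variable {F : Type} [NormedAddCommGroup F] [NormedSpace ℝ F]

theorem pS_eq_zero {U : Set ℝ} (hU : IsOpen U) {f : Cyl → F} (h : ∀ p : Cyl, p.1 ∈ U → f p = 0)
    (p : Cyl) (hp : p.1 ∈ U) : pS f p = 0 := by
  have : (fun σ : ℝ => f (σ, p.2)) =ᶠ[𝓝 p.1] fun _ => 0 := by
    filter_upwards [hU.mem_nhds hp] with σ hσ using h (σ, p.2) hσ
  rw [pS, this.deriv_eq, deriv_const]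

theorem pT_eq_zero {U : Set ℝ} {f : Cyl → F} (h : ∀ p : Cyl, p.1 ∈ U → f p = 0)
    (p : Cyl) (hp : p.1 ∈ U) : pT f p = 0 := by
  have : (fun τ : ℝ => f (p.1, p.2 + (τ : UnitAddCircle))) = fun _ => 0 :=
    funext fun τ => h _ hp
  rw [pT, this, deriv_const]

theorem pST_eq_zero {U : Set ℝ} (hU : IsOpen U) {f : Cyl → F} (h : ∀ p : Cyl, p.1 ∈ U → f p = 0)
    (i j : ℕ) (p : Cyl) (hp : p.1 ∈ U) : pST i j f p = 0 := by
  have hT : ∀ p : Cyl, p.1 ∈ U → (pT^[j] f) p = 0 := by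
    induction j with
    | zero => exact h
    | succ j ih => rw [Function.iterate_succ_apply']; exact pT_eq_zero ih
  induction i generalizing p with
  | zero => exact hT p hp
  | succ i ih => rw [← pS_pST]; exact pS_eq_zero hU ih p hp

/-- Smooth functions on `ℝ` all of whose derivatives are bounded. -/
def IsBoundedSmooth (χ : ℝ → ℝ) : Prop := ContDiff ℝ ∞ χ ∧ ∀ k, ∃ C, ∀ s, |iteratedDeriv k χ s| ≤ C

theorem IsBoundedSmooth.deriv {χ : ℝ → ℝ} (h : IsBoundedSmooth χ) : IsBoundedSmooth (deriv χ) := by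
  refine ⟨h.1.iterate_deriv 1, fun k => ?_⟩
  obtain ⟨C, hC⟩ := h.2 (k + 1)
  exact ⟨C, fun s => by rw [← iteratedDeriv_succ']; exact hC s⟩

theorem IsBoundedSmooth.exists_bound {χ : ℝ → ℝ} (h : IsBoundedSmooth χ) :
    ∃ C, 0 ≤ C ∧ ∀ s, |χ s| ≤ C := by
  obtain ⟨C, hC⟩ := h.2 0
  exact ⟨C, (abs_nonneg _).trans (hC 0), fun s => by simpa using hC s⟩

/-- A smooth function that is constant outside a compact interval. -/
theorem isBoundedSmooth_of_eq {χ : ℝ → ℝ} (h : ContDiff ℝ ∞ χ) {a b c d : ℝ}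
    (ha : ∀ s ≤ a, χ s = c) (hb : ∀ s, b ≤ s → χ s = d) : IsBoundedSmooth χ := by
  refine ⟨h, fun k => ?_⟩
  obtain ⟨C, hC⟩ := (isCompact_Icc (a := a - 1) (b := b + 1)).exists_bound_of_continuousOn
    (h.continuous_iteratedDeriv k (by exact_mod_cast le_top)).continuousOn
  refine ⟨max C (max |c| |d|), fun s => ?_⟩
  have hconst : ∀ e : ℝ, |iteratedDeriv k (fun _ : ℝ => e) s| ≤ |e| := by
    intro e
    rw [iteratedDeriv_const]
    split_ifs <;> simp
  by_cases h1 : s < a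
  · have : χ =ᶠ[𝓝 s] fun _ => c := by
      filter_upwards [Iio_mem_nhds h1] with σ hσ using ha σ (le_of_lt hσ)
    rw [this.iteratedDeriv_eq k]
    exact (hconst c).trans ((le_max_left _ _).trans (le_max_right _ _))
  · by_cases h2 : b < s
    · have : χ =ᶠ[𝓝 s] fun _ => d := by
        filter_upwards [Ioi_mem_nhds h2] with σ hσ using hb σ (le_of_lt hσ)
      rw [this.iteratedDeriv_eq k]
      exact (hconst d).trans ((le_max_right _ _).trans (le_max_right _ _))
    · exact (hC s ⟨by linarith, by linarith⟩).trans (le_max_left _ _)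

/-- Leibniz' rule by induction on the number of s-derivatives; t-derivatives commute with the
factor. The constant does not depend on the shift r, which makes all later estimates uniform in the
gluing length. -/
theorem exists_norm_pST_mul_s_le {χ : ℝ → ℝ} (hχ : IsBoundedSmooth χ) (i : ℕ) :
    ∃ C, 0 ≤ C ∧ ∀ (j : ℕ) (r : ℝ) (f : Cyl → F), IsSmooth f → ∀ p,
      ‖pST i j (fun p => χ (p.1 - r) • f p) p‖ ≤
        C * ∑ k ∈ Finset.range (i + 1), ‖pST k j f p‖ := by
  induction i generalizing χ with
  | zero =>
    obtain ⟨C, hC0, hC⟩ := hχ.exists_bound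
    refine ⟨C, hC0, fun j r f hf p => ?_⟩
    rw [hf.pST_mul_s_zero hχ.1, norm_smul]
    simpa using mul_le_mul_of_nonneg_right (hC _) (norm_nonneg _)
  | succ i ih =>
    obtain ⟨C, hC0, hC⟩ := ih hχ
    obtain ⟨C', hC0', hC'⟩ := ih hχ.deriv
    refine ⟨C + C', by positivity, fun j r f hf p => ?_⟩
    have h1 : pST (i + 1) j (fun p => χ (p.1 - r) • f p) =
        pST i j (pS (fun p => χ (p.1 - r) • f p)) := by
      have := (hf.mul_s hχ.1 r).pST_pST i j 1 0
      exact this.symm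
    rw [h1, hf.pS_mul_s hχ.1, (hf.mul_s hχ.deriv.1 r).pST_add (hf.pS.mul_s hχ.1 r)]
    refine (norm_add_le _ _).trans ?_
    have e : ∀ k, pST k j (pS f) = pST (k + 1) j f := fun k => hf.pST_pST k j 1 0
    have h2 := hC j r (pS f) hf.pS p
    have h3 := hC' j r f hf p
    simp only [e] at h2
    have h4 : ∑ k ∈ Finset.range (i + 1), ‖pST (k + 1) j f p‖ ≤
        ∑ k ∈ Finset.range (i + 1 + 1), ‖pST k j f p‖ := by
      rw [Finset.sum_range_succ' _ (i + 1)]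
      exact le_add_of_nonneg_right (norm_nonneg _)
    have h5 : ∑ k ∈ Finset.range (i + 1), ‖pST k j f p‖ ≤
        ∑ k ∈ Finset.range (i + 1 + 1), ‖pST k j f p‖ := by
      rw [Finset.sum_range_succ _ (i + 1)]
      exact le_add_of_nonneg_right (norm_nonneg _)
    have := mul_le_mul_of_nonneg_left h4 hC0
    have := mul_le_mul_of_nonneg_left h5 hC0'
    linarith

theorem eLpNorm_le_mul_sum {α E G : Type} [MeasurableSpace α] [NormedAddCommGroup E]
    [NormedAddCommGroup G] {μ : Measure α} {f : α → E} {κ : Type} (s : Finset κ) {g : κ → α → G}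
    (hg : ∀ k ∈ s, AEStronglyMeasurable (g k) μ) {C : ℝ}
    (h : ∀ᵐ p ∂μ, ‖f p‖ ≤ C * ∑ k ∈ s, ‖g k p‖) :
    eLpNorm f 2 μ ≤ ENNReal.ofReal C * ∑ k ∈ s, eLpNorm (g k) 2 μ := by
  have h1 : eLpNorm f 2 μ ≤ ENNReal.ofReal C * eLpNorm (∑ k ∈ s, fun p => ‖g k p‖) 2 μ := by
    refine eLpNorm_le_mul_eLpNorm_of_ae_le_mul ?_ 2
    filter_upwards [h] with p hp
    rw [Finset.sum_apply, Real.norm_of_nonneg (Finset.sum_nonneg fun _ _ => norm_nonneg _)]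
    exact hp
  refine h1.trans ?_
  gcongr
  refine (eLpNorm_sum_le (fun k hk => (hg k hk).norm) (by norm_num)).trans ?_
  exact Finset.sum_le_sum fun k _ => (eLpNorm_norm (g k)).le

/-- Dominated convergence for the squares; it controls the error of truncating far out on the
cylinder. -/
theorem tendsto_eLpNorm_tail {δ : ℝ} {g : Cyl → F} (hg : MemLp g 2 (weightedMeasure (Ioi 0) δ)) :
    Filter.Tendsto (fun N : ℕ => eLpNorm ({p : Cyl | (N : ℝ) ≤ p.1}.indicator g) 2
      (weightedMeasure (Ioi 0) δ)) Filter.atTop (𝓝 0) := by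
  have hms : ∀ N : ℕ, MeasurableSet {p : Cyl | (N : ℝ) ≤ p.1} := fun N =>
    measurableSet_le measurable_const measurable_fst
  have h2 : Filter.Tendsto (fun N : ℕ => eLpNorm ({p : Cyl | (N : ℝ) ≤ p.1}.indicator g) 2
      (weightedMeasure (Ioi 0) δ) ^ 2) Filter.atTop (𝓝 0) := by
    simp only [eLpNorm_two_sq]
    have := tendsto_lintegral_of_dominated_convergence' (μ := weightedMeasure (Ioi 0) δ)
      (F := fun N : ℕ => fun p => ‖({p : Cyl | (N : ℝ) ≤ p.1}.indicator g) p‖ₑ ^ 2)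
      (f := fun _ => 0) (fun p => ‖g p‖ₑ ^ 2)
      (fun N => ((hg.1.indicator (hms N)).enorm.pow_const 2))
      (fun N => Filter.Eventually.of_forall fun p => ?_) ?_ (Filter.Eventually.of_forall fun p => ?_)
    · simpa using this
    · beta_reduce
      gcongr
      rw [enorm_indicator_eq_indicator_enorm]
      exact indicator_le_self' (fun _ _ => zero_le) p
    · rw [← eLpNorm_two_sq]
      exact ENNReal.pow_ne_top hg.eLpNorm_ne_top
    · obtain ⟨N₀, hN₀⟩ := exists_nat_gt p.1
      refine tendsto_const_nhds.congr' ?_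
      filter_upwards [Filter.eventually_ge_atTop N₀] with N hN
      rw [indicator_of_notMem]
      · simp
      · have : (N₀ : ℝ) ≤ N := by exact_mod_cast hN
        simp only [mem_ofPred_eq, not_le]
        linarith
  have h3 := (ENNReal.continuous_rpow_const (y := (1 / 2 : ℝ))).tendsto 0 |>.comp h2
  rw [ENNReal.zero_rpow_of_pos (by norm_num)] at h3
  refine h3.congr fun N => ?_
  simp only [Function.comp_apply]
  rw [← ENNReal.rpow_natCast, ← ENNReal.rpow_mul]
  norm_num

/-- Test functions supported over I only see f over I. This matters for the core, whose disk maps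
agree with the given smooth functions only for s ≥ 0. -/
theorem IsWeakDeriv.congr_left {I : Set ℝ} {i j : ℕ} {f f' g : Cyl → F}
    (h : IsWeakDeriv I i j f g) (e : ∀ p : Cyl, p.1 ∈ I → f p = f' p) : IsWeakDeriv I i j f' g := by
  intro φ h1 h2 h3
  rw [← h φ h1 h2 h3]
  congr 1
  funext p
  by_cases hp : p ∈ tsupport φ
  · rw [e (cover p) (h3 hp).1]
  · have : (dS^[i] (dT^[j] φ)) p = 0 := by
      by_contra h0
      exact hp ((test_dST h1 i j).2 (subset_tsupport _ h0))
    rw [this, zero_smul, zero_smul]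

end Calculus

end GWSplicing

end
noncomputable section

namespace GWSplicing

/-! ### The dense subspace of maps that are smooth on the cylinders and constant near the nodes -/

/-- Smooth maps on the cylinder that vanish for large `s`. -/
def Sm (n : ℕ) : Submodule ℝ (Cyl → Target n) where
  carrier := {f | IsSmooth f ∧ ∃ N : ℝ, ∀ p : Cyl, N ≤ p.1 → f p = 0}
  zero_mem' := ⟨isSmooth_const 0, 0, fun _ _ => rfl⟩
  add_mem' := by
    rintro f g ⟨hf, N, hN⟩ ⟨hg, M, hM⟩
    refine ⟨hf.add hg, max N M, fun p hp => ?_⟩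
    rw [Pi.add_apply, hN p ((le_max_left _ _).trans hp), hM p ((le_max_right _ _).trans hp),
      add_zero]
  smul_mem' := by
    rintro c f ⟨hf, N, hN⟩
    exact ⟨hf.const_smul c, N, fun p hp => by rw [Pi.smul_apply, hN p hp, smul_zero]⟩

theorem Sm.isSmooth {n : ℕ} (f : Sm n) : IsSmooth (f : Cyl → Target n) := f.2.1

/-- Asymptotic constants together with pairs of smooth maps that vanish for large `s`. -/
abbrev Core (n : ℕ) : Type := Target n × (Bool → Sm n)

/-! ### Polar coordinates and the extension of core functions over the nodes. -/

section PolarCoordinates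

/-- The direction `z / |z|`. -/
def direction (z : {z : Metric.closedBall (0 : ℂ) 1 // (z : ℂ) ≠ 0}) : Circle :=
  ⟨(z.1 : ℂ) / ‖(z.1 : ℂ)‖, by
    rw [Submonoid.unitSphere, Submonoid.mem_mk]
    simp [z.2]⟩

theorem continuous_direction : Continuous direction := by
  unfold direction
  refine Continuous.subtype_mk (f := fun z : {z : Metric.closedBall (0 : ℂ) 1 // (z : ℂ) ≠ 0} =>
    (z.1 : ℂ) / ‖(z.1 : ℂ)‖) ?_ _
  refine Continuous.div (by fun_prop) (by fun_prop) fun z => ?_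
  simpa using z.2

/-- The coordinates `(s,t)` of a point `z = e^{-2π(s+it)} ≠ 0`. -/
def polar (z : {z : Metric.closedBall (0 : ℂ) 1 // (z : ℂ) ≠ 0}) : Cyl :=
  (-Real.log ‖(z.1 : ℂ)‖ / (2 * Real.pi),
    -(AddCircle.homeomorphCircle (one_ne_zero (α := ℝ))).symm (direction z))

theorem continuous_polar : Continuous polar := by
  unfold polar
  refine Continuous.prodMk ?_ ?_
  · refine Continuous.div_const (Continuous.neg (Continuous.log (by fun_prop) fun z => ?_)) _
    exact norm_ne_zero_iff.2 z.2
  · have := (AddCircle.homeomorphCircle (one_ne_zero (α := ℝ))).symm.continuous.comp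
      continuous_direction
    exact continuous_neg.comp this

theorem diskPoint_ne_zero (p : Cyl) : (diskPoint p : ℂ) ≠ 0 := by
  simp [diskPoint]

theorem polar_diskPoint (p : Cyl) : polar ⟨diskPoint p, diskPoint_ne_zero p⟩ = (|p.1|, p.2) := by
  have hn : ‖(diskPoint p : ℂ)‖ = Real.exp (-(2 * Real.pi * |p.1|)) := by
    simp only [diskPoint]
    rw [norm_mul, Circle.norm_coe, mul_one, Complex.norm_real, Real.norm_eq_abs,
      abs_of_pos (Real.exp_pos _)]
  refine Prod.ext ?_ ?_
  · simp only [polar]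
    rw [hn, Real.log_exp]
    have := Real.pi_ne_zero
    field_simp
  · simp only [polar]
    rw [neg_eq_iff_eq_neg, Homeomorph.symm_apply_eq, AddCircle.homeomorphCircle_apply]
    apply Subtype.ext
    change (diskPoint p : ℂ) / ‖(diskPoint p : ℂ)‖ = (AddCircle.toCircle (-p.2) : ℂ)
    rw [hn]
    simp only [diskPoint]
    rw [mul_div_cancel_left₀]
    exact_mod_cast (Real.exp_pos _).ne'

variable {n : ℕ}

open Classical in
/-- The map on the disk with the value `0` at the center that is `f` in polar coordinates. -/
def diskExtend (f : Sm n) : C(Metric.closedBall (0 : ℂ) 1, Target n) where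
  toFun z := if h : (z : ℂ) ≠ 0 then f.1 (polar ⟨z, h⟩) else 0
  continuous_toFun := by
    rw [continuous_iff_continuousAt]
    intro z
    by_cases hz : (z : ℂ) ≠ 0
    · have ho : IsOpen {z : Metric.closedBall (0 : ℂ) 1 | (z : ℂ) ≠ 0} :=
        isOpen_ne_fun continuous_subtype_val continuous_const
      have he := (ho.isOpenEmbedding_subtypeVal.continuousAt_iff
        (x := (⟨z, hz⟩ : {z : Metric.closedBall (0 : ℂ) 1 | (z : ℂ) ≠ 0}))
        (g := fun z : Metric.closedBall (0 : ℂ) 1 =>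
          if h : (z : ℂ) ≠ 0 then f.1 (polar ⟨z, h⟩) else 0)).1
      refine he (Continuous.continuousAt ?_)
      refine ((Sm.isSmooth f).continuous.comp continuous_polar).congr fun w => ?_
      have hw : ((w : Metric.closedBall (0 : ℂ) 1) : ℂ) ≠ 0 := w.2
      simp only [Function.comp_apply]
      rw [dif_pos hw]
    · obtain ⟨N, hN⟩ := f.2.2
      have hz0 : (z : ℂ) = 0 := by simpa using hz
      -- Close to the center the coordinate s exceeds N, where f vanishes; the extension is
      -- therefore locally zero there.
      have hnb : ∀ᶠ w : Metric.closedBall (0 : ℂ) 1 in 𝓝 z,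
          ‖(w : ℂ)‖ < Real.exp (-(2 * Real.pi * N)) := by
        refine ContinuousAt.eventually_lt (by fun_prop) continuousAt_const ?_
        rw [hz0, norm_zero]
        exact Real.exp_pos _
      refine (continuousAt_const (y := (0 : Target n))).congr ?_
      filter_upwards [hnb] with w hw
      split_ifs with h
      · refine (hN _ ?_).symm
        simp only [polar]
        rw [le_div_iff₀ Real.two_pi_pos]
        have := Real.log_lt_log (norm_pos_iff.2 h) hw
        rw [Real.log_exp] at this
        linarith
      · rfl

theorem diskExtend_diskPoint (f : Sm n) (p : Cyl) : diskExtend f (diskPoint p) = f.1 (|p.1|, p.2) := by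
  have : diskExtend f (diskPoint p) = f.1 (polar ⟨diskPoint p, diskPoint_ne_zero p⟩) :=
    dif_pos (diskPoint_ne_zero p)
  rw [this, polar_diskPoint]

theorem diskExtend_zero (f : Sm n) (z : Metric.closedBall (0 : ℂ) 1) (hz : (z : ℂ) = 0) :
    diskExtend f z = 0 := dif_neg (not_not.2 hz)

/-- The pair of disk maps defined by an element of the core. -/
def coreMap (D : NodedDiskPair) (x : Core n) : DiskMap D n :=
  (ContinuousMap.const _ x.1 + (diskExtend (x.2 true)).comp ⟨D.chartX, D.chartX.continuous⟩,
    ContinuousMap.const _ x.1 + (diskExtend (x.2 false)).comp ⟨D.chartY, D.chartY.continuous⟩)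

theorem coreMap_fst_x (D : NodedDiskPair) (x : Core n) : (coreMap D x).1 D.x = x.1 := by
  simp [coreMap, NodedDiskPair.x, diskExtend_zero]

theorem coreMap_snd_y (D : NodedDiskPair) (x : Core n) : (coreMap D x).2 D.y = x.1 := by
  simp [coreMap, NodedDiskPair.y, diskExtend_zero]

theorem dec_coreMap (D : NodedDiskPair) (x : Core n) (b : Bool) (p : Cyl) :
    dec (coreMap D x) b p = (x.2 b).1 (|p.1|, p.2) := by
  cases b
  · rw [dec_false_apply, coreMap_snd_y]
    simp [coreMap, diskExtend_diskPoint]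
  · rw [dec_true_apply, coreMap_fst_x]
    simp [coreMap, diskExtend_diskPoint]

theorem dec_coreMap_of_nonneg (D : NodedDiskPair) (x : Core n) (b : Bool) {p : Cyl} (hp : 0 ≤ p.1) :
    dec (coreMap D x) b p = (x.2 b).1 p := by
  rw [dec_coreMap, abs_of_nonneg hp]

end PolarCoordinates

/-! ### The core as a subspace of every level. -/

section CoreNorm

variable {n : ℕ}

theorem Sm.exists_pST_eq_zero (f : Sm n) : ∃ N : ℝ, 0 ≤ N ∧ ∀ i j (p : Cyl), N ≤ p.1 →
    pST i j f.1 p = 0 := by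
  obtain ⟨N, hN⟩ := f.2.2
  refine ⟨|N| + 1, by positivity, fun i j p hp => ?_⟩
  refine pST_eq_zero (U := Ioi N) isOpen_Ioi (fun p hp => hN p (le_of_lt hp)) i j p ?_
  exact lt_of_le_of_lt (le_abs_self N) (by linarith)

theorem memLp_of_vanishing {F : Type} [NormedAddCommGroup F] {f : Cyl → F} (hf : Continuous f)
    {N : ℝ} (hN : ∀ p : Cyl, N ≤ p.1 → f p = 0) {δ : ℝ} (hδ : 0 ≤ δ) :
    MemLp f 2 (weightedMeasure (Ioi 0) δ) := by
  refine ⟨hf.aestronglyMeasurable, ?_⟩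
  obtain ⟨B, hB⟩ := ((isCompact_Icc (a := (0 : ℝ)) (b := N)).prod
    (isCompact_univ (X := UnitAddCircle))).exists_bound_of_continuousOn hf.continuousOn
  have h2 : eLpNorm f 2 (weightedMeasure (Ioi 0) δ) ^ 2 < ⊤ := by
    rw [eLpNorm_weighted_sq]
    have hle : ∫⁻ p in Ioi 0 ×ˢ univ, ENNReal.ofReal (Real.exp (2 * δ * |p.1|)) * ‖f p‖ₑ ^ 2 ≤
        ∫⁻ p in Icc 0 N ×ˢ (univ : Set UnitAddCircle),
          ENNReal.ofReal (Real.exp (2 * δ * N)) * ENNReal.ofReal B ^ 2 := by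
      rw [← lintegral_indicator (measurableSet_Ioi.prod MeasurableSet.univ),
        ← lintegral_indicator (measurableSet_Icc.prod MeasurableSet.univ)]
      refine lintegral_mono fun p => ?_
      by_cases hp : p.1 ∈ Icc 0 N
      · rw [indicator_of_mem (show p ∈ Icc 0 N ×ˢ univ from ⟨hp, mem_univ _⟩)]
        refine (indicator_le_self' (fun _ _ => zero_le) p).trans ?_
        gcongr
        · rw [abs_of_nonneg hp.1]; exact hp.2
        · rw [← ofReal_norm]
          exact ENNReal.ofReal_le_ofReal (hB p ⟨hp, mem_univ _⟩)
      · rw [indicator_of_notMem (show p ∉ Icc 0 N ×ˢ univ from fun h => hp h.1)]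
        refine le_of_eq (indicator_apply_eq_zero.2 fun h => ?_)
        have : N ≤ p.1 := by
          by_contra hc
          exact hp ⟨le_of_lt h.1, (not_le.1 hc).le⟩
        rw [hN p this]
        simp
    refine hle.trans_lt ?_
    rw [lintegral_const, Measure.restrict_apply_univ]
    refine ENNReal.mul_lt_top (ENNReal.mul_lt_top ENNReal.ofReal_lt_top
      (ENNReal.pow_lt_top ENNReal.ofReal_lt_top)) ?_
    exact (isCompact_Icc.prod isCompact_univ).measure_lt_top
  by_contra h
  rw [not_lt, top_le_iff] at h
  rw [h] at h2
  simp at h2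

theorem Sm.memLp (f : Sm n) (i j : ℕ) {δ : ℝ} (hδ : 0 ≤ δ) :
    MemLp (pST i j f.1) 2 (weightedMeasure (Ioi 0) δ) := by
  obtain ⟨N, _, hN⟩ := Sm.exists_pST_eq_zero f
  exact memLp_of_vanishing ((Sm.isSmooth f).pST i j).continuous (hN i j) hδ

variable (D : NodedDiskPair) (W : Weights) (m : ℕ)

theorem wDeriv_coreMap (x : Core n) (b : Bool) (i j : ℕ) :
    HasWDeriv (Ioi 0) (W.δ m) i j (dec (coreMap D x) b) ∧
    wDeriv (Ioi 0) (W.δ m) i j (dec (coreMap D x) b) =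
      (Sm.memLp (x.2 b) i j (W.pos m).le).toLp (pST i j (x.2 b).1) :=
  IsWeakDeriv.wDeriv_eq isOpen_Ioi (W.pos m).le
    (((Sm.isSmooth (x.2 b)).isWeakDeriv (Ioi 0) i j).congr_left fun _ hp =>
      (dec_coreMap_of_nonneg D x b (le_of_lt hp)).symm) _

theorem coreMap_mem_level (x : Core n) : coreMap D x ∈ level D n W m :=
  (mem_level_iff _).2 ⟨by rw [coreMap_fst_x, coreMap_snd_y],
    fun b i j _ => (wDeriv_coreMap D W m x b i j).1⟩

/-- The embedding of the core into `E_m`. -/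
def coreIncl : Core n →ₗ[ℝ] LevelSpace D n W m where
  toFun x := ⟨coreMap D x, coreMap_mem_level D W m x⟩
  map_add' x y := by
    refine LevelSpace.ext_dec ?_ fun b p hp => ?_
    · change (coreMap D (x + y)).1 D.x = (coreMap D x).1 D.x + (coreMap D y).1 D.x
      simp only [coreMap_fst_x]; rfl
    · change dec (coreMap D (x + y)) b p = dec (coreMap D x + coreMap D y) b p
      rw [dec_add]
      simp only [dec_coreMap_of_nonneg _ _ _ hp]; rfl
  map_smul' c x := by
    refine LevelSpace.ext_dec ?_ fun b p hp => ?_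
    · change (coreMap D (c • x)).1 D.x = c • (coreMap D x).1 D.x
      simp only [coreMap_fst_x]; rfl
    · change dec (coreMap D (c • x)) b p = dec (c • coreMap D x) b p
      rw [dec_smul]
      simp only [dec_coreMap_of_nonneg _ _ _ hp]; rfl

theorem coreIncl_node (x : Core n) : (coreIncl D W m x).1.1 D.x = x.1 := coreMap_fst_x D x

theorem dec_coreIncl (x : Core n) (b : Bool) {p : Cyl} (hp : 0 ≤ p.1) :
    dec (coreIncl D W m x).1 b p = (x.2 b).1 p := dec_coreMap_of_nonneg D x b hp

theorem wDeriv_coreIncl (x : Core n) (b : Bool) (i j : ℕ) :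
    wDeriv (Ioi 0) (W.δ m) i j (dec (coreIncl D W m x).1 b) =
      (Sm.memLp (x.2 b) i j (W.pos m).le).toLp (pST i j (x.2 b).1) :=
  (wDeriv_coreMap D W m x b i j).2

/-- On the core weak derivatives are classical ones, so every level norm becomes a finite list of
weighted L² norms of smooth functions. All operator bounds are proved in this form. -/
theorem norm_coreIncl_le_iff (x : Core n) {r : ℝ} (hr : 0 ≤ r) : ‖coreIncl D W m x‖ ≤ r ↔
    ‖x.1‖ ≤ r ∧ ∀ b i j, i + j ≤ m + 3 →
      eLpNorm (pST i j (x.2 b).1) 2 (weightedMeasure (Ioi 0) (W.δ m)) ≤ ENNReal.ofReal r := by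
  rw [levelNorm_le_iff _ hr, coreIncl_node]
  refine and_congr_right fun _ => forall_congr' fun b => forall_congr' fun i =>
    forall_congr' fun j => imp_congr_right fun _ => ?_
  rw [wDeriv_coreIncl, Lp.norm_toLp, ]
  exact (ENNReal.le_ofReal_iff_toReal_le (Sm.memLp (x.2 b) i j (W.pos m).le).eLpNorm_ne_top hr).symm

theorem eLpNorm_pST_le_coreIncl (x : Core n) (b : Bool) {i j : ℕ} (h : i + j ≤ m + 3) :
    eLpNorm (pST i j (x.2 b).1) 2 (weightedMeasure (Ioi 0) (W.δ m)) ≤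
      ENNReal.ofReal ‖coreIncl D W m x‖ :=
  ((norm_coreIncl_le_iff D W m x (norm_nonneg _)).1 le_rfl).2 b i j h

theorem levelIncl_coreIncl {m k : ℕ} (h : m ≤ k) (x : Core n) :
    levelIncl D n W h (coreIncl D W k x) = coreIncl D W m x := rfl

end CoreNorm

/-! ### Density of the core. -/

section Density

variable {n : ℕ}

/-- The factor -1 lets a truncation be written as the sum f + (-χ)f, whose second term is a product
covered by the Leibniz estimate. -/
theorem isBoundedSmooth_smoothTransition :
    IsBoundedSmooth (fun s => (-1 : ℝ) * Real.smoothTransition s) :=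
  isBoundedSmooth_of_eq (contDiff_const.mul Real.smoothTransition.contDiff) (a := 0) (b := 1)
    (c := 0) (d := -1) (fun s hs => by rw [Real.smoothTransition.zero_of_nonpos hs, mul_zero])
    (fun s hs => by rw [Real.smoothTransition.one_of_one_le hs, mul_one])

/-- Truncation of a smooth map. -/
def truncate {f : Cyl → Target n} (hf : IsSmooth f) (N : ℝ) : Sm n :=
  ⟨fun p => f p + ((-1 : ℝ) * Real.smoothTransition (p.1 - N)) • f p,
    hf.add (hf.mul_s isBoundedSmooth_smoothTransition.1 N), N + 1, fun p hp => by
      beta_reduce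
      rw [Real.smoothTransition.one_of_one_le (by linarith)]
      simp⟩

/-- Half of η is spent on mollification, half on truncation at N. The truncation error is supported
in s ≥ N and bounded by tails of finitely many derivatives, with a constant independent of N, so it
tends to 0. -/
theorem exists_sm_approx {δ : ℝ} (hδ : 0 ≤ δ) {k : ℕ} {f : Cyl → Target n} (hf : Continuous f)
    (hs : IsSobolev (Ioi 0) k δ f) {η : ℝ} (hη : 0 < η) : ∃ g : Sm n, ∀ i j, i + j ≤ k →
      eLpNorm (fun p => pST i j g.1 p - wDeriv (Ioi 0) δ i j f p) 2 (weightedMeasure (Ioi 0) δ) ≤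
        ENNReal.ofReal η := by
  obtain ⟨g, hg, -, hg2⟩ := exists_smooth_approx hδ hf hs 0 (half_pos hη)
  have hmem : ∀ i j, i + j ≤ k → MemLp (pST i j g) 2 (weightedMeasure (Ioi 0) δ) := by
    intro i j hij
    have h1 : MemLp (fun p => pST i j g p - wDeriv (Ioi 0) δ i j f p) 2
        (weightedMeasure (Ioi 0) δ) :=
      ⟨(hg.pST i j).continuous.aestronglyMeasurable.sub (Lp.aestronglyMeasurable _),
        (hg2 i j hij).trans_lt ENNReal.ofReal_lt_top⟩
    have h2 := h1.add (Lp.memLp (wDeriv (Ioi 0) δ i j f))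
    refine (memLp_congr_ae (Filter.Eventually.of_forall fun p => ?_)).1 h2
    simp
  have htail : ∀ i j, i + j ≤ k → ∀ᶠ N : ℕ in Filter.atTop,
      eLpNorm (pST i j (fun p => ((-1 : ℝ) * Real.smoothTransition (p.1 - N)) • g p)) 2
        (weightedMeasure (Ioi 0) δ) ≤ ENNReal.ofReal (η / 2) := by
    intro i j hij
    obtain ⟨C, hC0, hC⟩ := exists_norm_pST_mul_s_le (F := Target n)
      isBoundedSmooth_smoothTransition i
    have hms : ∀ N : ℕ, MeasurableSet {p : Cyl | (N : ℝ) ≤ p.1} := fun N =>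
      measurableSet_le measurable_const measurable_fst
    have hle : ∀ N : ℕ,
        eLpNorm (pST i j (fun p => ((-1 : ℝ) * Real.smoothTransition (p.1 - N)) • g p)) 2
        (weightedMeasure (Ioi 0) δ) ≤ ENNReal.ofReal C * ∑ a ∈ Finset.range (i + 1),
          eLpNorm ({p : Cyl | (N : ℝ) ≤ p.1}.indicator (pST a j g)) 2
            (weightedMeasure (Ioi 0) δ) := by
      intro N
      refine eLpNorm_le_mul_sum _ (fun a _ =>
        ((hg.pST a j).continuous.aestronglyMeasurable).indicator (hms N))
        (Filter.Eventually.of_forall fun p => ?_)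
      by_cases hp : (N : ℝ) ≤ p.1
      · simp only [indicator_of_mem (show p ∈ {p : Cyl | (N : ℝ) ≤ p.1} from hp)]
        exact hC j N g hg p
      · rw [pST_eq_zero (U := Iio (N : ℝ)) isOpen_Iio (fun q hq => ?_) i j p (not_le.1 hp), norm_zero]
        · exact mul_nonneg hC0 (Finset.sum_nonneg fun _ _ => norm_nonneg _)
        · rw [Real.smoothTransition.zero_of_nonpos (by linarith [mem_Iio.1 hq]), mul_zero, zero_smul]
    have hlim : Filter.Tendsto (fun N : ℕ => ENNReal.ofReal C * ∑ a ∈ Finset.range (i + 1),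
          eLpNorm ({p : Cyl | (N : ℝ) ≤ p.1}.indicator (pST a j g)) 2
            (weightedMeasure (Ioi 0) δ)) Filter.atTop (𝓝 0) := by
      have h1 := tendsto_finsetSum (Finset.range (i + 1)) fun a ha =>
        tendsto_eLpNorm_tail (hmem a j (by have := Finset.mem_range.1 ha; omega))
      have h2 := ENNReal.Tendsto.const_mul h1 (a := ENNReal.ofReal C) (Or.inr ENNReal.ofReal_ne_top)
      simpa using h2
    have hpos : (0 : ℝ≥0∞) < ENNReal.ofReal (η / 2) := ENNReal.ofReal_pos.2 (half_pos hη)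
    filter_upwards [hlim.eventually (gt_mem_nhds hpos)] with N hN
    exact (hle N).trans hN.le
  have hall : ∀ᶠ N : ℕ in Filter.atTop, ∀ a ∈ (Finset.range (k + 1) ×ˢ Finset.range (k + 1)),
      a.1 + a.2 ≤ k →
      eLpNorm (pST a.1 a.2 (fun p => ((-1 : ℝ) * Real.smoothTransition (p.1 - N)) • g p)) 2
        (weightedMeasure (Ioi 0) δ) ≤ ENNReal.ofReal (η / 2) := by
    rw [Filter.eventually_all_finset]
    intro a _
    by_cases ha : a.1 + a.2 ≤ k
    · filter_upwards [htail a.1 a.2 ha] with N hN _ using hN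
    · exact Filter.Eventually.of_forall fun N h => absurd h ha
  obtain ⟨N, hN⟩ := hall.exists
  refine ⟨truncate hg N, fun i j hij => ?_⟩
  have hN' := hN (i, j) (by simp; omega) hij
  have hsm := hg.mul_s isBoundedSmooth_smoothTransition.1 N
  have e : (fun p => pST i j (truncate hg N).1 p - wDeriv (Ioi 0) δ i j f p) =
      (fun p => pST i j g p - wDeriv (Ioi 0) δ i j f p) +
        pST i j (fun p => ((-1 : ℝ) * Real.smoothTransition (p.1 - N)) • g p) := by
    funext p
    have := congrFun (hg.pST_add hsm i j) p
    rw [show pST i j (truncate hg N).1 p = _ from this, Pi.add_apply]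
    abel
  rw [e]
  refine (eLpNorm_add_le ((hg.pST i j).continuous.aestronglyMeasurable.sub
    (Lp.aestronglyMeasurable _)) (hsm.pST i j).continuous.aestronglyMeasurable (by norm_num)).trans ?_
  rw [← add_halves η, ENNReal.ofReal_add (half_pos hη).le (half_pos hη).le]
  exact add_le_add (hg2 i j hij) hN'

/-- The asymptotic constant is kept exactly; only the two decaying parts are approximated,
independently of each other. -/
theorem denseRange_coreIncl (D : NodedDiskPair) (W : Weights) (m : ℕ) :
    DenseRange (coreIncl (n := n) D W m) := by
  refine Metric.denseRange_iff.2 fun u η hη => ?_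
  choose g hg using fun b => exists_sm_approx (W.pos m).le (continuous_dec u.1 b) (u.isSobolev b)
    (half_pos hη)
  let x : Core n := (u.1.1 D.x, g)
  refine ⟨x, ?_⟩
  rw [dist_comm, dist_eq_norm]
  refine lt_of_le_of_lt ?_ (half_lt_self hη)
  refine (levelNorm_le_iff _ (half_pos hη).le).2 ⟨?_, fun b i j hij => ?_⟩
  · have : (coreIncl D W m x - u).1.1 D.x = (coreIncl D W m x).1.1 D.x - u.1.1 D.x := rfl
    rw [this, coreIncl_node, sub_self, norm_zero]
    exact (half_pos hη).le
  · have h1 := LevelSpace.wDeriv_add (coreIncl D W m x - u) u b hij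
    rw [sub_add_cancel, ← sub_eq_iff_eq_add] at h1
    rw [← h1, wDeriv_coreIncl, Lp.norm_def]
    refine ENNReal.toReal_le_of_le_ofReal (half_pos hη).le (le_trans (le_of_eq ?_) (hg b i j hij))
    refine eLpNorm_congr_ae ?_
    filter_upwards [Lp.coeFn_sub ((Sm.memLp (x.2 b) i j (W.pos m).le).toLp (pST i j (x.2 b).1))
      (wDeriv (Ioi 0) (W.δ m) i j (dec u.1 b)), (Sm.memLp (x.2 b) i j (W.pos m).le).coeFn_toLp]
      with p hp1 hp2
    rw [hp1, Pi.sub_apply, hp2]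

end Density

end GWSplicing

end
noncomputable section

namespace GWSplicing

/-! ### Compactness of the inclusions -/

/-- An operator is compact if it is bounded by arbitrarily small multiples of the norm up to
operators of finite rank. -/
theorem isCompactOperator_of_le {X Y V : Type} [NormedAddCommGroup X] [NormedSpace ℝ X]
    [NormedAddCommGroup Y] [NormedSpace ℝ Y] [CompleteSpace Y] [NormedAddCommGroup V]
    [NormedSpace ℝ V] [FiniteDimensional ℝ V] (A : X →L[ℝ] Y)
    (h : ∀ ε > 0, ∃ (ι : Type) (_ : Fintype ι) (φ : X →L[ℝ] (ι → V)) (C : ℝ), 0 ≤ C ∧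
      ∀ x, ‖A x‖ ≤ ε * ‖x‖ + C * ‖φ x‖) : IsCompactOperator A := by
  have ht : TotallyBounded (A '' Metric.closedBall 0 1) := by
    rw [Metric.totallyBounded_iff]
    intro ε hε
    obtain ⟨ι, _, φ, C, hC0, hC⟩ := h (ε / 4) (by positivity)
    have hproper : ProperSpace (ι → V) := FiniteDimensional.proper ℝ _
    have hbd : Bornology.IsBounded (φ '' Metric.closedBall 0 1) :=
      φ.lipschitz.isBounded_image Metric.isBounded_closedBall
    have hb : TotallyBounded (φ '' Metric.closedBall 0 1) :=
      hbd.isCompact_closure.totallyBounded.subset subset_closure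
    -- A finite net for the finite-dimensional image pulls back to a finite net for A: points of the
    -- unit ball differ by at most 2, so the two terms of the hypothesis contribute at most ε/2 and
    -- ε/4.
    obtain ⟨t, hts, htf, hcov⟩ := Metric.finite_approx_of_totallyBounded hb (ε / (4 * (C + 1)))
      (by positivity)
    have hts' : ∀ y ∈ t, ∃ z, z ∈ Metric.closedBall (0 : X) 1 ∧ φ z = y := fun y hy => hts hy
    choose! z hz using hts'
    refine ⟨(fun y => A (z y)) '' t, htf.image _, ?_⟩
    rintro _ ⟨x, hx, rfl⟩
    obtain ⟨y, hy, hxy⟩ := mem_iUnion₂.1 (hcov ⟨x, hx, rfl⟩)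
    refine mem_iUnion₂.2 ⟨A (z y), ⟨y, hy, rfl⟩, ?_⟩
    have hx1 : ‖x‖ ≤ 1 := mem_closedBall_zero_iff.1 hx
    have hz1 : ‖z y‖ ≤ 1 := mem_closedBall_zero_iff.1 (hz y hy).1
    rw [Metric.mem_ball, dist_eq_norm, ← map_sub]
    rw [Metric.mem_ball, dist_eq_norm, ← (hz y hy).2, ← map_sub] at hxy
    have h1 := hC (x - z y)
    have h2 : ‖x - z y‖ ≤ 2 := (norm_sub_le _ _).trans (by linarith)
    have h3 : C * ‖φ (x - z y)‖ ≤ C * (ε / (4 * (C + 1))) :=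
      mul_le_mul_of_nonneg_left hxy.le hC0
    have h4 : C * (ε / (4 * (C + 1))) ≤ ε / 4 := by
      rw [mul_div_assoc', div_le_div_iff₀ (by positivity) (by norm_num)]
      nlinarith
    have h5 : ε / 4 * ‖x - z y‖ ≤ ε / 4 * 2 := mul_le_mul_of_nonneg_left h2 (by positivity)
    linarith
  exact (isCompactOperator_iff_isCompact_closure_image_closedBall
    (A : X →ₗ[ℝ] Y) one_pos).2 (ht.closure.isCompact_of_isClosed isClosed_closure)

section Evaluation

variable {D : NodedDiskPair} {n : ℕ} {W : Weights} {m : ℕ}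

/-- The asymptotic constant. -/
def nodeEval : LevelSpace D n W m →L[ℝ] Target n :=
  LinearMap.mkContinuous
    { toFun := fun u => u.1.1 D.x, map_add' := fun _ _ => rfl, map_smul' := fun _ _ => rfl } 1
    fun u => by rw [one_mul]; exact norm_node_le u

/-- Point evaluations of the decaying parts. -/
def decEval (b : Bool) (p : {p : Cyl // 0 ≤ p.1}) : LevelSpace D n W m →L[ℝ] Target n :=
  LinearMap.mkContinuous
    { toFun := fun u => dec u.1 b p.1
      map_add' := fun u v => congrFun (dec_add u.1 v.1 b) p.1
      map_smul' := fun c u => congrFun (dec_smul c u.1 b) p.1 } 4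
    fun u => norm_dec_le' u b p.2

end Evaluation

/-! ### Interpolation: first derivatives bounded by the function and second derivatives. -/

section Interpolation

variable {F : Type} [NormedAddCommGroup F] [NormedSpace ℝ F]

/-- Taylor's formula on [0,1]: the difference w(1) - w(0) is w'(0) up to the total variation of w',
which is at most ∫‖w''‖. -/
theorem norm_deriv_zero_le [CompleteSpace F] {w w' w'' : ℝ → F} (h1 : ∀ t, HasDerivAt w (w' t) t)
    (h2 : ∀ t, HasDerivAt w' (w'' t) t) (hc : Continuous w'') :
    ‖w' 0‖ ≤ ‖w 1‖ + ‖w 0‖ + ∫ t in (0 : ℝ)..1, ‖w'' t‖ := by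
  set K := ∫ t in (0 : ℝ)..1, ‖w'' t‖
  have hK : ∀ t ∈ Icc (0 : ℝ) 1, ‖w' t - w' 0‖ ≤ K := by
    intro t ht
    rw [← intervalIntegral.integral_eq_sub_of_hasDerivAt (fun s _ => h2 s)
      (hc.intervalIntegrable (μ := volume) _ _)]
    refine (intervalIntegral.norm_integral_le_integral_norm ht.1).trans ?_
    exact intervalIntegral.integral_mono_interval le_rfl ht.1 ht.2
      (Filter.Eventually.of_forall fun _ => norm_nonneg _)
      (hc.norm.intervalIntegrable (μ := volume) _ _)
  have h3 := norm_image_sub_le_of_norm_deriv_le_segment_01' (f := fun t => w t - t • w' 0)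
    (f' := fun t => w' t - w' 0) (C := K)
    (fun t _ => (((h1 t).sub (by simpa using (hasDerivAt_id t).smul_const (w' 0)))).hasDerivWithinAt)
    (fun t ht => hK t (Ico_subset_Icc_self ht))
  simp only [one_smul, zero_smul, sub_zero] at h3
  have h4 : w' 0 = w 1 - w 0 - (w 1 - w' 0 - w 0) := by abel
  rw [h4]
  refine (norm_sub_le _ _).trans ?_
  linarith [norm_sub_le (w 1) (w 0)]

/-- Translating towards +∞ stays in the half-cylinder, and the weight grows in that direction, so
the norm of the translate can only drop. -/
theorem eLpNorm_translate_le {δ : ℝ} (hδ : 0 ≤ δ) {q : Cyl} (hq : 0 ≤ q.1) (g : Cyl → F) :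
    eLpNorm (fun p => g (p + q)) 2 (weightedMeasure (Ioi 0) δ) ≤
      eLpNorm g 2 (weightedMeasure (Ioi 0) δ) := by
  rw [← ENNReal.pow_le_pow_left_iff two_ne_zero, eLpNorm_weighted_sq, eLpNorm_weighted_sq,
    ← lintegral_indicator (measurableSet_Ioi.prod MeasurableSet.univ),
    ← lintegral_indicator (measurableSet_Ioi.prod MeasurableSet.univ)]
  rw [← lintegral_add_right_eq_self (μ := (volume : Measure Cyl)) (fun p : Cyl =>
    (Ioi (0 : ℝ) ×ˢ (univ : Set UnitAddCircle)).indicator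
      (fun p : Cyl => ENNReal.ofReal (Real.exp (2 * δ * |p.1|)) * ‖g p‖ₑ ^ 2) p) q]
  refine lintegral_mono fun p => ?_
  by_cases hp : 0 < p.1
  · have hp' : 0 < p.1 + q.1 := by linarith
    rw [indicator_of_mem (show p ∈ Ioi (0 : ℝ) ×ˢ univ from ⟨hp, mem_univ _⟩),
      indicator_of_mem (show p + q ∈ Ioi (0 : ℝ) ×ˢ univ from ⟨hp', mem_univ _⟩)]
    gcongr
    exact le_add_of_nonneg_right hq
  · rw [indicator_of_notMem (show p ∉ Ioi (0 : ℝ) ×ˢ univ from fun h => hp h.1)]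
    exact zero_le

theorem continuous_line {g : Cyl → F} (hg : Continuous g) (q : ℝ × ℝ) :
    Continuous (fun z : Cyl × ℝ => g (z.1 + cover (z.2 • q))) :=
  hg.comp (continuous_fst.add (continuous_cover.comp (by fun_prop)))

/-- Jensen in the time variable, Tonelli, and the contraction property of each translate. -/
theorem eLpNorm_integral_translate_le {δ : ℝ} (hδ : 0 ≤ δ) {q : ℝ × ℝ} (hq : 0 ≤ q.1)
    {g : Cyl → F} (hg : Continuous g) :
    eLpNorm (fun p => ∫ t in (0 : ℝ)..1, ‖g (p + cover (t • q))‖) 2 (weightedMeasure (Ioi 0) δ) ≤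
      eLpNorm g 2 (weightedMeasure (Ioi 0) δ) := by
  have hcont := continuous_line hg q
  refine eLpNorm_two_le ?_
  have hprob : IsProbabilityMeasure (volume.restrict (Ioc (0 : ℝ) 1)) := ⟨by simp⟩
  calc ∫⁻ p, ‖∫ t in (0 : ℝ)..1, ‖g (p + cover (t • q))‖‖ₑ ^ 2 ∂(weightedMeasure (Ioi 0) δ)
      ≤ ∫⁻ p, (∫⁻ t in Ioc (0 : ℝ) 1, ‖g (p + cover (t • q))‖ₑ ^ 2) ∂(weightedMeasure (Ioi 0) δ) := by
        refine lintegral_mono fun p => ?_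
        rw [intervalIntegral.integral_of_le zero_le_one]
        have := enorm_integral_sq_le (ν := volume.restrict (Ioc (0 : ℝ) 1))
          (h := fun t => ‖g (p + cover (t • q))‖)
          ((hcont.comp (by fun_prop : Continuous fun t : ℝ => (p, t))).norm.aestronglyMeasurable)
        simpa using this
    _ = ∫⁻ t in Ioc (0 : ℝ) 1, ∫⁻ p, ‖g (p + cover (t • q))‖ₑ ^ 2 ∂(weightedMeasure (Ioi 0) δ) := by
        rw [lintegral_lintegral_swap]
        exact (hcont.enorm.measurable.pow_const 2).aemeasurable
    _ ≤ ∫⁻ t in Ioc (0 : ℝ) 1, eLpNorm g 2 (weightedMeasure (Ioi 0) δ) ^ 2 := by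
        refine setLIntegral_mono measurable_const fun t ht => ?_
        rw [← eLpNorm_two_sq]
        gcongr
        exact eLpNorm_translate_le hδ (mul_nonneg ht.1.le hq) g
    _ = eLpNorm g 2 (weightedMeasure (Ioi 0) δ) ^ 2 := by simp

/-- The derivative in the direction `q`. -/
def pDir (q : ℝ × ℝ) (f : Cyl → F) (p : Cyl) : F := q.1 • pS f p + q.2 • pT f p

theorem IsSmooth.pDir {f : Cyl → F} (hf : IsSmooth f) (q : ℝ × ℝ) : IsSmooth (pDir q f) :=
  (hf.pS.const_smul q.1).add (hf.pT.const_smul q.2)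

theorem IsSmooth.hasDerivAt_line {f : Cyl → F} (hf : IsSmooth f) (q : ℝ × ℝ) (p : Cyl) (t : ℝ) :
    HasDerivAt (fun t : ℝ => f (p + cover (t • q))) (GWSplicing.pDir q f (p + cover (t • q))) t := by
  obtain ⟨p, rfl⟩ := cover_surjective p
  have h1 := (hf.differentiable (p + t • q)).hasFDerivAt
  have h2 : HasDerivAt (fun t : ℝ => p + t • q) q t := by
    simpa using ((hasDerivAt_id t).smul_const q).const_add p
  have h3 := h1.comp_hasDerivAt t h2
  rw [hf.fderiv_cover] at h3
  exact h3

theorem IsSmooth.norm_pDir_le [CompleteSpace F] {f : Cyl → F} (hf : IsSmooth f) (q : ℝ × ℝ)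
    (p : Cyl) : ‖GWSplicing.pDir q f p‖ ≤ ‖f (p + cover q)‖ + ‖f p‖ +
      ∫ t in (0 : ℝ)..1, ‖GWSplicing.pDir q (GWSplicing.pDir q f) (p + cover (t • q))‖ := by
  have hc0 : p + cover ((0 : ℝ) • q) = p := by
    rw [zero_smul, show cover (0 : ℝ × ℝ) = 0 from rfl, add_zero]
  have hc : Continuous (fun t : ℝ =>
      GWSplicing.pDir q (GWSplicing.pDir q f) (p + cover (t • q))) :=
    ((hf.pDir q).pDir q).continuous.comp
      (continuous_const.add (continuous_cover.comp (continuous_id.smul continuous_const)))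
  have := norm_deriv_zero_le (w := fun t : ℝ => f (p + cover (t • q)))
    (w' := fun t : ℝ => GWSplicing.pDir q f (p + cover (t • q)))
    (w'' := fun t : ℝ => GWSplicing.pDir q (GWSplicing.pDir q f) (p + cover (t • q)))
    (hf.hasDerivAt_line q p) ((hf.pDir q).hasDerivAt_line q p) hc
  rwa [hc0, one_smul] at this

/-- Take weighted norms in the pointwise Taylor bound; the translates have q.1 ≥ 0 and cost nothing.
Scaling q later produces the interpolation parameter. -/
theorem IsSmooth.eLpNorm_pDir_le [CompleteSpace F] {f : Cyl → F} (hf : IsSmooth f) {δ : ℝ}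
    (hδ : 0 ≤ δ) {q : ℝ × ℝ} (hq : 0 ≤ q.1) :
    eLpNorm (GWSplicing.pDir q f) 2 (weightedMeasure (Ioi 0) δ) ≤
      2 * eLpNorm f 2 (weightedMeasure (Ioi 0) δ) +
        eLpNorm (GWSplicing.pDir q (GWSplicing.pDir q f)) 2 (weightedMeasure (Ioi 0) δ) := by
  set μ := weightedMeasure (Ioi 0) δ
  obtain ⟨A, hA⟩ : ∃ A : Cyl → ℝ, A = fun p => ‖f (p + cover q)‖ := ⟨_, rfl⟩
  obtain ⟨B, hB⟩ : ∃ B : Cyl → ℝ, B = fun p => ‖f p‖ := ⟨_, rfl⟩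
  obtain ⟨K, hK⟩ : ∃ K : Cyl → ℝ, K = fun p => ∫ t in (0 : ℝ)..1,
      ‖GWSplicing.pDir q (GWSplicing.pDir q f) (p + cover (t • q))‖ := ⟨_, rfl⟩
  have hm1 : AEStronglyMeasurable A μ := by
    rw [hA]
    exact (hf.continuous.comp (continuous_id.add continuous_const)).norm.aestronglyMeasurable
  have hm2 : AEStronglyMeasurable B μ := by
    rw [hB]
    exact hf.continuous.norm.aestronglyMeasurable
  have hm3 : AEStronglyMeasurable K μ := by
    rw [hK]
    exact (intervalIntegral.continuous_parametric_intervalIntegral_of_continuous'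
      (f := fun p t => ‖GWSplicing.pDir q (GWSplicing.pDir q f) (p + cover (t • q))‖)
      (continuous_line ((hf.pDir q).pDir q).continuous q).norm 0 1).aestronglyMeasurable
  have h2 : eLpNorm (GWSplicing.pDir q f) 2 μ ≤ eLpNorm (A + B + K) 2 μ :=
    eLpNorm_mono_real fun p => by
      rw [Pi.add_apply, Pi.add_apply, hA, hB, hK]
      exact hf.norm_pDir_le q p
  have hA' : eLpNorm A 2 μ ≤ eLpNorm f 2 μ := by
    rw [hA]
    refine (eLpNorm_norm (fun p => f (p + cover q))).le.trans ?_
    exact eLpNorm_translate_le hδ hq f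
  have hB' : eLpNorm B 2 μ = eLpNorm f 2 μ := by rw [hB]; exact eLpNorm_norm f
  have hK' : eLpNorm K 2 μ ≤ eLpNorm (GWSplicing.pDir q (GWSplicing.pDir q f)) 2 μ := by
    rw [hK]
    exact eLpNorm_integral_translate_le hδ hq ((hf.pDir q).pDir q).continuous
  refine h2.trans ((eLpNorm_add_le (hm1.add hm2) hm3 (by norm_num)).trans ?_)
  refine add_le_add ((eLpNorm_add_le hm1 hm2 (by norm_num)).trans ?_) hK'
  rw [hB', two_mul]
  exact add_le_add_left hA' _

end Interpolation

end GWSplicing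

end
-- Ehrling's inequality and the sc-structure of E.
noncomputable section

namespace GWSplicing

section Ehrling

variable {n : ℕ}

/-- The norm of the weighted `L²`-space, for the weight `e^{δ|s|}` on `ℝ⁺ × S¹`. -/
def wnorm (δ : ℝ) (g : Cyl → Target n) : ℝ := (eLpNorm g 2 (weightedMeasure (Ioi 0) δ)).toReal

theorem wnorm_mono {δ δ' : ℝ} (h : δ ≤ δ') {g : Cyl → Target n}
    (hg : MemLp g 2 (weightedMeasure (Ioi 0) δ')) : wnorm δ g ≤ wnorm δ' g :=
  ENNReal.toReal_mono hg.eLpNorm_ne_top (eLpNorm_mono_measure _ (weighted_mono _ h))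

theorem wnorm_pST_le_coreIncl (D : NodedDiskPair) (W : Weights) (k : ℕ) (x : Core n) (b : Bool)
    {i j : ℕ} (h : i + j ≤ k + 3) : wnorm (W.δ k) (pST i j (x.2 b).1) ≤ ‖coreIncl D W k x‖ :=
  ENNReal.toReal_le_of_le_ofReal (norm_nonneg _) (eLpNorm_pST_le_coreIncl D W k x b h)

/-- The Sobolev inequality consumes two derivatives, so the k+3 derivatives of E_k give pointwise
exponential decay up to order k+1. -/
theorem norm_pST_le_coreIncl (D : NodedDiskPair) (W : Weights) (k : ℕ) (x : Core n) (b : Bool)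
    {i j : ℕ} (h : i + j ≤ k + 1) {p : Cyl} (hp : 0 ≤ p.1) :
    ‖pST i j (x.2 b).1 p‖ ≤ Real.exp (-(W.δ k * p.1)) * (4 * ‖coreIncl D W k x‖) := by
  have h1 := ((Sm.isSmooth (x.2 b)).pST i j).enorm_le (W.pos k).le hp
  have h2 : ∑ a ∈ Finset.range 2 ×ˢ Finset.range 2,
      eLpNorm (pST a.1 a.2 (pST i j (x.2 b).1)) 2 (weightedMeasure (Ioi 0) (W.δ k)) ≤
        ENNReal.ofReal (4 * ‖coreIncl D W k x‖) := by
    refine (Finset.sum_le_card_nsmul _ _ (ENNReal.ofReal ‖coreIncl D W k x‖) fun a ha => ?_).trans ?_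
    · simp only [Finset.mem_product, Finset.mem_range] at ha
      rw [(Sm.isSmooth (x.2 b)).pST_pST]
      exact eLpNorm_pST_le_coreIncl D W k x b (by omega)
    · rw [ENNReal.ofReal_mul (by norm_num)]
      simp
  rw [← ofReal_norm] at h1
  have h3 := h1.trans (mul_le_mul_right h2 _)
  rw [← ENNReal.ofReal_mul (Real.exp_pos _).le] at h3
  exact (ENNReal.ofReal_le_ofReal_iff (by positivity)).1 h3

/-- Apply the directional estimate with q = (h,0) or (0,h): the first directional derivative scales
by h, the second by h². -/
theorem Sm.interpolate (f : Sm n) {δ : ℝ} (hδ : 0 ≤ δ) {h : ℝ} (hh : 0 < h) (i j : ℕ) :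
    h * wnorm δ (pST (i + 1) j f.1) ≤
      2 * wnorm δ (pST i j f.1) + h ^ 2 * wnorm δ (pST (i + 2) j f.1) ∧
    h * wnorm δ (pST i (j + 1) f.1) ≤
      2 * wnorm δ (pST i j f.1) + h ^ 2 * wnorm δ (pST i (j + 2) f.1) := by
  have hf := Sm.isSmooth f
  have hg := hf.pST i j
  have hfin : ∀ i j, eLpNorm (pST i j f.1) 2 (weightedMeasure (Ioi 0) δ) ≠ ⊤ := fun i j =>
    (Sm.memLp f i j hδ).eLpNorm_ne_top
  have key : ∀ {q : ℝ × ℝ} (_ : 0 ≤ q.1) (g₁ g₂ : Cyl → Target n),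
      pDir q (pST i j f.1) = h • g₁ → pDir q (pDir q (pST i j f.1)) = h ^ 2 • g₂ →
      eLpNorm g₂ 2 (weightedMeasure (Ioi 0) δ) ≠ ⊤ →
      h * wnorm δ g₁ ≤ 2 * wnorm δ (pST i j f.1) + h ^ 2 * wnorm δ g₂ := by
    intro q hq g₁ g₂ e₁ e₂ h2
    have := hg.eLpNorm_pDir_le hδ hq
    rw [e₂, e₁, eLpNorm_const_smul, eLpNorm_const_smul] at this
    have h3 := ENNReal.toReal_mono (by
      refine ENNReal.add_ne_top.2 ⟨ENNReal.mul_ne_top (by simp) (hfin i j),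
        ENNReal.mul_ne_top (by simp) h2⟩) this
    rw [ENNReal.toReal_add (ENNReal.mul_ne_top (by simp) (hfin i j))
      (ENNReal.mul_ne_top (by simp) h2), ENNReal.toReal_mul, ENNReal.toReal_mul,
      ENNReal.toReal_mul] at h3
    simpa [abs_of_pos hh, wnorm] using h3
  constructor
  · refine key (q := (h, 0)) hh.le _ _ ?_ ?_ (hfin (i + 2) j)
    · funext p
      simp [pDir, pS_pST]
    · have e : pDir (h, 0) (pST i j f.1) = fun p => h • pST (i + 1) j f.1 p := by
        funext p
        simp [pDir, pS_pST]
      rw [e]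
      funext p
      have := congrFun ((hf.pST (i + 1) j).pST_smul h 1 0) p
      rw [show pST 1 0 (pST (i + 1) j f.1) = pST (i + 2) j f.1 from pS_pST (i + 1) j f.1] at this
      simp only [pDir, zero_smul, add_zero, Pi.smul_apply, pow_two, mul_smul]
      rw [show pS (fun p => h • pST (i + 1) j f.1 p) p = _ from this]
  · refine key (q := (0, h)) le_rfl _ _ ?_ ?_ (hfin i (j + 2))
    · funext p
      simp [pDir, hf.pT_pST]
    · have e : pDir (0, h) (pST i j f.1) = fun p => h • pST i (j + 1) f.1 p := by
        funext p
        simp [pDir, hf.pT_pST]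
      rw [e]
      funext p
      have := congrFun ((hf.pST i (j + 1)).pST_smul h 0 1) p
      rw [show pST 0 1 (pST i (j + 1) f.1) = pST i (j + 2) f.1 from hf.pT_pST i (j + 1)] at this
      simp only [pDir, zero_smul, zero_add, Pi.smul_apply, pow_two, mul_smul]
      rw [show pT (fun p => h • pST i (j + 1) f.1 p) p = _ from this]

/-- Divide by h = ε/2. The second-order term gives (ε/2)X, and the smallness εh/4 of the
zeroth-order term becomes another (ε/2)X. -/
theorem ehrling_step {h ε N₀ N₁ N₂ X B C : ℝ} (hε : 0 < ε) (he : h = ε / 2)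
    (h1 : h * N₁ ≤ 2 * N₀ + h ^ 2 * N₂) (h0 : N₀ ≤ ε * h / 4 * X + C * B) (h2 : N₂ ≤ X) :
    N₁ ≤ ε * X + (2 / h * C) * B := by
  have hh : 0 < h := by rw [he]; positivity
  have h3 : h ^ 2 * N₂ ≤ h ^ 2 * X := mul_le_mul_of_nonneg_left h2 (by positivity)
  have h4 : h * N₁ ≤ h * (ε * X + (2 / h * C) * B) := by
    have e1 : h * (ε * X + (2 / h * C) * B) = h * ε * X + 2 * C * B := by field_simp
    have e2 : h ^ 2 * X = h * ε / 2 * X := by rw [he]; ring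
    rw [e1]
    linarith
  exact le_of_mul_le_mul_left h4 hh

variable (D : NodedDiskPair) (W : Weights)

/-- Induction on the order: each derivative is interpolated between the one below and the one above.
The latter has order at most k+3 and is controlled by E_k, whence the restriction to order k+2. -/
theorem exists_wnorm_pST_le {m k : ℕ} (hmk : m ≤ k) (i j : ℕ) (hij : i + j ≤ k + 2) {ε : ℝ}
    (hε : 0 < ε) : ∃ C, 0 ≤ C ∧ ∀ (x : Core n) b, wnorm (W.δ m) (pST i j (x.2 b).1) ≤
      ε * ‖coreIncl D W k x‖ + C * wnorm (W.δ m) (x.2 b).1 := by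
  have hle : ∀ (x : Core n) b i j, i + j ≤ k + 3 →
      wnorm (W.δ m) (pST i j (x.2 b).1) ≤ ‖coreIncl D W k x‖ := fun x b i j h =>
    (wnorm_mono (W.strictMono.monotone hmk) (Sm.memLp (x.2 b) i j (W.pos k).le)).trans
      (wnorm_pST_le_coreIncl D W k x b h)
  induction i generalizing ε with
  | zero =>
    induction j generalizing ε with
    | zero =>
      refine ⟨1, zero_le_one, fun x b => ?_⟩
      rw [one_mul]
      exact le_add_of_nonneg_left (by positivity)
    | succ j ih =>
      obtain ⟨C, hC0, hC⟩ := ih (by omega) (ε := ε * (ε / 2) / 4) (by positivity)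
      refine ⟨2 / (ε / 2) * C, by positivity, fun x b => ?_⟩
      exact ehrling_step hε rfl (Sm.interpolate (x.2 b) (W.pos m).le (half_pos hε) 0 j).2 (hC x b)
        (hle x b 0 (j + 2) (by omega))
  | succ i ih =>
    obtain ⟨C, hC0, hC⟩ := ih (by omega) (ε := ε * (ε / 2) / 4) (by positivity)
    refine ⟨2 / (ε / 2) * C, by positivity, fun x b => ?_⟩
    exact ehrling_step hε rfl (Sm.interpolate (x.2 b) (W.pos m).le (half_pos hε) i j).1 (hC x b)
      (hle x b (i + 2) j (by omega))

theorem Sm.norm_sub_le (f : Sm n) {B : ℝ}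
    (hS : ∀ p : Cyl, 0 ≤ p.1 → ‖pS f.1 p‖ ≤ B) (hT : ∀ p : Cyl, 0 ≤ p.1 → ‖pT f.1 p‖ ≤ B)
    {p q : ℝ × ℝ} (hp : 0 ≤ p.1) (hq : 0 ≤ q.1) :
    ‖f.1 (cover p) - f.1 (cover q)‖ ≤ 2 * B * ‖p - q‖ := by
  have hf := Sm.isSmooth f
  have hconv : Convex ℝ {p : ℝ × ℝ | 0 ≤ p.1} :=
    (convex_Ici (0 : ℝ)).is_linear_preimage (IsLinearMap.mk (fun _ _ => rfl) (fun _ _ => rfl))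
  refine hconv.norm_image_sub_le_of_norm_fderiv_le (𝕜 := ℝ) (f := fun p => f.1 (cover p))
    (fun z _ => hf.differentiable z) (fun z hz => ?_) hq hp
  have hz' : 0 ≤ (cover z).1 := hz
  refine ContinuousLinearMap.opNorm_le_bound _ (by
    have := (norm_nonneg _).trans (hS _ hz'); positivity) fun v => ?_
  rw [hf.fderiv_cover]
  refine (norm_add_le _ _).trans ?_
  rw [norm_smul, norm_smul]
  have h1 := mul_le_mul (norm_fst_le v) (hS _ hz') (norm_nonneg _) (norm_nonneg _)
  have h2 := mul_le_mul (norm_snd_le v) (hT _ hz') (norm_nonneg _) (norm_nonneg _)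
  linarith

theorem memLp_exp {δ δ' : ℝ} (h : δ < δ') :
    MemLp (fun p : Cyl => Real.exp (-(δ' * |p.1|))) 2 (weightedMeasure (Ioi 0) δ) := by
  have hcont : Continuous (fun p : Cyl => Real.exp (-(δ' * |p.1|))) := by fun_prop
  refine ⟨hcont.aestronglyMeasurable, ?_⟩
  have h2 : eLpNorm (fun p : Cyl => Real.exp (-(δ' * |p.1|))) 2
      (weightedMeasure (Ioi 0) δ) ^ 2 < ⊤ := by
    rw [eLpNorm_weighted_sq]
    have hint : IntegrableOn (fun p : Cyl => Real.exp (-(2 * (δ' - δ)) * p.1))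
        (Ioi 0 ×ˢ univ) := by
      have h1 := exp_neg_integrableOn_Ioi 0 (by linarith : 0 < 2 * (δ' - δ))
      have h3 := h1.integrable.comp_fst (volume.restrict (univ : Set UnitAddCircle))
      rw [Measure.prod_restrict] at h3
      exact h3
    refine lt_of_le_of_lt ?_ hint.2
    refine setLIntegral_mono' (measurableSet_Ioi.prod MeasurableSet.univ) fun p hp => ?_
    have hp0 : 0 ≤ p.1 := le_of_lt hp.1
    rw [abs_of_nonneg hp0, Real.enorm_of_nonneg (Real.exp_pos _).le,
      Real.enorm_of_nonneg (Real.exp_pos _).le, ← ENNReal.ofReal_pow (Real.exp_pos _).le,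
      ← ENNReal.ofReal_mul (Real.exp_pos _).le, ← Real.exp_nat_mul, ← Real.exp_add]
    refine ENNReal.ofReal_le_ofReal (Real.exp_le_exp.2 (le_of_eq ?_))
    push_cast
    ring
  by_contra hc
  rw [not_lt, top_le_iff] at hc
  rw [hc] at h2
  simp at h2

/-- The function is compared pointwise with e^{-δ's}, for a weight δ' strictly between δ_m and δ_k.
Beyond s = N the decay of rate δ_k wins by a small factor; up to s = N the function is Lipschitz
with constant controlled by E_k, so a fine finite net of point values suffices. -/
theorem exists_wnorm_le {m k : ℕ} (hmk : m < k) {ε : ℝ} (hε : 0 < ε) :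
    ∃ (t : Finset (ℝ × ℝ)) (C : ℝ), 0 ≤ C ∧ (∀ q ∈ t, 0 ≤ q.1) ∧ ∀ (x : Core n) b M, 0 ≤ M →
      (∀ q ∈ t, ‖(x.2 b).1 (cover q)‖ ≤ M) →
      wnorm (W.δ m) (x.2 b).1 ≤ ε * ‖coreIncl D W k x‖ + C * M := by
  have hδ := W.strictMono hmk
  have hδm := W.pos m
  -- δ' > δ_m makes e^{-δ's} square integrable for the weight δ_m, and δ' < δ_k leaves decay to
  -- spare at infinity.
  set δ' := (W.δ m + W.δ k) / 2 with hδ'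
  set L := (eLpNorm (fun p : Cyl => Real.exp (-(δ' * |p.1|))) 2
    (weightedMeasure (Ioi 0) (W.δ m))).toReal with hL
  have hL0 : 0 ≤ L := ENNReal.toReal_nonneg
  have hmem := memLp_exp (δ := W.δ m) (δ' := δ') (by rw [hδ']; linarith)
  set ε₁ := ε / (L + 1) with hε₁
  have hε₁0 : 0 < ε₁ := by positivity
  obtain ⟨N, hN0, hN⟩ : ∃ N : ℝ, 0 ≤ N ∧ 4 * Real.exp (-((W.δ k - δ') * N)) ≤ ε₁ := by
    have h1 : Filter.Tendsto (fun N : ℝ => 4 * Real.exp (-((W.δ k - δ') * N))) Filter.atTop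
        (𝓝 (4 * 0)) := by
      refine (Real.tendsto_exp_neg_atTop_nhds_zero.comp ?_).const_mul 4
      exact Filter.Tendsto.const_mul_atTop (by rw [hδ']; linarith) Filter.tendsto_id
    rw [mul_zero] at h1
    obtain ⟨N, h2, h3⟩ := ((Filter.eventually_ge_atTop 0).and
      (h1.eventually (gt_mem_nhds hε₁0))).exists
    exact ⟨N, h2, h3.le⟩
  -- On [0,N] the comparison function is at least e^{-δ'N}. The mesh ε₂/8 below is matched to the
  -- Lipschitz constant 2·4‖x‖ of core functions.
  set ε₂ := ε₁ * Real.exp (-(δ' * N)) with hε₂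
  have hε₂0 : 0 < ε₂ := by positivity
  obtain ⟨t, htK, htf, htc⟩ := Metric.finite_approx_of_totallyBounded
    ((isCompact_Icc (a := (0 : ℝ)) (b := N)).prod
      (isCompact_Icc (a := (0 : ℝ)) (b := 1))).totallyBounded (ε₂ / 8) (by positivity)
  refine ⟨htf.toFinset, Real.exp (δ' * N) * (L + 1), by positivity,
    fun q hq => (htK (htf.mem_toFinset.1 hq)).1.1, fun x b M hM0 hM => ?_⟩
  set X := ‖coreIncl D W k x‖ with hX
  have hX0 : 0 ≤ X := norm_nonneg _
  have hexp1 : ∀ p : Cyl, 0 ≤ p.1 → Real.exp (-(W.δ k * p.1)) * (4 * X) ≤ 4 * X := by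
    intro p hp
    refine mul_le_of_le_one_left (by positivity) (Real.exp_le_one_iff.2 ?_)
    have := mul_nonneg (W.pos k).le hp
    linarith
  have hpt : ∀ p : Cyl, 0 < p.1 →
      ‖(x.2 b).1 p‖ ≤ (ε₁ * X + Real.exp (δ' * N) * M) * ‖Real.exp (-(δ' * |p.1|))‖ := by
    intro p hp
    rw [Real.norm_of_nonneg (Real.exp_pos _).le, abs_of_pos hp]
    rcases le_total N p.1 with h | h
    · have h1 := norm_pST_le_coreIncl D W k x b (i := 0) (j := 0) (by omega) hp.le
      rw [pST_zero] at h1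
      have h2 : Real.exp (-(W.δ k * p.1)) ≤
          Real.exp (-((W.δ k - δ') * N)) * Real.exp (-(δ' * p.1)) := by
        rw [← Real.exp_add]
        apply Real.exp_le_exp.2
        have : 0 < W.δ k - δ' := by rw [hδ']; linarith
        nlinarith
      calc ‖(x.2 b).1 p‖ ≤ Real.exp (-(W.δ k * p.1)) * (4 * X) := h1
        _ ≤ (Real.exp (-((W.δ k - δ') * N)) * Real.exp (-(δ' * p.1))) * (4 * X) := by gcongr
        _ = (4 * Real.exp (-((W.δ k - δ') * N))) * X * Real.exp (-(δ' * p.1)) := by ring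
        _ ≤ (ε₁ * X + Real.exp (δ' * N) * M) * Real.exp (-(δ' * p.1)) := by
          gcongr
          have : 4 * Real.exp (-((W.δ k - δ') * N)) * X ≤ ε₁ * X := by gcongr
          have : 0 ≤ Real.exp (δ' * N) * M := by positivity
          linarith
    · obtain ⟨τ, hτ, hτe⟩ : ∃ τ ∈ Icc (0 : ℝ) 1, (τ : UnitAddCircle) = p.2 := by
        have := AddCircle.coe_image_Icc_eq (p := (1 : ℝ)) 0
        obtain ⟨τ, hτ, h⟩ : p.2 ∈ ((↑) : ℝ → UnitAddCircle) '' Icc 0 (0 + 1) := by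
          rw [this]; exact mem_univ _
        exact ⟨τ, by simpa using hτ, h⟩
      obtain ⟨q, hq, hpq⟩ := mem_iUnion₂.1 (htc (show ((p.1, τ) : ℝ × ℝ) ∈ Icc 0 N ×ˢ Icc 0 1 from
        ⟨⟨hp.le, h⟩, hτ⟩))
      rw [Metric.mem_ball, dist_eq_norm] at hpq
      have hcov : cover (p.1, τ) = p := Prod.ext rfl hτe
      have h1 := Sm.norm_sub_le (x.2 b) (B := 4 * X)
        (fun p hp => (norm_pST_le_coreIncl D W k x b (i := 1) (j := 0) (by omega) hp).trans
          (hexp1 p hp))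
        (fun p hp => (norm_pST_le_coreIncl D W k x b (i := 0) (j := 1) (by omega) hp).trans
          (hexp1 p hp)) (p := (p.1, τ)) (q := q) hp.le (htK hq).1.1
      rw [hcov] at h1
      have h2 := hM q (htf.mem_toFinset.2 hq)
      have h3 : ‖(x.2 b).1 p‖ ≤ M + ε₂ * X := by
        have h4 := norm_le_norm_sub_add ((x.2 b).1 p) ((x.2 b).1 (cover q))
        have h5 : 2 * (4 * X) * ‖((p.1, τ) : ℝ × ℝ) - q‖ ≤ 2 * (4 * X) * (ε₂ / 8) := by gcongr
        linarith
      have h6 : 1 ≤ Real.exp (δ' * N) * Real.exp (-(δ' * p.1)) := by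
        rw [← Real.exp_add, Real.one_le_exp_iff]
        have : 0 < δ' := by rw [hδ']; linarith
        nlinarith
      calc ‖(x.2 b).1 p‖ ≤ (M + ε₂ * X) * 1 := by rw [mul_one]; exact h3
        _ ≤ (M + ε₂ * X) * (Real.exp (δ' * N) * Real.exp (-(δ' * p.1))) := by gcongr
        _ = (ε₁ * (Real.exp (-(δ' * N)) * Real.exp (δ' * N)) * X + Real.exp (δ' * N) * M) *
            Real.exp (-(δ' * p.1)) := by rw [hε₂]; ring
        _ = _ := by rw [← Real.exp_add, neg_add_cancel, Real.exp_zero, mul_one]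
  have hle : eLpNorm (x.2 b).1 2 (weightedMeasure (Ioi 0) (W.δ m)) ≤
      ENNReal.ofReal (ε₁ * X + Real.exp (δ' * N) * M) *
        eLpNorm (fun p : Cyl => Real.exp (-(δ' * |p.1|))) 2 (weightedMeasure (Ioi 0) (W.δ m)) := by
    refine eLpNorm_le_mul_eLpNorm_of_ae_le_mul ?_ 2
    filter_upwards [ae_mem_weightedMeasure measurableSet_Ioi (W.δ m)] with p hp using hpt p hp
  have h1 := ENNReal.toReal_mono (ENNReal.mul_ne_top ENNReal.ofReal_ne_top hmem.eLpNorm_ne_top) hle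
  rw [ENNReal.toReal_mul, ENNReal.toReal_ofReal (by positivity), ← hL] at h1
  refine h1.trans ?_
  calc (ε₁ * X + Real.exp (δ' * N) * M) * L ≤ (ε₁ * X + Real.exp (δ' * N) * M) * (L + 1) := by
        gcongr
        linarith
    _ = ε₁ * (L + 1) * X + Real.exp (δ' * N) * (L + 1) * M := by ring
    _ = _ := by rw [hε₁, div_mul_cancel₀ _ (by positivity)]

theorem norm_coreIncl_le_iff_wnorm (m : ℕ) (x : Core n) {r : ℝ} (hr : 0 ≤ r) :
    ‖coreIncl D W m x‖ ≤ r ↔ ‖x.1‖ ≤ r ∧ ∀ b i j, i + j ≤ m + 3 →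
      wnorm (W.δ m) (pST i j (x.2 b).1) ≤ r := by
  rw [norm_coreIncl_le_iff D W m x hr]
  refine and_congr_right fun _ => forall_congr' fun b => forall_congr' fun i =>
    forall_congr' fun j => imp_congr_right fun _ => ?_
  exact ENNReal.le_ofReal_iff_toReal_le (Sm.memLp (x.2 b) i j (W.pos m).le).eLpNorm_ne_top hr

/-- Both gains between the levels are used: the extra derivative for interpolating all derivatives
against the function itself, and the extra weight for bounding the function by finitely many
evaluations. The inequality is proved on the core and extends by density. -/
theorem isCompactOperator_incl {m k : ℕ} (hmk : m < k) :
    IsCompactOperator ((mapScale D n W).incl hmk.le) := by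
  let A : LevelSpace D n W k →L[ℝ] LevelSpace D n W m := (mapScale D n W).incl hmk.le
  change IsCompactOperator A
  refine isCompactOperator_of_le (V := Target n) A fun ε hε => ?_
  have h1 : ∀ a : ℕ × ℕ, ∃ C, 0 ≤ C ∧ (a.1 + a.2 ≤ k + 2 → ∀ (x : Core n) b,
      wnorm (W.δ m) (pST a.1 a.2 (x.2 b).1) ≤
        ε / 2 * ‖coreIncl D W k x‖ + C * wnorm (W.δ m) (x.2 b).1) := by
    intro a
    by_cases ha : a.1 + a.2 ≤ k + 2
    · obtain ⟨C, hC0, hC⟩ := exists_wnorm_pST_le (n := n) D W hmk.le a.1 a.2 ha (half_pos hε)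
      exact ⟨C, hC0, fun _ => hC⟩
    · exact ⟨0, le_rfl, fun h => absurd h ha⟩
  choose C hC0 hC using h1
  set C₁ := ∑ a ∈ Finset.range (m + 4) ×ˢ Finset.range (m + 4), C a with hC₁
  have hC₁0 : 0 ≤ C₁ := Finset.sum_nonneg fun a _ => hC0 a
  obtain ⟨t, C₂, hC₂0, ht, hC₂⟩ := exists_wnorm_le (n := n) D W hmk
    (ε := ε / (2 * (C₁ + 1))) (by positivity)
  -- The finite-rank part: the asymptotic constant and the values of both decaying parts at the
  -- points of the net.
  let φ : LevelSpace D n W k →L[ℝ] (Option (Bool × t) → Target n) :=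
    ContinuousLinearMap.pi fun o => match o with
      | none => nodeEval
      | some (b, q) => decEval b ⟨cover q.1, ht q.1 q.2⟩
  refine ⟨Option (Bool × t), inferInstance, φ, C₁ * C₂ + 1, by positivity, fun u => ?_⟩
  refine (denseRange_coreIncl D W k).induction_on (p := fun u =>
    ‖A u‖ ≤ ε * ‖u‖ + (C₁ * C₂ + 1) * ‖φ u‖) u ?_ fun x => ?_
  · exact isClosed_le (by fun_prop) (by fun_prop)
  · have hA : A (coreIncl D W k x) = coreIncl D W m x := rfl
    rw [hA]
    set M := ‖φ (coreIncl D W k x)‖ with hM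
    have hM0 : 0 ≤ M := norm_nonneg _
    set X := ‖coreIncl D W k x‖ with hX
    have hX0 : 0 ≤ X := norm_nonneg _
    refine (norm_coreIncl_le_iff_wnorm D W m x (by positivity)).2 ⟨?_, fun b i j hij => ?_⟩
    · have h2 := norm_le_pi_norm (φ (coreIncl D W k x)) none
      have h3 : φ (coreIncl D W k x) none = x.1 := coreIncl_node D W k x
      rw [h3] at h2
      have : 0 ≤ C₁ * C₂ * M := by positivity
      have : 0 ≤ ε * X := by positivity
      linarith
    · have h2 : ∀ q ∈ t, ‖(x.2 b).1 (cover q)‖ ≤ M := by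
        intro q hq
        have h3 := norm_le_pi_norm (φ (coreIncl D W k x)) (some (b, ⟨q, hq⟩))
        have h4 : φ (coreIncl D W k x) (some (b, ⟨q, hq⟩)) = (x.2 b).1 (cover q) :=
          dec_coreIncl D W k x b (ht q hq)
        rwa [h4] at h3
      have h3 := hC₂ x b M hM0 h2
      -- Here m < k enters through i + j ≤ m + 3 ≤ k + 2.
      have h4 := hC (i, j) (by simp only; omega) x b
      have h5 : C (i, j) ≤ C₁ :=
        Finset.single_le_sum (f := C) (fun a _ => hC0 a) (by
          simp only [Finset.mem_product, Finset.mem_range]; omega)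
      have hB0 : 0 ≤ wnorm (W.δ m) (x.2 b).1 := ENNReal.toReal_nonneg
      have h6 : C (i, j) * wnorm (W.δ m) (x.2 b).1 ≤
          C₁ * (ε / (2 * (C₁ + 1)) * X + C₂ * M) :=
        mul_le_mul h5 h3 hB0 hC₁0
      have h7 : C₁ * (ε / (2 * (C₁ + 1))) ≤ ε / 2 := by
        rw [mul_div_assoc', div_le_div_iff₀ (by positivity) (by norm_num)]
        nlinarith
      have h8 := mul_le_mul_of_nonneg_right h7 hX0
      simp only at h4
      linarith

theorem isScBanach_mapScale : (mapScale D n W).IsScBanach where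
  complete m := inferInstanceAs (CompleteSpace (LevelSpace D n W m))
  incl_refl _ _ := rfl
  incl_trans _ _ _ := rfl
  injective h := Submodule.inclusion_injective (level_mono D n W h)
  compact h := isCompactOperator_incl D W h
  -- Core elements lie in every level, hence in E_∞.
  dense m := (denseRange_coreIncl D W m).mono (by
    rintro _ ⟨x, rfl⟩ k
    exact ⟨coreIncl D W k x, rfl⟩)

end Ehrling

end GWSplicing

end
noncomputable section

namespace GWSplicing

/-! ### Cut-off, reflection and averaging operators on the core -/

/-- Smooth functions that are constant on `(-∞,-1]` and on `[1,∞)`. -/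
structure Profile where
  toFun : ℝ → ℝ
  lo : ℝ
  hi : ℝ
  smooth : ContDiff ℝ ∞ toFun
  eq_lo : ∀ s ≤ -1, toFun s = lo
  eq_hi : ∀ s, 1 ≤ s → toFun s = hi

namespace Profile

theorem isBoundedSmooth (F : Profile) : IsBoundedSmooth F.toFun :=
  isBoundedSmooth_of_eq F.smooth F.eq_lo F.eq_hi

/-- The derivative of a profile. -/
def deriv (F : Profile) : Profile where
  toFun := _root_.deriv F.toFun
  lo := 0
  hi := 0
  smooth := F.smooth.iterate_deriv 1
  eq_lo := by
    have h : ∀ s ∈ Iio (-1 : ℝ), _root_.deriv F.toFun s = 0 := fun s hs => by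
      have : F.toFun =ᶠ[𝓝 s] fun _ => F.lo := by
        filter_upwards [Iio_mem_nhds hs] with σ hσ using F.eq_lo σ (le_of_lt hσ)
      rw [this.deriv_eq, deriv_const]
    -- The endpoint s = -1 itself follows by continuity of the derivative.
    have h2 := (show EqOn (_root_.deriv F.toFun) (fun _ => 0) (Iio (-1)) from h).closure
      (F.smooth.continuous_deriv (by norm_num)) continuous_const
    rw [closure_Iio] at h2
    exact h2
  eq_hi := by
    have h : ∀ s ∈ Ioi (1 : ℝ), _root_.deriv F.toFun s = 0 := fun s hs => by
      have : F.toFun =ᶠ[𝓝 s] fun _ => F.hi := by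
        filter_upwards [Ioi_mem_nhds hs] with σ hσ using F.eq_hi σ (le_of_lt hσ)
      rw [this.deriv_eq, deriv_const]
    have h2 := (show EqOn (_root_.deriv F.toFun) (fun _ => 0) (Ioi 1) from h).closure
      (F.smooth.continuous_deriv (by norm_num)) continuous_const
    rw [closure_Ioi] at h2
    exact h2

theorem hasDerivAt (F : Profile) (s : ℝ) : HasDerivAt F.toFun (F.deriv.toFun s) s :=
  (F.smooth.differentiable (by norm_num) s).hasDerivAt

end Profile

section Operators

variable {n : ℕ}

/-- Multiplication by `F(s - R/2)`. -/
def mulOp (F : Profile) (R : ℝ) : Sm n →ₗ[ℝ] Sm n where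
  toFun f := ⟨fun p => F.toFun (p.1 - R / 2) • f.1 p, (Sm.isSmooth f).mul_s F.smooth _, by
    obtain ⟨N, hN⟩ := f.2.2
    exact ⟨N, fun p hp => by beta_reduce; rw [hN p hp, smul_zero]⟩⟩
  map_add' f g := Subtype.ext (funext fun p => smul_add _ _ _)
  map_smul' c f := Subtype.ext (funext fun p => smul_comm (F.toFun (p.1 - R / 2)) c (f.1 p))

theorem isSmooth_reflOp (F : Profile) (R : ℝ) (θ : UnitAddCircle) (i j : ℕ) (f : Sm n) :
    IsSmooth (fun p : Cyl => F.toFun (p.1 - R / 2) • pST i j f.1 ((R, θ) - p)) :=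
  (((Sm.isSmooth f).pST i j).reflect (R, θ)).mul_s F.smooth _

/-- The operator `f ↦ F(s - R/2) ∂^{(i,j)}f(R - s, θ - t)`. -/
def reflOp (F : Profile) (hF : F.hi = 0) (i j : ℕ) (R : ℝ) (θ : UnitAddCircle) :
    Sm n →ₗ[ℝ] Sm n where
  toFun f := ⟨fun p => F.toFun (p.1 - R / 2) • pST i j f.1 ((R, θ) - p),
    isSmooth_reflOp F R θ i j f, R / 2 + 1, fun p hp => by
      beta_reduce; rw [F.eq_hi _ (by linarith), hF, zero_smul]⟩
  map_add' f g := Subtype.ext (funext fun p => by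
    have := congrFun ((Sm.isSmooth f).pST_add (Sm.isSmooth g) i j) ((R, θ) - p)
    exact (congrArg _ this).trans (smul_add _ _ _))
  map_smul' c f := Subtype.ext (funext fun p => by
    have := congrFun ((Sm.isSmooth f).pST_smul c i j) ((R, θ) - p)
    exact (congrArg _ this).trans (smul_comm _ _ _))

/-- The operator `v ↦ F(s - R/2) v`. -/
def bumpOp (F : Profile) (hF : F.hi = 0) (R : ℝ) : Target n →ₗ[ℝ] Sm n where
  toFun v := ⟨fun p => F.toFun (p.1 - R / 2) • v, (isSmooth_const v).mul_s F.smooth _, R / 2 + 1,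
    fun p hp => by beta_reduce; rw [F.eq_hi _ (by linarith), hF, zero_smul]⟩
  map_add' v w := Subtype.ext (funext fun p => smul_add _ _ _)
  map_smul' c v := Subtype.ext (funext fun p => smul_comm _ _ _)

theorem integrable_slice {g : Cyl → Target n} (hg : Continuous g) (s : ℝ) :
    Integrable (fun t : UnitAddCircle => g (s, t)) :=
  (hg.comp (by fun_prop : Continuous fun t : UnitAddCircle => (s, t))).integrable_of_hasCompactSupport
    (HasCompactSupport.of_compactSpace _)

/-- The average `½ Σ_b ∫ ∂_s^i f_b(R/2, t) dt`. -/
def avgOp (i : ℕ) (R : ℝ) : Core n →ₗ[ℝ] Target n where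
  toFun x := (1 / 2 : ℝ) • ((∫ t, pST i 0 (x.2 true).1 (R / 2, t)) +
    ∫ t, pST i 0 (x.2 false).1 (R / 2, t))
  map_add' x y := by
    have h : ∀ b, ∫ t, pST i 0 ((x + y).2 b).1 (R / 2, t) =
        (∫ t, pST i 0 (x.2 b).1 (R / 2, t)) + ∫ t, pST i 0 (y.2 b).1 (R / 2, t) := by
      intro b
      rw [← integral_add (integrable_slice ((Sm.isSmooth (x.2 b)).pST i 0).continuous _)
        (integrable_slice ((Sm.isSmooth (y.2 b)).pST i 0).continuous _)]
      congr 1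
      funext t
      exact congrFun ((Sm.isSmooth (x.2 b)).pST_add (Sm.isSmooth (y.2 b)) i 0) (R / 2, t)
    rw [h, h]
    module
  map_smul' c x := by
    have h : ∀ b, ∫ t, pST i 0 ((c • x).2 b).1 (R / 2, t) =
        c • ∫ t, pST i 0 (x.2 b).1 (R / 2, t) := by
      intro b
      rw [← integral_smul]
      congr 1
      funext t
      exact congrFun ((Sm.isSmooth (x.2 b)).pST_smul c i 0) (R / 2, t)
    rw [h, h]
    simp only [RingHom.id_apply]
    module

/-- Operators on the core that depend on a gluing length and a gluing angle. -/
abbrev CoreOp (n : ℕ) : Type := ℝ → UnitAddCircle → Core n →ₗ[ℝ] Core n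

/-- `(c,f) ↦ (0, F(s - R/2) f_b)`. -/
def mulTerm (F : Profile) : CoreOp n := fun R _ =>
  LinearMap.prod 0 (LinearMap.pi fun b => (mulOp F R).comp
    ((LinearMap.proj b).comp (LinearMap.snd ℝ _ _)))

/-- `(c,f) ↦ (0, F(s - R/2) ∂^{(i,j)}f_{¬b}(R - s, θ - t))`. -/
def reflTerm (F : Profile) (hF : F.hi = 0) (i j : ℕ) : CoreOp n := fun R θ =>
  LinearMap.prod 0 (LinearMap.pi fun b => (reflOp F hF i j R θ).comp
    ((LinearMap.proj (!b)).comp (LinearMap.snd ℝ _ _)))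

/-- `(c,f) ↦ (0, F(s - R/2) A_i)`, with the average `A_i`. -/
def avgTerm (F : Profile) (hF : F.hi = 0) (i : ℕ) : CoreOp n := fun R _ =>
  LinearMap.prod 0 (LinearMap.pi fun _ => (bumpOp F hF R).comp (avgOp i R))

/-- `(c,f) ↦ (A_i, 0)`, with the average `A_i`. -/
def nodeTerm (i : ℕ) : CoreOp n := fun R _ => LinearMap.prod (avgOp i R) 0

/-- Evaluations on the core. -/
def coreEv : Option (Bool × Cyl) → Core n → Target n
  | none => fun x => x.1
  | some (b, p) => fun x => (x.2 b).1 p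

theorem coreEv_add (o : Option (Bool × Cyl)) (x y : Core n) :
    coreEv o (x + y) = coreEv o x + coreEv o y := by
  rcases o with _ | ⟨b, p⟩ <;> rfl

theorem coreEv_smul (o : Option (Bool × Cyl)) (c : ℝ) (x : Core n) :
    coreEv o (c • x) = c • coreEv o x := by
  rcases o with _ | ⟨b, p⟩ <;> rfl

theorem coreEv_zero (o : Option (Bool × Cyl)) : coreEv o (0 : Core n) = 0 := by
  rcases o with _ | ⟨b, p⟩ <;> rfl

end Operators

/-! ### Derivatives of the elementary operators in the gluing length and angle. -/

section ParameterDerivatives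

variable {n : ℕ}

/-- The linear map `ℝ² → Y` with partial derivatives `y₁`, `y₂`. -/
def partials₂ {Y : Type} [NormedAddCommGroup Y] [NormedSpace ℝ Y] (y₁ y₂ : Y) : ℝ × ℝ →L[ℝ] Y :=
  (ContinuousLinearMap.fst ℝ ℝ ℝ).smulRight y₁ + (ContinuousLinearMap.snd ℝ ℝ ℝ).smulRight y₂

theorem partials₂_apply {Y : Type} [NormedAddCommGroup Y] [NormedSpace ℝ Y] (y₁ y₂ : Y)
    (v : ℝ × ℝ) : partials₂ y₁ y₂ v = v.1 • y₁ + v.2 • y₂ := by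
  simp [partials₂]

/-- `TR` and `Tθ` are the derivatives of `T` with respect to the gluing length and angle. -/
def HasParamDeriv (T TR Tθ : CoreOp n) : Prop := ∀ (o : Option (Bool × Cyl)) (x : Core n) (R ϑ : ℝ),
  HasFDerivAt (fun z : ℝ × ℝ => coreEv o (T z.1 (z.2 : UnitAddCircle) x))
    (partials₂ (coreEv o (TR R ϑ x)) (coreEv o (Tθ R ϑ x))) (R, ϑ)

theorem HasParamDeriv.add {T TR Tθ S SR Sθ : CoreOp n} (h : HasParamDeriv T TR Tθ)
    (h' : HasParamDeriv S SR Sθ) : HasParamDeriv (fun R θ => T R θ + S R θ)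
      (fun R θ => TR R θ + SR R θ) (fun R θ => Tθ R θ + Sθ R θ) := by
  intro o x R ϑ
  have := (h o x R ϑ).add (h' o x R ϑ)
  simp only [LinearMap.add_apply, coreEv_add]
  refine this.congr_fderiv ?_
  ext v <;> simp [partials₂_apply]

theorem HasParamDeriv.smul (c : ℝ) {T TR Tθ : CoreOp n} (h : HasParamDeriv T TR Tθ) :
    HasParamDeriv (fun R θ => c • T R θ) (fun R θ => c • TR R θ) (fun R θ => c • Tθ R θ) := by
  intro o x R ϑ
  have := (h o x R ϑ).const_smul c
  simp only [LinearMap.smul_apply, coreEv_smul]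
  refine this.congr_fderiv ?_
  ext v <;> simp [partials₂_apply]

theorem hasFDerivAt_profile (F : Profile) (s : ℝ) (z : ℝ × ℝ) :
    HasFDerivAt (fun z : ℝ × ℝ => F.toFun (s - z.1 / 2))
      ((-(1 / 2) * F.deriv.toFun (s - z.1 / 2)) • ContinuousLinearMap.fst ℝ ℝ ℝ) z := by
  have h1 : HasDerivAt (fun R : ℝ => F.toFun (s - R / 2))
      (F.deriv.toFun (s - z.1 / 2) * (-(1 / 2))) z.1 :=
    (F.hasDerivAt _).comp z.1 (((hasDerivAt_id z.1).div_const 2).const_sub s)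
  have h2 := h1.comp_hasFDerivAt z (hasFDerivAt_fst (𝕜 := ℝ) (p := z))
  rw [mul_comm]
  exact h2

theorem hasParamDeriv_mulTerm (F : Profile) :
    HasParamDeriv (mulTerm F : CoreOp n) (fun R θ => (-(1 / 2) : ℝ) • mulTerm F.deriv R θ)
      (fun _ _ => 0) := by
  intro o x R ϑ
  rcases o with _ | ⟨b, p⟩
  · refine (hasFDerivAt_const (0 : Target n) _).congr_fderiv ?_
    ext v <;> simp [partials₂_apply, coreEv, mulTerm]
  · refine ((hasFDerivAt_profile F p.1 (R, ϑ)).smul_const ((x.2 b).1 p)).congr_fderiv ?_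
    refine ContinuousLinearMap.ext fun v => ?_
    rw [partials₂_apply, LinearMap.smul_apply, coreEv_smul, LinearMap.zero_apply, coreEv_zero]
    change (-(1 / 2) * F.deriv.toFun (p.1 - R / 2) * v.1) • (x.2 b).1 p = v.1 • ((-(1 / 2) : ℝ) •
      F.deriv.toFun (p.1 - R / 2) • (x.2 b).1 p) + v.2 • 0
    module

/-- R occurs in the cut-off, with inner derivative -1/2, and in the argument (R - s, ϑ - t), with
inner derivative 1; ϑ occurs only in the argument. Each derivative that falls on the argument raises
the order of f by one, which is why the reflection operators carry the indices i, j from the start.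
-/
theorem hasParamDeriv_reflTerm (F : Profile) (hF : F.hi = 0) (i j : ℕ) :
    HasParamDeriv (reflTerm F hF i j : CoreOp n)
      (fun R θ => (-(1 / 2) : ℝ) • reflTerm F.deriv rfl i j R θ + reflTerm F hF (i + 1) j R θ)
      (reflTerm F hF i (j + 1)) := by
  intro o x R ϑ
  rcases o with _ | ⟨b, p⟩
  · refine (hasFDerivAt_const (0 : Target n) _).congr_fderiv ?_
    ext v <;> simp [partials₂_apply, coreEv, reflTerm]
  · obtain ⟨p, rfl⟩ := cover_surjective p
    have hf := Sm.isSmooth (x.2 (!b))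
    have hg := hf.pST i j
    have h1 : HasFDerivAt (fun z : ℝ × ℝ => pST i j (x.2 (!b)).1 (cover (z - p)))
        (fderiv ℝ (fun p : ℝ × ℝ => pST i j (x.2 (!b)).1 (cover p)) ((R, ϑ) - p)) (R, ϑ) := by
      have := (hg.differentiable ((R, ϑ) - p)).hasFDerivAt.comp (R, ϑ)
        ((hasFDerivAt_id (𝕜 := ℝ) (R, ϑ)).sub_const p)
      exact this
    refine ((hasFDerivAt_profile F p.1 (R, ϑ)).smul h1).congr_fderiv ?_
    refine ContinuousLinearMap.ext fun v => ?_
    rw [partials₂_apply, LinearMap.add_apply, coreEv_add, LinearMap.smul_apply, coreEv_smul]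
    change F.toFun (p.1 - R / 2) • (fderiv ℝ (fun p : ℝ × ℝ => pST i j (x.2 (!b)).1 (cover p))
        ((R, ϑ) - p)) v + (-(1 / 2) * F.deriv.toFun (p.1 - R / 2) * v.1) •
          pST i j (x.2 (!b)).1 (cover ((R, ϑ) - p)) =
      v.1 • ((-(1 / 2) : ℝ) • F.deriv.toFun (p.1 - R / 2) •
        pST i j (x.2 (!b)).1 (cover ((R, ϑ) - p)) +
          F.toFun (p.1 - R / 2) • pST (i + 1) j (x.2 (!b)).1 (cover ((R, ϑ) - p))) +
      v.2 • F.toFun (p.1 - R / 2) • pST i (j + 1) (x.2 (!b)).1 (cover ((R, ϑ) - p))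
    rw [hg.fderiv_cover, pS_pST, hf.pT_pST]
    module

/-- Differentiation under the integral over the compact circle, with a bound for ∂_s g on a compact
neighbourhood. -/
theorem IsSmooth.hasDerivAt_integral {g : Cyl → Target n} (hg : IsSmooth g) (s : ℝ) :
    HasDerivAt (fun s : ℝ => ∫ t : UnitAddCircle, g (s, t))
      (∫ t : UnitAddCircle, GWSplicing.pS g (s, t)) s := by
  obtain ⟨B, hB⟩ := ((isCompact_Icc (a := s - 1) (b := s + 1)).prod
    (isCompact_univ (X := UnitAddCircle))).exists_bound_of_continuousOn
      hg.pS.continuous.continuousOn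
  refine (hasDerivAt_integral_of_dominated_loc_of_deriv_le (bound := fun _ => B)
    (F := fun (s : ℝ) (t : UnitAddCircle) => g (s, t))
    (F' := fun (s : ℝ) (t : UnitAddCircle) => GWSplicing.pS g (s, t))
    (Ioo_mem_nhds (sub_one_lt s) (lt_add_one s))
    (Filter.Eventually.of_forall fun σ => (integrable_slice hg.continuous σ).aestronglyMeasurable)
    (integrable_slice hg.continuous s)
    (integrable_slice hg.pS.continuous s).aestronglyMeasurable
    (Filter.Eventually.of_forall fun t σ hσ => hB (σ, t) ⟨Ioo_subset_Icc_self hσ, mem_univ _⟩)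
    (integrable_const B) (Filter.Eventually.of_forall fun t σ _ => ?_)).2
  obtain ⟨τ, rfl⟩ := QuotientAddGroup.mk_surjective t
  have h1 := hg.hasDerivAt_s (σ, τ)
  rw [← hg.pS_cover] at h1
  exact h1

theorem hasDerivAt_avgOp (i : ℕ) (x : Core n) (R : ℝ) :
    HasDerivAt (fun R => avgOp i R x) ((1 / 2 : ℝ) • avgOp (i + 1) R x) R := by
  have h : ∀ b, HasDerivAt (fun R : ℝ => ∫ t : UnitAddCircle, pST i 0 (x.2 b).1 (R / 2, t))
      ((1 / 2 : ℝ) • ∫ t : UnitAddCircle, pST (i + 1) 0 (x.2 b).1 (R / 2, t)) R := by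
    intro b
    have h1 := ((Sm.isSmooth (x.2 b)).pST i 0).hasDerivAt_integral (R / 2)
    rw [pS_pST] at h1
    exact HasDerivAt.scomp (h := fun R : ℝ => R / 2) R h1 ((hasDerivAt_id R).div_const 2)
  refine (((h true).add (h false)).const_smul (1 / 2 : ℝ)).congr_deriv ?_
  rw [← smul_add]
  rfl

theorem hasFDerivAt_avgOp (i : ℕ) (x : Core n) (z : ℝ × ℝ) :
    HasFDerivAt (fun z : ℝ × ℝ => avgOp i z.1 x)
      (partials₂ ((1 / 2 : ℝ) • avgOp (i + 1) z.1 x) 0) z := by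
  have h := (hasDerivAt_avgOp i x z.1).hasFDerivAt.comp z (hasFDerivAt_fst (𝕜 := ℝ) (p := z))
  refine h.congr_fderiv (ContinuousLinearMap.ext fun v => ?_)
  rw [partials₂_apply]
  simp

theorem hasParamDeriv_nodeTerm (i : ℕ) :
    HasParamDeriv (nodeTerm i : CoreOp n) (fun R θ => (1 / 2 : ℝ) • nodeTerm (i + 1) R θ)
      (fun _ _ => 0) := by
  intro o x R ϑ
  rcases o with _ | ⟨b, p⟩
  · exact hasFDerivAt_avgOp i x (R, ϑ)
  · refine (hasFDerivAt_const (0 : Target n) _).congr_fderiv ?_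
    ext v <;> simp [partials₂_apply, coreEv, nodeTerm]

theorem hasParamDeriv_avgTerm (F : Profile) (hF : F.hi = 0) (i : ℕ) :
    HasParamDeriv (avgTerm F hF i : CoreOp n)
      (fun R θ => (-(1 / 2) : ℝ) • avgTerm F.deriv rfl i R θ + (1 / 2 : ℝ) • avgTerm F hF (i + 1) R θ)
      (fun _ _ => 0) := by
  intro o x R ϑ
  rcases o with _ | ⟨b, p⟩
  · refine (hasFDerivAt_const (0 : Target n) _).congr_fderiv ?_
    ext v <;> simp [partials₂_apply, coreEv, avgTerm]
  · refine ((hasFDerivAt_profile F p.1 (R, ϑ)).smul (hasFDerivAt_avgOp i x (R, ϑ))).congr_fderiv ?_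
    refine ContinuousLinearMap.ext fun v => ?_
    rw [partials₂_apply, LinearMap.add_apply, coreEv_add, LinearMap.smul_apply, coreEv_smul,
      LinearMap.smul_apply, coreEv_smul, LinearMap.zero_apply, coreEv_zero]
    change F.toFun (p.1 - R / 2) • (partials₂ ((1 / 2 : ℝ) • avgOp (i + 1) R x) 0) v +
        (-(1 / 2) * F.deriv.toFun (p.1 - R / 2) * v.1) • avgOp i R x =
      v.1 • ((-(1 / 2) : ℝ) • F.deriv.toFun (p.1 - R / 2) • avgOp i R x +
        (1 / 2 : ℝ) • F.toFun (p.1 - R / 2) • avgOp (i + 1) R x) + v.2 • 0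
    rw [partials₂_apply]
    module

end ParameterDerivatives

end GWSplicing

end
noncomputable section

namespace GWSplicing

/-! ### Exponential bounds -/

section WeightedEstimates

variable {F G : Type} [NormedAddCommGroup F] [NormedAddCommGroup G]

theorem ofReal_exp_mul_enorm_sq (δ : ℝ) {s : ℝ} (hs : 0 < s) (y : F) :
    ENNReal.ofReal (Real.exp (2 * δ * |s|)) * ‖y‖ₑ ^ 2 =
      ENNReal.ofReal (Real.exp (δ * s) * ‖y‖) ^ 2 := by
  rw [← ofReal_norm, ENNReal.ofReal_mul (Real.exp_pos _).le, mul_pow, abs_of_pos hs,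
    ← ENNReal.ofReal_pow (Real.exp_pos _).le, ← Real.exp_nat_mul]
  rw [show 2 * δ * s = ((2 : ℕ) : ℝ) * (δ * s) by push_cast; ring]

theorem eLpNorm_le_of_exp_le {δ δ' K : ℝ} (hK : 0 ≤ K) {f : Cyl → F} {g : Cyl → G}
    (h : ∀ p : Cyl, 0 < p.1 → Real.exp (δ * p.1) * ‖f p‖ ≤ K * (Real.exp (δ' * p.1) * ‖g p‖)) :
    eLpNorm f 2 (weightedMeasure (Ioi 0) δ) ≤
      ENNReal.ofReal K * eLpNorm g 2 (weightedMeasure (Ioi 0) δ') := by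
  rw [← ENNReal.pow_le_pow_left_iff two_ne_zero, mul_pow, eLpNorm_weighted_sq, eLpNorm_weighted_sq,
    ← lintegral_const_mul' _ _ (by finiteness)]
  refine setLIntegral_mono' (measurableSet_Ioi.prod MeasurableSet.univ) fun p hp => ?_
  rw [ofReal_exp_mul_enorm_sq δ hp.1, ofReal_exp_mul_enorm_sq δ' hp.1, ← mul_pow,
    ← ENNReal.ofReal_mul hK]
  exact pow_le_pow_left' (ENNReal.ofReal_le_ofReal (h p hp.1)) 2

/-- A pointwise comparison across the reflection p ↦ q - p suffices, since this map preserves the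
measure. Points whose reflection leaves the half-cylinder are admitted only where f vanishes. -/
theorem eLpNorm_le_of_exp_reflect_le {δ δ' K : ℝ} (hK : 0 ≤ K) (q : Cyl) {f : Cyl → F} {g : Cyl → G}
    (h : ∀ p : Cyl, 0 < p.1 → f p = 0 ∨ (0 < q.1 - p.1 ∧
      Real.exp (δ * p.1) * ‖f p‖ ≤ K * (Real.exp (δ' * (q.1 - p.1)) * ‖g (q - p)‖))) :
    eLpNorm f 2 (weightedMeasure (Ioi 0) δ) ≤
      ENNReal.ofReal K * eLpNorm g 2 (weightedMeasure (Ioi 0) δ') := by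
  rw [← ENNReal.pow_le_pow_left_iff two_ne_zero, mul_pow, eLpNorm_weighted_sq, eLpNorm_weighted_sq,
    ← lintegral_const_mul' _ _ (by finiteness),
    ← lintegral_indicator (measurableSet_Ioi.prod MeasurableSet.univ),
    ← lintegral_indicator (measurableSet_Ioi.prod MeasurableSet.univ),
    ← lintegral_sub_left_eq_self (μ := (volume : Measure Cyl)) (fun p : Cyl =>
      (Ioi (0 : ℝ) ×ˢ (univ : Set UnitAddCircle)).indicator (fun p : Cyl => ENNReal.ofReal K ^ 2 *
        (ENNReal.ofReal (Real.exp (2 * δ' * |p.1|)) * ‖g p‖ₑ ^ 2)) p) q]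
  refine lintegral_mono fun p => ?_
  by_cases hp : 0 < p.1
  · rw [indicator_of_mem (show p ∈ Ioi (0 : ℝ) ×ˢ univ from ⟨hp, mem_univ _⟩)]
    rcases h p hp with h0 | ⟨hq, hle⟩
    · simp [h0]
    · rw [indicator_of_mem (show q - p ∈ Ioi (0 : ℝ) ×ˢ univ from ⟨hq, mem_univ _⟩),
        ofReal_exp_mul_enorm_sq δ hp, ofReal_exp_mul_enorm_sq δ' (show 0 < (q - p).1 from hq),
        ← mul_pow, ← ENNReal.ofReal_mul hK]
      exact pow_le_pow_left' (ENNReal.ofReal_le_ofReal hle) 2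
  · rw [indicator_of_notMem (show p ∉ Ioi (0 : ℝ) ×ˢ univ from fun h => hp h.1)]
    exact zero_le

end WeightedEstimates

/-! ### Weighted bounds for the elementary operators, uniform in the gluing parameters. -/

section TermBounds

variable {n : ℕ} (D : NodedDiskPair) (W : Weights) {m k : ℕ}

theorem pST_const (v : Target n) (i j : ℕ) (p : Cyl) : ‖pST i j (fun _ => v) p‖ ≤ ‖v‖ := by
  have hS : ∀ w : Target n, pS (fun _ : Cyl => w) = fun _ => 0 := fun w => by
    funext p; simp [pS]
  have hT : ∀ w : Target n, pT (fun _ : Cyl => w) = fun _ => 0 := fun w => by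
    funext p; simp [pT]
  have h1 : ∃ w : Target n, pT^[j] (fun _ => v) = (fun _ => w) ∧ ‖w‖ ≤ ‖v‖ := by
    cases j with
    | zero => exact ⟨v, rfl, le_rfl⟩
    | succ j =>
      refine ⟨0, ?_, by simp⟩
      induction j with
      | zero => exact hT v
      | succ j ih => rw [Function.iterate_succ_apply', ih, hT]
  obtain ⟨w, hw, hwv⟩ := h1
  have h2 : ∃ w' : Target n, pS^[i] (fun _ => w) = (fun _ => w') ∧ ‖w'‖ ≤ ‖w‖ := by
    cases i with
    | zero => exact ⟨w, rfl, le_rfl⟩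
    | succ i =>
      refine ⟨0, ?_, by simp⟩
      induction i with
      | zero => exact hS w
      | succ i ih => rw [Function.iterate_succ_apply', ih, hS]
  obtain ⟨w', hw', hwv'⟩ := h2
  rw [pST, hw, hw']
  exact hwv'.trans hwv

/-- The average is taken on the circle s = R/2, where functions in E_k and their derivatives of
order at most k+1 have decayed by e^{-δ_k R/2}. -/
theorem norm_avgOp_le {i : ℕ} (hi : i ≤ k + 1) {R : ℝ} (hR : 0 ≤ R) (x : Core n) :
    ‖avgOp i R x‖ ≤ Real.exp (-(W.δ k * (R / 2))) * (4 * ‖coreIncl D W k x‖) := by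
  set B := Real.exp (-(W.δ k * (R / 2))) * (4 * ‖coreIncl D W k x‖)
  have h : ∀ b, ‖∫ t, pST i 0 (x.2 b).1 (R / 2, t)‖ ≤ B := by
    intro b
    refine (norm_integral_le_of_norm_le_const (μ := (volume : Measure UnitAddCircle)) (C := B)
      (Filter.Eventually.of_forall fun t => ?_)).trans (le_of_eq (by simp [measureReal_def]))
    exact norm_pST_le_coreIncl D W k x b (by omega) (p := (R / 2, t)) (by positivity)
  change ‖(1 / 2 : ℝ) • ((∫ t, pST i 0 (x.2 true).1 (R / 2, t)) +
    ∫ t, pST i 0 (x.2 false).1 (R / 2, t))‖ ≤ B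
  rw [norm_smul]
  have := norm_add_le (∫ t, pST i 0 (x.2 true).1 (R / 2, t)) (∫ t, pST i 0 (x.2 false).1 (R / 2, t))
  have h1 := h true
  have h2 := h false
  rw [Real.norm_of_nonneg (by norm_num : (0 : ℝ) ≤ 1 / 2)]
  linarith

/-- With lower value 0 the cut-off is supported in s ≥ R/2 - 1, and there the weight δ_m is smaller
than the weight δ_k by at least e^{-(δ_k-δ_m)(R/2-1)}. The shift by 1 goes into the constant. -/
theorem exists_mulOp_le (F : Profile) (hlo : F.lo = 0) (hmk : m ≤ k) (i : ℕ) :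
    ∃ C, 0 ≤ C ∧ ∀ (R : ℝ) (x : Core n) b j, i + j ≤ m + 3 →
      eLpNorm (pST i j (mulOp F R (x.2 b)).1) 2 (weightedMeasure (Ioi 0) (W.δ m)) ≤
        ENNReal.ofReal (C * Real.exp (-((W.δ k - W.δ m) * (R / 2))) * ‖coreIncl D W k x‖) := by
  obtain ⟨C, hC0, hC⟩ := exists_norm_pST_mul_s_le (F := Target n) F.isBoundedSmooth i
  have hδ := W.strictMono.monotone hmk
  refine ⟨Real.exp (W.δ k - W.δ m) * C * (i + 1), by positivity, fun R x b j hij => ?_⟩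
  set H : Cyl → ℝ := fun p => ∑ a ∈ Finset.range (i + 1), ‖pST a j (x.2 b).1 p‖
  have hH0 : ∀ p, 0 ≤ H p := fun p => Finset.sum_nonneg fun _ _ => norm_nonneg _
  have hH : eLpNorm H 2 (weightedMeasure (Ioi 0) (W.δ k)) ≤
      (i + 1 : ℕ) * ENNReal.ofReal ‖coreIncl D W k x‖ := by
    have h1 := eLpNorm_le_mul_sum (μ := weightedMeasure (Ioi 0) (W.δ k)) (f := H)
      (Finset.range (i + 1)) (g := fun a => pST a j (x.2 b).1) (C := 1)
      (fun a _ => ((Sm.isSmooth (x.2 b)).pST a j).continuous.aestronglyMeasurable)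
      (Filter.Eventually.of_forall fun p => by rw [one_mul, Real.norm_of_nonneg (hH0 p)])
    rw [ENNReal.ofReal_one, one_mul] at h1
    refine h1.trans ((Finset.sum_le_card_nsmul _ _ (ENNReal.ofReal ‖coreIncl D W k x‖)
      fun a ha => ?_).trans (by simp))
    have := Finset.mem_range.1 ha
    exact eLpNorm_pST_le_coreIncl D W k x b (by omega)
  have key := eLpNorm_le_of_exp_le (δ := W.δ m) (δ' := W.δ k)
    (K := Real.exp (-((W.δ k - W.δ m) * (R / 2 - 1))) * C) (by positivity)
    (f := pST i j (mulOp F R (x.2 b)).1) (g := H) fun p hp => ?_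
  · refine key.trans ((mul_le_mul_right hH _).trans (le_of_eq ?_))
    rw [← ENNReal.ofReal_natCast, ← ENNReal.ofReal_mul (by positivity),
      ← ENNReal.ofReal_mul (by positivity)]
    congr 1
    rw [show -((W.δ k - W.δ m) * (R / 2 - 1)) = -((W.δ k - W.δ m) * (R / 2)) + (W.δ k - W.δ m) by
      ring, Real.exp_add]
    push_cast
    ring
  · rw [Real.norm_of_nonneg (hH0 p)]
    rcases lt_or_ge p.1 (R / 2 - 1) with h | h
    · rw [pST_eq_zero (U := Iio (R / 2 - 1)) isOpen_Iio (fun q hq => ?_) i j p h, norm_zero, mul_zero]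
      · have := hH0 p
        positivity
      · change F.toFun (q.1 - R / 2) • (x.2 b).1 q = 0
        rw [F.eq_lo _ (by linarith [mem_Iio.1 hq]), hlo, zero_smul]
    · have h1 := hC j (R / 2) (x.2 b).1 (Sm.isSmooth (x.2 b)) p
      have h2 : Real.exp (W.δ m * p.1) ≤
          Real.exp (-((W.δ k - W.δ m) * (R / 2 - 1))) * Real.exp (W.δ k * p.1) := by
        rw [← Real.exp_add]
        apply Real.exp_le_exp.2
        nlinarith
      calc _ ≤ (Real.exp (-((W.δ k - W.δ m) * (R / 2 - 1))) * Real.exp (W.δ k * p.1)) *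
            (C * H p) := mul_le_mul h2 h1 (norm_nonneg _) (by positivity)
        _ = _ := by ring

/-- The cut-off lives in |s - R/2| ≤ 1, so s and R - s are both R/2 up to 1: the norm measures
e^{δ_m R/2} while the reflected function has decayed by e^{-δ_k R/2}. R > 2 keeps the reflected
point in the half-cylinder. The i'+j' derivatives inside the operator are paid for by the difference
of the levels. -/
theorem exists_reflOp_le (F : Profile) (hlo : F.lo = 0) (hF : F.hi = 0) {i' j' : ℕ}
    (hmk : m + (i' + j') ≤ k) (i : ℕ) :
    ∃ C, 0 ≤ C ∧ ∀ (R : ℝ) (_ : 2 < R) (θ : UnitAddCircle) (x : Core n) b j, i + j ≤ m + 3 →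
      eLpNorm (pST i j (reflOp F hF i' j' R θ (x.2 b)).1) 2 (weightedMeasure (Ioi 0) (W.δ m)) ≤
        ENNReal.ofReal (C * Real.exp (-((W.δ k - W.δ m) * (R / 2))) * ‖coreIncl D W k x‖) := by
  obtain ⟨C, hC0, hC⟩ := exists_norm_pST_mul_s_le (F := Target n) F.isBoundedSmooth i
  have hδm := W.pos m
  have hδk := W.pos k
  refine ⟨Real.exp (W.δ k + W.δ m) * C * (i + 1), by positivity, fun R hR θ x b j hij => ?_⟩
  have hf := Sm.isSmooth (x.2 b)
  have hg := hf.pST i' j'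
  set H : Cyl → ℝ := fun p => ∑ a ∈ Finset.range (i + 1), ‖pST (a + i') (j + j') (x.2 b).1 p‖
  have hH0 : ∀ p, 0 ≤ H p := fun p => Finset.sum_nonneg fun _ _ => norm_nonneg _
  have hH : eLpNorm H 2 (weightedMeasure (Ioi 0) (W.δ k)) ≤
      (i + 1 : ℕ) * ENNReal.ofReal ‖coreIncl D W k x‖ := by
    have h1 := eLpNorm_le_mul_sum (μ := weightedMeasure (Ioi 0) (W.δ k)) (f := H)
      (Finset.range (i + 1)) (g := fun a => pST (a + i') (j + j') (x.2 b).1) (C := 1)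
      (fun a _ => (hf.pST (a + i') (j + j')).continuous.aestronglyMeasurable)
      (Filter.Eventually.of_forall fun p => by rw [one_mul, Real.norm_of_nonneg (hH0 p)])
    rw [ENNReal.ofReal_one, one_mul] at h1
    refine h1.trans ((Finset.sum_le_card_nsmul _ _ (ENNReal.ofReal ‖coreIncl D W k x‖)
      fun a ha => ?_).trans (by simp))
    have := Finset.mem_range.1 ha
    exact eLpNorm_pST_le_coreIncl D W k x b (by omega)
  have hzero : ∀ p : Cyl, p.1 < R / 2 - 1 ∨ R / 2 + 1 < p.1 →
      pST i j (reflOp F hF i' j' R θ (x.2 b)).1 p = 0 := by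
    rintro p (h | h)
    · refine pST_eq_zero (U := Iio (R / 2 - 1)) isOpen_Iio (fun q hq => ?_) i j p h
      change F.toFun (q.1 - R / 2) • _ = _
      rw [F.eq_lo _ (by linarith [mem_Iio.1 hq]), hlo, zero_smul]
    · refine pST_eq_zero (U := Ioi (R / 2 + 1)) isOpen_Ioi (fun q hq => ?_) i j p h
      change F.toFun (q.1 - R / 2) • _ = _
      rw [F.eq_hi _ (by linarith [mem_Ioi.1 hq]), hF, zero_smul]
  have key := eLpNorm_le_of_exp_reflect_le (δ := W.δ m) (δ' := W.δ k)
    (K := Real.exp (W.δ m * (R / 2 + 1) - W.δ k * (R / 2 - 1)) * C) (by positivity) (R, θ)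
    (f := pST i j (reflOp F hF i' j' R θ (x.2 b)).1) (g := H) fun p hp => ?_
  · refine key.trans ((mul_le_mul_right hH _).trans (le_of_eq ?_))
    rw [← ENNReal.ofReal_natCast, ← ENNReal.ofReal_mul (by positivity),
      ← ENNReal.ofReal_mul (by positivity)]
    congr 1
    rw [show W.δ m * (R / 2 + 1) - W.δ k * (R / 2 - 1) =
      -((W.δ k - W.δ m) * (R / 2)) + (W.δ k + W.δ m) by ring, Real.exp_add]
    push_cast
    ring
  · rw [Real.norm_of_nonneg (hH0 _)]
    rcases lt_or_ge p.1 (R / 2 - 1) with h | h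
    · exact Or.inl (hzero p (Or.inl h))
    rcases lt_or_ge (R / 2 + 1) p.1 with h' | h'
    · exact Or.inl (hzero p (Or.inr h'))
    right
    refine ⟨by simp only; linarith, ?_⟩
    have h1 := hC j (R / 2) (fun p => pST i' j' (x.2 b).1 ((R, θ) - p)) (hg.reflect (R, θ)) p
    have h2 : ∀ a, ‖pST a j (fun p => pST i' j' (x.2 b).1 ((R, θ) - p)) p‖ =
        ‖pST (a + i') (j + j') (x.2 b).1 ((R, θ) - p)‖ := by
      intro a
      rw [hg.pST_reflect, hf.pST_pST, norm_smul]
      simp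
    simp only [h2] at h1
    have h3 : Real.exp (W.δ m * p.1) ≤ Real.exp (W.δ m * (R / 2 + 1) - W.δ k * (R / 2 - 1)) *
        Real.exp (W.δ k * (R - p.1)) := by
      rw [← Real.exp_add]
      apply Real.exp_le_exp.2
      nlinarith
    calc _ ≤ (Real.exp (W.δ m * (R / 2 + 1) - W.δ k * (R / 2 - 1)) *
          Real.exp (W.δ k * (R - p.1))) * (C * H ((R, θ) - p)) :=
          mul_le_mul h3 h1 (norm_nonneg _) (by positivity)
      _ = _ := by ring

/-- A constant cut off near s = R/2 has weighted norm of size e^{δ_m R/2}. This growth is harmless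
because the operator is only applied to averages, which decay like e^{-δ_k R/2}. -/
theorem exists_bumpOp_le (F : Profile) (hF : F.hi = 0) (m i : ℕ) :
    ∃ C, 0 ≤ C ∧ ∀ (R : ℝ) (v : Target n) j,
      eLpNorm (pST i j (bumpOp F hF R v).1) 2 (weightedMeasure (Ioi 0) (W.δ m)) ≤
        ENNReal.ofReal (C * Real.exp (W.δ m * (R / 2)) * ‖v‖) := by
  obtain ⟨C, hC0, hC⟩ := exists_norm_pST_mul_s_le (F := Target n) F.isBoundedSmooth i
  have hδm := W.pos m
  have hmem := memLp_exp (δ := W.δ m) (δ' := 2 * W.δ m) (by linarith)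
  set L := (eLpNorm (fun p : Cyl => Real.exp (-(2 * W.δ m * |p.1|))) 2
    (weightedMeasure (Ioi 0) (W.δ m))).toReal with hL
  have hL0 : 0 ≤ L := ENNReal.toReal_nonneg
  refine ⟨C * (i + 1) * Real.exp (W.δ m * 2) * L, by positivity, fun R v j => ?_⟩
  have hpt : ∀ p, ‖pST i j (bumpOp F hF R v).1 p‖ ≤ C * ((i + 1) * ‖v‖) := by
    intro p
    refine (hC j (R / 2) (fun _ => v) (isSmooth_const v) p).trans ?_
    gcongr
    refine (Finset.sum_le_card_nsmul _ _ ‖v‖ fun a _ => pST_const v a j p).trans (by simp)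
  -- With y = R/2 + 2 - s, the weight e^{δ_m s} equals e^{δ_m(R/2+2)} e^{δ_m y} e^{-2δ_m y}, so the
  -- bump is compared with a reflected exponential. The shift 2 exceeds the support margin 1, so y
  -- stays positive.
  have key := eLpNorm_le_of_exp_reflect_le (δ := W.δ m) (δ' := W.δ m)
    (K := C * ((i + 1) * ‖v‖) * Real.exp (W.δ m * (R / 2 + 2))) (by positivity)
    ((R / 2 + 2, 0) : Cyl)
    (f := pST i j (bumpOp F hF R v).1)
    (g := fun p : Cyl => Real.exp (-(2 * W.δ m * |p.1|))) fun p hp => ?_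
  · refine key.trans (le_of_eq ?_)
    rw [← ENNReal.ofReal_toReal hmem.eLpNorm_ne_top, ← hL, ← ENNReal.ofReal_mul (by positivity)]
    congr 1
    rw [mul_add, Real.exp_add]
    ring
  · rcases lt_or_ge (R / 2 + 1) p.1 with h | h
    · left
      refine pST_eq_zero (U := Ioi (R / 2 + 1)) isOpen_Ioi (fun q hq => ?_) i j p h
      change F.toFun (q.1 - R / 2) • v = 0
      rw [F.eq_hi _ (by linarith [mem_Ioi.1 hq]), hF, zero_smul]
    · have hq : 0 < R / 2 + 2 - p.1 := by linarith
      refine Or.inr ⟨hq, ?_⟩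
      rw [Real.norm_of_nonneg (Real.exp_pos _).le]
      change _ ≤ C * ((i + 1) * ‖v‖) * Real.exp (W.δ m * (R / 2 + 2)) *
        (Real.exp (W.δ m * (R / 2 + 2 - p.1)) * Real.exp (-(2 * W.δ m * |R / 2 + 2 - p.1|)))
      rw [abs_of_pos hq, mul_assoc (C * ((i + 1) * ‖v‖)), ← Real.exp_add, ← Real.exp_add,
        show W.δ m * (R / 2 + 2) + (W.δ m * (R / 2 + 2 - p.1) + -(2 * W.δ m * (R / 2 + 2 - p.1))) =
          W.δ m * p.1 by ring, mul_comm]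
      gcongr
      exact hpt p

end TermBounds

/-! ### The class of neck operators: derivatives, vanishing on core elements, exponential bounds. -/

section Terms

variable {n : ℕ}

/-- Sums of cut-off, reflection and averaging operators that lose `ℓ` derivatives and are supported
in the neck. -/
inductive IsTerm : ℕ → CoreOp n → Prop
  | mul (ℓ : ℕ) (F : Profile) (hlo : F.lo = 0) : IsTerm ℓ (mulTerm F)
  | refl {ℓ i j : ℕ} (F : Profile) (hlo : F.lo = 0) (hF : F.hi = 0) (h : i + j ≤ ℓ) :
      IsTerm ℓ (reflTerm F hF i j)
  | avg {ℓ i : ℕ} (F : Profile) (hF : F.hi = 0) (h : i ≤ ℓ) : IsTerm ℓ (avgTerm F hF i)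
  | node {ℓ i : ℕ} (h : i ≤ ℓ) : IsTerm ℓ (nodeTerm i)
  | zero (ℓ : ℕ) : IsTerm ℓ (fun _ _ => 0)
  | add {ℓ : ℕ} {T S : CoreOp n} (hT : IsTerm ℓ T) (hS : IsTerm ℓ S) :
      IsTerm ℓ (fun R θ => T R θ + S R θ)
  | smul {ℓ : ℕ} (c : ℝ) {T : CoreOp n} (hT : IsTerm ℓ T) : IsTerm ℓ (fun R θ => c • T R θ)

theorem IsTerm.exists_deriv {ℓ : ℕ} {T : CoreOp n} (h : IsTerm ℓ T) :
    ∃ TR Tθ, IsTerm (ℓ + 1) TR ∧ IsTerm (ℓ + 1) Tθ ∧ HasParamDeriv T TR Tθ := by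
  induction h with
  | mul F hlo => exact ⟨_, _, (IsTerm.mul _ F.deriv rfl).smul _, .zero _, hasParamDeriv_mulTerm F⟩
  | refl F hlo hF h =>
    exact ⟨_, _, ((IsTerm.refl F.deriv rfl rfl (h.trans (Nat.le_succ _))).smul _).add
      (.refl F hlo hF (by omega)), .refl F hlo hF (by omega), hasParamDeriv_reflTerm F hF _ _⟩
  | avg F hF h =>
    exact ⟨_, _, ((IsTerm.avg F.deriv rfl (h.trans (Nat.le_succ _))).smul _).add
      ((IsTerm.avg F hF (Nat.succ_le_succ h)).smul _), .zero _, hasParamDeriv_avgTerm F hF _⟩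
  | node h => exact ⟨_, _, (IsTerm.node (Nat.succ_le_succ h)).smul _, .zero _,
      hasParamDeriv_nodeTerm _⟩
  | zero =>
    refine ⟨_, _, .zero _, .zero _, fun o x R ϑ => ?_⟩
    refine (hasFDerivAt_const (coreEv o (0 : Core n)) _).congr_fderiv ?_
    ext v <;> simp [partials₂_apply, coreEv_zero]
  | add _ _ hT hS =>
    obtain ⟨TR, Tθ, h1, h2, h3⟩ := hT
    obtain ⟨SR, Sθ, h1', h2', h3'⟩ := hS
    exact ⟨_, _, h1.add h1', h2.add h2', h3.add h3'⟩
  | smul c _ hT =>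
    obtain ⟨TR, Tθ, h1, h2, h3⟩ := hT
    exact ⟨_, _, h1.smul c, h2.smul c, h3.smul c⟩

theorem avgOp_eq_zero {x : Core n} {N : ℝ} (hN : ∀ b i j (p : Cyl), N ≤ p.1 → pST i j (x.2 b).1 p = 0)
    (i : ℕ) {R : ℝ} (hR : N ≤ R / 2) : avgOp i R x = 0 := by
  change (1 / 2 : ℝ) • ((∫ t, pST i 0 (x.2 true).1 (R / 2, t)) +
    ∫ t, pST i 0 (x.2 false).1 (R / 2, t)) = 0
  simp [hN _ _ _ (R / 2, _) hR]

/-- A core element vanishes beyond some s = M, and every term involves its values only at s ≥ R/2 -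
1. On a fixed core element the families are therefore zero near a = 0, which makes differentiability
at a = 0 trivial there. -/
theorem IsTerm.eventually_zero {ℓ : ℕ} {T : CoreOp n} (h : IsTerm ℓ T) (x : Core n) :
    ∃ N : ℝ, ∀ R, N ≤ R → ∀ θ, T R θ x = 0 := by
  obtain ⟨M, hM⟩ : ∃ M : ℝ, ∀ b i j (p : Cyl), M ≤ p.1 → pST i j (x.2 b).1 p = 0 := by
    obtain ⟨N₁, -, h₁⟩ := Sm.exists_pST_eq_zero (x.2 true)
    obtain ⟨N₂, -, h₂⟩ := Sm.exists_pST_eq_zero (x.2 false)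
    refine ⟨max N₁ N₂, fun b i j p hp => ?_⟩
    cases b
    · exact h₂ i j p ((le_max_right _ _).trans hp)
    · exact h₁ i j p ((le_max_left _ _).trans hp)
  induction h with
  | mul F hlo =>
    refine ⟨2 * (M + 1), fun R hR θ => Prod.ext rfl (funext fun b => Subtype.ext (funext fun p => ?_))⟩
    change F.toFun (p.1 - R / 2) • (x.2 b).1 p = 0
    rcases le_total M p.1 with hp | hp
    · rw [show (x.2 b).1 p = 0 from hM b 0 0 p hp, smul_zero]
    · rw [F.eq_lo _ (by linarith), hlo, zero_smul]
  | refl F hlo hF h =>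
    refine ⟨2 * (M + 1), fun R hR θ => Prod.ext rfl (funext fun b => Subtype.ext (funext fun p => ?_))⟩
    change F.toFun (p.1 - R / 2) • pST _ _ (x.2 (!b)).1 ((R, θ) - p) = 0
    rcases le_total M (R - p.1) with hp | hp
    · rw [hM (!b) _ _ ((R, θ) - p) hp, smul_zero]
    · rw [F.eq_hi _ (by linarith), hF, zero_smul]
  | avg F hF h =>
    refine ⟨2 * M, fun R hR θ => Prod.ext rfl (funext fun b => Subtype.ext (funext fun p => ?_))⟩
    change F.toFun (p.1 - R / 2) • avgOp _ R x = 0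
    rw [avgOp_eq_zero hM _ (by linarith), smul_zero]
  | node h =>
    refine ⟨2 * M, fun R hR θ => Prod.ext ?_ rfl⟩
    exact avgOp_eq_zero hM _ (by linarith)
  | zero => exact ⟨0, fun _ _ _ => rfl⟩
  | add _ _ hT hS =>
    obtain ⟨N₁, h₁⟩ := hT
    obtain ⟨N₂, h₂⟩ := hS
    refine ⟨max N₁ N₂, fun R hR θ => ?_⟩
    rw [LinearMap.add_apply, h₁ R ((le_max_left _ _).trans hR),
      h₂ R ((le_max_right _ _).trans hR), add_zero]
  | smul c _ hT =>
    obtain ⟨N₁, h₁⟩ := hT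
    exact ⟨N₁, fun R hR θ => by rw [LinearMap.smul_apply, h₁ R hR, smul_zero]⟩

variable (D : NodedDiskPair) (W : Weights)

/-- Only finitely many orders enter a level norm, so constants that depend on the order can be
replaced by their sum. -/
theorem exists_forall_le_of_forall_exists {P : ℕ → ℝ → Prop} (N : ℕ)
    (hmono : ∀ i C C', C ≤ C' → P i C → P i C') (h : ∀ i, ∃ C, 0 ≤ C ∧ P i C) :
    ∃ C, 0 ≤ C ∧ ∀ i ≤ N, P i C := by
  choose C hC0 hC using h
  refine ⟨∑ i ∈ Finset.range (N + 1), C i, Finset.sum_nonneg fun i _ => hC0 i, fun i hi => ?_⟩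
  exact hmono i _ _ (Finset.single_le_sum (f := C) (fun i _ => hC0 i)
    (Finset.mem_range.2 (by omega))) (hC i)

/-- Each kind of term gains e^{-(δ_k-δ_m)R/2}. For averages this is the growth e^{δ_m R/2} of the
bump against the decay e^{-δ_k R/2} of the average, so their cut-offs need not vanish at the lower
end. For k = m the bound degenerates to uniform boundedness, which is what the projections
themselves need. -/
theorem IsTerm.exists_bound {ℓ : ℕ} {T : CoreOp n} (h : IsTerm ℓ T) {m k : ℕ} (hmk : m + ℓ ≤ k) :
    ∃ C, 0 ≤ C ∧ ∀ R, 2 < R → ∀ θ x, ‖coreIncl D W m (T R θ x)‖ ≤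
      C * Real.exp (-((W.δ k - W.δ m) * (R / 2))) * ‖coreIncl D W k x‖ := by
  have mono : ∀ {C C' : ℝ} (R : ℝ) (x : Core n), C ≤ C' →
      C * Real.exp (-((W.δ k - W.δ m) * (R / 2))) * ‖coreIncl D W k x‖ ≤
      C' * Real.exp (-((W.δ k - W.δ m) * (R / 2))) * ‖coreIncl D W k x‖ := fun R x h => by gcongr
  have havg : ∀ i, i ≤ k → ∀ R, 2 < R → ∀ x : Core n,
      Real.exp (W.δ m * (R / 2)) * ‖avgOp i R x‖ ≤
        4 * Real.exp (-((W.δ k - W.δ m) * (R / 2))) * ‖coreIncl D W k x‖ := by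
    intro i hi R hR x
    have h1 := norm_avgOp_le D W (k := k) (i := i) (by omega) (by linarith : 0 ≤ R) x
    refine (mul_le_mul_of_nonneg_left h1 (Real.exp_pos _).le).trans (le_of_eq ?_)
    rw [← mul_assoc, ← Real.exp_add]
    rw [show W.δ m * (R / 2) + -(W.δ k * (R / 2)) = -((W.δ k - W.δ m) * (R / 2)) by ring]
    ring
  induction h with
  | mul F hlo =>
    obtain ⟨C, hC0, hC⟩ := exists_forall_le_of_forall_exists (m + 3)
      (P := fun i C => ∀ (R : ℝ) (x : Core n) b j, i + j ≤ m + 3 →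
      eLpNorm (pST i j (mulOp F R (x.2 b)).1) 2 (weightedMeasure (Ioi 0) (W.δ m)) ≤
        ENNReal.ofReal (C * Real.exp (-((W.δ k - W.δ m) * (R / 2))) * ‖coreIncl D W k x‖))
      (fun i C C' hCC h R x b j hij => (h R x b j hij).trans (ENNReal.ofReal_le_ofReal (mono R x hCC)))
      (exists_mulOp_le D W F hlo (by omega))
    refine ⟨C, hC0, fun R hR θ x => (norm_coreIncl_le_iff D W m _ (by positivity)).2
      ⟨?_, fun b i j hij => hC i (by omega) R x b j hij⟩⟩
    rw [show (mulTerm F R θ x).1 = 0 from rfl, norm_zero]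
    positivity
  | @refl i' j' F hlo hF h =>
    obtain ⟨C, hC0, hC⟩ := exists_forall_le_of_forall_exists (m + 3)
      (P := fun i C => ∀ (R : ℝ) (_ : 2 < R) (θ : UnitAddCircle) (x : Core n) b j, i + j ≤ m + 3 →
      eLpNorm (pST i j (reflOp F hF i' j' R θ (x.2 b)).1) 2 (weightedMeasure (Ioi 0) (W.δ m)) ≤
        ENNReal.ofReal (C * Real.exp (-((W.δ k - W.δ m) * (R / 2))) * ‖coreIncl D W k x‖))
      (fun i C C' hCC h R hR θ x b j hij =>
        (h R hR θ x b j hij).trans (ENNReal.ofReal_le_ofReal (mono R x hCC)))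
      (exists_reflOp_le D W F hlo hF (by omega))
    refine ⟨C, hC0, fun R hR θ x => (norm_coreIncl_le_iff D W m _ (by positivity)).2
      ⟨?_, fun b i j hij => hC i (by omega) R hR θ x (!b) j hij⟩⟩
    rw [show (reflTerm F hF i' j' R θ x).1 = 0 from rfl, norm_zero]
    positivity
  | @avg i' F hF h =>
    obtain ⟨C, hC0, hC⟩ := exists_forall_le_of_forall_exists (m + 3)
      (P := fun i C => ∀ (R : ℝ) (v : Target n) j,
      eLpNorm (pST i j (bumpOp F hF R v).1) 2 (weightedMeasure (Ioi 0) (W.δ m)) ≤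
        ENNReal.ofReal (C * Real.exp (W.δ m * (R / 2)) * ‖v‖))
      (fun i C C' hCC h R v j => (h R v j).trans (ENNReal.ofReal_le_ofReal (by gcongr)))
      (exists_bumpOp_le W F hF m)
    refine ⟨C * 4, by positivity, fun R hR θ x =>
      (norm_coreIncl_le_iff D W m _ (by positivity)).2
      ⟨?_, fun b i j hij => (hC i (by omega) R (avgOp i' R x) j).trans
        (ENNReal.ofReal_le_ofReal ?_)⟩⟩
    · rw [show (avgTerm F hF i' R θ x).1 = 0 from rfl, norm_zero]
      positivity
    · have := mul_le_mul_of_nonneg_left (havg i' (by omega) R hR x) hC0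
      linarith
  | @node i' h =>
    refine ⟨4, by norm_num, fun R hR θ x => (norm_coreIncl_le_iff D W m _ (by positivity)).2
      ⟨?_, fun b i j hij => ?_⟩⟩
    · refine le_trans ?_ (havg i' (by omega) R hR x)
      refine le_mul_of_one_le_left (norm_nonneg _) (Real.one_le_exp ?_)
      have := (W.pos m).le
      positivity
    · have h0 : ∀ p, pST i j ((nodeTerm i' R θ x).2 b).1 p = 0 := fun p =>
        pST_eq_zero (U := univ) isOpen_univ (fun _ _ => rfl) i j p (mem_univ _)
      rw [show pST i j ((nodeTerm i' R θ x).2 b).1 = 0 from funext h0, eLpNorm_zero]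
      exact zero_le
  | zero => exact ⟨0, le_rfl, fun R hR θ x => by simp⟩
  | add _ _ hT hS =>
    obtain ⟨C₁, h₁0, h₁⟩ := hT
    obtain ⟨C₂, h₂0, h₂⟩ := hS
    refine ⟨C₁ + C₂, by positivity, fun R hR θ x => ?_⟩
    rw [LinearMap.add_apply, map_add]
    refine (norm_add_le _ _).trans ?_
    linarith [h₁ R hR θ x, h₂ R hR θ x]
  | smul c _ hT =>
    obtain ⟨C₁, h₁0, h₁⟩ := hT
    refine ⟨|c| * C₁, by positivity, fun R hR θ x => ?_⟩
    rw [LinearMap.smul_apply, map_smul, norm_smul, Real.norm_eq_abs]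
    have := mul_le_mul_of_nonneg_left (h₁ R hR θ x) (abs_nonneg c)
    linarith

end Terms

end GWSplicing

end
noncomputable section

namespace GWSplicing

/-! ### Coefficients of exponential growth in the gluing parameter -/

section Coefficients

/-- The algebra of functions generated by `Re a`, `Im a`, `1/|a|` and `e^{1/|a|}`. -/
inductive IsModerate : (ℂ → ℝ) → Prop
  | const (r : ℝ) : IsModerate fun _ => r
  | re : IsModerate fun a => a.re
  | im : IsModerate fun a => a.im
  | inv : IsModerate fun a => ‖a‖⁻¹
  | exp : IsModerate fun a => Real.exp ‖a‖⁻¹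
  | add {c d : ℂ → ℝ} (hc : IsModerate c) (hd : IsModerate d) : IsModerate fun a => c a + d a
  | mul {c d : ℂ → ℝ} (hc : IsModerate c) (hd : IsModerate d) : IsModerate fun a => c a * d a

theorem hasFDerivAt_norm_inv {a : ℂ} (ha : a ≠ 0) : HasFDerivAt (fun a : ℂ => ‖a‖⁻¹)
    (partials (-1 * (a.re * (‖a‖⁻¹ * (‖a‖⁻¹ * ‖a‖⁻¹)))) (-1 * (a.im * (‖a‖⁻¹ * (‖a‖⁻¹ * ‖a‖⁻¹))))) a := by
  have h1 : HasFDerivAt (fun a : ℂ => ‖a‖ ^ 2) (partials (2 * a.re) (2 * a.im)) a := by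
    have h := (Complex.reCLM.hasFDerivAt (x := a)).pow 2
    have h' := (Complex.imCLM.hasFDerivAt (x := a)).pow 2
    refine ((h.add h').congr_of_eventuallyEq (Filter.Eventually.of_forall fun z => ?_)).congr_fderiv ?_
    · rw [Complex.sq_norm, Complex.normSq_apply]
      simp [sq]
    · refine ContinuousLinearMap.ext fun v => ?_
      rw [partials_apply]
      simp
      ring
  have hr : 0 < ‖a‖ := norm_pos_iff.2 ha
  have h2 := (h1.sqrt (by positivity)).congr_of_eventuallyEq
    (Filter.Eventually.of_forall fun z : ℂ => (Real.sqrt_sq (norm_nonneg z)).symm)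
  rw [Real.sqrt_sq hr.le] at h2
  refine ((hasDerivAt_inv hr.ne').comp_hasFDerivAt a h2).congr_fderiv
    (ContinuousLinearMap.ext fun v => ?_)
  rw [partials_apply]
  simp [partials_apply]
  field_simp
  ring

/-- The algebra is closed under partial derivatives because those of 1/|a| are -Re(a)/|a|³ and
-Im(a)/|a|³. -/
theorem IsModerate.exists_deriv {c : ℂ → ℝ} (h : IsModerate c) :
    ∃ cx cy, IsModerate cx ∧ IsModerate cy ∧
      ∀ a ≠ 0, HasFDerivAt c (partials (cx a) (cy a)) a := by
  have hinv : ∀ {d : ℂ → ℝ}, IsModerate d →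
      IsModerate fun a => -1 * (d a * (‖a‖⁻¹ * (‖a‖⁻¹ * ‖a‖⁻¹))) := fun hd =>
    (IsModerate.const (-1)).mul (hd.mul (IsModerate.inv.mul (IsModerate.inv.mul .inv)))
  induction h with
  | const r =>
    refine ⟨_, _, .const 0, .const 0, fun a _ => (hasFDerivAt_const r a).congr_fderiv ?_⟩
    ext v
    all_goals simp [partials_apply]
  | re =>
    refine ⟨_, _, .const 1, .const 0, fun a _ => (Complex.reCLM.hasFDerivAt (x := a)).congr_fderiv ?_⟩
    ext v
    all_goals simp [partials_apply]
  | im =>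
    refine ⟨_, _, .const 0, .const 1, fun a _ => (Complex.imCLM.hasFDerivAt (x := a)).congr_fderiv ?_⟩
    ext v
    all_goals simp [partials_apply]
  | inv => exact ⟨_, _, hinv .re, hinv .im, fun a ha => hasFDerivAt_norm_inv ha⟩
  | exp =>
    refine ⟨_, _, IsModerate.exp.mul (hinv .re), IsModerate.exp.mul (hinv .im), fun a ha =>
      (hasFDerivAt_norm_inv ha).exp.congr_fderiv (ContinuousLinearMap.ext fun v => ?_)⟩
    rw [_root_.smul_apply, partials_apply, partials_apply]
    simp only [smul_eq_mul]
    ring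
  | add _ _ hc hd =>
    obtain ⟨cx, cy, h1, h2, h3⟩ := hc
    obtain ⟨dx, dy, h1', h2', h3'⟩ := hd
    refine ⟨_, _, h1.add h1', h2.add h2', fun a ha => ((h3 a ha).add (h3' a ha)).congr_fderiv
      (ContinuousLinearMap.ext fun v => ?_)⟩
    rw [_root_.add_apply, partials_apply, partials_apply, partials_apply]
    simp only [smul_eq_mul]
    ring
  | @mul c d hcm hdm hc hd =>
    obtain ⟨cx, cy, h1, h2, h3⟩ := hc
    obtain ⟨dx, dy, h1', h2', h3'⟩ := hd
    refine ⟨_, _, (hcm.mul h1').add (hdm.mul h1), (hcm.mul h2').add (hdm.mul h2), fun a ha =>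
      ((h3 a ha).mul (h3' a ha)).congr_fderiv (ContinuousLinearMap.ext fun v => ?_)⟩
    rw [_root_.add_apply, _root_.smul_apply, _root_.smul_apply, partials_apply, partials_apply,
      partials_apply]
    simp only [smul_eq_mul]
    ring

theorem IsModerate.exists_bound {c : ℂ → ℝ} (h : IsModerate c) :
    ∃ C N : ℝ, 0 ≤ C ∧ 0 ≤ N ∧ ∀ a ≠ 0, ‖a‖ ≤ 1 → |c a| ≤ C * Real.exp (N * ‖a‖⁻¹) := by
  induction h with
  | const r => exact ⟨|r|, 0, abs_nonneg r, le_rfl, fun a _ _ => by simp⟩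
  | re => exact ⟨1, 0, zero_le_one, le_rfl, fun a _ ha => by
      simpa using (Complex.abs_re_le_norm a).trans ha⟩
  | im => exact ⟨1, 0, zero_le_one, le_rfl, fun a _ ha => by
      simpa using (Complex.abs_im_le_norm a).trans ha⟩
  | inv =>
    refine ⟨1, 1, zero_le_one, zero_le_one, fun a _ _ => ?_⟩
    rw [abs_of_nonneg (by positivity), one_mul, one_mul]
    linarith [Real.add_one_le_exp ‖a‖⁻¹]
  | exp => exact ⟨1, 1, zero_le_one, zero_le_one, fun a _ _ => by simp⟩
  | add _ _ hc hd =>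
    obtain ⟨C₁, N₁, hC₁, hN₁, h₁⟩ := hc
    obtain ⟨C₂, N₂, hC₂, hN₂, h₂⟩ := hd
    refine ⟨C₁ + C₂, N₁ + N₂, by positivity, by positivity, fun a ha ha' => ?_⟩
    have hr := inv_nonneg.2 (norm_nonneg a)
    have e₁ : C₁ * Real.exp (N₁ * ‖a‖⁻¹) ≤ C₁ * Real.exp ((N₁ + N₂) * ‖a‖⁻¹) := by
      gcongr; linarith
    have e₂ : C₂ * Real.exp (N₂ * ‖a‖⁻¹) ≤ C₂ * Real.exp ((N₁ + N₂) * ‖a‖⁻¹) := by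
      gcongr; linarith
    rw [add_mul]
    exact (abs_add_le _ _).trans (add_le_add ((h₁ a ha ha').trans e₁) ((h₂ a ha ha').trans e₂))
  | mul _ _ hc hd =>
    obtain ⟨C₁, N₁, hC₁, hN₁, h₁⟩ := hc
    obtain ⟨C₂, N₂, hC₂, hN₂, h₂⟩ := hd
    refine ⟨C₁ * C₂, N₁ + N₂, by positivity, by positivity, fun a ha ha' => ?_⟩
    rw [abs_mul, add_mul, Real.exp_add]
    refine (mul_le_mul (h₁ a ha ha') (h₂ a ha ha') (abs_nonneg _) (by positivity)).trans
      (le_of_eq (by ring))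

theorem isModerate_gluingLength : IsModerate gluingLength := by
  have h := IsModerate.exp.add (.const (-Real.exp 1))
  convert h using 2 with a
  rw [gluingLength, one_div, sub_eq_add_neg]

theorem tendsto_gluingLength : Filter.Tendsto gluingLength (𝓝[≠] 0) Filter.atTop := by
  have h1 : Filter.Tendsto (fun a : ℂ => 1 / ‖a‖) (𝓝[≠] 0) Filter.atTop := by
    simp only [one_div]
    exact tendsto_norm_nhdsNE_zero.inv_tendsto_nhdsGT_zero
  exact Filter.tendsto_atTop_add_const_right _ _ (Real.tendsto_exp_atTop.comp h1)

/-- R > 2 keeps the neck [R/2-1, R/2+1] inside (0,R). The radius 5/9 is chosen slightly above 1/2 so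
that one open disk covers the closed disk |a| ≤ 1/2. -/
theorem two_lt_gluingLength {a : ℂ} (h0 : a ≠ 0) (ha : a ∈ Metric.ball (0 : ℂ) (5 / 9)) :
    2 < gluingLength a := by
  have hr : 0 < ‖a‖ := norm_pos_iff.2 h0
  have h1 : (9 / 5 : ℝ) ≤ 1 / ‖a‖ := by
    rw [le_div_iff₀ hr]
    linarith [mem_ball_zero_iff.1 ha]
  have h2 : Real.exp (9 / 5) ≤ Real.exp (1 / ‖a‖) := Real.exp_le_exp.2 h1
  have h3 : Real.exp (9 / 5) = Real.exp 1 * Real.exp (4 / 5) := by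
    rw [← Real.exp_add]; norm_num
  -- This gives e^{4/5} ≥ 2.12, hence R ≥ e·(2.12 - 1) > 2.
  have h4 := Real.quadratic_le_exp_of_nonneg (x := 4 / 5) (by norm_num)
  have h5 := Real.exp_one_gt_d9
  rw [gluingLength]
  nlinarith

/-- This is where the exponential gluing profile is used. With z = 1/|a| the exponent is Nz - κ(e^z
- e)/2; since e^z ≥ z²/2, it is at most Nz - κz²/4 + κe/2, and completing the square gives the
constant. -/
theorem exp_mul_exp_gluingLength_le {N κ : ℝ} (hκ : 0 < κ) (a : ℂ) :
    Real.exp (N * ‖a‖⁻¹) * Real.exp (-(κ * (gluingLength a / 2))) ≤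
      Real.exp (N ^ 2 / κ + κ * Real.exp 1 / 2) := by
  rw [← Real.exp_add]
  apply Real.exp_le_exp.2
  have h1 := Real.quadratic_le_exp_of_nonneg (x := ‖a‖⁻¹) (by positivity)
  have h0 : 0 ≤ ‖a‖⁻¹ := by positivity
  rw [gluingLength, one_div]
  set z := ‖a‖⁻¹
  have h2 : N * z - κ * z ^ 2 / 4 ≤ N ^ 2 / κ := by
    rw [le_div_iff₀ hκ]
    nlinarith [sq_nonneg (κ * z / 2 - N)]
  nlinarith

/-- The angle has no global real lift, but near a₀ it is lifted by arg a₀ + Im log(a/a₀), with the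
logarithm near 1, divided by -2π. The partial derivatives do not depend on the local choice and are
globally given moderate functions. -/
theorem exists_gluingAngle_lift : ∃ tx ty, IsModerate tx ∧ IsModerate ty ∧
    ∀ a₀ : ℂ, a₀ ≠ 0 → ∃ φ : ℂ → ℝ,
      (∀ᶠ a in 𝓝 a₀, gluingAngle a = (φ a : UnitAddCircle)) ∧
      HasFDerivAt φ (partials (tx a₀) (ty a₀)) a₀ := by
  refine ⟨_, _, (IsModerate.const (2 * Real.pi)⁻¹).mul (IsModerate.im.mul (IsModerate.inv.mul .inv)),
    (IsModerate.const (-(2 * Real.pi)⁻¹)).mul (IsModerate.re.mul (IsModerate.inv.mul .inv)),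
    fun a₀ h0 => ⟨fun a => -((Complex.arg a₀ + (Complex.log (a / a₀)).im) / (2 * Real.pi)), ?_, ?_⟩⟩
  · filter_upwards [isOpen_ne.mem_nhds h0] with a ha
    have h1 := Complex.arg_mul_coe_angle h0 (div_ne_zero ha h0)
    rw [mul_div_cancel₀ _ h0, ← Real.Angle.coe_add, Real.Angle.angle_eq_iff_two_pi_dvd_sub] at h1
    obtain ⟨k, hk⟩ := h1
    rw [gluingAngle, Complex.log_im, QuotientAddGroup.eq, AddSubgroup.mem_zmultiples_iff]
    refine ⟨k, ?_⟩
    have := Real.pi_ne_zero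
    field_simp
    simp only [zsmul_eq_mul, mul_one]
    linarith
  · have h1 : HasDerivAt (fun a : ℂ => Complex.log (a / a₀)) (1 / a₀) a₀ := by
      have := ((hasDerivAt_id a₀).div_const a₀).clog (by simp [h0])
      simpa [h0] using this
    have h2 := Complex.imCLM.hasFDerivAt.comp a₀ (h1.hasFDerivAt.restrictScalars ℝ)
    have h3 := ((h2.const_add (Complex.arg a₀)).mul_const (2 * Real.pi)⁻¹).neg
    refine (h3.congr_of_eventuallyEq (Filter.Eventually.of_forall fun a => rfl)).congr_fderiv
      (ContinuousLinearMap.ext fun v => ?_)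
    rw [partials_apply]
    simp [Complex.mul_im, Complex.inv_re, Complex.inv_im, Complex.normSq_eq_norm_sq]
    have : ‖a₀‖ ≠ 0 := norm_ne_zero_iff.2 h0
    field_simp
    ring

end Coefficients

/-! ### Families of operators depending on the gluing parameter -/

section Families

variable {n : ℕ}

theorem IsTerm.mono {ℓ ℓ' : ℕ} (hℓ : ℓ ≤ ℓ') {T : CoreOp n} (h : IsTerm ℓ T) : IsTerm ℓ' T := by
  induction h with
  | mul F hlo => exact .mul _ F hlo
  | refl F hlo hF h => exact .refl F hlo hF (h.trans hℓ)
  | avg F hF h => exact .avg F hF (h.trans hℓ)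
  | node h => exact .node (h.trans hℓ)
  | zero => exact .zero _
  | add _ _ hT hS => exact hT.add hS
  | smul c _ hT => exact hT.smul c

open Classical in
/-- The family `a ↦ c(a) T(R(a), ϑ(a))`, and `0` at `a = 0`. -/
def gluingFamily (c : ℂ → ℝ) (T : CoreOp n) (a : ℂ) : Core n →ₗ[ℝ] Core n :=
  if a = 0 then 0 else c a • T (gluingLength a) (gluingAngle a)

theorem gluingFamily_zero (c : ℂ → ℝ) (T : CoreOp n) : gluingFamily c T 0 = 0 := if_pos rfl

theorem gluingFamily_of_ne (c : ℂ → ℝ) (T : CoreOp n) {a : ℂ} (ha : a ≠ 0) :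
    gluingFamily c T a = c a • T (gluingLength a) (gluingAngle a) := if_neg ha

/-- Families of operators on the core that lose `ℓ` derivatives. -/
inductive IsFamily : ℕ → (ℂ → Core n →ₗ[ℝ] Core n) → Prop
  | id (ℓ : ℕ) : IsFamily ℓ fun _ => LinearMap.id
  | zero (ℓ : ℕ) : IsFamily ℓ fun _ => 0
  | add {ℓ : ℕ} {G H : ℂ → Core n →ₗ[ℝ] Core n} (hG : IsFamily ℓ G) (hH : IsFamily ℓ H) :
      IsFamily ℓ fun a => G a + H a
  | term {ℓ : ℕ} {c : ℂ → ℝ} {T : CoreOp n} (hc : IsModerate c) (hT : IsTerm ℓ T)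
      (h : ℓ = 0 → ∀ a, c a = 1) : IsFamily ℓ (gluingFamily c T)

/-- `Gx` and `Gy` are the partial derivatives of `G`, pointwise. -/
def HasPartials (G Gx Gy : ℂ → Core n →ₗ[ℝ] Core n) : Prop :=
  ∀ (o : Option (Bool × Cyl)) (x : Core n) (a : ℂ), HasFDerivAt (fun a => coreEv o (G a x))
    (partials (coreEv o (Gx a x)) (coreEv o (Gy a x))) a

theorem HasPartials.add {G Gx Gy H Hx Hy : ℂ → Core n →ₗ[ℝ] Core n} (hG : HasPartials G Gx Gy)
    (hH : HasPartials H Hx Hy) : HasPartials (fun a => G a + H a) (fun a => Gx a + Hx a)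
      (fun a => Gy a + Hy a) := by
  intro o x a
  have := (hG o x a).add (hH o x a)
  simp only [LinearMap.add_apply, coreEv_add]
  refine this.congr_fderiv (ContinuousLinearMap.ext fun v => ?_)
  rw [_root_.add_apply, partials_apply, partials_apply, partials_apply]
  module

theorem hasPartials_const (L : Core n →ₗ[ℝ] Core n) :
    HasPartials (fun _ => L) (fun _ => 0) (fun _ => 0) := by
  intro o x a
  refine (hasFDerivAt_const (coreEv o (L x)) a).congr_fderiv ?_
  refine ContinuousLinearMap.ext fun v => ?_
  simp [partials_apply, coreEv_zero]

/-- Away from 0 this is the product rule together with the chain rule through (R(a), ϑ(a)), with a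
local lift of the angle. At 0 the family vanishes near a = 0 on each core element, and so do the
prescribed derivatives at 0. -/
theorem hasPartials_gluingFamily {ℓ : ℕ} {T TR Tθ : CoreOp n} (hT : IsTerm ℓ T)
    (hD : HasParamDeriv T TR Tθ) {c cx cy Rx Ry tx ty : ℂ → ℝ}
    (hc : ∀ a ≠ 0, HasFDerivAt c (partials (cx a) (cy a)) a)
    (hR : ∀ a ≠ 0, HasFDerivAt gluingLength (partials (Rx a) (Ry a)) a)
    (ht : ∀ a₀ : ℂ, a₀ ≠ 0 → ∃ φ : ℂ → ℝ,
      (∀ᶠ a in 𝓝 a₀, gluingAngle a = (φ a : UnitAddCircle)) ∧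
      HasFDerivAt φ (partials (tx a₀) (ty a₀)) a₀) :
    HasPartials (gluingFamily c T)
      (fun a => gluingFamily cx T a + (gluingFamily (fun a => c a * Rx a) TR a +
        gluingFamily (fun a => c a * tx a) Tθ a))
      (fun a => gluingFamily cy T a + (gluingFamily (fun a => c a * Ry a) TR a +
        gluingFamily (fun a => c a * ty a) Tθ a)) := by
  intro o x a
  simp only [LinearMap.add_apply, coreEv_add]
  by_cases ha : a = 0
  · subst ha
    simp only [gluingFamily_zero, LinearMap.zero_apply, coreEv_zero, add_zero]
    obtain ⟨N, hN⟩ := hT.eventually_zero x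
    -- R(a) → ∞ as a → 0, so the term eventually vanishes on the fixed element x.
    have h1 : ∀ᶠ a in 𝓝[≠] (0 : ℂ), coreEv o (gluingFamily c T a x) = 0 := by
      filter_upwards [tendsto_gluingLength.eventually_ge_atTop N, self_mem_nhdsWithin] with a h h0
      rw [gluingFamily_of_ne _ _ h0, LinearMap.smul_apply, hN _ h, smul_zero, coreEv_zero]
    have h2 : (fun a => coreEv o (gluingFamily c T a x)) =ᶠ[𝓝 0] fun _ => 0 := by
      filter_upwards [eventually_nhdsWithin_iff.1 h1] with a h
      by_cases h0 : a = 0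
      · rw [h0, gluingFamily_zero, LinearMap.zero_apply, coreEv_zero]
      · exact h h0
    refine ((hasFDerivAt_const (0 : Target n) (0 : ℂ)).congr_of_eventuallyEq h2).congr_fderiv ?_
    ext v
    all_goals simp [partials_apply]
  · simp only [gluingFamily_of_ne _ _ ha, LinearMap.smul_apply, coreEv_smul]
    obtain ⟨φ, hφ, hφ'⟩ := ht a ha
    have e := hφ.self_of_nhds
    have h1 : HasFDerivAt (fun b => coreEv o (T (gluingLength b) (φ b : UnitAddCircle) x))
        ((partials₂ (coreEv o (TR (gluingLength a) (φ a : UnitAddCircle) x))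
          (coreEv o (Tθ (gluingLength a) (φ a : UnitAddCircle) x))).comp
          ((partials (Rx a) (Ry a)).prod (partials (tx a) (ty a)))) a :=
      HasFDerivAt.comp (g := fun z : ℝ × ℝ => coreEv o (T z.1 (z.2 : UnitAddCircle) x))
        (f := fun b => (gluingLength b, φ b)) a (hD o x (gluingLength a) (φ a))
        ((hR a ha).prodMk hφ')
    have h2 := (hc a ha).smul h1
    have h3 : (fun b => coreEv o (gluingFamily c T b x)) =ᶠ[𝓝 a]
        fun b => c b • coreEv o (T (gluingLength b) (φ b : UnitAddCircle) x) := by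
      filter_upwards [hφ, isOpen_ne.mem_nhds ha] with b hb hb0
      rw [gluingFamily_of_ne _ _ hb0, LinearMap.smul_apply, coreEv_smul, hb]
    refine (h2.congr_of_eventuallyEq h3).congr_fderiv (ContinuousLinearMap.ext fun v => ?_)
    rw [e]
    change c a • partials₂ (coreEv o (TR (gluingLength a) (φ a : UnitAddCircle) x))
        (coreEv o (Tθ (gluingLength a) (φ a : UnitAddCircle) x))
        (partials (Rx a) (Ry a) v, partials (tx a) (ty a) v) +
      (partials (cx a) (cy a) v) • coreEv o (T (gluingLength a) (φ a : UnitAddCircle) x) = _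
    simp only [partials₂_apply, partials_apply, smul_eq_mul]
    module

theorem IsFamily.exists_deriv {ℓ : ℕ} {G : ℂ → Core n →ₗ[ℝ] Core n} (h : IsFamily ℓ G) :
    ∃ Gx Gy, IsFamily (ℓ + 1) Gx ∧ IsFamily (ℓ + 1) Gy ∧ HasPartials G Gx Gy := by
  induction h with
  | id => exact ⟨_, _, .zero _, .zero _, hasPartials_const _⟩
  | zero => exact ⟨_, _, .zero _, .zero _, hasPartials_const _⟩
  | add _ _ hG hH =>
    obtain ⟨Gx, Gy, h1, h2, h3⟩ := hG
    obtain ⟨Hx, Hy, h1', h2', h3'⟩ := hH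
    exact ⟨_, _, h1.add h1', h2.add h2', h3.add h3'⟩
  | term hc hT h =>
    obtain ⟨TR, Tθ, hTR, hTθ, hD⟩ := hT.exists_deriv
    obtain ⟨cx, cy, hcx, hcy, hc'⟩ := hc.exists_deriv
    obtain ⟨Rx, Ry, hRx, hRy, hR'⟩ := isModerate_gluingLength.exists_deriv
    obtain ⟨tx, ty, htx, hty, ht'⟩ := exists_gluingAngle_lift
    exact ⟨_, _,
      (IsFamily.term hcx (hT.mono (Nat.le_succ _)) (by omega)).add
        ((IsFamily.term (hc.mul hRx) hTR (by omega)).add (.term (hc.mul htx) hTθ (by omega))),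
      (IsFamily.term hcy (hT.mono (Nat.le_succ _)) (by omega)).add
        ((IsFamily.term (hc.mul hRy) hTR (by omega)).add (.term (hc.mul hty) hTθ (by omega))),
      hasPartials_gluingFamily hT hD hc' hR' ht'⟩

variable (D : NodedDiskPair) (W : Weights)

theorem norm_coreIncl_mono {m k : ℕ} (h : m ≤ k) (x : Core n) :
    ‖coreIncl D W m x‖ ≤ ‖coreIncl D W k x‖ := by
  have := norm_mono D n W h (coreIncl D W k x)
  rwa [one_mul, levelIncl_coreIncl] at this

theorem IsFamily.exists_bound {ℓ : ℕ} {G : ℂ → Core n →ₗ[ℝ] Core n} (h : IsFamily ℓ G) {m k : ℕ}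
    (hmk : m + ℓ ≤ k) : ∃ C, ∀ a ∈ Metric.ball (0 : ℂ) (5 / 9), ∀ x,
      ‖coreIncl D W m (G a x)‖ ≤ C * ‖coreIncl D W k x‖ := by
  induction h with
  | id => exact ⟨1, fun a _ x => by
      rw [one_mul]; exact norm_coreIncl_mono D W (by omega) x⟩
  | zero => exact ⟨0, fun a _ x => by simp⟩
  | add _ _ hG hH =>
    obtain ⟨C₁, h₁⟩ := hG
    obtain ⟨C₂, h₂⟩ := hH
    refine ⟨C₁ + C₂, fun a ha x => ?_⟩
    rw [LinearMap.add_apply, map_add, add_mul]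
    exact (norm_add_le _ _).trans (add_le_add (h₁ a ha x) (h₂ a ha x))
  | @term c T hc hT h =>
    obtain ⟨C, hC0, hC⟩ := hT.exists_bound D W hmk
    obtain ⟨B, hB0, hB⟩ : ∃ B, 0 ≤ B ∧ ∀ a ≠ 0, ‖a‖ ≤ 1 → 2 < gluingLength a →
        |c a| * Real.exp (-((W.δ k - W.δ m) * (gluingLength a / 2))) ≤ B := by
      -- Without loss of levels there may be no exponential gain, so the coefficient must be 1; this
      -- is the side condition in the class of families. Any derivative has ℓ ≥ 1, and then δ_k -
      -- δ_m > 0 absorbs the coefficient.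
      rcases Nat.eq_zero_or_pos ℓ with h0 | h0
      · refine ⟨1, zero_le_one, fun a _ _ hR => ?_⟩
        rw [h h0, abs_one, one_mul, Real.exp_le_one_iff]
        have := W.strictMono.monotone (show m ≤ k by omega)
        nlinarith
      · obtain ⟨C', N, hC', hN, hcN⟩ := hc.exists_bound
        have hκ : 0 < W.δ k - W.δ m := sub_pos.2 (W.strictMono (show m < k by omega))
        refine ⟨C' * Real.exp (N ^ 2 / (W.δ k - W.δ m) + (W.δ k - W.δ m) * Real.exp 1 / 2),
          by positivity, fun a ha ha1 _ => ?_⟩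
        refine (mul_le_mul_of_nonneg_right (hcN a ha ha1) (Real.exp_pos _).le).trans ?_
        rw [mul_assoc]
        gcongr
        exact exp_mul_exp_gluingLength_le hκ a
    refine ⟨C * B, fun a ha x => ?_⟩
    by_cases h0 : a = 0
    · rw [h0, gluingFamily_zero, LinearMap.zero_apply, map_zero, norm_zero]
      positivity
    · have hR := two_lt_gluingLength h0 ha
      rw [gluingFamily_of_ne _ _ h0, LinearMap.smul_apply, map_smul, norm_smul, Real.norm_eq_abs]
      refine (mul_le_mul_of_nonneg_left (hC _ hR _ x) (abs_nonneg _)).trans ?_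
      have := hB a h0 (by linarith [mem_ball_zero_iff.1 ha]) hR
      calc _ = |c a| * Real.exp (-((W.δ k - W.δ m) * (gluingLength a / 2))) *
            (C * ‖coreIncl D W k x‖) := by ring
        _ ≤ B * (C * ‖coreIncl D W k x‖) := by gcongr
        _ = _ := by ring

end Families

end GWSplicing

end
noncomputable section

namespace GWSplicing

/-! ### The operator calculus on the sc-space of maps -/

section Calculus

variable (D : NodedDiskPair) (n : ℕ) (W : Weights)

/-- The evaluations at the node and at the points of the half-cylinders. -/
def mapEval : Option (Bool × {p : Cyl // 0 ≤ p.1}) → (LevelSpace D n W 0 →L[ℝ] Target n)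
  | none => nodeEval
  | some (b, p) => decEval b p

theorem mapEval_coreIncl (o : Option (Bool × {p : Cyl // 0 ≤ p.1})) (x : Core n) :
    mapEval D n W o (coreIncl D W 0 x) = coreEv (o.map fun z => (z.1, z.2.1)) x := by
  rcases o with _ | ⟨b, p⟩
  · exact coreIncl_node D W 0 x
  · exact dec_coreIncl D W 0 x b p.2

/-- The calculus of the families of operators that depend on the gluing parameter. -/
def gluingCalculus :
    OperatorCalculus (mapScale D n W) (Core n) (Target n) (Metric.ball 0 (5 / 9)) where
  sc := isScBanach_mapScale D W
  isOpen := Metric.isOpen_ball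
  ι m := coreIncl D W m
  dense := denseRange_coreIncl D W
  incl_ι h x := levelIncl_coreIncl D W h x
  Ev := Option (Bool × {p : Cyl // 0 ≤ p.1})
  ev := mapEval D n W
  sep u hu := by
    let u' : LevelSpace D n W 0 := u
    refine LevelSpace.ext_dec (u := u') (v := 0) (hu none) fun b p hp => ?_
    have h0 := hu (some (b, ⟨p, hp⟩))
    have h1 := map_zero (decEval (D := D) (n := n) (W := W) (m := 0) b ⟨p, hp⟩)
    exact h0.trans h1.symm
  cls := IsFamily
  bound h _ _ hmk := h.exists_bound D W hmk
  deriv h := by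
    obtain ⟨Gx, Gy, hx, hy, hG⟩ := h.exists_deriv
    refine ⟨Gx, Gy, hx, hy, fun x t v _ => ?_⟩
    have := hG (t.map fun z => (z.1, z.2.1)) x v
    simp only [← mapEval_coreIncl D n W] at this
    exact this

end Calculus

end GWSplicing

end
noncomputable section

namespace GWSplicing

/-! ### The projections along the kernel of gluing -/

section CutoffProfiles

variable {β : ℝ → ℝ}

theorem IsCutoff.eq_zero (hβ : IsCutoff β) (s : ℝ) (hs : 1 ≤ s) : β s = 0 := by
  have h1 := hβ.symm s
  rw [hβ.eq_one (-s) (by linarith)] at h1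
  linarith

theorem IsCutoff.apply_neg (hβ : IsCutoff β) (s : ℝ) : β (-s) = 1 - β s := by
  linarith [hβ.symm s]

theorem IsCutoff.apply_zero (hβ : IsCutoff β) : β 0 = 1 / 2 := by
  have := hβ.symm 0
  rw [neg_zero] at this
  linarith

theorem sq_add_sq_pos (r : ℝ) : 0 < r ^ 2 + (1 - r) ^ 2 := by nlinarith [sq_nonneg (2 * r - 1)]

theorem IsCutoff.contDiff_div (hβ : IsCutoff β) {f : ℝ → ℝ} (hf : ContDiff ℝ ∞ f) :
    ContDiff ℝ ∞ fun s => f s / (β s ^ 2 + (1 - β s) ^ 2) :=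
  hf.div ((hβ.smooth.pow 2).add ((contDiff_const.sub hβ.smooth).pow 2))
    fun s => (sq_add_sq_pos (β s)).ne'

/-- The profile `β²/(β² + (1-β)²) - 1`. -/
def IsCutoff.mulProfile (hβ : IsCutoff β) : Profile where
  toFun s := β s ^ 2 / (β s ^ 2 + (1 - β s) ^ 2) - 1
  lo := 0
  hi := -1
  smooth := (hβ.contDiff_div (hβ.smooth.pow 2)).sub contDiff_const
  eq_lo s hs := by simp [hβ.eq_one s hs]
  eq_hi s hs := by simp [hβ.eq_zero s hs]

/-- The profile `β(1-β)/(β² + (1-β)²)`. -/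
def IsCutoff.reflProfile (hβ : IsCutoff β) : Profile where
  toFun s := β s * (1 - β s) / (β s ^ 2 + (1 - β s) ^ 2)
  lo := 0
  hi := 0
  smooth := hβ.contDiff_div (hβ.smooth.mul (contDiff_const.sub hβ.smooth))
  eq_lo s hs := by simp [hβ.eq_one s hs]
  eq_hi s hs := by simp [hβ.eq_zero s hs]

/-- The profile `β/(β² + (1-β)²)`. -/
def IsCutoff.avgProfile (hβ : IsCutoff β) : Profile where
  toFun s := β s / (β s ^ 2 + (1 - β s) ^ 2)
  lo := 1
  hi := 0
  smooth := hβ.contDiff_div hβ.smooth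
  eq_lo s hs := by simp [hβ.eq_one s hs]
  eq_hi s hs := by simp [hβ.eq_zero s hs]

/-- The difference of the projection and the identity, on the core. -/
def splicingTerm (n : ℕ) (hβ : IsCutoff β) : CoreOp n := fun R θ =>
  mulTerm hβ.mulProfile R θ + (reflTerm hβ.reflProfile rfl 0 0 R θ +
    (nodeTerm 0 R θ + (-1 : ℝ) • avgTerm hβ.avgProfile rfl 0 R θ))

theorem isTerm_splicingTerm (n : ℕ) (hβ : IsCutoff β) : IsTerm 0 (splicingTerm n hβ) :=
  (IsTerm.mul _ _ rfl).add ((IsTerm.refl (i := 0) (j := 0) _ rfl rfl le_rfl).add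
    ((IsTerm.node le_rfl).add ((IsTerm.avg _ rfl le_rfl).smul _)))

/-- The projections `π_a` on the core. -/
def splicingFamily (n : ℕ) (hβ : IsCutoff β) (a : ℂ) : Core n →ₗ[ℝ] Core n :=
  LinearMap.id + gluingFamily (fun _ => 1) (splicingTerm n hβ) a

theorem isFamily_splicingFamily (n : ℕ) (hβ : IsCutoff β) : IsFamily 0 (splicingFamily n hβ) :=
  (IsFamily.id 0).add (.term (.const 1) (isTerm_splicingTerm n hβ) fun _ _ => rfl)

end CutoffProfiles

/-! ### The average over the middle circle of the neck. -/

section Average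

variable {D : NodedDiskPair} {n : ℕ} {W : Weights}

theorem integrable_dec (u : DiskMap D n) (b : Bool) (s : ℝ) :
    Integrable fun t : UnitAddCircle => dec u b (s, t) :=
  integrable_slice (continuous_dec u b) s

/-- In reflected coordinates the second integrand runs through -t, and the Haar measure of the
circle is invariant under negation. -/
theorem average_sub_node (u : LevelSpace D n W 0) (R : ℝ) :
    average D n R u.1 - u.1.1 D.x = (1 / 2 : ℝ) • ((∫ t : UnitAddCircle, dec u.1 true (R / 2, t)) +
      ∫ t : UnitAddCircle, dec u.1 false (R / 2, t)) := by
  have h1 : ∀ t : UnitAddCircle, uPlus u.1 (R / 2, t) + uMinus u.1 (-(R / 2), t) =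
      (2 : ℝ) • u.1.1 D.x + (dec u.1 true (R / 2, t) + dec u.1 false (R / 2, -t)) := by
    intro t
    have e : dec u.1 false (R / 2, -t) = uMinus u.1 (-(R / 2), t) - u.1.2 D.y := by
      simp [dec, decMinus]
    rw [e, u.snd_y, show dec u.1 true (R / 2, t) = uPlus u.1 (R / 2, t) - u.1.1 D.x from rfl]
    module
  have h2 : ∫ t : UnitAddCircle, dec u.1 false (R / 2, -t) =
      ∫ t : UnitAddCircle, dec u.1 false (R / 2, t) :=
    integral_neg_eq_self (fun t : UnitAddCircle => dec u.1 false (R / 2, t)) volume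
  have hi := integrable_dec u.1 true (R / 2)
  have hi' : Integrable fun t : UnitAddCircle => dec u.1 false (R / 2, -t) :=
    (integrable_dec u.1 false (R / 2)).comp_neg
  change (1 / 2 : ℝ) • (∫ t : UnitAddCircle, (uPlus u.1 (R / 2, t) + uMinus u.1 (-(R / 2), t))) -
    u.1.1 D.x = _
  have h3 : ∫ t : UnitAddCircle, (uPlus u.1 (R / 2, t) + uMinus u.1 (-(R / 2), t)) =
      (2 : ℝ) • u.1.1 D.x + ((∫ t : UnitAddCircle, dec u.1 true (R / 2, t)) +
        ∫ t : UnitAddCircle, dec u.1 false (R / 2, t)) := by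
    rw [← h2, ← integral_add hi hi', funext h1]
    refine (integral_add (integrable_const _) (hi.add hi')).trans ?_
    simp [measureReal_def]
  rw [h3]
  module

/-- The average of the decaying parts over the middle circle of the neck. -/
def avgEval {R : ℝ} (hR : 0 ≤ R) : LevelSpace D n W 0 →L[ℝ] Target n :=
  LinearMap.mkContinuous ((average D n R).comp (toMap D n W 0) - (nodeEval : _ →L[ℝ] _).toLinearMap) 4
    fun u => by
      change ‖average D n R u.1 - u.1.1 D.x‖ ≤ _
      have h : ∀ b, ‖∫ t : UnitAddCircle, dec u.1 b (R / 2, t)‖ ≤ 4 * ‖u‖ := by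
        intro b
        refine (norm_integral_le_of_norm_le_const (μ := (volume : Measure UnitAddCircle))
          (Filter.Eventually.of_forall fun t => norm_dec_le' u b (p := (R / 2, t))
            (div_nonneg hR zero_le_two))).trans (le_of_eq (by simp [measureReal_def]))
      rw [average_sub_node, norm_smul, Real.norm_of_nonneg (by norm_num)]
      have := norm_add_le (∫ t : UnitAddCircle, dec u.1 true (R / 2, t))
        (∫ t : UnitAddCircle, dec u.1 false (R / 2, t))
      linarith [h true, h false]

theorem avgEval_apply {R : ℝ} (hR : 0 ≤ R) (u : LevelSpace D n W 0) :
    avgEval hR u = (1 / 2 : ℝ) • ((∫ t : UnitAddCircle, dec u.1 true (R / 2, t)) +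
      ∫ t : UnitAddCircle, dec u.1 false (R / 2, t)) := average_sub_node u R

theorem average_eq {R : ℝ} (hR : 0 ≤ R) (u : LevelSpace D n W 0) :
    average D n R u.1 = u.1.1 D.x + avgEval hR u :=
  (add_sub_cancel (u.1.1 D.x) (average D n R u.1)).symm

theorem avgEval_coreIncl {R : ℝ} (hR : 0 ≤ R) (x : Core n) :
    avgEval hR (coreIncl D W 0 x) = avgOp 0 R x := by
  have h : ∀ b, ∫ t : UnitAddCircle, dec (coreIncl D W 0 x).1 b (R / 2, t) =
      ∫ t, pST 0 0 (x.2 b).1 (R / 2, t) := fun b => by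
    congr 1
    funext t
    exact dec_coreIncl D W 0 x b (p := (R / 2, t)) (div_nonneg hR zero_le_two)
  rw [avgEval_apply, h, h]
  rfl

end Average

section Projection

variable {D : NodedDiskPair} {n : ℕ} {W : Weights} {β : ℝ → ℝ}

/-- The bounded extension of `splicingFamily` to `E`. -/
def splicingOp (D : NodedDiskPair) (n : ℕ) (W : Weights) (hβ : IsCutoff β) (a : ℂ) :
    LevelSpace D n W 0 →L[ℝ] LevelSpace D n W 0 :=
  (gluingCalculus D n W).op (splicingFamily n hβ) 0 0 a

variable (hβ : IsCutoff β) {a : ℂ}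

theorem splicingOp_coreIncl (ha : a ∈ Metric.ball (0 : ℂ) (5 / 9)) (x : Core n) :
    splicingOp D n W hβ a (coreIncl D W 0 x) = coreIncl D W 0 (splicingFamily n hβ a x) :=
  OperatorCalculus.op_ι (S := gluingCalculus D n W) (isFamily_splicingFamily n hβ) (m := 0) (n := 0)
    le_rfl ha x

theorem splicingOp_zero (u : LevelSpace D n W 0) : splicingOp D n W hβ 0 u = u := by
  refine congrFun (DenseRange.equalizer (denseRange_coreIncl D W 0)
    (splicingOp D n W hβ 0).continuous continuous_id (funext fun x => ?_)) u
  have h := splicingOp_coreIncl (D := D) (W := W) hβ (a := 0)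
    (Metric.mem_ball_self (by norm_num)) x
  rw [splicingFamily, gluingFamily_zero, add_zero] at h
  exact h

theorem node_splicingOp (h0 : a ≠ 0) (ha : a ∈ Metric.ball (0 : ℂ) (5 / 9))
    (hR : 0 ≤ gluingLength a) (u : LevelSpace D n W 0) :
    (splicingOp D n W hβ a u).1.1 D.x = u.1.1 D.x + avgEval hR u := by
  refine congrFun (DenseRange.equalizer (denseRange_coreIncl D W 0)
    (g := fun u => nodeEval (splicingOp D n W hβ a u)) (h := fun u => nodeEval u + avgEval hR u)
    (nodeEval.continuous.comp (splicingOp D n W hβ a).continuous)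
    (nodeEval.continuous.add (avgEval hR).continuous) (funext fun x => ?_)) u
  change nodeEval (splicingOp D n W hβ a (coreIncl D W 0 x)) =
    (coreIncl D W 0 x).1.1 D.x + avgEval hR (coreIncl D W 0 x)
  rw [splicingOp_coreIncl hβ ha, avgEval_coreIncl, coreIncl_node]
  refine (coreIncl_node D W 0 _).trans ?_
  rw [splicingFamily, LinearMap.add_apply, gluingFamily_of_ne _ _ h0]
  simp [splicingTerm, mulTerm, reflTerm, nodeTerm, avgTerm]

/-- The solution of the 2×2 system, extended from the core by density: both sides are continuous in
u, since point evaluations at s ≥ 0 and the average are bounded on E_0. Keeping r as a variable lets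
the reflected point be treated by the substitution r ↦ 1 - r. -/
theorem dec_splicingOp (h0 : a ≠ 0) (ha : a ∈ Metric.ball (0 : ℂ) (5 / 9))
    (hR : 0 ≤ gluingLength a) (u : LevelSpace D n W 0) (b : Bool) {p : Cyl} (hp : 0 ≤ p.1) {r : ℝ}
    (hr : β (p.1 - gluingLength a / 2) = r) :
    dec (splicingOp D n W hβ a u).1 b p = (r / (r ^ 2 + (1 - r) ^ 2)) • (r • dec u.1 b p +
      (1 - r) • dec u.1 (!b) ((gluingLength a, gluingAngle a) - p) - avgEval hR u) := by
  have hR2 := two_lt_gluingLength h0 ha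
  subst hr
  by_cases hpR : p.1 ≤ gluingLength a
  · have hq : 0 ≤ ((gluingLength a, gluingAngle a) - p).1 := sub_nonneg.2 hpR
    set r := β (p.1 - gluingLength a / 2) with hr
    let L : LevelSpace D n W 0 →L[ℝ] Target n := (r / (r ^ 2 + (1 - r) ^ 2)) •
      (r • decEval b ⟨p, hp⟩ + (1 - r) • decEval (!b) ⟨_, hq⟩ - avgEval hR)
    refine congrFun (DenseRange.equalizer (denseRange_coreIncl D W 0)
      (g := fun u => decEval b ⟨p, hp⟩ (splicingOp D n W hβ a u)) (h := L)
      ((decEval b ⟨p, hp⟩).continuous.comp (splicingOp D n W hβ a).continuous)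
      L.continuous (funext fun x => ?_)) u
    change dec (splicingOp D n W hβ a (coreIncl D W 0 x)).1 b p =
      (r / (r ^ 2 + (1 - r) ^ 2)) • (r • dec (coreIncl D W 0 x).1 b p +
        (1 - r) • dec (coreIncl D W 0 x).1 (!b) ((gluingLength a, gluingAngle a) - p) -
          avgEval hR (coreIncl D W 0 x))
    rw [splicingOp_coreIncl hβ ha, avgEval_coreIncl, dec_coreIncl D W 0 _ _ hp,
      dec_coreIncl D W 0 _ _ hp, dec_coreIncl D W 0 _ _ hq, splicingFamily, LinearMap.add_apply,
      gluingFamily_of_ne _ _ h0, one_smul]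
    change (x.2 b).1 p + ((r ^ 2 / (r ^ 2 + (1 - r) ^ 2) - 1) • (x.2 b).1 p +
      ((r * (1 - r) / (r ^ 2 + (1 - r) ^ 2)) •
        (x.2 (!b)).1 ((gluingLength a, gluingAngle a) - p) +
      (0 + (-1 : ℝ) • (r / (r ^ 2 + (1 - r) ^ 2)) • avgOp 0 (gluingLength a) x))) = _
    module
  -- For s > R the reflected point has negative s, where evaluations of core functions are not
  -- controlled by the norm. Its coefficient vanishes, and both sides are 0.
  · have hr : β (p.1 - gluingLength a / 2) = 0 := hβ.eq_zero _ (by linarith)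
    refine (congrFun (DenseRange.equalizer (denseRange_coreIncl D W 0)
      (g := fun u => decEval b ⟨p, hp⟩ (splicingOp D n W hβ a u)) (h := fun _ => 0)
      ((decEval b ⟨p, hp⟩).continuous.comp (splicingOp D n W hβ a).continuous)
      continuous_const (funext fun x => ?_)) u).trans (by rw [hr, zero_div, zero_smul])
    change dec (splicingOp D n W hβ a (coreIncl D W 0 x)).1 b p = 0
    rw [splicingOp_coreIncl hβ ha, dec_coreIncl D W 0 _ _ hp, splicingFamily, LinearMap.add_apply,
      gluingFamily_of_ne _ _ h0, one_smul]
    set r := β (p.1 - gluingLength a / 2) with hr'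
    change (x.2 b).1 p + ((r ^ 2 / (r ^ 2 + (1 - r) ^ 2) - 1) • (x.2 b).1 p +
      ((r * (1 - r) / (r ^ 2 + (1 - r) ^ 2)) •
        (x.2 (!b)).1 ((gluingLength a, gluingAngle a) - p) +
      (0 + (-1 : ℝ) • (r / (r ^ 2 + (1 - r) ^ 2)) • avgOp 0 (gluingLength a) x))) = _
    rw [hr]
    simp

end Projection

end GWSplicing

end
-- The kernels of gluing and anti-gluing in reflected coordinates, and the projection property.
noncomputable section

namespace GWSplicing

section Kernels

variable {D : NodedDiskPair} {n : ℕ} {W : Weights} {β : ℝ → ℝ} {a : ℂ}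

theorem uPlus_eq (u : LevelSpace D n W 0) (p : Cyl) :
    uPlus u.1 p = u.1.1 D.x + dec u.1 true p :=
  (add_sub_cancel (u.1.1 D.x) (uPlus u.1 p)).symm

theorem uMinus_eq (u : LevelSpace D n W 0) (p q : Cyl) :
    uMinus u.1 (p - q) = u.1.1 D.x + dec u.1 false (q - p) := by
  have : dec u.1 false (q - p) = uMinus u.1 (p - q) - u.1.2 D.y := by
    simp only [dec, decMinus, neg_sub]
  rw [this, u.snd_y, add_sub_cancel]

theorem IsCutoff.apply_reflect (hβ : IsCutoff β) (R s : ℝ) :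
    β (R - s - R / 2) = 1 - β (s - R / 2) := by
  rw [← hβ.apply_neg]
  congr 1
  ring

/-- The pair `(R, ϑ)` of the gluing length and the gluing angle. -/
def gluingPoint (a : ℂ) : Cyl := (gluingLength a, gluingAngle a)

theorem IsCutoff.apply_gluingPoint_sub (hβ : IsCutoff β) {p : Cyl} {r : ℝ}
    (hr : β (p.1 - gluingLength a / 2) = r) :
    β ((gluingPoint a - p).1 - gluingLength a / 2) = 1 - r := by
  rw [← hr]
  exact hβ.apply_reflect _ _

theorem volume_real_univ : (volume : Measure UnitAddCircle).real univ = 1 := by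
  simp [measureReal_def]

/-- The gluing equation at p, rewritten with the decaying parts, is the case of the positive half;
the other case is the same equation at the reflected point, where r becomes 1 - r. -/
theorem mem_kerGlue_iff (hβ : IsCutoff β) (h0 : a ≠ 0) (u : LevelSpace D n W 0) :
    u ∈ kerGlue D n W β a ↔ ∀ b p, p.1 ∈ Icc 0 (gluingLength a) →
      ∀ r, β (p.1 - gluingLength a / 2) = r →
      u.1.1 D.x + r • dec u.1 b p + (1 - r) • dec u.1 (!b) (gluingPoint a - p) = 0 := by
  have key : ∀ (r : ℝ) (p : Cyl), r • uPlus u.1 p + (1 - r) • uMinus u.1 (p - gluingPoint a) =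
      u.1.1 D.x + r • dec u.1 true p + (1 - r) • dec u.1 false (gluingPoint a - p) := by
    intro r p
    rw [uPlus_eq, uMinus_eq]
    module
  let L : LevelSpace D n W 0 →ₗ[ℝ] _ := (glue D n β a).comp (toMap D n W 0)
  rw [kerGlue, if_neg h0]
  change L u = 0 ↔ _
  constructor
  · intro h b p hp r hr
    have h1 : ∀ p : Cyl, p.1 ∈ Icc 0 (gluingLength a) → β (p.1 - gluingLength a / 2) • uPlus u.1 p +
        (1 - β (p.1 - gluingLength a / 2)) • uMinus u.1 (p - gluingPoint a) = 0 := fun p hp =>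
      congrFun h ⟨p, hp⟩
    cases b
    · have h2 := h1 (gluingPoint a - p) ⟨sub_nonneg.2 hp.2, sub_le_self _ hp.1⟩
      rw [key, sub_sub_cancel, hβ.apply_gluingPoint_sub hr] at h2
      rw [← h2, Bool.not_false]
      module
    · have h2 := h1 p hp
      rwa [key, hr] at h2
  · intro h
    refine funext fun p => ?_
    exact (key _ p.1).trans (h true p.1 p.2 _ rfl)

theorem mem_kerAntiGlue_iff (hβ : IsCutoff β) (h0 : a ≠ 0) (hR : 0 ≤ gluingLength a)
    (u : LevelSpace D n W 0) : u ∈ kerAntiGlue D n W β a ↔ ∀ b p r,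
      β (p.1 - gluingLength a / 2) = r → (1 - r) • (dec u.1 b p - avgEval hR u) =
        r • (dec u.1 (!b) (gluingPoint a - p) - avgEval hR u) := by
  have key : ∀ (r : ℝ) (p : Cyl), -((1 - r) • (uPlus u.1 p - average D n (gluingLength a) u.1)) +
      r • (uMinus u.1 (p - gluingPoint a) - average D n (gluingLength a) u.1) =
      r • (dec u.1 false (gluingPoint a - p) - avgEval hR u) -
        (1 - r) • (dec u.1 true p - avgEval hR u) := by
    intro r p
    rw [uPlus_eq, uMinus_eq, average_eq hR]
    module
  let L : LevelSpace D n W 0 →ₗ[ℝ] _ := (antiGlue D n β a).comp (toMap D n W 0)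
  rw [kerAntiGlue, if_neg h0]
  change L u = 0 ↔ _
  constructor
  · intro h b p r hr
    have h1 : ∀ p : Cyl, -((1 - β (p.1 - gluingLength a / 2)) •
        (uPlus u.1 p - average D n (gluingLength a) u.1)) + β (p.1 - gluingLength a / 2) •
          (uMinus u.1 (p - gluingPoint a) - average D n (gluingLength a) u.1) = 0 := fun p =>
      congrFun h p
    cases b
    · have h2 := h1 (gluingPoint a - p)
      rw [key, sub_sub_cancel, hβ.apply_gluingPoint_sub hr, sub_sub_cancel] at h2
      exact sub_eq_zero.1 h2
    · have h2 := h1 p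
      rw [key, hr] at h2
      exact (sub_eq_zero.1 h2).symm
  · intro h
    refine funext fun p => ?_
    exact (key _ p).trans (sub_eq_zero.2 (h true p _ rfl).symm)

theorem dec_splicingOp_reflect (hβ : IsCutoff β) (h0 : a ≠ 0)
    (ha : a ∈ Metric.ball (0 : ℂ) (5 / 9)) (hR : 0 ≤ gluingLength a) (u : LevelSpace D n W 0)
    (b : Bool) {p : Cyl} (hp : p.1 ≤ gluingLength a) {r : ℝ}
    (hr : β (p.1 - gluingLength a / 2) = r) :
    dec (splicingOp D n W hβ a u).1 (!b) (gluingPoint a - p) =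
      ((1 - r) / (r ^ 2 + (1 - r) ^ 2)) • (r • dec u.1 b p +
      (1 - r) • dec u.1 (!b) (gluingPoint a - p) - avgEval hR u) := by
  have h := dec_splicingOp hβ h0 ha hR u (!b) (p := gluingPoint a - p) (sub_nonneg.2 hp)
    (r := 1 - r) (hβ.apply_gluingPoint_sub hr)
  rw [h, Bool.not_not, sub_sub_cancel, show ((gluingLength a, gluingAngle a) : Cyl) -
    (gluingPoint a - p) = p from sub_sub_cancel _ _, add_comm ((1 - r) ^ 2),
    add_comm ((1 - r) • _)]

/-- On the middle circle r = 1/2, so r/γ = 1 and the new decaying part is ½f_b + ½f_{!b}(reflected)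
- A. The circle integrals of the first two terms add up to A, independently of the rotation by ϑ. -/
theorem avgEval_splicingOp (hβ : IsCutoff β) (h0 : a ≠ 0)
    (ha : a ∈ Metric.ball (0 : ℂ) (5 / 9)) (hR : 0 ≤ gluingLength a) 
    (u : LevelSpace D n W 0) : avgEval hR (splicingOp D n W hβ a u) = 0 := by
  have h1 : ∀ b, ∫ t : UnitAddCircle, dec (splicingOp D n W hβ a u).1 b (gluingLength a / 2, t) =
      (1 / 2 : ℝ) • (∫ t : UnitAddCircle, dec u.1 b (gluingLength a / 2, t)) +
      (1 / 2 : ℝ) • (∫ t : UnitAddCircle, dec u.1 (!b) (gluingLength a / 2, t)) -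
        avgEval hR u := by
    intro b
    have h2 : ∀ t : UnitAddCircle, dec (splicingOp D n W hβ a u).1 b (gluingLength a / 2, t) =
        (1 / 2 : ℝ) • dec u.1 b (gluingLength a / 2, t) +
        (1 / 2 : ℝ) • dec u.1 (!b) (gluingLength a / 2, gluingAngle a - t) - avgEval hR u := by
      intro t
      rw [dec_splicingOp hβ h0 ha hR u b (p := (gluingLength a / 2, t)) (r := 1 / 2)
        (div_nonneg hR zero_le_two) (by rw [← hβ.apply_zero, sub_self]), Prod.mk_sub_mk, sub_half (gluingLength a)]
      norm_num
    have hi := (integrable_dec u.1 b (gluingLength a / 2)).smul (1 / 2 : ℝ)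
    have hi' := ((integrable_dec u.1 (!b) (gluingLength a / 2)).comp_sub_left
      (gluingAngle a)).smul (1 / 2 : ℝ)
    have h3 : ∫ t : UnitAddCircle, dec u.1 (!b) (gluingLength a / 2, gluingAngle a - t) =
        ∫ t : UnitAddCircle, dec u.1 (!b) (gluingLength a / 2, t) :=
      integral_sub_left_eq_self (fun t : UnitAddCircle => dec u.1 (!b) (gluingLength a / 2, t))
        volume (gluingAngle a)
    rw [funext h2]
    refine (integral_sub (hi.add hi') (integrable_const _)).trans ?_
    rw [integral_const, volume_real_univ, one_smul]
    refine congrArg (· - avgEval hR u) ((integral_add hi hi').trans ?_)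
    simp only [Pi.smul_apply, integral_smul, h3]
  rw [avgEval_apply, h1, h1, avgEval_apply]
  simp only [Bool.not_true, Bool.not_false]
  module

/-- The new values at p and at the reflected point are r/γ and (1-r)/γ times the same vector, and
the new average vanishes; this is the anti-gluing equation. Outside [0,R] one factor is zero, so
extended coordinates do no harm. -/
theorem splicingOp_mem_kerAntiGlue (hβ : IsCutoff β) (h0 : a ≠ 0)
    (ha : a ∈ Metric.ball (0 : ℂ) (5 / 9)) (u : LevelSpace D n W 0) :
    splicingOp D n W hβ a u ∈ kerAntiGlue D n W β a := by
  have hR2 := two_lt_gluingLength h0 ha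
  have hR : 0 ≤ gluingLength a := by linarith
  refine (mem_kerAntiGlue_iff hβ h0 hR _).2 fun b p r hr => ?_
  rw [avgEval_splicingOp hβ h0 ha hR, sub_zero, sub_zero]
  rcases lt_or_ge p.1 0 with hp | hp
  · have h1 : r = 1 := by rw [← hr, hβ.eq_one _ (by linarith)]
    rw [dec_splicingOp_reflect hβ h0 ha hR u b (by linarith) hr, h1]
    simp
  rcases lt_or_ge (gluingLength a) p.1 with hp' | hp'
  · have h1 : r = 0 := by rw [← hr, hβ.eq_zero _ (by linarith)]
    rw [dec_splicingOp hβ h0 ha hR u b hp hr, h1]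
    simp
  rw [dec_splicingOp_reflect hβ h0 ha hR u b hp' hr, dec_splicingOp hβ h0 ha hR u b hp hr]
  change _ • _ • (_ + _ • dec u.1 (!b) (gluingPoint a - p) - _) = _
  module

/-- Recombining with weights r and 1 - r cancels γ and gives back r f_b + (1-r) f_{!b} - A. The
defect A compensates the change of the constant from c to c + A, so u and its image have the same
gluing. -/
theorem sub_splicingOp_mem_kerGlue (hβ : IsCutoff β) (h0 : a ≠ 0)
    (ha : a ∈ Metric.ball (0 : ℂ) (5 / 9)) (u : LevelSpace D n W 0) :
    u - splicingOp D n W hβ a u ∈ kerGlue D n W β a := by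
  have hR2 := two_lt_gluingLength h0 ha
  have hR : 0 ≤ gluingLength a := by linarith
  refine (mem_kerGlue_iff hβ h0 _).2 fun b p hp r hr => ?_
  change u.1.1 D.x - (splicingOp D n W hβ a u).1.1 D.x +
    r • dec (u.1 - (splicingOp D n W hβ a u).1) b p +
    (1 - r) • dec (u.1 - (splicingOp D n W hβ a u).1) (!b) (gluingPoint a - p) = 0
  rw [dec_sub, dec_sub, dec_splicingOp_reflect hβ h0 ha hR u b hp.2 hr,
    dec_splicingOp hβ h0 ha hR u b hp.1 hr, node_splicingOp hβ h0 ha hR u]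
  change _ + _ • (_ - _ • (_ + _ • dec u.1 (!b) (gluingPoint a - p) - _)) + _ = _
  have := (sq_add_sq_pos r).ne'
  match_scalars
  all_goals field_simp
  all_goals ring

/-- Integrating the vanishing glued map over the middle circle gives c + A = 0. Then the bracket r
f_b + (1-r) f_{!b} - A equals -c - A = 0 at every point of [0,R], and beyond R the factor r
vanishes. -/
theorem splicingOp_eq_zero (hβ : IsCutoff β) (h0 : a ≠ 0)
    (ha : a ∈ Metric.ball (0 : ℂ) (5 / 9)) {u : LevelSpace D n W 0}
    (hu : u ∈ kerGlue D n W β a) : splicingOp D n W hβ a u = 0 := by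
  have hR2 := two_lt_gluingLength h0 ha
  have hR : 0 ≤ gluingLength a := by linarith
  have h1 := (mem_kerGlue_iff hβ h0 u).1 hu
  have hA : u.1.1 D.x + avgEval hR u = 0 := by
    have h2 : ∀ t : UnitAddCircle, (1 / 2 : ℝ) • dec u.1 true (gluingLength a / 2, t) +
        (1 / 2 : ℝ) • dec u.1 false (gluingLength a / 2, gluingAngle a - t) = -u.1.1 D.x := by
      intro t
      have h3 := h1 true (gluingLength a / 2, t) ⟨by simp only; linarith, by simp only; linarith⟩
        (1 / 2) (by rw [← hβ.apply_zero, sub_self])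
      rw [gluingPoint, Prod.mk_sub_mk, sub_half (gluingLength a), add_assoc] at h3
      rw [eq_neg_iff_add_eq_zero, add_comm, ← h3]
      norm_num
    have hi := (integrable_dec u.1 true (gluingLength a / 2)).smul (1 / 2 : ℝ)
    have hi' := ((integrable_dec u.1 false (gluingLength a / 2)).comp_sub_left
      (gluingAngle a)).smul (1 / 2 : ℝ)
    have h3 : ∫ t : UnitAddCircle, dec u.1 false (gluingLength a / 2, gluingAngle a - t) =
        ∫ t : UnitAddCircle, dec u.1 false (gluingLength a / 2, t) :=
      integral_sub_left_eq_self (fun t : UnitAddCircle => dec u.1 false (gluingLength a / 2, t))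
        volume (gluingAngle a)
    have h4 := (integral_add hi hi').symm.trans ((congrArg _ (funext h2)).trans (integral_const _))
    simp only [Pi.smul_apply, integral_smul, h3, volume_real_univ, one_smul] at h4
    rw [avgEval_apply, smul_add, h4, add_neg_cancel]
  refine LevelSpace.ext_dec (v := 0) ((node_splicingOp hβ h0 ha hR u).trans hA) fun b p hp => ?_
  rw [dec_splicingOp hβ h0 ha hR u b hp rfl]
  refine Eq.trans ?_ (map_zero (decEval (D := D) (n := n) (W := W) (m := 0) b ⟨p, hp⟩)).symm
  rcases lt_or_ge (gluingLength a) p.1 with hp' | hp'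
  · rw [hβ.eq_zero _ (by linarith), zero_div, zero_smul]
  · have h2 : β (p.1 - gluingLength a / 2) • dec u.1 b p + (1 - β (p.1 - gluingLength a / 2)) •
        dec u.1 (!b) (gluingPoint a - p) = avgEval hR u := by
      have h3 := h1 b p ⟨hp, hp'⟩ _ rfl
      rw [add_assoc] at h3
      exact (neg_eq_of_add_eq_zero_right h3).symm.trans (neg_eq_of_add_eq_zero_right hA)
    exact (congrArg (fun z => _ • (z - avgEval hR u)) h2).trans (by rw [sub_self, smul_zero])

/-- For s ≥ R the anti-gluing equation says that the decaying part is the constant A, so A = 0. The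
equation then reads (1-r) f_b = r f_{!b}(reflected), and substituting it turns r(r f_b + (1-r)
f_{!b}) into γ f_b. -/
theorem splicingOp_eq_self (hβ : IsCutoff β) (h0 : a ≠ 0)
    (ha : a ∈ Metric.ball (0 : ℂ) (5 / 9)) {u : LevelSpace D n W 0}
    (hu : u ∈ kerAntiGlue D n W β a) : splicingOp D n W hβ a u = u := by
  have hR2 := two_lt_gluingLength h0 ha
  have hR : 0 ≤ gluingLength a := by linarith
  have h1 := (mem_kerAntiGlue_iff hβ h0 hR u).1 hu
  have hA : avgEval hR u = 0 := by
    have h2 : ∀ s : ℝ, gluingLength a ≤ s → dec u.1 true (s, 0) = avgEval hR u := by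
      intro s hs
      have h3 := h1 true (s, 0) 0 (hβ.eq_zero _ (by simp only; linarith))
      rw [sub_zero, one_smul, zero_smul] at h3
      exact sub_eq_zero.1 h3
    have h3 : Filter.Tendsto (fun s : ℝ => Real.exp (-(W.δ 0 * s)) * (4 * ‖u‖)) Filter.atTop
        (𝓝 (0 * (4 * ‖u‖))) :=
      (Real.tendsto_exp_neg_atTop_nhds_zero.comp
        (Filter.tendsto_id.const_mul_atTop (W.pos 0))).mul_const _
    rw [zero_mul] at h3
    refine norm_le_zero_iff.1 (ge_of_tendsto h3 ?_)
    filter_upwards [Filter.eventually_ge_atTop (gluingLength a)] with s hs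
    rw [← h2 s hs]
    exact norm_dec_le u true (p := (s, 0)) (hR.trans hs)
  refine LevelSpace.ext_dec ((node_splicingOp hβ h0 ha hR u).trans (by rw [hA, add_zero]))
    fun b p hp => ?_
  have h2 := h1 b p _ rfl
  set r := β (p.1 - gluingLength a / 2) with hr
  rw [dec_splicingOp hβ h0 ha hR u b hp hr.symm]
  rw [hA, sub_zero, sub_zero] at h2
  change _ • (_ + _ • dec u.1 (!b) (gluingPoint a - p) - _) = _
  have h3 := (sq_add_sq_pos r).ne'
  rw [hA, sub_zero, div_eq_inv_mul, mul_smul, smul_add, smul_comm r (1 - r), ← h2,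
    inv_smul_eq_iff₀ h3]
  module

end Kernels

/-! ### The splitting of E and the splicing property. -/

section Splitting

/-- The four properties of the explicit operator yield complementarity and identify it with the
projection at once, so the abstractly defined π_a inherits the formula. -/
theorem exists_isCompl_of_projection {E : Type} [AddCommGroup E] [Module ℝ E] {p q : Submodule ℝ E}
    {P : E →ₗ[ℝ] E} (h₁ : ∀ u, P u ∈ p) (h₂ : ∀ u, u - P u ∈ q) (h₃ : ∀ u ∈ q, P u = 0)
    (h₄ : ∀ u ∈ p, P u = u) : ∃ h : IsCompl p q, p.projection q h = P := by
  have h : IsCompl p q := by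
    refine ⟨Submodule.disjoint_def.2 fun u hp hq => (h₄ u hp).symm.trans (h₃ u hq),
      codisjoint_iff.2 (eq_top_iff.2 fun u _ => ?_)⟩
    exact Submodule.mem_sup.2 ⟨P u, h₁ u, u - P u, h₂ u, add_sub_cancel _ _⟩
  refine ⟨h, LinearMap.ext fun u => ?_⟩
  conv_lhs => rw [← add_sub_cancel (P u) u]
  rw [map_add, Submodule.projection_apply_of_mem_left h (h₁ u),
    (Submodule.projection_apply_eq_zero_iff h).2 (h₂ u), add_zero]

variable (D : NodedDiskPair) (n : ℕ) (W : Weights) {β : ℝ → ℝ}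

theorem isCompl_kerAntiGlue_kerGlue (hβ : IsCutoff β) {a : ℂ}
    (ha : a ∈ Metric.ball (0 : ℂ) (5 / 9)) :
    ∃ h : IsCompl (kerAntiGlue D n W β a) (kerGlue D n W β a),
      (kerAntiGlue D n W β a).projection (kerGlue D n W β a) h =
        (splicingOp D n W hβ a).toLinearMap := by
  by_cases h0 : a = 0
  · subst h0
    refine exists_isCompl_of_projection (fun u => ?_) (fun u => ?_) (fun u hu => ?_) fun u _ => ?_
    · rw [kerAntiGlue, if_pos rfl, LinearMap.ker_zero]
      exact Submodule.mem_top
    · let u' : LevelSpace D n W 0 := u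
      have h : u' - splicingOp D n W hβ 0 u' = 0 := by rw [splicingOp_zero, sub_self]
      change u' - splicingOp D n W hβ 0 u' ∈ _
      rw [h]
      exact Submodule.zero_mem _
    · rw [kerGlue, if_pos rfl, LinearMap.ker_id, Submodule.mem_bot] at hu
      exact (splicingOp_zero hβ u).trans hu
    · exact splicingOp_zero hβ u
  · exact exists_isCompl_of_projection (splicingOp_mem_kerAntiGlue hβ h0 ha)
      (sub_splicingOp_mem_kerGlue hβ h0 ha) (fun u hu => splicingOp_eq_zero hβ h0 ha hu)
      fun u hu => splicingOp_eq_self hβ h0 ha hu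

theorem splicingProj_eq (hβ : IsCutoff β) {a : ℂ} (ha : a ∈ Metric.ball (0 : ℂ) (5 / 9)) :
    splicingProj D n W β a = (splicingOp D n W hβ a).toLinearMap := by
  obtain ⟨h, hP⟩ := isCompl_kerAntiGlue_kerGlue D n W hβ ha
  rw [splicingProj, dif_pos h, hP]

theorem IsScK.mono {k : ℕ} : ∀ {E F : ScScale} {U U' : Set (E.Lev 0)} {f : E.Lev 0 → F.Lev 0},
    U' ⊆ U → IsScK k E F U f → IsScK k E F U' f := by
  have h0 : ∀ {E F : ScScale} {U U' : Set (E.Lev 0)} {f : E.Lev 0 → F.Lev 0},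
      U' ⊆ U → IsSc0 E F U f → IsSc0 E F U' f := fun hU h m => by
    obtain ⟨g, hg, hgf⟩ := h m
    exact ⟨g, hg.mono (preimage_mono hU), fun x hx => hgf x (hU hx)⟩
  induction k with
  | zero => exact h0
  | succ k ih =>
    rintro E F U U' f hU ⟨hf, Tf, hT, hk⟩
    refine ⟨h0 hU hf, Tf, fun x hx => ?_, ih (fun p hp => hU hp) hk⟩
    obtain ⟨Df, h1, h2⟩ := hT x (hU hx)
    exact ⟨Df, h1, h2.mono (preimage_mono hU)⟩

theorem isPartialCone_univ_complex : IsPartialCone (univ : Set ℂ) :=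
  -- With k = 0 no sign condition is imposed, so the partial cone is the whole plane.
  ⟨2, 0, Complex.basisOneI.equivFun, by simp [image_univ, (LinearEquiv.surjective _).range_eq]⟩

theorem isScSmoothSplicing (hβ : IsCutoff β) :
    IsScSmoothSplicing (mapScale D n W) (Metric.ball (0 : ℂ) (1 / 2)) (splicingProj D n W β) := by
  have hsub : Metric.ball (0 : ℂ) (1 / 2) ⊆ Metric.ball 0 (5 / 9) :=
    Metric.ball_subset_ball (by norm_num)
  have hS := OperatorCalculus.isScSmooth (gluingCalculus D n W) (P := splicingFamily n hβ)
    (π := splicingProj D n W β) (isFamily_splicingFamily n hβ)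
    fun a ha e => LinearMap.congr_fun (splicingProj_eq D n W hβ ha) e
  refine ⟨⟨univ, _, isPartialCone_univ_complex, Metric.isOpen_ball, (univ_inter _).symm⟩,
    isScBanach_mapScale D W, fun a ha => hS.1 a (hsub ha), fun a ha => ?_,
    fun k => (hS.2 k).mono fun p hp => hsub hp⟩
  obtain ⟨h, -⟩ := isCompl_kerAntiGlue_kerGlue D n W hβ (hsub ha)
  rw [splicingProj, dif_pos h]
  exact Submodule.isIdempotentElem_projection h

end Splitting

end GWSplicing

end
theorem mainTheorem10 (D : GWSplicing.NodedDiskPair) (n : ℕ) (W : GWSplicing.Weights)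
    (β : ℝ → ℝ) (hβ : GWSplicing.IsCutoff β) :
    (∀ a : ℂ, ‖a‖ ≤ 1 / 2 → IsCompl (GWSplicing.kerAntiGlue D n W β a)
      (GWSplicing.kerGlue D n W β a)) ∧
    GWSplicing.IsScSmoothSplicing (GWSplicing.mapScale D n W) (Metric.ball (0 : ℂ) (1 / 2))
      (GWSplicing.splicingProj D n W β) := by
  refine ⟨fun a ha => ?_, GWSplicing.isScSmoothSplicing D n W hβ⟩
  -- The splitting includes the boundary circle |a| = 1/2, which the larger open disk covers.
  have ha' : a ∈ Metric.ball (0 : ℂ) (5 / 9) := mem_ball_zero_iff.2 (by linarith)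
  exact (GWSplicing.isCompl_kerAntiGlue_kerGlue D n W hβ ha').1
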